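/- Let $U=U(sl(2|1))$ be the associative superalgebra over $\mathbb C$ generated by even $h_1,h_2,h_3,e_1,f_1$ and odd $e_2,f_2,e_3,f_3$ with relations (in this paragraph $[\,,]$ is the $\mathbb Z_2$-graded commutator) $[h_i,h_j]=0$; $[h_1,e_1]=2e_1$, $[h_1,f_1]=-2f_1$, $[h_1,e_2]=-e_2$, $[h_1,f_2]=f_2$, $[h_1,e_3]=e_3$, $[h_1,f_3]=-f_3$; $[h_2,e_1]=-e_1$, $[h_2,f_1]=f_1$, $[h_2,e_2]=[h_2,f_2]=0$, $[h_2,e_3]=-e_3$, $[h_2,f_3]=f_3$; $[h_3,e_1]=e_1$, $[h_3,f_1]=-f_1$, $[h_3,e_2]=-e_2$, $[h_3,f_2]=f_2$, $[h_3,e_3]=[h_3,f_3]=0$; $[e_i,f_i]=h_i$; $[e_1,f_2]=[e_2,f_1]=0$; $e_2^2=f_2^2=e_3^2=f_3^2=0$; $[e_1,e_2]=e_3$, $[f_2,f_1]=f_3$, $[e_1,e_3]=[f_3,f_1]=[e_2,e_3]=[f_2,f_3]=0$, $[f_1,e_3]=e_2$, $[f_3,e_1]=f_2$, $[f_2,e_3]=e_1$,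 $[f_3,e_2]=f_1$. Let $h$ be a formal parameter and $U[[h]]$ the $h$-adically complete superalgebra of formal power series with coefficients in $U$ (graded coefficientwise). All tensor products are $h$-adically completed tensor products of superalgebras, $(a\otimes b)(c\otimes d)=(-1)^{\deg b\deg c}ac\otimes bd$. In $U[[h]]$ put $$T^{\pm1}=\pm he_1+\sqrt{1+h^2e_1^2},\quad H_1=\tfrac12(T+T^{-1})h_1,\quad F_1=f_1-\tfrac{h^2}4e_1(h_1^2-1),$$ $$H_2=h_2-\tfrac{h^2}2e_1^2h_1,\quad E_2=e_2-\tfrac{h^2}4e_1e_3(2h_1+1),\quad F_2=f_2,$$ $$H_3=h_3+\tfrac{h^2}2e_1^2h_1,\quad E_3=e_3,\quad F_3=f_3+\tfrac{h^2}4e_1f_2(2h_1+1),$$ and write $D=T-T^{-1}$, $P=T+T^{-1}$, $Q=T^2-T^{-2}$, $T^{\pm1/2}$ for the square roots of $T^{\pm1}$ with constant term $1$, and $X_1=h^{-1}\ln T$. (1) Relations. These elements satisfy (again with graded commutators) $TT^{-1}=T^{-1}T=1$ and - $[H_1,T^{\pm1}]=T^{\pm2}-1$, $[T^{\pm1},F_1]=\pm\frac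 h2(H_1T^{\pm1}+T^{\pm1}H_1)$, $[H_1,F_1]=-\frac12(TF_1+F_1T+T^{-1}F_1+F_1T^{-1})$; - $[H_1,H_2]=-\frac14D^2H_1$, $[H_1,H_3]=\frac14D^2H_1$, $[H_2,H_3]=0$; - $[H_1,E_2]=-\frac12E_2P-\frac h4(H_1D+DH_1)E_3$, $[H_1,F_2]=\frac12PF_2$, $[H_1,E_3]=\frac12PE_3$, $[H_1,F_3]=-\frac12F_3P+\frac h4(H_1D+DH_1)F_2$; - $[H_2,T]=-\frac14(T^3-T^{-1})$, $[H_2,T^{-1}]=-\frac14(T^{-3}-T)$, $[H_2,F_1]=\frac14P^2F_1-\frac h4DH_1^2-\frac h4QH_1-\frac h{16}QP$; - $[H_2,E_2]=\frac h{16}PQE_3+\frac18D^2E_2$, $[H_2,F_2]=-\frac18D^2F_2$, $[H_2,E_3]=-\frac18(T^2+6+T^{-2})E_3$, $[H_2,F_3]=\frac18(T^2+6+T^{-2})F_3-\frac h{16}QPF_2$; - $[H_3,T]=\frac14(T^3-T^{-1})$, $[H_3,T^{-1}]=\frac14(T^{-3}-T)$, $[H_3,F_1]=-\frac14P^2F_1+\frac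 h4DH_1^2+\frac h4QH_1+\frac h{16}QP$; - $[H_3,E_2]=-\frac18(T^2+6+T^{-2})E_2-\frac h{16}QPE_3$, $[H_3,F_2]=\frac18(T^2+6+T^{-2})F_2$, $[H_3,E_3]=\frac18D^2E_3$, $[H_3,F_3]=\frac h{16}PQF_2-\frac18D^2F_3$; - $[E_2,F_2]=H_2-\frac1{16}D^2-\frac h4DE_3F_2$, $[E_3,F_3]=H_3+\frac1{16}D^2+\frac h4DF_2E_3$; - $[E_2,F_1]=\frac h4DE_2+\frac h2DE_3F_1-\frac{h^2}4E_3H_1^2-\frac{3h^2}8PE_3H_1-\frac{h^2}2E_3-\frac{15h^2}{64}D^2E_3$; - $[F_3,F_1]=\frac h4DF_3-\frac h2DF_2F_1+\frac{h^2}4F_2H_1^2+\frac{3h^2}8PF_2H_1+\frac{h^2}2F_2+\frac{15h^2}{64}D^2F_2$; - $E_2^2=\frac h4DE_3E_2$, $F_2^2=E_3^2=0$, $F_3^2=-\frac h4DF_2F_3$, $[E_2,E_3]=[F_2,F_3]=0$; - $[T^{\pm1},F_2]=[T^{\pm1},E_3]=0$, $[T^{\pm1},E_2]=\pm\frac h2(T^{\pm2}+1)E_3$,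 $[T^{\pm1},F_3]=\mp\frac h2(T^{\pm2}+1)F_2$; - $[F_2,F_1]=F_3$, $[F_1,E_3]=E_2$, $[F_2,E_3]=\frac1{2h}D$; - $[F_3,E_2]=F_1-\frac h4DF_2E_2+\frac h4DE_3F_3-\frac h8DH_1^2-\frac h8QH_1-\frac h{16}H_1Q+\frac{7h}{128}D^3$. (2) Presentation. $U[[h]]$, with these elements, is the superalgebra $U_h(sl(2|1))$ generated by $H_1,T,T^{-1},F_1,H_2,E_2,F_2,H_3,E_3,F_3$ and the relations in (1): for every $h$-adically complete, separated and $h$-torsion-free $\mathbb C[[h]]$-algebra $B$ and all elements of $B$ that satisfy these relations (the one for $[F_2,E_3]$ multiplied by $h$) with $T\in1+hB$, there is exactly one homomorphism of $\mathbb C[[h]]$-algebras $U[[h]]\to B$ taking the generators to them. The grading is the only one for which exactly $E_2,F_2,E_3,F_3$ among the generators are odd. (3) Automorphism. There is exactly one $\mathbb C[[h]]$-algebra automorphism $\Phi$ of $U_h(sl(2|1))$ with $\Phi(T^{\pm1})=T^{\pm1}$, $\Phi(F_1)=F_1$, $\Phi(H_1)=H_1$, $\Phi(E_2)=F_3$,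 $\Phi(F_2)=-E_3$, $\Phi(H_2)=-H_3$, $\Phi(E_3)=-F_2$, $\Phi(F_3)=E_2$, $\Phi(H_3)=-H_2$. (4) Hopf structure. $U_h(sl(2|1))$ has exactly one structure of ($h$-adically completed) Hopf superalgebra over $\mathbb C[[h]]$ with - $\Delta(T^{\pm1})=T^{\pm1}\otimes T^{\pm1}$, $\Delta(H_1)=H_1\otimes T+T^{-1}\otimes H_1$, $\Delta(F_1)=F_1\otimes T+T^{-1}\otimes F_1$, - $\Delta(E_2)=E_2\otimes T^{1/2}+T^{-1/2}\otimes E_2+\frac h4T^{-1}E_3\otimes(T^{-1/2}H_1+H_1T^{-1/2})-\frac h4(T^{1/2}H_1+H_1T^{1/2})\otimes TE_3$, - $\Delta(F_2)=F_2\otimes T^{-1/2}+T^{1/2}\otimes F_2$, $\Delta(E_3)=E_3\otimes T^{-1/2}+T^{1/2}\otimes E_3$, - $\Delta(F_3)=F_3\otimes T^{1/2}+T^{-1/2}\otimes F_3-\frac h4T^{-1}F_2\otimes(T^{-1/2}H_1+H_1T^{-1/2})+\frac h4(T^{1/2}H_1+H_1T^{1/2})\otimes TF_2$, - $\Delta(H_2)=H_2\otimes1+1\otimes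 H_2+\frac14TH_1\otimes(1-T^2)+\frac14(1-T^{-2})\otimes T^{-1}H_1$, $\Delta(H_3)=H_3\otimes1+1\otimes H_3-\frac14TH_1\otimes(1-T^2)-\frac14(1-T^{-2})\otimes T^{-1}H_1$, - $S(T^{\pm1})=T^{\mp1}$, $S(H_1)=-TH_1T^{-1}$, $S(F_1)=-TF_1T^{-1}$, $S(E_2)=-E_2-\frac h2(T+T^{-1})E_3$, $S(F_3)=-F_3+\frac h2(T+T^{-1})F_2$, $S(F_2)=-F_2$, $S(E_3)=-E_3$, $S(H_2)=-H_2+\frac12(T^{-2}-1)$, $S(H_3)=-H_3-\frac12(T^{-2}-1)$, - $\epsilon(T^{\pm1})=1$, and $\epsilon=0$ on $H_i$, $F_i$, $E_2$, $E_3$. (5) Universal $R$-matrix. The element $$\mathcal R_h=\exp(-hX_1\otimes TH_1)\,\exp(hTH_1\otimes X_1)$$ is a triangular universal $R$-matrix of $U_h(sl(2|1))$: it is even and invertible, $\mathcal R_h\Delta(a)=\Delta^{op}(a)\mathcal R_h$ for all $a$, $(\Delta\otimes1)\mathcal R_h=\mathcal R_{13}\mathcal R_{23}$, $(1\otimes\Delta)\mathcal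 R_h=\mathcal R_{13}\mathcal R_{12}$, and $\mathcal R_{21}\mathcal R_h=1$. It coincides with the universal $R$-matrix of the subalgebra $U_h(sl(2))$: with $J_0,J_\pm$ the standard generators of $U(sl(2))$ and $e^{\pm hX}=\pm hJ_++\sqrt{1+h^2J_+^2}$, $H=\frac12(e^{hX}+e^{-hX})J_0$, $Y=J_--\frac{h^2}4J_+(J_0^2-1)$, the algebra $U(sl(2))[[h]]$ has a Hopf structure with $[H,X]=2\frac{\sinh hX}h$, $[H,Y]=-Y\cosh hX-(\cosh hX)Y$, $[X,Y]=H$, $\Delta(X)=X\otimes1+1\otimes X$, $\Delta(Y)=Y\otimes e^{hX}+e^{-hX}\otimes Y$, $\Delta(H)=H\otimes e^{hX}+e^{-hX}\otimes H$, for which $\exp(-hX\otimes e^{hX}H)\exp(he^{hX}H\otimes X)$ is a triangular universal $R$-matrix; and an injective algebra homomorphism $U(sl(2))\to U(sl(2|1))$ extends to an embedding of Hopf superalgebras that sends $e^{\pm hX},H,Y$ to $T^{\pm1},H_1,F_1$ and this $R$-matrix to $\mathcal R_h$. -/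

import Mathlib

open scoped TensorProduct PowerSeries
open PowerSeries (C X coeff)

noncomputable section

namespace SuperJordan

/-! ## Superalgebras and their graded tensor products -/

/-- A superalgebra over `ℂ`: a `ℤ/2`-grading of the algebra `A`, given by its parity automorphism
(the identity on even elements, minus the identity on odd elements). -/
class SuperAlgebra (A : Type*) [Ring A] [Algebra ℂ A] where
  /-- the parity automorphism -/
  parity : A →ₐ[ℂ] A
  parity_parity : ∀ a, parity (parity a) = a

/-- The even (`i = 0`) and odd (`i = 1`) parts of a superalgebra. -/
def grading (A : Type*) [Ring A] [Algebra ℂ A] [SuperAlgebra A] (i : ZMod 2) : Submodule ℂ A where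
  carrier := {a | SuperAlgebra.parity a = if i = 0 then a else -a}
  add_mem' := by
    intro a b ha hb
    simp only [Set.mem_ofPred_eq, map_add] at *
    rw [ha, hb]
    split_ifs
    · rfl
    · abel
  zero_mem' := by simp
  smul_mem' := by
    intro c a ha
    simp only [Set.mem_ofPred_eq, map_smul] at *
    rw [ha]
    split_ifs
    · rfl
    · simp

section Grading

variable {A : Type*} [Ring A] [Algebra ℂ A] [SuperAlgebra A]

theorem mem_grading_zero {a : A} : a ∈ grading A 0 ↔ SuperAlgebra.parity a = a := by
  change (SuperAlgebra.parity a = if (0 : ZMod 2) = 0 then a else -a) ↔ _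
  rw [if_pos rfl]

theorem mem_grading_one {a : A} : a ∈ grading A 1 ↔ SuperAlgebra.parity a = -a := by
  change (SuperAlgebra.parity a = if (1 : ZMod 2) = 0 then a else -a) ↔ _
  rw [if_neg (by decide)]

theorem even_part_mem (a : A) : (1 / 2 : ℂ) • (a + SuperAlgebra.parity a) ∈ grading A 0 := by
  rw [mem_grading_zero, map_smul, map_add, SuperAlgebra.parity_parity, add_comm]

theorem odd_part_mem (a : A) : (1 / 2 : ℂ) • (a - SuperAlgebra.parity a) ∈ grading A 1 := by
  rw [mem_grading_one, map_smul, map_sub, SuperAlgebra.parity_parity, ← smul_neg, neg_sub]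

instance gradedMonoid_grading : SetLike.GradedMonoid (grading A) where
  one_mem := by rw [mem_grading_zero, map_one]
  mul_mem := by
    intro i j a b ha hb
    fin_cases i <;> fin_cases j
    · exact mem_grading_zero.2 (by rw [map_mul, mem_grading_zero.1 ha, mem_grading_zero.1 hb])
    · exact mem_grading_one.2 (by rw [map_mul, mem_grading_zero.1 ha, mem_grading_one.1 hb, mul_neg])
    · exact mem_grading_one.2 (by rw [map_mul, mem_grading_one.1 ha, mem_grading_zero.1 hb, neg_mul])
    · exact mem_grading_zero.2
        (by rw [map_mul, mem_grading_one.1 ha, mem_grading_one.1 hb, neg_mul_neg])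

/-- Decomposition of an element into its even and its odd part. -/
def decomposeMap : A →+ DirectSum (ZMod 2) fun i => grading A i where
  toFun a := DirectSum.of (fun i => grading A i) 0 ⟨_, even_part_mem a⟩ +
    DirectSum.of (fun i => grading A i) 1 ⟨_, odd_part_mem a⟩
  map_zero' := by
    have h0 : (⟨_, even_part_mem (0 : A)⟩ : grading A 0) = 0 := Subtype.ext (by simp)
    have h1 : (⟨_, odd_part_mem (0 : A)⟩ : grading A 1) = 0 := Subtype.ext (by simp)
    rw [h0, h1, map_zero, map_zero, add_zero]
  map_add' a b := by
    have h0 : (⟨_, even_part_mem (a + b)⟩ : grading A 0) =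
        ⟨_, even_part_mem a⟩ + ⟨_, even_part_mem b⟩ :=
      Subtype.ext (by simp only [map_add, AddMemClass.coe_add, ← smul_add]; congr 1; abel)
    have h1 : (⟨_, odd_part_mem (a + b)⟩ : grading A 1) =
        ⟨_, odd_part_mem a⟩ + ⟨_, odd_part_mem b⟩ :=
      Subtype.ext (by simp only [map_add, AddMemClass.coe_add, ← smul_add]; congr 1; abel)
    rw [h0, h1, map_add, map_add]
    abel

instance decomposition_grading : DirectSum.Decomposition (grading A) :=
  DirectSum.Decomposition.ofAddHom (grading A) decomposeMap
    (by
      ext a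
      simp only [AddMonoidHom.comp_apply, decomposeMap, AddMonoidHom.coe_mk, ZeroHom.coe_mk,
        map_add, DirectSum.coeAddMonoidHom_of, AddMonoidHom.id_apply]
      rw [← smul_add, add_add_sub_cancel, ← two_smul ℂ a, smul_smul]
      norm_num)
    (by
      ext i a : 2
      obtain ⟨a, ha⟩ := a
      simp only [AddMonoidHom.comp_apply, decomposeMap, AddMonoidHom.coe_mk, ZeroHom.coe_mk,
        DirectSum.coeAddMonoidHom_of, AddMonoidHom.id_apply]
      fin_cases i
      · have h := mem_grading_zero.1 ha
        have h0 : (⟨_, even_part_mem a⟩ : grading A 0) = ⟨a, ha⟩ := Subtype.ext (by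
          simp only [h]
          rw [← two_smul ℂ a, smul_smul]; norm_num)
        have h1 : (⟨_, odd_part_mem a⟩ : grading A 1) = 0 := Subtype.ext (by simp [h])
        rw [h0, h1, map_zero, add_zero]
        rfl
      · have h := mem_grading_one.1 ha
        have h0 : (⟨_, even_part_mem a⟩ : grading A 0) = 0 := Subtype.ext (by simp [h])
        have h1 : (⟨_, odd_part_mem a⟩ : grading A 1) = ⟨a, ha⟩ := Subtype.ext (by
          simp only [h]
          rw [sub_neg_eq_add, ← two_smul ℂ a, smul_smul]; norm_num)
        rw [h0, h1, map_zero, zero_add]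
        rfl)

instance gradedAlgebra_grading : GradedAlgebra (grading A) where

end Grading

/-- The tensor product of superalgebras, with
`(a ⊗ b) (c ⊗ d) = (-1) ^ (deg b * deg c) (a c ⊗ b d)`. -/
abbrev STensor (A B : Type*) [Ring A] [Algebra ℂ A] [SuperAlgebra A]
    [Ring B] [Algebra ℂ B] [SuperAlgebra B] : Type _ :=
  grading A ᵍ⊗[ℂ] grading B

infixl:100 " ⊗ˢ " => STensor

section Tensor

variable {A B A' B' : Type*} [Ring A] [Algebra ℂ A] [SuperAlgebra A]
  [Ring B] [Algebra ℂ B] [SuperAlgebra B] [Ring A'] [Algebra ℂ A'] [SuperAlgebra A']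
  [Ring B'] [Algebra ℂ B'] [SuperAlgebra B']

theorem units_pow_zero : ((-1 : ℤˣ) ^ (0 : ZMod 2)) = 1 := uzpow_zero _

theorem units_pow_one : ((-1 : ℤˣ) ^ (1 : ZMod 2)) = -1 := uzpow_one _

theorem parity_coe {i : ZMod 2} (a : grading A i) :
    SuperAlgebra.parity (a : A) = ((-1 : ℤˣ) ^ i) • (a : A) := by
  obtain ⟨a, ha⟩ := a
  fin_cases i
  · change SuperAlgebra.parity a = ((-1 : ℤˣ) ^ (0 : ZMod 2)) • a
    rw [units_pow_zero, one_smul, mem_grading_zero.1 ha]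
  · change SuperAlgebra.parity a = ((-1 : ℤˣ) ^ (1 : ZMod 2)) • a
    rw [units_pow_one, mem_grading_one.1 ha, Units.neg_smul, one_smul]

theorem parity_mem {i : ZMod 2} {a : A} (ha : a ∈ grading A i) :
    SuperAlgebra.parity a ∈ grading A i := by
  change SuperAlgebra.parity (SuperAlgebra.parity a) = if i = 0 then SuperAlgebra.parity a
    else -SuperAlgebra.parity a
  have h : SuperAlgebra.parity a = if i = 0 then a else -a := ha
  split_ifs with hi
  · rw [if_pos hi] at h; rw [h, h]
  · rw [if_neg hi] at h; rw [h, map_neg, h]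

/-- The tensor product of two linear maps that preserve parity. -/
def smap (f : A →ₗ[ℂ] A') (g : B →ₗ[ℂ] B') : A ⊗ˢ B →ₗ[ℂ] A' ⊗ˢ B' :=
  (GradedTensorProduct.of ℂ (grading A') (grading B')).toLinearMap ∘ₗ TensorProduct.map f g ∘ₗ
    (GradedTensorProduct.of ℂ (grading A) (grading B)).symm.toLinearMap

/-- The parity of a tensor product: `a ⊗ b` is sent to `parity a ⊗ parity b`. -/
def tensorParity (A B : Type*) [Ring A] [Algebra ℂ A] [SuperAlgebra A]
    [Ring B] [Algebra ℂ B] [SuperAlgebra B] : A ⊗ˢ B →ₐ[ℂ] A ⊗ˢ B :=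
  GradedTensorProduct.lift (grading A) (grading B)
    ((GradedTensorProduct.includeLeft (grading A) (grading B)).comp SuperAlgebra.parity)
    ((GradedTensorProduct.includeRight (grading A) (grading B)).comp SuperAlgebra.parity)
    (by
      intro i j a b
      have h := GradedTensorProduct.tmul_coe_mul_coe_tmul (R := ℂ) (𝒜 := grading A)
        (ℬ := grading B) (1 : A) (⟨_, parity_mem b.2⟩ : grading B j)
        (⟨_, parity_mem a.2⟩ : grading A i) (1 : B)
      simp only [one_mul, mul_one] at h
      simp only [AlgHom.comp_apply, GradedTensorProduct.includeLeft_apply,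
        GradedTensorProduct.includeRight_apply]
      rw [h, smul_smul, Int.units_mul_self, one_smul, GradedTensorProduct.tmul_one_mul_one_tmul])

instance superAlgebra_tensor : SuperAlgebra (A ⊗ˢ B) where
  parity := tensorParity A B
  parity_parity := by
    have h : (tensorParity A B).comp (tensorParity A B) = AlgHom.id ℂ _ := by
      have one : (1 ᵍ⊗ₜ[ℂ] 1 : A ⊗ˢ B) = 1 := rfl
      refine GradedTensorProduct.algHom_ext _ _ ?_ ?_ <;> ext a <;>
        simp [tensorParity, SuperAlgebra.parity_parity, one]
    exact fun x => DFunLike.congr_fun h x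

/-- The multiplication `A ⊗ A → A`, as a linear map. -/
def mulMap (A : Type*) [Ring A] [Algebra ℂ A] [SuperAlgebra A] : A ⊗ˢ A →ₗ[ℂ] A :=
  LinearMap.mul' ℂ A ∘ₗ (GradedTensorProduct.of ℂ (grading A) (grading A)).symm.toLinearMap

/-- The associativity isomorphism `(A ⊗ B) ⊗ D → A ⊗ (B ⊗ D)`. -/
def sassoc (A B D : Type*) [Ring A] [Algebra ℂ A] [SuperAlgebra A] [Ring B] [Algebra ℂ B]
    [SuperAlgebra B] [Ring D] [Algebra ℂ D] [SuperAlgebra D] :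
    (A ⊗ˢ B) ⊗ˢ D →ₗ[ℂ] A ⊗ˢ (B ⊗ˢ D) :=
  (GradedTensorProduct.of ℂ (grading A) (grading (B ⊗ˢ D))).toLinearMap ∘ₗ
    TensorProduct.map LinearMap.id
      (GradedTensorProduct.of ℂ (grading B) (grading D)).toLinearMap ∘ₗ
    (TensorProduct.assoc ℂ A B D).toLinearMap ∘ₗ
    TensorProduct.map (GradedTensorProduct.of ℂ (grading A) (grading B)).symm.toLinearMap
      LinearMap.id ∘ₗ
    (GradedTensorProduct.of ℂ (grading (A ⊗ˢ B)) (grading D)).symm.toLinearMap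

/-- The graded flip `a ⊗ b ↦ (-1) ^ (deg a * deg b) (b ⊗ a)`. -/
def flip (A : Type*) [Ring A] [Algebra ℂ A] [SuperAlgebra A] : A ⊗ˢ A →ₗ[ℂ] A ⊗ˢ A :=
  (GradedTensorProduct.comm (grading A) (grading A)).toLinearMap

end Tensor

instance superAlgebra_complex : SuperAlgebra ℂ where
  parity := AlgHom.id ℂ ℂ
  parity_parity _ := rfl

/-! ## Formal power series in the deformation parameter `h` -/

/-- `A⟦h⟧` is an algebra over `ℂ⟦h⟧`, for every (noncommutative) complex algebra `A`. -/
instance (priority := 50) formalAlgebra {A : Type*} [Ring A] [Algebra ℂ A] :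
    Algebra ℂ⟦X⟧ A⟦X⟧ :=
  (PowerSeries.map (algebraMap ℂ A)).toAlgebra' (by
    intro c x
    ext n
    rw [PowerSeries.coeff_mul, PowerSeries.coeff_mul,
      ← Finset.Nat.sum_antidiagonal_swap (f := fun p => coeff p.1 x * _)]
    refine Finset.sum_congr rfl fun ij _ => ?_
    simp only [Prod.fst_swap, Prod.snd_swap, PowerSeries.coeff_map]
    exact Algebra.commutes _ _)

instance (priority := 50) formalTower {A : Type*} [Ring A] [Algebra ℂ A] :
    IsScalarTower ℂ ℂ⟦X⟧ A⟦X⟧ :=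
  IsScalarTower.of_algebraMap_eq' (by
    ext c n
    change coeff n (algebraMap ℂ A⟦X⟧ c) =
      coeff n (PowerSeries.map (algebraMap ℂ A) (algebraMap ℂ ℂ⟦X⟧ c))
    rw [PowerSeries.algebraMap_apply, PowerSeries.algebraMap_apply]
    simp)

/-- The deformation parameter. -/
def hbar : ℂ⟦X⟧ := X

section Formal

variable {A B D : Type*} [Ring A] [Algebra ℂ A] [Ring B] [Algebra ℂ B] [Ring D] [Algebra ℂ D]

/-- Coefficientwise extension `A⟦h⟧ → B⟦h⟧` of a linear map `A → B`. -/
def coeffMap (f : A →ₗ[ℂ] B) (a : A⟦X⟧) : B⟦X⟧ := PowerSeries.mk fun n => f (coeff n a)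

/-- Division by `h` of a series without constant term. -/
def divH (a : A⟦X⟧) : A⟦X⟧ := PowerSeries.mk fun n => coeff (n + 1) a

/-- The series `∑ₖ fₖ aᵏ`, for a scalar power series `f = ∑ₖ fₖ xᵏ` and an element `a` of `A⟦h⟧`
without constant term (then `aᵏ` is divisible by `hᵏ`). -/
def subst (f : ℂ⟦X⟧) (a : A⟦X⟧) : A⟦X⟧ :=
  PowerSeries.mk fun n => ∑ k ∈ Finset.range (n + 1), coeff k f • coeff n (a ^ k)

/-- The exponential of a series without constant term. -/
def hexp (a : A⟦X⟧) : A⟦X⟧ := subst (PowerSeries.exp ℂ) a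

/-- The logarithm of a series with constant term `1`. -/
def hlog (a : A⟦X⟧) : A⟦X⟧ := subst (PowerSeries.log ℂ) (a - 1)

/-- The power `a ^ r`, with a complex exponent `r`, of a series with constant term `1`. -/
def hpow (a : A⟦X⟧) (r : ℂ) : A⟦X⟧ := subst (PowerSeries.binomialSeries ℂ r) (a - 1)

/-- The components `Fₙ : A → B` of a linear map `F : A⟦h⟧ → B⟦h⟧`, so that
`F a = ∑ₙ hⁿ Fₙ a` for `a` in `A`. -/
def component (F : A⟦X⟧ →ₗ[ℂ] B⟦X⟧) (n : ℕ) : A →ₗ[ℂ] B where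
  toFun a := coeff n (F (C a))
  map_add' a b := by simp
  map_smul' c a := by
    have h : (C (c • a) : A⟦X⟧) = c • C a := by
      ext m
      simp only [PowerSeries.coeff_C, PowerSeries.coeff_smul]
      split_ifs <;> simp
    rw [h, map_smul]
    rfl

/-- The `h`-linear and `h`-adically continuous extension `A⟦h⟧ → B⟦h⟧` of `∑ₙ hⁿ fₙ`. -/
def extend (f : ℕ → A →ₗ[ℂ] B) (a : A⟦X⟧) : B⟦X⟧ :=
  PowerSeries.mk fun n => ∑ ij ∈ Finset.HasAntidiagonal.antidiagonal n, f ij.2 (coeff ij.1 a)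

variable [SuperAlgebra A] [SuperAlgebra B] [SuperAlgebra D]

/-- The element `a ⊗ b` of the completed tensor product `(A ⊗ B)⟦h⟧` of `A⟦h⟧` and `B⟦h⟧`. -/
def htmul (a : A⟦X⟧) (b : B⟦X⟧) : (A ⊗ˢ B)⟦X⟧ :=
  PowerSeries.mk fun n => ∑ ij ∈ Finset.HasAntidiagonal.antidiagonal n,
    (GradedTensorProduct.tmul ℂ (coeff ij.1 a) (coeff ij.2 b) : A ⊗ˢ B)

infixl:100 " ⊗ʰ " => htmul

/-- `F ⊗ id`, on completed tensor products, for an even `ℂ⟦h⟧`-linear map `F`. -/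
def mapLeft (F : A⟦X⟧ →ₗ[ℂ] B⟦X⟧) : (A ⊗ˢ D)⟦X⟧ → (B ⊗ˢ D)⟦X⟧ :=
  extend fun n => smap (component F n) LinearMap.id

/-- `id ⊗ F`, on completed tensor products, for an even `ℂ⟦h⟧`-linear map `F`. -/
def mapRight (F : A⟦X⟧ →ₗ[ℂ] B⟦X⟧) : (D ⊗ˢ A)⟦X⟧ → (D ⊗ˢ B)⟦X⟧ :=
  extend fun n => smap LinearMap.id (component F n)

end Formal

/-- The parity of `A⟦h⟧`. -/
def hparity {A : Type*} [Ring A] [Algebra ℂ A] [SuperAlgebra A] (a : A⟦X⟧) : A⟦X⟧ :=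
  coeffMap (SuperAlgebra.parity : A →ₐ[ℂ] A).toLinearMap a

/-- A structure of topological Hopf superalgebra over `ℂ⟦h⟧` on the superalgebra `A⟦h⟧`. -/
structure HopfStructure (A : Type*) [Ring A] [Algebra ℂ A] [SuperAlgebra A] where
  /-- coproduct -/
  comul : A⟦X⟧ →ₐ[ℂ⟦X⟧] (A ⊗ˢ A)⟦X⟧
  /-- counit -/
  counit : A⟦X⟧ →ₐ[ℂ⟦X⟧] ℂ⟦X⟧
  /-- antipode -/
  antipode : A⟦X⟧ →ₗ[ℂ⟦X⟧] A⟦X⟧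
  comul_parity : ∀ a, comul (hparity a) = hparity (comul a)
  counit_parity : ∀ a, counit (hparity a) = counit a
  antipode_parity : ∀ a, antipode (hparity a) = hparity (antipode a)
  coassoc : ∀ a,
    coeffMap (sassoc A A A) (mapLeft (comul.toLinearMap.restrictScalars ℂ) (comul a)) =
      mapRight (comul.toLinearMap.restrictScalars ℂ) (comul a)
  counit_left : ∀ a, mapLeft (counit.toLinearMap.restrictScalars ℂ) (comul a) = 1 ⊗ʰ a
  counit_right : ∀ a, mapRight (counit.toLinearMap.restrictScalars ℂ) (comul a) = a ⊗ʰ 1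
  antipode_left : ∀ a, coeffMap (mulMap A) (mapLeft (antipode.restrictScalars ℂ) (comul a)) =
    algebraMap ℂ⟦X⟧ A⟦X⟧ (counit a)
  antipode_right : ∀ a, coeffMap (mulMap A) (mapRight (antipode.restrictScalars ℂ) (comul a)) =
    algebraMap ℂ⟦X⟧ A⟦X⟧ (counit a)

/-- `R` is a universal `R`-matrix: an invertible even element with `R Δ(a) = Δᵒᵖ(a) R`,
`(Δ ⊗ id) R = R₁₃ R₂₃` and `(id ⊗ Δ) R = R₁₃ R₁₂`; moreover it is triangular: `R₂₁ R = 1`. -/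
structure IsTriangularRMatrix {A : Type*} [Ring A] [Algebra ℂ A] [SuperAlgebra A]
    (𝓗 : HopfStructure A) (R : (A ⊗ˢ A)⟦X⟧) : Prop where
  isUnit : IsUnit R
  even : hparity R = R
  intertwine : ∀ a, R * 𝓗.comul a = coeffMap (flip A) (𝓗.comul a) * R
  comul_left : mapLeft (𝓗.comul.toLinearMap.restrictScalars ℂ) R =
    coeffMap (smap (GradedTensorProduct.includeLeft (grading A) (grading A)).toLinearMap
      LinearMap.id) R *
    coeffMap (smap (GradedTensorProduct.includeRight (grading A) (grading A)).toLinearMap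
      LinearMap.id) R
  comul_right : mapRight (𝓗.comul.toLinearMap.restrictScalars ℂ) R =
    coeffMap (smap LinearMap.id
      (GradedTensorProduct.includeRight (grading A) (grading A)).toLinearMap) R *
    coeffMap (smap LinearMap.id
      (GradedTensorProduct.includeLeft (grading A) (grading A)).toLinearMap) R
  triangular : coeffMap (flip A) R * R = 1

/-! ## The classical enveloping superalgebra `U(sl(2|1))` -/

/-- The generators of `U(sl(2|1))`. -/
inductive Gen
  | h1 | h2 | h3 | e1 | f1 | e2 | f2 | e3 | f3

/-- The degree of a generator is odd. -/
def Gen.odd : Gen → Bool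
  | .e2 | .f2 | .e3 | .f3 => true
  | _ => false

/-- The generators, as elements of the free algebra. -/
def gen : Gen → FreeAlgebra ℂ Gen := FreeAlgebra.ι ℂ

/-- The `ℤ/2`-graded commutator of two generators, in the free algebra. -/
def gbr (x y : Gen) : FreeAlgebra ℂ Gen :=
  if x.odd && y.odd then gen x * gen y + gen y * gen x else gen x * gen y - gen y * gen x

open Gen in
/-- The defining relations of `U(sl(2|1))`. -/
inductive Rel : FreeAlgebra ℂ Gen → FreeAlgebra ℂ Gen → Prop
  | h1_h2 : Rel (gbr h1 h2) 0
  | h1_h3 : Rel (gbr h1 h3) 0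
  | h2_h3 : Rel (gbr h2 h3) 0
  | h1_e1 : Rel (gbr h1 e1) ((2 : ℂ) • gen e1)
  | h1_f1 : Rel (gbr h1 f1) ((-2 : ℂ) • gen f1)
  | h1_e2 : Rel (gbr h1 e2) (-gen e2)
  | h1_f2 : Rel (gbr h1 f2) (gen f2)
  | h1_e3 : Rel (gbr h1 e3) (gen e3)
  | h1_f3 : Rel (gbr h1 f3) (-gen f3)
  | h2_e1 : Rel (gbr h2 e1) (-gen e1)
  | h2_f1 : Rel (gbr h2 f1) (gen f1)
  | h2_e2 : Rel (gbr h2 e2) 0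
  | h2_f2 : Rel (gbr h2 f2) 0
  | h2_e3 : Rel (gbr h2 e3) (-gen e3)
  | h2_f3 : Rel (gbr h2 f3) (gen f3)
  | h3_e1 : Rel (gbr h3 e1) (gen e1)
  | h3_f1 : Rel (gbr h3 f1) (-gen f1)
  | h3_e2 : Rel (gbr h3 e2) (-gen e2)
  | h3_f2 : Rel (gbr h3 f2) (gen f2)
  | h3_e3 : Rel (gbr h3 e3) 0
  | h3_f3 : Rel (gbr h3 f3) 0
  | e1_f1 : Rel (gbr e1 f1) (gen h1)
  | e2_f2 : Rel (gbr e2 f2) (gen h2)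
  | e3_f3 : Rel (gbr e3 f3) (gen h3)
  | e1_f2 : Rel (gbr e1 f2) 0
  | e2_f1 : Rel (gbr e2 f1) 0
  | e2_e2 : Rel (gen e2 ^ 2) 0
  | f2_f2 : Rel (gen f2 ^ 2) 0
  | e1_e2 : Rel (gbr e1 e2) (gen e3)
  | f2_f1 : Rel (gbr f2 f1) (gen f3)
  | e3_e3 : Rel (gen e3 ^ 2) 0
  | f3_f3 : Rel (gen f3 ^ 2) 0
  | e1_e3 : Rel (gbr e1 e3) 0
  | f3_f1 : Rel (gbr f3 f1) 0
  | e2_e3 : Rel (gbr e2 e3) 0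
  | f2_f3 : Rel (gbr f2 f3) 0
  | f1_e3 : Rel (gbr f1 e3) (gen e2)
  | f3_e1 : Rel (gbr f3 e1) (gen f2)
  | f2_e3 : Rel (gbr f2 e3) (gen e1)
  | f3_e2 : Rel (gbr f3 e2) (gen f1)

/-- The enveloping superalgebra `U(sl(2|1))`. -/
def U : Type := RingQuot Rel

instance ring_U : Ring U := inferInstanceAs (Ring (RingQuot Rel))

instance algebra_U : Algebra ℂ U := inferInstanceAs (Algebra ℂ (RingQuot Rel))

/-- The canonical projection from the free algebra to `U(sl(2|1))`. -/
def proj : FreeAlgebra ℂ Gen →ₐ[ℂ] U := RingQuot.mkAlgHom ℂ Rel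

/-- The classical generators, as elements of `U(sl(2|1))`. -/
def u (x : Gen) : U := proj (gen x)

theorem proj_gen (x : Gen) : proj (gen x) = u x := rfl

theorem proj_rel {x y : FreeAlgebra ℂ Gen} (h : Rel x y) : proj x = proj y :=
  RingQuot.mkAlgHom_rel ℂ h

/-- The universal property of `U(sl(2|1))`. -/
def liftU {B : Type*} [Ring B] [Algebra ℂ B] (f : FreeAlgebra ℂ Gen →ₐ[ℂ] B)
    (h : ∀ ⦃x y⦄, Rel x y → f x = f y) : U →ₐ[ℂ] B :=
  RingQuot.liftAlgHom ℂ ⟨f, h⟩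

theorem liftU_proj {B : Type*} [Ring B] [Algebra ℂ B] (f : FreeAlgebra ℂ Gen →ₐ[ℂ] B)
    (h : ∀ ⦃x y⦄, Rel x y → f x = f y) (x : FreeAlgebra ℂ Gen) : liftU f h (proj x) = f x :=
  RingQuot.liftAlgHom_mkAlgHom_apply ..

theorem proj_surjective : Function.Surjective proj := RingQuot.mkAlgHom_surjective ℂ Rel

/-- The sign change of the odd generators. -/
def signHom : FreeAlgebra ℂ Gen →ₐ[ℂ] U :=
  FreeAlgebra.lift ℂ fun x => if x.odd then -u x else u x

theorem signHom_gen (x : Gen) : signHom (gen x) = if x.odd then -u x else u x := by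
  simp [signHom, gen]

theorem signHom_rel ⦃x y : FreeAlgebra ℂ Gen⦄ (h : Rel x y) : signHom x = signHom y := by
  have key := proj_rel h
  cases h <;>
    simp [gbr, signHom_gen, Gen.odd, proj_gen] at key ⊢ <;>
    grind

instance superAlgebra_U : SuperAlgebra U where
  parity := liftU signHom signHom_rel
  parity_parity := by
    have h : ((liftU signHom signHom_rel).comp (liftU signHom signHom_rel)).comp proj =
        proj := by
      apply FreeAlgebra.hom_ext
      funext x
      have hx : FreeAlgebra.ι ℂ x = gen x := rfl
      have hy : ∀ x, liftU signHom signHom_rel (u x) = signHom (gen x) :=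
        fun x => liftU_proj ..
      simp only [Function.comp_apply, AlgHom.comp_apply, hx, liftU_proj, signHom_gen]
      by_cases ho : x.odd <;> simp [ho, hy, signHom_gen, proj_gen]
    intro a
    obtain ⟨a, rfl⟩ := proj_surjective a
    exact DFunLike.congr_fun h a

/-! ## The super-Jordanian generators and relations -/

/-- A family of elements of `B` named like the super-Jordanian generators
(`Tinv` stands for `T⁻¹`). -/
structure Gens (B : Type*) where
  (H1 T Tinv F1 H2 E2 F2 H3 E3 F3 : B)

/-- The super-Jordanian relations with deformation parameter `h`. Here `⁅x, y⁆ = x y - y x`, and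
the graded commutator of two odd generators `x`, `y` is written out as `x y + y x`. -/
structure DeformedRelations {B : Type*} [Ring B] [Algebra ℂ B] (h : B) (g : Gens B) : Prop where
  T_Tinv : g.T * g.Tinv = 1
  Tinv_T : g.Tinv * g.T = 1
  H1_T : ⁅g.H1, g.T⁆ = g.T ^ 2 - 1
  H1_Tinv : ⁅g.H1, g.Tinv⁆ = g.Tinv ^ 2 - 1
  T_F1 : ⁅g.T, g.F1⁆ = (1 / 2 : ℂ) • (h * (g.H1 * g.T + g.T * g.H1))
  Tinv_F1 : ⁅g.Tinv, g.F1⁆ = -((1 / 2 : ℂ) • (h * (g.H1 * g.Tinv + g.Tinv * g.H1)))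
  H1_F1 : ⁅g.H1, g.F1⁆ =
    -((1 / 2 : ℂ) • (g.T * g.F1 + g.F1 * g.T + g.Tinv * g.F1 + g.F1 * g.Tinv))
  H1_H2 : ⁅g.H1, g.H2⁆ = -((1 / 4 : ℂ) • ((g.T - g.Tinv) ^ 2 * g.H1))
  H1_H3 : ⁅g.H1, g.H3⁆ = (1 / 4 : ℂ) • ((g.T - g.Tinv) ^ 2 * g.H1)
  H2_H3 : ⁅g.H2, g.H3⁆ = 0
  H1_E2 : ⁅g.H1, g.E2⁆ = -((1 / 2 : ℂ) • (g.E2 * (g.T + g.Tinv))) -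
    (1 / 4 : ℂ) • (h * (g.H1 * (g.T - g.Tinv) + (g.T - g.Tinv) * g.H1) * g.E3)
  H1_F2 : ⁅g.H1, g.F2⁆ = (1 / 2 : ℂ) • ((g.T + g.Tinv) * g.F2)
  H1_E3 : ⁅g.H1, g.E3⁆ = (1 / 2 : ℂ) • ((g.T + g.Tinv) * g.E3)
  H1_F3 : ⁅g.H1, g.F3⁆ = -((1 / 2 : ℂ) • (g.F3 * (g.T + g.Tinv))) +
    (1 / 4 : ℂ) • (h * (g.H1 * (g.T - g.Tinv) + (g.T - g.Tinv) * g.H1) * g.F2)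
  H2_T : ⁅g.H2, g.T⁆ = -((1 / 4 : ℂ) • (g.T ^ 3 - g.Tinv))
  H2_Tinv : ⁅g.H2, g.Tinv⁆ = -((1 / 4 : ℂ) • (g.Tinv ^ 3 - g.T))
  H2_F1 : ⁅g.H2, g.F1⁆ = (1 / 4 : ℂ) • ((g.T + g.Tinv) ^ 2 * g.F1) -
    (1 / 4 : ℂ) • (h * (g.T - g.Tinv) * g.H1 ^ 2) -
    (1 / 4 : ℂ) • (h * (g.T ^ 2 - g.Tinv ^ 2) * g.H1) -
    (1 / 16 : ℂ) • (h * (g.T ^ 2 - g.Tinv ^ 2) * (g.T + g.Tinv))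
  H2_E2 : ⁅g.H2, g.E2⁆ = (1 / 16 : ℂ) • (h * (g.T + g.Tinv) * (g.T ^ 2 - g.Tinv ^ 2) * g.E3) +
    (1 / 8 : ℂ) • ((g.T - g.Tinv) ^ 2 * g.E2)
  H2_F2 : ⁅g.H2, g.F2⁆ = -((1 / 8 : ℂ) • ((g.T - g.Tinv) ^ 2 * g.F2))
  H2_E3 : ⁅g.H2, g.E3⁆ = -((1 / 8 : ℂ) • ((g.T ^ 2 + 6 + g.Tinv ^ 2) * g.E3))
  H2_F3 : ⁅g.H2, g.F3⁆ = (1 / 8 : ℂ) • ((g.T ^ 2 + 6 + g.Tinv ^ 2) * g.F3) -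
    (1 / 16 : ℂ) • (h * (g.T ^ 2 - g.Tinv ^ 2) * (g.T + g.Tinv) * g.F2)
  H3_T : ⁅g.H3, g.T⁆ = (1 / 4 : ℂ) • (g.T ^ 3 - g.Tinv)
  H3_Tinv : ⁅g.H3, g.Tinv⁆ = (1 / 4 : ℂ) • (g.Tinv ^ 3 - g.T)
  H3_F1 : ⁅g.H3, g.F1⁆ = -((1 / 4 : ℂ) • ((g.T + g.Tinv) ^ 2 * g.F1)) +
    (1 / 4 : ℂ) • (h * (g.T - g.Tinv) * g.H1 ^ 2) +
    (1 / 4 : ℂ) • (h * (g.T ^ 2 - g.Tinv ^ 2) * g.H1) +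
    (1 / 16 : ℂ) • (h * (g.T ^ 2 - g.Tinv ^ 2) * (g.T + g.Tinv))
  H3_E2 : ⁅g.H3, g.E2⁆ = -((1 / 8 : ℂ) • ((g.T ^ 2 + 6 + g.Tinv ^ 2) * g.E2)) -
    (1 / 16 : ℂ) • (h * (g.T ^ 2 - g.Tinv ^ 2) * (g.T + g.Tinv) * g.E3)
  H3_F2 : ⁅g.H3, g.F2⁆ = (1 / 8 : ℂ) • ((g.T ^ 2 + 6 + g.Tinv ^ 2) * g.F2)
  H3_E3 : ⁅g.H3, g.E3⁆ = (1 / 8 : ℂ) • ((g.T - g.Tinv) ^ 2 * g.E3)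
  H3_F3 : ⁅g.H3, g.F3⁆ = (1 / 16 : ℂ) • (h * (g.T + g.Tinv) * (g.T ^ 2 - g.Tinv ^ 2) * g.F2) -
    (1 / 8 : ℂ) • ((g.T - g.Tinv) ^ 2 * g.F3)
  E2_F2 : g.E2 * g.F2 + g.F2 * g.E2 = g.H2 - (1 / 16 : ℂ) • (g.T - g.Tinv) ^ 2 -
    (1 / 4 : ℂ) • (h * (g.T - g.Tinv) * g.E3 * g.F2)
  E3_F3 : g.E3 * g.F3 + g.F3 * g.E3 = g.H3 + (1 / 16 : ℂ) • (g.T - g.Tinv) ^ 2 +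
    (1 / 4 : ℂ) • (h * (g.T - g.Tinv) * g.F2 * g.E3)
  T_F2 : ⁅g.T, g.F2⁆ = 0
  Tinv_F2 : ⁅g.Tinv, g.F2⁆ = 0
  E2_F1 : ⁅g.E2, g.F1⁆ = (1 / 4 : ℂ) • (h * (g.T - g.Tinv) * g.E2) +
    (1 / 2 : ℂ) • (h * (g.T - g.Tinv) * g.E3 * g.F1) -
    (1 / 4 : ℂ) • (h ^ 2 * g.E3 * g.H1 ^ 2) -
    (3 / 8 : ℂ) • (h ^ 2 * (g.T + g.Tinv) * g.E3 * g.H1) -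
    (1 / 2 : ℂ) • (h ^ 2 * g.E3) -
    (15 / 64 : ℂ) • (h ^ 2 * (g.T - g.Tinv) ^ 2 * g.E3)
  E2_sq : g.E2 ^ 2 = (1 / 4 : ℂ) • (h * (g.T - g.Tinv) * g.E3 * g.E2)
  F2_sq : g.F2 ^ 2 = 0
  E3_sq : g.E3 ^ 2 = 0
  F3_sq : g.F3 ^ 2 = -((1 / 4 : ℂ) • (h * (g.T - g.Tinv) * g.F2 * g.F3))
  T_E2 : ⁅g.T, g.E2⁆ = (1 / 2 : ℂ) • (h * (g.T ^ 2 + 1) * g.E3)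
  Tinv_E2 : ⁅g.Tinv, g.E2⁆ = -((1 / 2 : ℂ) • (h * (g.Tinv ^ 2 + 1) * g.E3))
  F2_F1 : ⁅g.F2, g.F1⁆ = g.F3
  T_E3 : ⁅g.T, g.E3⁆ = 0
  Tinv_E3 : ⁅g.Tinv, g.E3⁆ = 0
  F3_F1 : ⁅g.F3, g.F1⁆ = (1 / 4 : ℂ) • (h * (g.T - g.Tinv) * g.F3) -
    (1 / 2 : ℂ) • (h * (g.T - g.Tinv) * g.F2 * g.F1) +
    (1 / 4 : ℂ) • (h ^ 2 * g.F2 * g.H1 ^ 2) +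
    (3 / 8 : ℂ) • (h ^ 2 * (g.T + g.Tinv) * g.F2 * g.H1) +
    (1 / 2 : ℂ) • (h ^ 2 * g.F2) +
    (15 / 64 : ℂ) • (h ^ 2 * (g.T - g.Tinv) ^ 2 * g.F2)
  E2_E3 : g.E2 * g.E3 + g.E3 * g.E2 = 0
  F2_F3 : g.F2 * g.F3 + g.F3 * g.F2 = 0
  F1_E3 : ⁅g.F1, g.E3⁆ = g.E2
  T_F3 : ⁅g.T, g.F3⁆ = -((1 / 2 : ℂ) • (h * (g.T ^ 2 + 1) * g.F2))
  Tinv_F3 : ⁅g.Tinv, g.F3⁆ = (1 / 2 : ℂ) • (h * (g.Tinv ^ 2 + 1) * g.F2)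
  /-- `[F₂, E₃] = (T - T⁻¹) / (2 h)` -/
  F2_E3 : h * (g.F2 * g.E3 + g.E3 * g.F2) = (1 / 2 : ℂ) • (g.T - g.Tinv)
  F3_E2 : g.F3 * g.E2 + g.E2 * g.F3 = g.F1 -
    (1 / 4 : ℂ) • (h * (g.T - g.Tinv) * g.F2 * g.E2) +
    (1 / 4 : ℂ) • (h * (g.T - g.Tinv) * g.E3 * g.F3) -
    (1 / 8 : ℂ) • (h * (g.T - g.Tinv) * g.H1 ^ 2) -
    (1 / 8 : ℂ) • (h * (g.T ^ 2 - g.Tinv ^ 2) * g.H1) -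
    (1 / 16 : ℂ) • (h * g.H1 * (g.T ^ 2 - g.Tinv ^ 2)) +
    (7 / 128 : ℂ) • (h * (g.T - g.Tinv) ^ 3)

/-- The deformation parameter, as an element of a `ℂ⟦h⟧`-algebra. -/
def hIn (B : Type*) [Ring B] [Algebra ℂ⟦X⟧ B] : B := algebraMap ℂ⟦X⟧ B hbar

/-- The square root `√(1 + h² e²)`. -/
def sqrtSeries {A : Type*} [Ring A] [Algebra ℂ A] (e : A) : A⟦X⟧ :=
  hpow (1 + hbar ^ 2 • C (e ^ 2)) (1 / 2)

/-- The element `T = h e + √(1 + h² e²)`. -/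
def TSeries {A : Type*} [Ring A] [Algebra ℂ A] (e : A) : A⟦X⟧ := hbar • C e + sqrtSeries e

/-- The element `T⁻¹ = -h e + √(1 + h² e²)`. -/
def TinvSeries {A : Type*} [Ring A] [Algebra ℂ A] (e : A) : A⟦X⟧ := -(hbar • C e) + sqrtSeries e

open Gen in
/-- The nonlinear map: the super-Jordanian generators, as elements of `U(sl(2|1))⟦h⟧`. -/
def jordanGens : Gens U⟦X⟧ where
  T := TSeries (u e1)
  Tinv := TinvSeries (u e1)
  H1 := (1 / 2 : ℂ) • ((TSeries (u e1) + TinvSeries (u e1)) * C (u h1))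
  F1 := C (u f1) - (1 / 4 : ℂ) • hbar ^ 2 • C (u e1 * (u h1 ^ 2 - 1))
  H2 := C (u h2) - (1 / 2 : ℂ) • hbar ^ 2 • C (u e1 ^ 2 * u h1)
  E2 := C (u e2) - (1 / 4 : ℂ) • hbar ^ 2 • C (u e1 * u e3 * ((2 : ℂ) • u h1 + 1))
  F2 := C (u f2)
  H3 := C (u h3) + (1 / 2 : ℂ) • hbar ^ 2 • C (u e1 ^ 2 * u h1)
  E3 := C (u e3)
  F3 := C (u f3) + (1 / 4 : ℂ) • hbar ^ 2 • C (u e1 * u f2 * ((2 : ℂ) • u h1 + 1))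

/-- The element `X = h⁻¹ ln T`. -/
def lnT {A : Type*} [Ring A] [Algebra ℂ A] (T : A⟦X⟧) : A⟦X⟧ := divH (hlog T)

/-- The element `exp (-h X ⊗ T H) exp (h T H ⊗ X)`, where `X = h⁻¹ ln T`. -/
def RMatrix {A : Type*} [Ring A] [Algebra ℂ A] [SuperAlgebra A] (T H : A⟦X⟧) : (A ⊗ˢ A)⟦X⟧ :=
  hexp (-(hbar • (lnT T ⊗ʰ (T * H)))) * hexp (hbar • ((T * H) ⊗ʰ lnT T))

/-- The automorphism `Φ` on the generators: `IsPhi g Φ` says that `Φ` takes the prescribed values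
on the generators `g`. -/
structure IsPhi {B : Type*} [Ring B] (g : Gens B) (Φ : B → B) : Prop where
  T : Φ g.T = g.T
  Tinv : Φ g.Tinv = g.Tinv
  F1 : Φ g.F1 = g.F1
  H1 : Φ g.H1 = g.H1
  E2 : Φ g.E2 = g.F3
  F2 : Φ g.F2 = -g.E3
  H2 : Φ g.H2 = -g.H3
  E3 : Φ g.E3 = -g.F2
  F3 : Φ g.F3 = g.E2
  H3 : Φ g.H3 = -g.H2

/-- The prescribed degrees: `IsParity g π` says that `π` fixes the even generators and changes the
sign of the odd ones. -/
structure IsParity {B : Type*} [Ring B] (g : Gens B) (π : B → B) : Prop where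
  T : π g.T = g.T
  Tinv : π g.Tinv = g.Tinv
  H1 : π g.H1 = g.H1
  H2 : π g.H2 = g.H2
  H3 : π g.H3 = g.H3
  F1 : π g.F1 = g.F1
  E2 : π g.E2 = -g.E2
  F2 : π g.F2 = -g.F2
  E3 : π g.E3 = -g.E3
  F3 : π g.F3 = -g.F3

/-- The images of the generators `g` under a map `f`. -/
def Gens.map {B B' : Type*} (f : B → B') (g : Gens B) : Gens B' where
  H1 := f g.H1
  T := f g.T
  Tinv := f g.Tinv
  F1 := f g.F1
  H2 := f g.H2
  E2 := f g.E2
  F2 := f g.F2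
  H3 := f g.H3
  E3 := f g.E3
  F3 := f g.F3

/-- The prescribed coproducts, counits and antipodes of the generators `g`, where `T^(1/2)` and
`T^(-1/2)` are written `hpow g.T (1 / 2)` and `hpow g.T (-1 / 2)`. -/
structure IsJordanCoalgebra {A : Type*} [Ring A] [Algebra ℂ A] [SuperAlgebra A]
    (g : Gens A⟦X⟧) (𝓗 : HopfStructure A) : Prop where
  comul_T : 𝓗.comul g.T = g.T ⊗ʰ g.T
  comul_Tinv : 𝓗.comul g.Tinv = g.Tinv ⊗ʰ g.Tinv
  comul_H1 : 𝓗.comul g.H1 = g.H1 ⊗ʰ g.T + g.Tinv ⊗ʰ g.H1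
  comul_F1 : 𝓗.comul g.F1 = g.F1 ⊗ʰ g.T + g.Tinv ⊗ʰ g.F1
  comul_E2 : 𝓗.comul g.E2 = g.E2 ⊗ʰ hpow g.T (1 / 2) + hpow g.T (-1 / 2) ⊗ʰ g.E2 +
    (1 / 4 : ℂ) • hbar •
      ((g.Tinv * g.E3) ⊗ʰ (hpow g.T (-1 / 2) * g.H1 + g.H1 * hpow g.T (-1 / 2))) -
    (1 / 4 : ℂ) • hbar •
      ((hpow g.T (1 / 2) * g.H1 + g.H1 * hpow g.T (1 / 2)) ⊗ʰ (g.T * g.E3))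
  comul_F2 : 𝓗.comul g.F2 = g.F2 ⊗ʰ hpow g.T (-1 / 2) + hpow g.T (1 / 2) ⊗ʰ g.F2
  comul_E3 : 𝓗.comul g.E3 = g.E3 ⊗ʰ hpow g.T (-1 / 2) + hpow g.T (1 / 2) ⊗ʰ g.E3
  comul_F3 : 𝓗.comul g.F3 = g.F3 ⊗ʰ hpow g.T (1 / 2) + hpow g.T (-1 / 2) ⊗ʰ g.F3 -
    (1 / 4 : ℂ) • hbar •
      ((g.Tinv * g.F2) ⊗ʰ (hpow g.T (-1 / 2) * g.H1 + g.H1 * hpow g.T (-1 / 2))) +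
    (1 / 4 : ℂ) • hbar •
      ((hpow g.T (1 / 2) * g.H1 + g.H1 * hpow g.T (1 / 2)) ⊗ʰ (g.T * g.F2))
  comul_H2 : 𝓗.comul g.H2 = g.H2 ⊗ʰ 1 + 1 ⊗ʰ g.H2 +
    (1 / 4 : ℂ) • ((g.T * g.H1) ⊗ʰ (1 - g.T ^ 2)) +
    (1 / 4 : ℂ) • ((1 - g.Tinv ^ 2) ⊗ʰ (g.Tinv * g.H1))
  comul_H3 : 𝓗.comul g.H3 = g.H3 ⊗ʰ 1 + 1 ⊗ʰ g.H3 -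
    (1 / 4 : ℂ) • ((g.T * g.H1) ⊗ʰ (1 - g.T ^ 2)) -
    (1 / 4 : ℂ) • ((1 - g.Tinv ^ 2) ⊗ʰ (g.Tinv * g.H1))
  antipode_T : 𝓗.antipode g.T = g.Tinv
  antipode_Tinv : 𝓗.antipode g.Tinv = g.T
  antipode_H1 : 𝓗.antipode g.H1 = -(g.T * g.H1 * g.Tinv)
  antipode_F1 : 𝓗.antipode g.F1 = -(g.T * g.F1 * g.Tinv)
  antipode_E2 : 𝓗.antipode g.E2 =
    -g.E2 - (1 / 2 : ℂ) • hbar • ((g.T + g.Tinv) * g.E3)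
  antipode_F2 : 𝓗.antipode g.F2 = -g.F2
  antipode_E3 : 𝓗.antipode g.E3 = -g.E3
  antipode_F3 : 𝓗.antipode g.F3 =
    -g.F3 + (1 / 2 : ℂ) • hbar • ((g.T + g.Tinv) * g.F2)
  antipode_H2 : 𝓗.antipode g.H2 = -g.H2 + (1 / 2 : ℂ) • (g.Tinv ^ 2 - 1)
  antipode_H3 : 𝓗.antipode g.H3 = -g.H3 - (1 / 2 : ℂ) • (g.Tinv ^ 2 - 1)
  counit_T : 𝓗.counit g.T = 1
  counit_Tinv : 𝓗.counit g.Tinv = 1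
  counit_H1 : 𝓗.counit g.H1 = 0
  counit_F1 : 𝓗.counit g.F1 = 0
  counit_H2 : 𝓗.counit g.H2 = 0
  counit_H3 : 𝓗.counit g.H3 = 0
  counit_E2 : 𝓗.counit g.E2 = 0
  counit_F2 : 𝓗.counit g.F2 = 0
  counit_E3 : 𝓗.counit g.E3 = 0
  counit_F3 : 𝓗.counit g.F3 = 0

/-! ## The Jordanian quantum algebra `U_h(sl(2))` -/

/-- The enveloping algebra `U(sl(2))`, purely even as a superalgebra. -/
abbrev V : Type := UniversalEnvelopingAlgebra ℂ (LieAlgebra.SpecialLinear.sl (Fin 2) ℂ)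

instance superAlgebra_V : SuperAlgebra V where
  parity := AlgHom.id ℂ V
  parity_parity _ := rfl

/-- The classical generator `J₀ = diag (1, -1)`. -/
def J0 : V := UniversalEnvelopingAlgebra.ι ℂ (LieAlgebra.SpecialLinear.singleSubSingle 0 1 1)

/-- The classical generator `J₊`, the upper triangular matrix unit. -/
def Jp : V := UniversalEnvelopingAlgebra.ι ℂ
  (LieAlgebra.SpecialLinear.single 0 1 Fin.zero_ne_one 1)

/-- The classical generator `J₋`, the lower triangular matrix unit. -/
def Jm : V := UniversalEnvelopingAlgebra.ι ℂ
  (LieAlgebra.SpecialLinear.single 1 0 Fin.zero_ne_one.symm 1)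

/-- The Jordanian `e^{hX}`, in `U(sl(2))⟦h⟧`. -/
def ohnT : V⟦X⟧ := TSeries Jp

/-- The Jordanian `e^{-hX}`, in `U(sl(2))⟦h⟧`. -/
def ohnTinv : V⟦X⟧ := TinvSeries Jp

/-- The Jordanian generator `X`. -/
def ohnX : V⟦X⟧ := lnT ohnT

/-- The Jordanian generator `H`. -/
def ohnH : V⟦X⟧ := (1 / 2 : ℂ) • ((ohnT + ohnTinv) * C J0)

/-- The Jordanian generator `Y`. -/
def ohnY : V⟦X⟧ := C Jm - (1 / 4 : ℂ) • hbar ^ 2 • C (Jp * (J0 ^ 2 - 1))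

/-- Ohn's relations and coproducts of `U_h(sl(2))`. -/
structure IsOhn (𝓗 : HopfStructure V) : Prop where
  exp_X : ohnT = hexp (hbar • ohnX)
  exp_neg_X : ohnTinv = hexp (-(hbar • ohnX))
  H_X : hbar • ⁅ohnH, ohnX⁆ = ohnT - ohnTinv
  H_Y : ⁅ohnH, ohnY⁆ =
    -((1 / 2 : ℂ) • (ohnY * (ohnT + ohnTinv))) - (1 / 2 : ℂ) • ((ohnT + ohnTinv) * ohnY)
  X_Y : ⁅ohnX, ohnY⁆ = ohnH
  comul_X : 𝓗.comul ohnX = ohnX ⊗ʰ 1 + 1 ⊗ʰ ohnX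
  comul_Y : 𝓗.comul ohnY = ohnY ⊗ʰ ohnT + ohnTinv ⊗ʰ ohnY
  comul_H : 𝓗.comul ohnH = ohnH ⊗ʰ ohnT + ohnTinv ⊗ʰ ohnH

/-- `f : A → A'` extends `h`-linearly to an embedding of Hopf superalgebras. -/
structure IsHopfEmbedding {A A' : Type*} [Ring A] [Algebra ℂ A] [SuperAlgebra A]
    [Ring A'] [Algebra ℂ A'] [SuperAlgebra A'] (𝓗 : HopfStructure A) (𝓗' : HopfStructure A')
    (f : A →ₐ[ℂ] A') : Prop where
  injective : Function.Injective f
  parity : ∀ a, f (SuperAlgebra.parity a) = SuperAlgebra.parity (f a)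
  comul : ∀ a, 𝓗'.comul (coeffMap f.toLinearMap a) =
    coeffMap (smap f.toLinearMap f.toLinearMap) (𝓗.comul a)
  counit : ∀ a, 𝓗'.counit (coeffMap f.toLinearMap a) = 𝓗.counit a
  antipode : ∀ a, 𝓗'.antipode (coeffMap f.toLinearMap a) =
    coeffMap f.toLinearMap (𝓗.antipode a)

end SuperJordan
end

set_option linter.unusedSectionVars false
set_option linter.unusedSimpArgs false

noncomputable section

namespace SuperJordan

/-! ## `h`-adic linear algebra -/

section Hausdorff

variable {M N : Type*} [AddCommGroup M] [Module ℂ⟦X⟧ M] [AddCommGroup N] [Module ℂ⟦X⟧ N]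

theorem mem_span_hbar_pow_smul_top {n : ℕ} {m : M} :
    m ∈ ((Ideal.span {hbar}) ^ n • ⊤ : Submodule ℂ⟦X⟧ M) ↔ ∃ m', m = hbar ^ n • m' := by
  rw [Ideal.span_singleton_pow, Submodule.ideal_span_singleton_smul,
    Submodule.mem_smul_pointwise_iff_exists]
  simp [eq_comm]

variable (M) in
/-- `h`-adically separated modules. -/
abbrev Separated : Prop := IsHausdorff (Ideal.span {hbar}) M

theorem separated_iff :
    Separated M ↔ ∀ m : M, (∀ n, ∃ m', m = hbar ^ n • m') → m = 0 := by
  unfold Separated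
  rw [isHausdorff_iff]
  simp only [SModEq.zero, mem_span_hbar_pow_smul_top]

theorem eq_of_forall_pow [hM : Separated M] {m m' : M}
    (h : ∀ n, ∃ x, m - m' = hbar ^ n • x) : m = m' :=
  sub_eq_zero.1 (separated_iff.1 hM _ h)

/-- In a separated module, an element that is infinitely often divisible vanishes. -/
theorem eq_zero_of_step [hM : Separated M] (P : M → Prop)
    (h : ∀ m, P m → ∃ m', P m' ∧ m = hbar • m') {m : M} (hm : P m) : m = 0 := by
  refine separated_iff.1 hM _ fun n => ?_
  have : ∃ m', P m' ∧ m = hbar ^ n • m' := by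
    induction n with
    | zero => exact ⟨m, hm, by simp⟩
    | succ n ih =>
      obtain ⟨m', h1, rfl⟩ := ih
      obtain ⟨m'', h2, rfl⟩ := h m' h1
      exact ⟨m'', h2, by rw [pow_succ, mul_smul]⟩
  obtain ⟨m', -, h⟩ := this
  exact ⟨m', h⟩

theorem eq_of_submodule_dense [Separated N] (𝒮 : Submodule ℂ⟦X⟧ M)
    (hS : ∀ m : M, ∃ s ∈ 𝒮, ∃ b, m = s + hbar • b) {L₁ L₂ : M →ₗ[ℂ⟦X⟧] N}
    (h : ∀ s ∈ 𝒮, L₁ s = L₂ s) : L₁ = L₂ := by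
  ext m
  rw [← sub_eq_zero, ← LinearMap.sub_apply]
  refine eq_zero_of_step (fun x => ∃ m, x = (L₁ - L₂) m) ?_ ⟨m, rfl⟩
  rintro _ ⟨m, rfl⟩
  obtain ⟨s, hs, b, rfl⟩ := hS m
  refine ⟨_, ⟨b, rfl⟩, ?_⟩
  rw [map_add, map_smul, LinearMap.sub_apply, h s hs, sub_self, zero_add]

theorem exists_series_decomp (c : ℂ⟦X⟧) : ∃ c' : ℂ⟦X⟧, c = C (coeff 0 c) + hbar * c' :=
  ⟨PowerSeries.mk fun p => coeff (p + 1) c, by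
    rw [PowerSeries.coeff_zero_eq_constantCoeff_apply, add_comm]
    exact PowerSeries.eq_X_mul_shift_add_const c⟩

/-- A `ℂ`-linear map that commutes with `h` is `ℂ⟦h⟧`-linear if its target is separated. -/
def ofHbar [Module ℂ M] [Module ℂ N] [IsScalarTower ℂ ℂ⟦X⟧ M] [IsScalarTower ℂ ℂ⟦X⟧ N]
    [Separated N] (f : M →ₗ[ℂ] N) (hf : ∀ m, f (hbar • m) = hbar • f m) : M →ₗ[ℂ⟦X⟧] N where
  toFun := f
  map_add' := map_add f
  map_smul' c m := by
    rw [RingHom.id_apply, ← sub_eq_zero]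
    refine eq_zero_of_step (fun x => ∃ c : ℂ⟦X⟧, x = f (c • m) - c • f m) ?_ ⟨c, rfl⟩
    rintro _ ⟨c, rfl⟩
    obtain ⟨c', hc⟩ := exists_series_decomp c
    refine ⟨_, ⟨c', rfl⟩, ?_⟩
    have hC : ∀ (z : ℂ), (C z : ℂ⟦X⟧) = z • (1 : ℂ⟦X⟧) := fun z => by
      rw [PowerSeries.smul_eq_C_mul, mul_one]
    conv_lhs => rw [hc]
    rw [add_smul, add_smul, mul_smul, mul_smul, map_add, hf, hC, smul_assoc, smul_assoc,
      one_smul, one_smul, map_smul, smul_sub]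
    abel

end Hausdorff

section Series

variable {A B D : Type*} [Ring A] [Algebra ℂ A] [Ring B] [Algebra ℂ B] [Ring D] [Algebra ℂ D]

theorem hbar_smul (a : A⟦X⟧) : hbar • a = X * a := by
  rw [Algebra.smul_def]
  change PowerSeries.map (algebraMap ℂ A) X * a = _
  rw [PowerSeries.map_X]

theorem hbar_pow_smul (n : ℕ) (a : A⟦X⟧) : hbar ^ n • a = X ^ n * a := by
  induction n with
  | zero => simp
  | succ n ih => rw [pow_succ', mul_smul, ih, hbar_smul, pow_succ', mul_assoc]

@[simp] theorem coeff_zero_hbar_smul (a : A⟦X⟧) : coeff 0 (hbar • a) = 0 := by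
  rw [hbar_smul, PowerSeries.coeff_zero_X_mul]

@[simp] theorem constantCoeff_hbar_smul (a : A⟦X⟧) :
    PowerSeries.constantCoeff (hbar • a) = 0 := by
  rw [← PowerSeries.coeff_zero_eq_constantCoeff_apply, coeff_zero_hbar_smul]

@[simp] theorem coeff_succ_hbar_smul (n : ℕ) (a : A⟦X⟧) :
    coeff (n + 1) (hbar • a) = coeff n a := by
  rw [hbar_smul, PowerSeries.coeff_succ_X_mul]

theorem hbar_smul_injective {a b : A⟦X⟧} (h : hbar • a = hbar • b) : a = b := by
  ext n
  rw [← coeff_succ_hbar_smul, h, coeff_succ_hbar_smul]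

@[simp] theorem coeff_csmul (n : ℕ) (c : ℂ) (a : A⟦X⟧) : coeff n (c • a) = c • coeff n a := rfl

theorem hbar_divH {a : A⟦X⟧} (h : coeff 0 a = 0) : hbar • divH a = a := by
  ext n
  cases n with
  | zero => rw [coeff_zero_hbar_smul, h]
  | succ n => rw [coeff_succ_hbar_smul, divH, PowerSeries.coeff_mk]

instance separated_series : Separated A⟦X⟧ := by
  rw [separated_iff]
  intro a h
  ext n
  obtain ⟨a', rfl⟩ := h (n + 1)
  rw [hbar_pow_smul, PowerSeries.coeff_X_pow_mul', if_neg (by omega), map_zero]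

instance separated_scalars : Separated ℂ⟦X⟧ := by
  rw [separated_iff]
  intro a h
  ext n
  obtain ⟨a', rfl⟩ := h (n + 1)
  rw [smul_eq_mul, hbar, PowerSeries.coeff_X_pow_mul', if_neg (by omega), map_zero]

theorem exists_decomp (a : A⟦X⟧) : a = C (coeff 0 a) + hbar • divH a := by
  ext n
  cases n with
  | zero => simp
  | succ n => simp [divH, PowerSeries.coeff_succ_C]

theorem exists_hbar_smul {a : A⟦X⟧} (h : coeff 0 a = 0) : ∃ b, a = hbar • b :=
  ⟨_, (hbar_divH h).symm⟩

variable {M : Type*} [AddCommGroup M] [Module ℂ⟦X⟧ M]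

theorem linearMap_ext_C [Separated M] {L₁ L₂ : A⟦X⟧ →ₗ[ℂ⟦X⟧] M}
    (h : ∀ a, L₁ (C a) = L₂ (C a)) : L₁ = L₂ :=
  eq_of_submodule_dense (Submodule.span ℂ⟦X⟧ (Set.range C))
    (fun a => ⟨_, Submodule.subset_span ⟨_, rfl⟩, _, exists_decomp a⟩)
    fun s hs => LinearMap.eqOn_span (by rintro _ ⟨a, rfl⟩; exact h a) hs

/-- `extend f`, as a linear map. -/
def extendₗ (f : ℕ → A →ₗ[ℂ] B) : A⟦X⟧ →ₗ[ℂ⟦X⟧] B⟦X⟧ :=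
  ofHbar
    { toFun := extend f
      map_add' := fun a b => by
        ext n
        simp [extend, Finset.sum_add_distrib]
      map_smul' := fun c a => by
        ext n
        simp only [extend, PowerSeries.coeff_mk, coeff_csmul, map_smul, RingHom.id_apply,
          Finset.smul_sum] }
    (fun a => by
      ext n
      cases n with
      | zero => simp [extend]
      | succ n =>
        simp only [extend, LinearMap.coe_mk, AddHom.coe_mk, PowerSeries.coeff_mk,
          coeff_succ_hbar_smul, Finset.Nat.sum_antidiagonal_succ, coeff_zero_hbar_smul, map_zero,
          zero_add])

@[simp] theorem extendₗ_apply (f : ℕ → A →ₗ[ℂ] B) (a : A⟦X⟧) : extendₗ f a = extend f a := rfl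

theorem extend_C (f : ℕ → A →ₗ[ℂ] B) (a : A) :
    extend f (C a) = PowerSeries.mk fun n => f n a := by
  ext n
  simp only [extend, PowerSeries.coeff_mk]
  rw [Finset.sum_eq_single (0, n)]
  · simp
  · rintro ⟨i, j⟩ hij hne
    have : i ≠ 0 := by
      rintro rfl
      simp at hij
      exact hne (by rw [hij])
    rw [PowerSeries.coeff_C_of_ne_zero this, map_zero]
  · simp

/-- `coeffMap f`, as a linear map. -/
def coeffMapₗ (f : A →ₗ[ℂ] B) : A⟦X⟧ →ₗ[ℂ⟦X⟧] B⟦X⟧ :=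
  ofHbar
    { toFun := coeffMap f
      map_add' := fun a b => by ext n; simp [coeffMap]
      map_smul' := fun c a => by
        ext n
        simp only [coeffMap, PowerSeries.coeff_mk, coeff_csmul, map_smul, RingHom.id_apply] }
    (fun a => by
      ext n
      cases n <;> simp [coeffMap])

@[simp] theorem coeffMapₗ_apply (f : A →ₗ[ℂ] B) (a : A⟦X⟧) : coeffMapₗ f a = coeffMap f a := rfl

@[simp] theorem coeff_coeffMap (f : A →ₗ[ℂ] B) (a : A⟦X⟧) (n : ℕ) :
    coeff n (coeffMap f a) = f (coeff n a) := PowerSeries.coeff_mk _ _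

@[simp] theorem coeffMap_C (f : A →ₗ[ℂ] B) (a : A) : coeffMap f (C a) = C (f a) := by
  ext n
  cases n <;> simp [PowerSeries.coeff_succ_C]

theorem coeffMap_injective {f : A →ₗ[ℂ] B} (hf : Function.Injective f) :
    Function.Injective (coeffMap f) := by
  intro a b h
  ext n
  exact hf (by rw [← coeff_coeffMap, h, coeff_coeffMap])

/-- A linear map `A⟦h⟧ → B⟦h⟧` that is multiplicative on `A`, as a homomorphism of algebras. -/
def homOfLinear {R : Type*} [Ring R] [Algebra ℂ⟦X⟧ R] [Separated R] (F : A⟦X⟧ →ₗ[ℂ⟦X⟧] R)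
    (h1 : F 1 = 1) (hm : ∀ a b : A, F (C a * C b) = F (C a) * F (C b)) : A⟦X⟧ →ₐ[ℂ⟦X⟧] R :=
  AlgHom.ofLinearMap F h1 (by
    intro x y
    have key : ∀ b : A, F ∘ₗ LinearMap.mulRight ℂ⟦X⟧ (C b) =
        LinearMap.mulRight ℂ⟦X⟧ (F (C b)) ∘ₗ F := fun b => linearMap_ext_C fun a => hm a b
    have : F ∘ₗ LinearMap.mulLeft ℂ⟦X⟧ x = LinearMap.mulLeft ℂ⟦X⟧ (F x) ∘ₗ F :=
      linearMap_ext_C fun b => DFunLike.congr_fun (key b) x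
    exact DFunLike.congr_fun this y)

/-- The coefficientwise extension of a homomorphism. -/
def coeffHom (f : A →ₐ[ℂ] B) : A⟦X⟧ →ₐ[ℂ⟦X⟧] B⟦X⟧ :=
  homOfLinear (coeffMapₗ f.toLinearMap) (by
    rw [← map_one (C (R := A)), coeffMapₗ_apply, coeffMap_C]; simp) (by
    intro a b
    rw [← map_mul, coeffMapₗ_apply, coeffMapₗ_apply, coeffMapₗ_apply, coeffMap_C, coeffMap_C,
      coeffMap_C, AlgHom.toLinearMap_apply, map_mul, map_mul]
    rfl)

@[simp] theorem coeffHom_C (f : A →ₐ[ℂ] B) (a : A) : coeffHom f (C a) = C (f a) :=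
  coeffMap_C f.toLinearMap a

@[simp] theorem coeff_coeffHom (f : A →ₐ[ℂ] B) (a : A⟦X⟧) (n : ℕ) :
    coeff n (coeffHom f a) = f (coeff n a) :=
  coeff_coeffMap f.toLinearMap a n

theorem C_smul (c : ℂ) (a : A) : (C (c • a) : A⟦X⟧) = c • C a := by
  ext n
  cases n <;> simp [PowerSeries.coeff_succ_C]

/-- The extension of a homomorphism `A → B⟦h⟧` to `A⟦h⟧`. -/
def liftHom (f : A →ₐ[ℂ] B⟦X⟧) : A⟦X⟧ →ₐ[ℂ⟦X⟧] B⟦X⟧ :=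
  have hC : ∀ a, extend (fun n => (PowerSeries.coeff (R := B) n).restrictScalars ℂ ∘ₗ f.toLinearMap) (C a) = f a :=
    fun a => by
      ext n
      rw [extend_C, PowerSeries.coeff_mk]
      rfl
  homOfLinear
    (extendₗ fun n => (PowerSeries.coeff (R := B) n).restrictScalars ℂ ∘ₗ f.toLinearMap)
    (by rw [← map_one (C (R := A)), extendₗ_apply, hC, map_one])
    (by intro a b; rw [← map_mul, extendₗ_apply, extendₗ_apply, extendₗ_apply, hC, hC, hC, map_mul])

@[simp] theorem liftHom_C (f : A →ₐ[ℂ] B⟦X⟧) (a : A) : liftHom f (C a) = f a := by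
  ext n
  change coeff n (extend (fun n => (PowerSeries.coeff (R := B) n).restrictScalars ℂ ∘ₗ
    f.toLinearMap) (C a)) = _
  rw [extend_C, PowerSeries.coeff_mk]
  rfl

theorem component_apply (F : A⟦X⟧ →ₗ[ℂ] B⟦X⟧) (n : ℕ) (a : A) :
    component F n a = coeff n (F (C a)) := rfl

/-- `h`-linear maps preserve the `h`-adic filtration. -/
theorem map_dvd (F : A⟦X⟧ →ₗ[ℂ⟦X⟧] B⟦X⟧) {a : A⟦X⟧} (h : coeff 0 a = 0) : coeff 0 (F a) = 0 := by
  obtain ⟨b, rfl⟩ := exists_hbar_smul h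
  rw [map_smul, coeff_zero_hbar_smul]

/-- An `h`-linear endomorphism of `A⟦h⟧` that is the identity modulo `h` is bijective. -/
theorem bijective_of_id_mod (F : A⟦X⟧ →ₗ[ℂ⟦X⟧] A⟦X⟧) (hF : ∀ a, coeff 0 (F a) = coeff 0 a) :
    Function.Bijective F := by
  have hM : ∀ a, ∃ b, a - F a = hbar • b := fun a => exists_hbar_smul (by rw [map_sub, hF, sub_self])
  constructor
  · rw [injective_iff_map_eq_zero]
    intro a ha
    refine eq_zero_of_step (fun a => F a = 0) ?_ ha
    intro a ha
    obtain ⟨b, hb⟩ := exists_hbar_smul (a := a) (by rw [← hF, ha, map_zero])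
    refine ⟨b, hbar_smul_injective ?_, hb⟩
    rw [← map_smul, ← hb, ha, smul_zero]
  · choose m hm using hM
    intro y
    let x : A⟦X⟧ := PowerSeries.mk fun n => ∑ k ∈ Finset.range (n + 1), coeff (n - k) (m^[k] y)
    have hx : ∀ (n : ℕ), ∃ z, x = (∑ k ∈ Finset.range n, hbar ^ k • m^[k] y) + hbar ^ n • z := by
      intro n
      have : ∃ z, x - ∑ k ∈ Finset.range n, hbar ^ k • m^[k] y = X ^ n * z := by
        rw [← dvd_def, PowerSeries.X_pow_dvd_iff]
        intro i hi
        rw [map_sub, map_sum, sub_eq_zero]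
        simp only [x, PowerSeries.coeff_mk, hbar_pow_smul, PowerSeries.coeff_X_pow_mul']
        rw [← Finset.sum_filter]
        refine Finset.sum_congr ?_ fun _ _ => rfl
        ext k
        simp only [Finset.mem_range, Finset.mem_filter]
        omega
      obtain ⟨z, hz⟩ := this
      exact ⟨z, by rw [hbar_pow_smul, ← hz]; abel⟩
    refine ⟨x, eq_of_forall_pow fun n => ?_⟩
    obtain ⟨z, hz⟩ := hx n
    have hs : F (∑ k ∈ Finset.range n, hbar ^ k • m^[k] y) = y - hbar ^ n • m^[n] y := by
      clear hz
      induction n with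
      | zero => simp
      | succ n ih =>
        have e : F (m^[n] y) = m^[n] y - hbar • m^[n + 1] y := by
          rw [Function.iterate_succ_apply', ← hm]; abel
        rw [Finset.sum_range_succ, map_add, ih, map_smul, e, smul_sub, smul_smul, ← pow_succ]
        abel
    exact ⟨F z - m^[n] y, by rw [hz, map_add, hs, map_smul, smul_sub]; abel⟩

end Series

/-! ## Substitution of series without constant term -/

section Subst

variable {A B : Type*} [Ring A] [Algebra ℂ A] [Ring B] [Algebra ℂ B]

/-- A continuous linear map on `ℂ⟦X⟧` is determined by its values on the powers of `X`. -/
theorem series_ext (L : ℂ⟦X⟧ →ₗ[ℂ] A⟦X⟧) (c : ℕ)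
    (hc : ∀ n f, ∃ m, L (X ^ (n + c) * f) = hbar ^ n • m) (h : ∀ k, L (X ^ k) = 0) (f : ℂ⟦X⟧) :
    L f = 0 := by
  refine eq_of_forall_pow fun n => ?_
  obtain ⟨m, hm⟩ := hc n (PowerSeries.mk fun i => coeff (i + (n + c)) f)
  refine ⟨m, ?_⟩
  rw [sub_zero, ← hm]
  conv_lhs => rw [PowerSeries.eq_X_pow_mul_shift_add_trunc (n + c) f, map_add]
  convert add_zero _
  have : ∀ p : Polynomial ℂ, L (p : ℂ⟦X⟧) = 0 := by
    intro p
    induction p using Polynomial.induction_on' with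
    | add p q hp hq => rw [Polynomial.coe_add, map_add, hp, hq, add_zero]
    | monomial k a =>
      rw [Polynomial.coe_monomial, ← mul_one a, ← smul_eq_mul, map_smul,
        ← PowerSeries.X_pow_eq]
      have : (a • (X ^ k : ℂ⟦X⟧)) = a • X ^ k := rfl
      rw [LinearMap.map_smul, h, smul_zero]
  exact this _

theorem exists_pow_eq {a : A⟦X⟧} (ha : coeff 0 a = 0) (k : ℕ) : ∃ b, a ^ k = hbar ^ k • b := by
  obtain ⟨b, rfl⟩ := exists_hbar_smul ha
  exact ⟨b ^ k, smul_pow _ _ _⟩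

theorem coeff_hbar_pow_smul_of_lt {n k : ℕ} (h : n < k) (a : A⟦X⟧) :
    coeff n (hbar ^ k • a) = 0 := by
  rw [hbar_pow_smul, PowerSeries.coeff_X_pow_mul', if_neg (by omega)]

theorem coeff_pow_of_lt {a : A⟦X⟧} (ha : coeff 0 a = 0) {n k : ℕ} (h : n < k) :
    coeff n (a ^ k) = 0 := by
  obtain ⟨b, hb⟩ := exists_pow_eq ha k
  rw [hb, coeff_hbar_pow_smul_of_lt h]

theorem coeff_subst {a : A⟦X⟧} (ha : coeff 0 a = 0) (f : ℂ⟦X⟧) {n N : ℕ} (h : n < N) :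
    coeff n (subst f a) = ∑ k ∈ Finset.range N, coeff k f • coeff n (a ^ k) := by
  rw [subst, PowerSeries.coeff_mk]
  refine Finset.sum_subset (fun k hk => ?_) fun k _ hk => ?_
  · simp at *; omega
  · rw [coeff_pow_of_lt ha (by simpa using hk), smul_zero]

/-- Substitution is linear in the series. -/
def substₗ (a : A⟦X⟧) : ℂ⟦X⟧ →ₗ[ℂ] A⟦X⟧ where
  toFun f := subst f a
  map_add' f g := by
    ext n; simp [subst, add_smul, Finset.sum_add_distrib]
  map_smul' c f := by
    ext n
    simp [subst, mul_smul, Finset.smul_sum]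

theorem exists_hbar_pow_iff {a : A⟦X⟧} {n : ℕ} :
    (∃ b, a = hbar ^ n • b) ↔ ∀ m < n, coeff m a = 0 := by
  simp_rw [hbar_pow_smul]
  exact PowerSeries.X_pow_dvd_iff

theorem subst_X_pow_mul (a : A⟦X⟧) (n : ℕ) (f : ℂ⟦X⟧) :
    ∃ b, subst (X ^ n * f) a = hbar ^ n • b := by
  rw [exists_hbar_pow_iff]
  intro m hm
  rw [subst, PowerSeries.coeff_mk]
  refine Finset.sum_eq_zero fun k hk => ?_
  rw [PowerSeries.coeff_X_pow_mul', if_neg (by simp at hk; omega), zero_smul]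

theorem subst_X_pow {a : A⟦X⟧} (ha : coeff 0 a = 0) (k : ℕ) : subst (X ^ k) a = a ^ k := by
  ext n
  rw [coeff_subst ha _ (show n < n + k + 1 by omega), Finset.sum_eq_single k]
  · rw [PowerSeries.coeff_X_pow_self, one_smul]
  · intro j _ hj
    rw [PowerSeries.coeff_X_pow, if_neg hj, zero_smul]
  · simp

theorem subst_mul {a : A⟦X⟧} (ha : coeff 0 a = 0) (f g : ℂ⟦X⟧) :
    subst (f * g) a = subst f a * subst g a := by
  have h1 : ∀ (k : ℕ) (g : ℂ⟦X⟧), subst (X ^ k * g) a = a ^ k * subst g a := by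
    intro k g
    rw [← sub_eq_zero]
    refine series_ext (substₗ a ∘ₗ LinearMap.mulLeft ℂ (X ^ k) -
      LinearMap.mulLeft ℂ (a ^ k) ∘ₗ substₗ a) 0 (fun n f => ?_) (fun j => ?_) g
    · obtain ⟨b, hb⟩ := subst_X_pow_mul a n (X ^ k * f)
      obtain ⟨c, hc⟩ := subst_X_pow_mul a n f
      refine ⟨b - a ^ k * c, ?_⟩
      change subst (X ^ k * (X ^ n * f)) a - a ^ k * subst (X ^ n * f) a = _
      rw [hc, mul_left_comm, hb, smul_sub, mul_smul_comm]
    · change subst (X ^ k * X ^ j) a - a ^ k * subst (X ^ j) a = 0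
      rw [← pow_add, subst_X_pow ha, subst_X_pow ha, pow_add, sub_self]
  rw [← sub_eq_zero]
  refine series_ext (substₗ a ∘ₗ LinearMap.mulRight ℂ g -
      LinearMap.mulRight ℂ (subst g a) ∘ₗ substₗ a) 0 (fun n f => ?_) (fun j => ?_) f
  · obtain ⟨b, hb⟩ := subst_X_pow_mul a n (f * g)
    obtain ⟨c, hc⟩ := subst_X_pow_mul a n f
    refine ⟨b - c * subst g a, ?_⟩
    change subst (X ^ n * f * g) a - subst (X ^ n * f) a * subst g a = _
    rw [hc, mul_assoc, hb, smul_sub, smul_mul_assoc]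
  · change subst (X ^ j * g) a - subst (X ^ j) a * subst g a = 0
    rw [h1, subst_X_pow ha, sub_self]

/-- Substitution, as a homomorphism. -/
def substHom (a : A⟦X⟧) (ha : coeff 0 a = 0) : ℂ⟦X⟧ →ₐ[ℂ] A⟦X⟧ :=
  AlgHom.ofLinearMap (substₗ a) (by
    have := subst_X_pow ha 0
    rwa [pow_zero, pow_zero] at this) (subst_mul ha)

@[simp] theorem substHom_apply (a : A⟦X⟧) (ha : coeff 0 a = 0) (f : ℂ⟦X⟧) :
    substHom a ha f = subst f a := rfl

theorem subst_X {a : A⟦X⟧} (ha : coeff 0 a = 0) : subst X a = a := by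
  simpa using subst_X_pow ha 1

theorem coeff_zero_subst (f : ℂ⟦X⟧) (a : A⟦X⟧) :
    coeff 0 (subst f a) = algebraMap ℂ A (coeff 0 f) := by
  simp [subst, Algebra.algebraMap_eq_smul_one]

/-- Continuous linear maps that are multiplicative on powers commute with substitution. -/
theorem map_subst (Ψ : A⟦X⟧ →ₗ[ℂ] B⟦X⟧) (hΨ : ∀ n x, ∃ y, Ψ (hbar ^ n • x) = hbar ^ n • y)
    {a : A⟦X⟧} {b : B⟦X⟧} (ha : coeff 0 a = 0) (hb : coeff 0 b = 0)
    (h : ∀ k, Ψ (a ^ k) = b ^ k) (f : ℂ⟦X⟧) : Ψ (subst f a) = subst f b := by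
  rw [← sub_eq_zero]
  refine series_ext (Ψ ∘ₗ substₗ a - substₗ b) 0 (fun n f => ?_) (fun k => ?_) f
  · obtain ⟨x, hx⟩ := subst_X_pow_mul a n f
    obtain ⟨y, hy⟩ := subst_X_pow_mul b n f
    obtain ⟨z, hz⟩ := hΨ n x
    refine ⟨z - y, ?_⟩
    change Ψ (subst (X ^ n * f) a) - subst (X ^ n * f) b = _
    rw [hx, hz, hy, smul_sub]
  · change Ψ (subst (X ^ k) a) - subst (X ^ k) b = 0
    rw [subst_X_pow ha, subst_X_pow hb, h, sub_self]

theorem algHom_subst (Ψ : A⟦X⟧ →ₐ[ℂ⟦X⟧] B⟦X⟧) {a : A⟦X⟧} (ha : coeff 0 a = 0) (f : ℂ⟦X⟧) :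
    Ψ (subst f a) = subst f (Ψ a) :=
  map_subst (Ψ.toLinearMap.restrictScalars ℂ) (fun _ x => ⟨Ψ x, map_smul Ψ _ _⟩) ha
    (map_dvd Ψ.toLinearMap ha) (fun k => map_pow Ψ a k) f

theorem subst_subst {a : A⟦X⟧} (ha : coeff 0 a = 0) {g : ℂ⟦X⟧} (hg : coeff 0 g = 0) (f : ℂ⟦X⟧) :
    subst f (subst g a) = subst (subst f g) a := by
  refine (map_subst (substₗ a) (fun n x => ?_) hg ?_ (fun k => ?_) f).symm
  · obtain ⟨y, hy⟩ := subst_X_pow_mul a n x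
    exact ⟨y, by rw [← hy]; rfl⟩
  · rw [coeff_zero_subst, hg, map_zero]
  · exact map_pow (substHom a ha) g k

/-! ### Commutation rules -/

theorem subst_intertwine {a b x : A⟦X⟧} (ha : coeff 0 a = 0) (hb : coeff 0 b = 0)
    (h : a * x = x * b) (f : ℂ⟦X⟧) : subst f a * x = x * subst f b := by
  rw [← sub_eq_zero]
  refine series_ext (LinearMap.mulRight ℂ x ∘ₗ substₗ a - LinearMap.mulLeft ℂ x ∘ₗ substₗ b) 0
    (fun n f => ?_) (fun k => ?_) f
  · obtain ⟨y, hy⟩ := subst_X_pow_mul a n f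
    obtain ⟨z, hz⟩ := subst_X_pow_mul b n f
    refine ⟨y * x - x * z, ?_⟩
    change subst (X ^ n * f) a * x - x * subst (X ^ n * f) b = _
    rw [hy, hz, smul_sub, smul_mul_assoc, mul_smul_comm]
  · change subst (X ^ k) a * x - x * subst (X ^ k) b = 0
    rw [subst_X_pow ha, subst_X_pow hb, sub_eq_zero]
    induction k with
    | zero => simp
    | succ k ih => rw [pow_succ, mul_assoc, h, ← mul_assoc, ih, mul_assoc, ← pow_succ]

theorem subst_commute {a x : A⟦X⟧} (ha : coeff 0 a = 0) (h : a * x = x * a) (f : ℂ⟦X⟧) :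
    subst f a * x = x * subst f a := subst_intertwine ha ha h f

/-- Second order commutation rule. -/
theorem subst_mul_of_comm_two {a x y z : A⟦X⟧} (ha : coeff 0 a = 0) (hx : a * x = x * a + y)
    (hy : a * y = y * a + z) (hz : a * z = z * a) (f : ℂ⟦X⟧) :
    subst f a * x = x * subst f a + y * subst (d⁄dX ℂ f) a +
      (1 / 2 : ℂ) • (z * subst (d⁄dX ℂ (d⁄dX ℂ f)) a) := by
  rw [← sub_eq_zero]
  have hd : ∀ (n : ℕ) (f : ℂ⟦X⟧), ∃ g, d⁄dX ℂ (X ^ (n + 1) * f) = X ^ n * g := fun n f => by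
    refine ⟨(n + 1) • f + X * d⁄dX ℂ f, ?_⟩
    rw [Derivation.leibniz, Derivation.leibniz_pow]
    simp only [PowerSeries.derivative_X, smul_eq_mul, nsmul_eq_mul, Nat.add_sub_cancel]
    push_cast
    ring
  refine series_ext (LinearMap.mulRight ℂ x ∘ₗ substₗ a - (LinearMap.mulLeft ℂ x ∘ₗ substₗ a +
      LinearMap.mulLeft ℂ y ∘ₗ substₗ a ∘ₗ (d⁄dX ℂ).toLinearMap +
      (1 / 2 : ℂ) • LinearMap.mulLeft ℂ z ∘ₗ substₗ a ∘ₗ (d⁄dX ℂ).toLinearMap ∘ₗ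
        (d⁄dX ℂ).toLinearMap)) 2
    (fun n f => ?_) (fun k => ?_) f
  · obtain ⟨u, hu⟩ := subst_X_pow_mul a n (X ^ 2 * f)
    obtain ⟨g, hg⟩ := hd (n + 1) f
    obtain ⟨v, hv⟩ := subst_X_pow_mul a n (X * g)
    obtain ⟨g', hg'⟩ := hd n g
    obtain ⟨w, hw⟩ := subst_X_pow_mul a n g'
    refine ⟨u * x - (x * u + y * v + (1 / 2 : ℂ) • (z * w)), ?_⟩
    change subst (X ^ (n + 2) * f) a * x - (x * subst (X ^ (n + 2) * f) a +
      y * subst (d⁄dX ℂ (X ^ (n + 2) * f)) a +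
      (1 / 2 : ℂ) • (z * subst (d⁄dX ℂ (d⁄dX ℂ (X ^ (n + 2) * f))) a)) = _
    rw [show (n + 2) = n + 1 + 1 from rfl, hg, hg', hw,
      show (X ^ (n + 1) * g : ℂ⟦X⟧) = X ^ n * (X * g) by ring, hv,
      show (X ^ (n + 1 + 1) * f : ℂ⟦X⟧) = X ^ n * (X ^ 2 * f) by ring, hu]
    simp only [smul_sub, smul_add, smul_mul_assoc, mul_smul_comm, smul_comm (1 / 2 : ℂ) (hbar ^ n)]
  · change subst (X ^ k) a * x - (x * subst (X ^ k) a +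
      y * subst (d⁄dX ℂ (X ^ k)) a + (1 / 2 : ℂ) • (z * subst (d⁄dX ℂ (d⁄dX ℂ (X ^ k))) a)) = 0
    have e1 : ∀ k : ℕ, d⁄dX ℂ (X ^ k : ℂ⟦X⟧) = (k : ℂ) • X ^ (k - 1) := fun k => by
      rw [Derivation.leibniz_pow, PowerSeries.derivative_X]
      simp [← Nat.cast_smul_eq_nsmul ℂ]
    have e2 : ∀ (c : ℂ) (k : ℕ), subst (c • X ^ k : ℂ⟦X⟧) a = c • a ^ k := fun c k => by
      rw [← subst_X_pow ha]; exact map_smul (substₗ a) c _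
    rw [e1, Derivation.map_smul, e1, smul_smul, e2, e2, subst_X_pow ha, sub_eq_zero]
    have e3 : ∀ k : ℕ, a ^ k * x = x * a ^ k + (k : ℂ) • (y * a ^ (k - 1)) +
        ((k * (k - 1 : ℕ) / 2 : ℂ)) • (z * a ^ (k - 1 - 1)) := by
      intro k
      have e4 : ∀ k : ℕ, a ^ k * z = z * a ^ k := fun k => by
        rw [← subst_X_pow ha, subst_commute ha hz]
      have e5 : ∀ k : ℕ, a * (y * a ^ k) = y * a ^ (k + 1) + z * a ^ k := fun k => by
        rw [← mul_assoc, hy, add_mul, mul_assoc, ← pow_succ']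
      induction k with
      | zero => simp
      | succ k ih =>
        rw [pow_succ', mul_assoc, ih, mul_add, mul_add, ← mul_assoc a x, hx, mul_smul_comm,
          mul_smul_comm, e5, add_mul, mul_assoc x, ← mul_assoc a z, hz, mul_assoc z, ← pow_succ',
          ← pow_succ']
        rcases k with _ | _ | k
        · simp
        · simp [pow_succ]; module
        · simp only [Nat.add_sub_cancel]
          push_cast
          module
    rw [e3, mul_smul_comm, mul_smul_comm, smul_smul]
    congr 2
    ring

/-! ### Exponentials, logarithms and powers -/

theorem hexp_intertwine {a b x : A⟦X⟧} (ha : coeff 0 a = 0) (hb : coeff 0 b = 0)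
    (h : a * x = x * b) : hexp a * x = x * hexp b := subst_intertwine ha hb h _

theorem hexp_mul_of_comm_two {a x y z : A⟦X⟧} (ha : coeff 0 a = 0) (hx : a * x = x * a + y)
    (hy : a * y = y * a + z) (hz : a * z = z * a) :
    hexp a * x = (x + y + (1 / 2 : ℂ) • z) * hexp a := by
  rw [hexp, subst_mul_of_comm_two ha hx hy hz, PowerSeries.derivative_exp,
    PowerSeries.derivative_exp, add_mul, add_mul, smul_mul_assoc]

theorem hexp_zero : hexp (0 : A⟦X⟧) = 1 := by
  ext n
  rw [hexp, coeff_subst (by simp) _ (Nat.lt_succ_self n), Finset.sum_eq_single 0]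
  · simp
  · intro k _ hk
    simp [hk]
  · simp

theorem sum_range_eq_antidiagonal {M : Type*} [AddCommMonoid M] (g : ℕ → ℕ → M) (N : ℕ)
    (hg : ∀ i j, N ≤ i + j → g i j = 0) :
    ∑ i ∈ Finset.range N, ∑ j ∈ Finset.range N, g i j =
      ∑ k ∈ Finset.range N, ∑ ij ∈ Finset.HasAntidiagonal.antidiagonal k, g ij.1 ij.2 := by
  rw [← Finset.sum_product', Finset.sum_sigma']
  symm
  refine Finset.sum_of_injOn (fun p => p.2) ?_ ?_ ?_ ?_
  · rintro ⟨k, p⟩ h ⟨k', p'⟩ h' e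
    simp at h h' e
    subst e
    obtain rfl : k = k' := by omega
    rfl
  · rintro ⟨k, p⟩ h
    simp at h ⊢
    omega
  · rintro ⟨i, j⟩ h h'
    refine hg _ _ ?_
    by_contra hlt
    exact h' ⟨⟨i + j, (i, j)⟩, by simpa using hlt, rfl⟩
  · simp

theorem coeff_mul_congr {a a' b b' : A⟦X⟧} (n : ℕ) (ha : ∀ m ≤ n, coeff m a = coeff m a')
    (hb : ∀ m ≤ n, coeff m b = coeff m b') : coeff n (a * b) = coeff n (a' * b') := by
  rw [PowerSeries.coeff_mul, PowerSeries.coeff_mul]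
  refine Finset.sum_congr rfl fun p hp => ?_
  rw [Finset.HasAntidiagonal.mem_antidiagonal] at hp
  rw [ha _ (by omega), hb _ (by omega)]

theorem hexp_add {a b : A⟦X⟧} (ha : coeff 0 a = 0) (hb : coeff 0 b = 0) (h : a * b = b * a) :
    hexp (a + b) = hexp a * hexp b := by
  have hab : coeff 0 (a + b) = 0 := by rw [map_add, ha, hb, add_zero]
  have hc : ∀ k, coeff k (PowerSeries.exp ℂ) = ((k.factorial : ℂ))⁻¹ := fun k => by
    rw [PowerSeries.coeff_exp]; simp
  ext n
  let S : A⟦X⟧ → A⟦X⟧ := fun a => ∑ k ∈ Finset.range (n + 1), ((k.factorial : ℂ))⁻¹ • a ^ k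
  have hS : ∀ a : A⟦X⟧, coeff 0 a = 0 → ∀ m ≤ n, coeff m (hexp a) = coeff m (S a) := by
    intro a ha m hm
    rw [hexp, coeff_subst ha _ (show m < n + 1 by omega), map_sum]
    exact Finset.sum_congr rfl fun k _ => by rw [hc, coeff_csmul]
  rw [hS _ hab n le_rfl, coeff_mul_congr n (hS a ha) (hS b hb)]
  simp only [S, Finset.sum_mul_sum, map_sum]
  rw [sum_range_eq_antidiagonal]
  · refine Finset.sum_congr rfl fun k _ => ?_
    rw [coeff_csmul, (show Commute a b from h).add_pow', map_sum, Finset.smul_sum]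
    refine Finset.sum_congr rfl fun p hp => ?_
    rw [Finset.HasAntidiagonal.mem_antidiagonal] at hp
    subst hp
    rw [← Nat.cast_smul_eq_nsmul ℂ, coeff_csmul, smul_smul, smul_mul_smul_comm, coeff_csmul,
      Nat.choose_symm_add, Nat.add_choose]
    congr 1
    rw [Nat.cast_div (Nat.factorial_mul_factorial_dvd_factorial_add _ _)
      (by exact_mod_cast mul_ne_zero (Nat.factorial_ne_zero _) (Nat.factorial_ne_zero _))]
    have := Nat.factorial_ne_zero (p.1 + p.2)
    field_simp
    push_cast
    ring
  · intro i j hij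
    obtain ⟨x, hx⟩ := exists_pow_eq ha i
    obtain ⟨y, hy⟩ := exists_pow_eq hb j
    rw [hx, hy, smul_mul_smul_comm, coeff_csmul, smul_mul_smul_comm, ← pow_add,
      coeff_hbar_pow_smul_of_lt (by omega), smul_zero]

theorem hexp_mul_neg {a : A⟦X⟧} (ha : coeff 0 a = 0) : hexp a * hexp (-a) = 1 := by
  rw [← hexp_add ha (by rw [map_neg, ha, neg_zero]) (by simp), add_neg_cancel, hexp_zero]

theorem hexp_neg_mul {a : A⟦X⟧} (ha : coeff 0 a = 0) : hexp (-a) * hexp a = 1 := by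
  have := hexp_mul_neg (a := -a) (by rw [map_neg, ha, neg_zero])
  rwa [neg_neg] at this

theorem coeff_zero_hexp (a : A⟦X⟧) : coeff 0 (hexp a) = 1 := by
  rw [hexp, coeff_zero_subst]; simp

theorem coeff_zero_sub_one {a : A⟦X⟧} (ha : coeff 0 a = 1) : coeff 0 (a - 1) = 0 := by
  rw [map_sub, ha]; simp

theorem coeff_zero_hpow (a : A⟦X⟧) (r : ℂ) : coeff 0 (hpow a r) = 1 := by
  rw [hpow, coeff_zero_subst]; simp

theorem coeff_zero_hlog (a : A⟦X⟧) : coeff 0 (hlog a) = 0 := by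
  rw [hlog, coeff_zero_subst]; simp

theorem hpow_add {a : A⟦X⟧} (ha : coeff 0 a = 1) (r s : ℂ) :
    hpow a (r + s) = hpow a r * hpow a s := by
  rw [hpow, PowerSeries.binomialSeries_add, subst_mul (coeff_zero_sub_one ha)]
  rfl

theorem hpow_one {a : A⟦X⟧} (ha : coeff 0 a = 1) : hpow a 1 = a := by
  have := PowerSeries.binomialSeries_nat (R := ℂ) (A := ℂ) 1
  rw [hpow, ← Nat.cast_one, this, pow_one]
  change substHom _ (coeff_zero_sub_one ha) (1 + X) = a
  rw [map_add, map_one, substHom_apply, subst_X (coeff_zero_sub_one ha)]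
  abel

theorem hpow_zero {a : A⟦X⟧} (ha : coeff 0 a = 1) : hpow a 0 = 1 := by
  rw [hpow, PowerSeries.binomialSeries_zero]
  exact map_one (substHom _ (coeff_zero_sub_one ha))

theorem hpow_half_sq {a : A⟦X⟧} (ha : coeff 0 a = 1) : hpow a (1 / 2) ^ 2 = a := by
  rw [sq, ← hpow_add ha, show (1 / 2 + 1 / 2 : ℂ) = 1 by norm_num, hpow_one ha]

theorem hpow_mul_neg {a : A⟦X⟧} (ha : coeff 0 a = 1) (r : ℂ) : hpow a r * hpow a (-r) = 1 := by
  rw [← hpow_add ha, add_neg_cancel, hpow_zero ha]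

theorem algHom_hpow (Ψ : A⟦X⟧ →ₐ[ℂ⟦X⟧] B⟦X⟧) {a : A⟦X⟧} (ha : coeff 0 a = 1) (r : ℂ) :
    Ψ (hpow a r) = hpow (Ψ a) r := by
  rw [hpow, algHom_subst Ψ (coeff_zero_sub_one ha), map_sub, map_one, hpow]

theorem algHom_hlog (Ψ : A⟦X⟧ →ₐ[ℂ⟦X⟧] B⟦X⟧) {a : A⟦X⟧} (ha : coeff 0 a = 1) :
    Ψ (hlog a) = hlog (Ψ a) := by
  rw [hlog, algHom_subst Ψ (coeff_zero_sub_one ha), map_sub, map_one, hlog]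

theorem algHom_hexp (Ψ : A⟦X⟧ →ₐ[ℂ⟦X⟧] B⟦X⟧) {a : A⟦X⟧} (ha : coeff 0 a = 0) :
    Ψ (hexp a) = hexp (Ψ a) := algHom_subst Ψ ha _

theorem derivative_subst_comp {g : ℂ⟦X⟧} (hg : coeff 0 g = 0) (f : ℂ⟦X⟧) :
    d⁄dX ℂ (subst f g) = subst (d⁄dX ℂ f) g * d⁄dX ℂ g := by
  rw [← sub_eq_zero]
  have hd : ∀ (n : ℕ) (f : ℂ⟦X⟧), ∃ g, d⁄dX ℂ (X ^ (n + 1) * f) = X ^ n * g := fun n f => by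
    refine ⟨(n + 1) • f + X * d⁄dX ℂ f, ?_⟩
    rw [Derivation.leibniz, Derivation.leibniz_pow]
    simp only [PowerSeries.derivative_X, smul_eq_mul, nsmul_eq_mul, Nat.add_sub_cancel]
    push_cast
    ring
  refine series_ext ((d⁄dX ℂ).toLinearMap ∘ₗ substₗ g -
    LinearMap.mulRight ℂ (d⁄dX ℂ g) ∘ₗ substₗ g ∘ₗ (d⁄dX ℂ).toLinearMap) 1
    (fun n f => ?_) (fun k => ?_) f
  · obtain ⟨u, hu⟩ := subst_X_pow_mul g (n + 1) f
    obtain ⟨v, hv⟩ := hd n f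
    obtain ⟨w, hw⟩ := subst_X_pow_mul g n v
    obtain ⟨u', hu'⟩ := hd n u
    refine ⟨u' - w * d⁄dX ℂ g, ?_⟩
    change d⁄dX ℂ (subst (X ^ (n + 1) * f) g) - subst (d⁄dX ℂ (X ^ (n + 1) * f)) g * d⁄dX ℂ g = _
    rw [hu, hv, hw, hbar_pow_smul, hu', hbar_pow_smul, hbar_pow_smul, mul_sub, mul_assoc]
  · change d⁄dX ℂ (subst (X ^ k : ℂ⟦X⟧) g) - subst (d⁄dX ℂ (X ^ k : ℂ⟦X⟧)) g * d⁄dX ℂ g = 0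
    rw [subst_X_pow hg, Derivation.leibniz_pow, Derivation.leibniz_pow, PowerSeries.derivative_X,
      sub_eq_zero]
    have : subst (k • (X : ℂ⟦X⟧) ^ (k - 1) • (1 : ℂ⟦X⟧)) g = k • g ^ (k - 1) := by
      rw [smul_eq_mul, mul_one, ← subst_X_pow hg]
      exact map_nsmul (substₗ g) k _
    rw [this, smul_eq_mul, smul_mul_assoc]

theorem one_add_X_mul_derivative_log : (1 + X) * d⁄dX ℂ (PowerSeries.log ℂ) = 1 := by
  rw [PowerSeries.deriv_log]
  ext n
  cases n with
  | zero => simp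
  | succ n => simp [add_mul, PowerSeries.coeff_one, pow_succ, PowerSeries.coeff_succ_X_mul]

theorem hexp_log : hexp (PowerSeries.log ℂ) = 1 + X := by
  have hl : coeff 0 (PowerSeries.log ℂ) = 0 := by simp
  have hd : d⁄dX ℂ (hexp (PowerSeries.log ℂ)) =
      hexp (PowerSeries.log ℂ) * d⁄dX ℂ (PowerSeries.log ℂ) := by
    rw [hexp, derivative_subst_comp hl, PowerSeries.derivative_exp]
  set y := d⁄dX ℂ (PowerSeries.log ℂ) with hy
  have h1 : (1 + X) * y = 1 := one_add_X_mul_derivative_log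
  have h2 : d⁄dX ℂ y = -y ^ 2 := by
    have := congrArg (d⁄dX ℂ) h1
    rw [Derivation.leibniz, map_add, PowerSeries.derivative_X, PowerSeries.derivative_one,
      smul_eq_mul, smul_eq_mul] at this
    linear_combination y * this - d⁄dX ℂ y * h1
  have h3 : hexp (PowerSeries.log ℂ) * y = 1 := by
    refine PowerSeries.derivative.ext ?_ ?_
    · rw [Derivation.leibniz, hd, h2, PowerSeries.derivative_one, smul_eq_mul, smul_eq_mul]
      ring
    · have e1 : PowerSeries.constantCoeff y = 1 := by
        rw [hy, PowerSeries.deriv_log, PowerSeries.constantCoeff_mk]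
        simp
      have := coeff_zero_hexp (PowerSeries.log ℂ)
      rw [PowerSeries.coeff_zero_eq_constantCoeff_apply] at this
      rw [map_mul, this, e1, map_one, mul_one]
  linear_combination (1 + X) * h3 - hexp (PowerSeries.log ℂ) * h1

theorem hexp_hlog {a : A⟦X⟧} (ha : coeff 0 a = 1) : hexp (hlog a) = a := by
  rw [hexp, hlog, subst_subst (coeff_zero_sub_one ha) (by simp)]
  change subst (hexp (PowerSeries.log ℂ)) (a - 1) = a
  rw [hexp_log]
  change substHom _ (coeff_zero_sub_one ha) (1 + X) = a
  rw [map_add, map_one, substHom_apply, subst_X (coeff_zero_sub_one ha)]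
  abel

end Subst

/-! ## Completed graded tensor products -/

section Graded

variable {A B D A' B' : Type*} [Ring A] [Algebra ℂ A] [SuperAlgebra A]
  [Ring B] [Algebra ℂ B] [SuperAlgebra B] [Ring D] [Algebra ℂ D] [SuperAlgebra D]
  [Ring A'] [Algebra ℂ A'] [SuperAlgebra A'] [Ring B'] [Algebra ℂ B'] [SuperAlgebra B']

open SuperAlgebra (parity)

theorem add_parity_add_sub_parity (a : A) :
    (1 / 2 : ℂ) • (a + parity a) + (1 / 2 : ℂ) • (a - parity a) = a := by
  module

/-- Induction over homogeneous elements. -/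
@[elab_as_elim]
theorem parity_induction {P : A → Prop} (a : A) (hadd : ∀ a b, P a → P b → P (a + b))
    (h0 : ∀ a, parity a = a → P a) (h1 : ∀ a, parity a = -a → P a) : P a := by
  rw [← add_parity_add_sub_parity a]
  exact hadd _ _ (h0 _ (mem_grading_zero.1 (even_part_mem a)))
    (h1 _ (mem_grading_one.1 (odd_part_mem a)))

theorem tmul_mul_of_even_left (a : A) {b : B} (hb : parity b = b) (c : A) (d : B) :
    (GradedTensorProduct.tmul ℂ a b : A ⊗ˢ B) * GradedTensorProduct.tmul ℂ c d =
      GradedTensorProduct.tmul ℂ (a * c) (b * d) := by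
  refine parity_induction c (fun c c' h h' => ?_) (fun c hc => ?_) (fun c hc => ?_)
  · simp only [GradedTensorProduct.tmul, TensorProduct.add_tmul, mul_add, map_add] at *
    rw [h, h']
  · have := GradedTensorProduct.tmul_zero_coe_mul_coe_tmul (R := ℂ) (grading A) (grading B) a
      ⟨b, mem_grading_zero.2 hb⟩ ⟨c, mem_grading_zero.2 hc⟩ d
    exact this
  · have := GradedTensorProduct.tmul_zero_coe_mul_coe_tmul (R := ℂ) (grading A) (grading B) a
      ⟨b, mem_grading_zero.2 hb⟩ ⟨c, mem_grading_one.2 hc⟩ d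
    exact this

theorem tmul_mul_of_even_right (a : A) (b : B) {c : A} (hc : parity c = c) (d : B) :
    (GradedTensorProduct.tmul ℂ a b : A ⊗ˢ B) * GradedTensorProduct.tmul ℂ c d =
      GradedTensorProduct.tmul ℂ (a * c) (b * d) := by
  refine parity_induction b (fun c c' h h' => ?_) (fun b hb => ?_) (fun b hb => ?_)
  · simp only [GradedTensorProduct.tmul, TensorProduct.tmul_add, add_mul, map_add] at *
    rw [h, h']
  · have := GradedTensorProduct.tmul_coe_mul_zero_coe_tmul (R := ℂ) (grading A) (grading B) a
      ⟨b, mem_grading_zero.2 hb⟩ ⟨c, mem_grading_zero.2 hc⟩ d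
    exact this
  · have := GradedTensorProduct.tmul_coe_mul_zero_coe_tmul (R := ℂ) (grading A) (grading B) a
      ⟨b, mem_grading_one.2 hb⟩ ⟨c, mem_grading_zero.2 hc⟩ d
    exact this

theorem tmul_mul_of_odd (a : A) {b : B} (hb : parity b = -b) {c : A} (hc : parity c = -c) (d : B) :
    (GradedTensorProduct.tmul ℂ a b : A ⊗ˢ B) * GradedTensorProduct.tmul ℂ c d =
      -GradedTensorProduct.tmul ℂ (a * c) (b * d) := by
  have := GradedTensorProduct.tmul_coe_mul_coe_tmul (R := ℂ) (grading A) (grading B) a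
    ⟨b, mem_grading_one.2 hb⟩ ⟨c, mem_grading_one.2 hc⟩ d
  rw [mul_one, units_pow_one, Units.neg_smul, one_smul] at this
  exact this

theorem flip_tmul_of_even_left {a : A} (ha : parity a = a) (b : A) :
    flip A (GradedTensorProduct.tmul ℂ a b) = GradedTensorProduct.tmul ℂ b a := by
  refine parity_induction b (fun c c' h h' => ?_) (fun b hb => ?_) (fun b hb => ?_)
  · simp only [GradedTensorProduct.tmul, TensorProduct.add_tmul, TensorProduct.tmul_add,
      map_add] at *
    rw [h, h']
  · have := GradedTensorProduct.comm_coe_tmul_coe (R := ℂ) (grading A) (grading A)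
      ⟨a, mem_grading_zero.2 ha⟩ ⟨b, mem_grading_zero.2 hb⟩
    rw [mul_zero, units_pow_zero, one_smul] at this
    exact this
  · have := GradedTensorProduct.comm_coe_tmul_coe (R := ℂ) (grading A) (grading A)
      ⟨a, mem_grading_zero.2 ha⟩ ⟨b, mem_grading_one.2 hb⟩
    rw [mul_zero, units_pow_zero, one_smul] at this
    exact this

theorem flip_tmul_of_even_right (a : A) {b : A} (hb : parity b = b) :
    flip A (GradedTensorProduct.tmul ℂ a b) = GradedTensorProduct.tmul ℂ b a := by
  refine parity_induction a (fun c c' h h' => ?_) (fun a ha => ?_) (fun a ha => ?_)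
  · simp only [GradedTensorProduct.tmul, TensorProduct.add_tmul, TensorProduct.tmul_add,
      map_add] at *
    rw [h, h']
  · exact flip_tmul_of_even_left ha b
  · have := GradedTensorProduct.comm_coe_tmul_coe (R := ℂ) (grading A) (grading A)
      ⟨a, mem_grading_one.2 ha⟩ ⟨b, mem_grading_zero.2 hb⟩
    rw [zero_mul, units_pow_zero, one_smul] at this
    exact this

theorem flip_tmul_of_odd {a b : A} (ha : parity a = -a) (hb : parity b = -b) :
    flip A (GradedTensorProduct.tmul ℂ a b) = -GradedTensorProduct.tmul ℂ b a := by
  have := GradedTensorProduct.comm_coe_tmul_coe (R := ℂ) (grading A) (grading A)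
    ⟨a, mem_grading_one.2 ha⟩ ⟨b, mem_grading_one.2 hb⟩
  rw [mul_one, units_pow_one, Units.neg_smul, one_smul] at this
  exact this

/-! ### Parity -/

/-- The parity of `A⟦h⟧`, as a homomorphism. -/
def hparityHom (A : Type*) [Ring A] [Algebra ℂ A] [SuperAlgebra A] : A⟦X⟧ →ₐ[ℂ⟦X⟧] A⟦X⟧ :=
  coeffHom parity

theorem hparityHom_apply (a : A⟦X⟧) : hparityHom A a = hparity a := rfl

@[simp] theorem hparity_C (a : A) : hparity (C a) = C (parity a) := coeffMap_C _ _

@[simp] theorem coeff_hparity (a : A⟦X⟧) (n : ℕ) : coeff n (hparity a) = parity (coeff n a) :=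
  coeff_coeffMap _ _ _

@[simp] theorem hparity_hparity (a : A⟦X⟧) : hparity (hparity a) = a := by
  ext n
  rw [coeff_hparity, coeff_hparity, SuperAlgebra.parity_parity]

/-- Even elements of `A⟦h⟧`. -/
def Even (a : A⟦X⟧) : Prop := hparity a = a

/-- Odd elements of `A⟦h⟧`. -/
def Odd (a : A⟦X⟧) : Prop := hparity a = -a

theorem Even.coeff {a : A⟦X⟧} (h : Even a) (n : ℕ) : parity (coeff n a) = coeff n a := by
  rw [← coeff_hparity, h]

theorem Even.mul {a b : A⟦X⟧} (ha : Even a) (hb : Even b) : Even (a * b) := by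
  rw [Even, ← hparityHom_apply, map_mul, hparityHom_apply, hparityHom_apply, ha, hb]

theorem Even.add {a b : A⟦X⟧} (ha : Even a) (hb : Even b) : Even (a + b) := by
  rw [Even, ← hparityHom_apply, map_add, hparityHom_apply, hparityHom_apply, ha, hb]

theorem Even.sub {a b : A⟦X⟧} (ha : Even a) (hb : Even b) : Even (a - b) := by
  rw [Even, ← hparityHom_apply, map_sub, hparityHom_apply, hparityHom_apply, ha, hb]

theorem Even.neg {a : A⟦X⟧} (ha : Even a) : Even (-a) := by
  rw [Even, ← hparityHom_apply, map_neg, hparityHom_apply, ha]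

theorem Even.one : Even (1 : A⟦X⟧) := map_one (hparityHom A)

theorem Even.hsmul {a : A⟦X⟧} (ha : Even a) (c : ℂ⟦X⟧) : Even (c • a) := by
  rw [Even, ← hparityHom_apply, map_smul, hparityHom_apply, ha]

theorem hparity_csmul (c : ℂ) (a : A⟦X⟧) : hparity (c • a) = c • hparity a :=
  map_smul ((hparityHom A).toLinearMap.restrictScalars ℂ) c a

theorem Even.csmul {a : A⟦X⟧} (ha : Even a) (c : ℂ) : Even (c • a) := by
  rw [Even, hparity_csmul, ha]

theorem Even.subst {a : A⟦X⟧} (ha : Even a) (h0 : PowerSeries.coeff 0 a = 0) (f : ℂ⟦X⟧) :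
    Even (subst f a) := by
  rw [Even, ← hparityHom_apply, algHom_subst _ h0, hparityHom_apply, ha]

theorem Even.hpow {a : A⟦X⟧} (ha : Even a) (h0 : PowerSeries.coeff 0 a = 1) (r : ℂ) :
    Even (hpow a r) := (ha.sub Even.one).subst (coeff_zero_sub_one h0) _

theorem Even.hlog {a : A⟦X⟧} (ha : Even a) (h0 : PowerSeries.coeff 0 a = 1) :
    Even (hlog a) := (ha.sub Even.one).subst (coeff_zero_sub_one h0) _

theorem Even.hexp {a : A⟦X⟧} (ha : Even a) (h0 : PowerSeries.coeff 0 a = 0) :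
    Even (hexp a) := ha.subst h0 _

theorem Even.mul_odd {a b : A⟦X⟧} (ha : Even a) (hb : Odd b) : Odd (a * b) := by
  rw [Odd, ← hparityHom_apply, map_mul, hparityHom_apply, hparityHom_apply, ha, hb, mul_neg]

theorem Odd.mul_even {a b : A⟦X⟧} (ha : Odd a) (hb : Even b) : Odd (a * b) := by
  rw [Odd, ← hparityHom_apply, map_mul, hparityHom_apply, hparityHom_apply, ha, hb, neg_mul]

theorem Odd.mul {a b : A⟦X⟧} (ha : Odd a) (hb : Odd b) : Even (a * b) := by
  rw [Even, ← hparityHom_apply, map_mul, hparityHom_apply, hparityHom_apply, ha, hb, neg_mul_neg]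

theorem Odd.add {a b : A⟦X⟧} (ha : Odd a) (hb : Odd b) : Odd (a + b) := by
  rw [Odd, ← hparityHom_apply, map_add, hparityHom_apply, hparityHom_apply, ha, hb, neg_add]

theorem Odd.sub {a b : A⟦X⟧} (ha : Odd a) (hb : Odd b) : Odd (a - b) := by
  rw [Odd, ← hparityHom_apply, map_sub, hparityHom_apply, hparityHom_apply, ha, hb]
  abel

theorem Odd.neg {a : A⟦X⟧} (ha : Odd a) : Odd (-a) := by
  rw [Odd, ← hparityHom_apply, map_neg, hparityHom_apply, ha]

theorem Odd.csmul {a : A⟦X⟧} (ha : Odd a) (c : ℂ) : Odd (c • a) := by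
  rw [Odd, hparity_csmul, ha, smul_neg]

/-! ### The tensor product of two series -/

theorem coeff_htmul (a : A⟦X⟧) (b : B⟦X⟧) (n : ℕ) :
    coeff n (a ⊗ʰ b) = ∑ ij ∈ Finset.HasAntidiagonal.antidiagonal n,
      (GradedTensorProduct.tmul ℂ (coeff ij.1 a) (coeff ij.2 b) : A ⊗ˢ B) :=
  PowerSeries.coeff_mk _ _

/-- `a ⊗ b`, as a linear function of `a`. -/
def htmulLeft (b : B⟦X⟧) : A⟦X⟧ →ₗ[ℂ⟦X⟧] (A ⊗ˢ B)⟦X⟧ :=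
  ofHbar
    { toFun := fun a => a ⊗ʰ b
      map_add' := fun a a' => by
        ext n
        simp only [coeff_htmul, map_add, GradedTensorProduct.tmul, TensorProduct.add_tmul,
          Finset.sum_add_distrib]
      map_smul' := fun c a => by
        ext n
        simp only [coeff_htmul, coeff_csmul, GradedTensorProduct.tmul, ← TensorProduct.smul_tmul',
          map_smul, Finset.smul_sum, RingHom.id_apply] }
    (fun a => by
      ext n
      cases n with
      | zero => simp [coeff_htmul, GradedTensorProduct.tmul]
      | succ n =>
        simp [coeff_htmul, GradedTensorProduct.tmul, Finset.Nat.sum_antidiagonal_succ])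

/-- `a ⊗ b`, as a linear function of `b`. -/
def htmulRight (a : A⟦X⟧) : B⟦X⟧ →ₗ[ℂ⟦X⟧] (A ⊗ˢ B)⟦X⟧ :=
  ofHbar
    { toFun := fun b => a ⊗ʰ b
      map_add' := fun b b' => by
        ext n
        simp only [coeff_htmul, map_add, GradedTensorProduct.tmul, TensorProduct.tmul_add,
          Finset.sum_add_distrib]
      map_smul' := fun c a => by
        ext n
        simp only [coeff_htmul, coeff_csmul, GradedTensorProduct.tmul, TensorProduct.tmul_smul,
          map_smul, Finset.smul_sum, RingHom.id_apply] }
    (fun a => by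
      ext n
      cases n with
      | zero => simp [coeff_htmul, GradedTensorProduct.tmul]
      | succ n =>
        simp [coeff_htmul, GradedTensorProduct.tmul, Finset.Nat.sum_antidiagonal_succ'])

theorem add_htmul (a a' : A⟦X⟧) (b : B⟦X⟧) : (a + a') ⊗ʰ b = a ⊗ʰ b + a' ⊗ʰ b :=
  map_add (htmulLeft b) a a'

theorem htmul_add (a : A⟦X⟧) (b b' : B⟦X⟧) : a ⊗ʰ (b + b') = a ⊗ʰ b + a ⊗ʰ b' :=
  map_add (htmulRight a) b b'

theorem sub_htmul (a a' : A⟦X⟧) (b : B⟦X⟧) : (a - a') ⊗ʰ b = a ⊗ʰ b - a' ⊗ʰ b :=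
  map_sub (htmulLeft b) a a'

theorem htmul_sub (a : A⟦X⟧) (b b' : B⟦X⟧) : a ⊗ʰ (b - b') = a ⊗ʰ b - a ⊗ʰ b' :=
  map_sub (htmulRight a) b b'

theorem neg_htmul (a : A⟦X⟧) (b : B⟦X⟧) : (-a) ⊗ʰ b = -(a ⊗ʰ b) :=
  map_neg (htmulLeft b) a

theorem htmul_neg (a : A⟦X⟧) (b : B⟦X⟧) : a ⊗ʰ (-b) = -(a ⊗ʰ b) :=
  map_neg (htmulRight a) b

@[simp] theorem zero_htmul (b : B⟦X⟧) : (0 : A⟦X⟧) ⊗ʰ b = 0 := map_zero (htmulLeft b)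

theorem hsmul_htmul (c : ℂ⟦X⟧) (a : A⟦X⟧) (b : B⟦X⟧) : (c • a) ⊗ʰ b = c • (a ⊗ʰ b) :=
  map_smul (htmulLeft b) c a

theorem htmul_hsmul (c : ℂ⟦X⟧) (a : A⟦X⟧) (b : B⟦X⟧) : a ⊗ʰ (c • b) = c • (a ⊗ʰ b) :=
  map_smul (htmulRight a) c b

theorem csmul_htmul (c : ℂ) (a : A⟦X⟧) (b : B⟦X⟧) : (c • a) ⊗ʰ b = c • (a ⊗ʰ b) :=
  map_smul ((htmulLeft b).restrictScalars ℂ) c a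

theorem htmul_csmul (c : ℂ) (a : A⟦X⟧) (b : B⟦X⟧) : a ⊗ʰ (c • b) = c • (a ⊗ʰ b) :=
  map_smul ((htmulRight a).restrictScalars ℂ) c b

theorem C_htmul_C (a : A) (b : B) :
    (C a : A⟦X⟧) ⊗ʰ (C b : B⟦X⟧) = C (GradedTensorProduct.tmul ℂ a b : A ⊗ˢ B) := by
  ext n
  rw [coeff_htmul]
  cases n with
  | zero => simp
  | succ n =>
    rw [PowerSeries.coeff_succ_C]
    refine Finset.sum_eq_zero fun p hp => ?_
    rw [Finset.HasAntidiagonal.mem_antidiagonal] at hp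
    rcases p with ⟨_ | i, j⟩
    · obtain rfl : j = n + 1 := by simpa using hp
      simp [PowerSeries.coeff_succ_C, GradedTensorProduct.tmul]
    · simp [PowerSeries.coeff_succ_C, GradedTensorProduct.tmul]

theorem one_htmul_one : (1 : A⟦X⟧) ⊗ʰ (1 : B⟦X⟧) = 1 := by
  rw [← map_one (C (R := A)), ← map_one (C (R := B)), C_htmul_C, ← map_one (C (R := A ⊗ˢ B))]
  rfl

theorem coeff_zero_htmul (a : A⟦X⟧) (b : B⟦X⟧) :
    coeff 0 (a ⊗ʰ b) = (GradedTensorProduct.tmul ℂ (coeff 0 a) (coeff 0 b) : A ⊗ˢ B) := by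
  rw [coeff_htmul]
  simp

variable {M : Type*} [AddCommGroup M] [Module ℂ⟦X⟧ M]

theorem ext_of_isLinearMap [Separated M] {f g : A⟦X⟧ → M} (hf : IsLinearMap ℂ⟦X⟧ f)
    (hg : IsLinearMap ℂ⟦X⟧ g) (h : ∀ a, f (C a) = g (C a)) (a : A⟦X⟧) : f a = g a :=
  DFunLike.congr_fun (linearMap_ext_C (L₁ := hf.mk' f) (L₂ := hg.mk' g) h) a

theorem tensor_induction {P : A ⊗ˢ B → Prop} (h0 : P 0) (hadd : ∀ x y, P x → P y → P (x + y))
    (h : ∀ a b, P (GradedTensorProduct.tmul ℂ a b)) (x : A ⊗ˢ B) : P x := by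
  refine TensorProduct.induction_on (motive := fun y => P (GradedTensorProduct.of ℂ _ _ y))
    ((GradedTensorProduct.of ℂ _ _).symm x) ?_ h fun x y hx hy => ?_
  · rw [map_zero]; exact h0
  · rw [map_add]; exact hadd _ _ hx hy

/-- Linear maps on a completed tensor product are determined by the tensors `a ⊗ b`. -/
theorem tensor_ext [Separated M] {L₁ L₂ : (A ⊗ˢ B)⟦X⟧ →ₗ[ℂ⟦X⟧] M}
    (h : ∀ (a : A) (b : B), L₁ (C a ⊗ʰ C b) = L₂ (C a ⊗ʰ C b)) : L₁ = L₂ := by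
  refine linearMap_ext_C fun x => ?_
  refine tensor_induction (P := fun x => L₁ (C x) = L₂ (C x)) ?_ (fun x y hx hy => ?_)
    (fun a b => ?_) x
  · rw [map_zero, map_zero, map_zero]
  · rw [map_add, map_add, map_add, hx, hy]
  · rw [← C_htmul_C, h]

theorem htmul_ext [Separated M] {f g : A⟦X⟧ → B⟦X⟧ → M}
    (hf : ∀ b, IsLinearMap ℂ⟦X⟧ fun a => f a b) (hf' : ∀ a, IsLinearMap ℂ⟦X⟧ (f a))
    (hg : ∀ b, IsLinearMap ℂ⟦X⟧ fun a => g a b) (hg' : ∀ a, IsLinearMap ℂ⟦X⟧ (g a))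
    (h : ∀ a b, f (C a) (C b) = g (C a) (C b)) (a : A⟦X⟧) (b : B⟦X⟧) : f a b = g a b := by
  refine ext_of_isLinearMap (hf b) (hg b) (fun a => ?_) a
  exact ext_of_isLinearMap (hf' _) (hg' _) (h a) b

theorem htmul_mul_of_odd_or_even (a : A⟦X⟧) (b : B⟦X⟧) (c : A⟦X⟧) (d : B⟦X⟧) :
    (a ⊗ʰ b) * (c ⊗ʰ d) = (1 / 2 : ℂ) • ((a * (c + hparity c)) ⊗ʰ (b * d) +
      (a * (c - hparity c)) ⊗ʰ (hparity b * d)) := by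
  have hp : ∀ (r : ℂ⟦X⟧) (x : A⟦X⟧), hparity (r • x) = r • hparity x :=
    fun r x => map_smul (hparityHom A) r x
  have hp' : ∀ (r : ℂ⟦X⟧) (x : B⟦X⟧), hparity (r • x) = r • hparity x :=
    fun r x => map_smul (hparityHom B) r x
  have ha : ∀ (x y : A⟦X⟧), hparity (x + y) = hparity x + hparity y :=
    fun x y => map_add (hparityHom A) x y
  have ha' : ∀ (x y : B⟦X⟧), hparity (x + y) = hparity x + hparity y :=
    fun x y => map_add (hparityHom B) x y
  refine htmul_ext (f := fun a b => (a ⊗ʰ b) * (c ⊗ʰ d))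
    (g := fun a b => (1 / 2 : ℂ) • ((a * (c + hparity c)) ⊗ʰ (b * d) +
      (a * (c - hparity c)) ⊗ʰ (hparity b * d))) ?_ ?_ ?_ ?_ ?_ a b
  · exact fun b => ⟨fun x y => by rw [add_htmul, add_mul],
      fun r x => by rw [hsmul_htmul, smul_mul_assoc]⟩
  · exact fun b => ⟨fun x y => by rw [htmul_add, add_mul],
      fun r x => by rw [htmul_hsmul, smul_mul_assoc]⟩
  · exact fun b => ⟨fun x y => by simp only [add_mul, add_htmul]; module,
      fun r x => by
        simp only [smul_mul_assoc, hsmul_htmul, smul_comm (1 / 2 : ℂ) r, ← smul_add]⟩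
  · exact fun b => ⟨fun x y => by simp only [ha', add_mul, htmul_add]; module,
      fun r x => by
        simp only [hp', smul_mul_assoc, htmul_hsmul, smul_comm (1 / 2 : ℂ) r, ← smul_add]⟩
  intro a b
  refine htmul_ext (f := fun c d => (C a ⊗ʰ C b) * (c ⊗ʰ d))
    (g := fun c d => (1 / 2 : ℂ) • ((C a * (c + hparity c)) ⊗ʰ (C b * d) +
      (C a * (c - hparity c)) ⊗ʰ (hparity (C b) * d))) ?_ ?_ ?_ ?_ ?_ c d
  · exact fun b => ⟨fun x y => by rw [add_htmul, mul_add],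
      fun r x => by rw [hsmul_htmul, mul_smul_comm]⟩
  · exact fun b => ⟨fun x y => by rw [htmul_add, mul_add],
      fun r x => by rw [htmul_hsmul, mul_smul_comm]⟩
  · exact fun b => ⟨fun x y => by
        simp only [ha, mul_add, mul_sub, add_htmul, sub_htmul]; module,
      fun r x => by
        simp only [hp, mul_smul_comm, hsmul_htmul, ← smul_sub, smul_comm (1 / 2 : ℂ) r,
          ← smul_add]⟩
  · exact fun b => ⟨fun x y => by simp only [mul_add, htmul_add]; module,
      fun r x => by
        simp only [mul_smul_comm, htmul_hsmul, smul_comm (1 / 2 : ℂ) r, ← smul_add]⟩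
  intro c d
  rw [hparity_C, hparity_C, ← map_add, ← map_sub, ← map_mul, ← map_mul, ← map_mul, ← map_mul,
    C_htmul_C, C_htmul_C, C_htmul_C, C_htmul_C, ← map_mul, ← map_add, ← C_smul]
  congr 1
  refine parity_induction c (fun c c' h h' => ?_) (fun c hc => ?_) (fun c hc => ?_)
  · simp only [GradedTensorProduct.tmul, TensorProduct.add_tmul, mul_add, mul_sub, map_add,
      TensorProduct.sub_tmul, map_sub] at *
    rw [h, h']
    module
  · rw [hc, sub_self, mul_zero, tmul_mul_of_even_right _ _ hc, mul_add]
    simp only [GradedTensorProduct.tmul, TensorProduct.add_tmul, TensorProduct.zero_tmul, map_add,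
      map_zero]
    module
  · rw [hc, add_neg_cancel, mul_zero, sub_neg_eq_add]
    refine parity_induction b (fun b b' h h' => ?_) (fun b hb => ?_) (fun b hb => ?_)
    · simp only [GradedTensorProduct.tmul, TensorProduct.add_tmul, mul_add, map_add, add_mul,
        TensorProduct.zero_tmul, map_zero, TensorProduct.tmul_add] at *
      rw [h, h']
      module
    · rw [tmul_mul_of_even_left _ hb, hb]
      simp only [GradedTensorProduct.tmul, TensorProduct.add_tmul, TensorProduct.zero_tmul, map_add,
        map_zero, mul_add]
      module
    · rw [tmul_mul_of_odd _ hb hc, hb]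
      simp only [GradedTensorProduct.tmul, TensorProduct.add_tmul, TensorProduct.zero_tmul, map_add,
        map_zero, mul_add, neg_mul, TensorProduct.tmul_neg, map_neg]
      module

theorem htmul_mul_of_even_right (a : A⟦X⟧) (b : B⟦X⟧) {c : A⟦X⟧} (hc : Even c) (d : B⟦X⟧) :
    (a ⊗ʰ b) * (c ⊗ʰ d) = (a * c) ⊗ʰ (b * d) := by
  rw [htmul_mul_of_odd_or_even, hc, sub_self, mul_zero, zero_htmul, mul_add, add_htmul]
  module

theorem htmul_mul_of_even_left (a : A⟦X⟧) {b : B⟦X⟧} (hb : Even b) (c : A⟦X⟧) (d : B⟦X⟧) :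
    (a ⊗ʰ b) * (c ⊗ʰ d) = (a * c) ⊗ʰ (b * d) := by
  rw [htmul_mul_of_odd_or_even, hb, mul_add, add_htmul, mul_sub, sub_htmul]
  module

theorem htmul_mul_of_odd (a : A⟦X⟧) {b : B⟦X⟧} (hb : Odd b) {c : A⟦X⟧} (hc : Odd c) (d : B⟦X⟧) :
    (a ⊗ʰ b) * (c ⊗ʰ d) = -((a * c) ⊗ʰ (b * d)) := by
  rw [htmul_mul_of_odd_or_even, hb, hc]
  simp only [mul_add, add_htmul, mul_sub, sub_htmul, mul_neg, neg_htmul, neg_mul, htmul_neg]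
  module

theorem hparity_htmul (a : A⟦X⟧) (b : B⟦X⟧) :
    hparity (a ⊗ʰ b) = hparity a ⊗ʰ hparity b := by
  refine htmul_ext (f := fun a b => hparityHom (A ⊗ˢ B) (a ⊗ʰ b))
    (g := fun a b => hparityHom A a ⊗ʰ hparityHom B b) ?_ ?_ ?_ ?_ ?_ a b
  · exact fun b => ⟨fun x y => by rw [add_htmul, map_add],
      fun r x => by rw [hsmul_htmul, map_smul]⟩
  · exact fun b => ⟨fun x y => by rw [htmul_add, map_add],
      fun r x => by rw [htmul_hsmul, map_smul]⟩
  · exact fun b => ⟨fun x y => by rw [map_add, add_htmul],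
      fun r x => by rw [map_smul, hsmul_htmul]⟩
  · exact fun b => ⟨fun x y => by rw [map_add, htmul_add],
      fun r x => by rw [map_smul, htmul_hsmul]⟩
  intro a b
  simp only [hparityHom_apply, hparity_C, C_htmul_C]
  congr 1
  change tensorParity A B _ = _
  rw [tensorParity, GradedTensorProduct.lift_tmul]
  simp only [AlgHom.comp_apply, GradedTensorProduct.includeLeft_apply,
    GradedTensorProduct.includeRight_apply]
  rw [GradedTensorProduct.tmul_one_mul_one_tmul]

theorem Even.htmul {a : A⟦X⟧} {b : B⟦X⟧} (ha : Even a) (hb : Even b) : Even (a ⊗ʰ b) := by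
  rw [Even, hparity_htmul, ha, hb]

theorem Odd.htmul_even {a : A⟦X⟧} {b : B⟦X⟧} (ha : Odd a) (hb : Even b) : Odd (a ⊗ʰ b) := by
  rw [Odd, hparity_htmul, ha, hb, neg_htmul]

theorem Even.htmul_odd {a : A⟦X⟧} {b : B⟦X⟧} (ha : Even a) (hb : Odd b) : Odd (a ⊗ʰ b) := by
  rw [Odd, hparity_htmul, ha, hb, htmul_neg]

@[elab_as_elim]
theorem hparity_induction {P : A⟦X⟧ → Prop} (a : A⟦X⟧) (hadd : ∀ a b, P a → P b → P (a + b))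
    (h0 : ∀ a, Even a → P a) (h1 : ∀ a, Odd a → P a) : P a := by
  have : a = (1 / 2 : ℂ) • (a + hparity a) + (1 / 2 : ℂ) • (a - hparity a) := by module
  rw [this]
  refine hadd _ _ (h0 _ ?_) (h1 _ ?_)
  · refine Even.csmul ?_ _
    rw [Even, ← hparityHom_apply, map_add, hparityHom_apply, hparityHom_apply, hparity_hparity,
      add_comm]
  · refine Odd.csmul ?_ _
    rw [Odd, ← hparityHom_apply, map_sub, hparityHom_apply, hparityHom_apply, hparity_hparity,
      neg_sub]

/-! ### Homomorphisms out of completed tensor products -/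

/-- Images of two superalgebras that commute up to the usual sign. -/
structure SuperCommute {R : Type*} [Ring R] (f : A⟦X⟧ → R) (g : B⟦X⟧ → R) : Prop where
  even_left : ∀ a b, Even a → g b * f a = f a * g b
  even_right : ∀ a b, Even b → g b * f a = f a * g b
  odd : ∀ a b, Odd a → Odd b → g b * f a = -(f a * g b)

theorem SuperCommute.of_parity {R : Type*} [Ring R] {f : A⟦X⟧ → R} {g : B⟦X⟧ → R}
    (hf : ∀ a, f (-a) = -f a) (hg : ∀ b b', g (b + b') = g b + g b')
    (he : ∀ a b, Even b → g b * f a = f a * g b)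
    (ho : ∀ a b, Odd b → g b * f a = f (hparity a) * g b) : SuperCommute f g where
  even_left a b ha := by
    refine hparity_induction b (fun b b' h h' => ?_) (fun b hb => he a b hb) (fun b hb => ?_)
    · rw [hg, add_mul, mul_add, h, h']
    · rw [ho a b hb, ha]
  even_right a b hb := he a b hb
  odd a b ha hb := by rw [ho a b hb, ha, hf, neg_mul]

theorem map_mul_of_superCommute {R : Type*} [Ring R] [Algebra ℂ⟦X⟧ R] [Separated R]
    (L : (A ⊗ˢ B)⟦X⟧ →ₗ[ℂ⟦X⟧] R) {f : A⟦X⟧ →ₐ[ℂ⟦X⟧] R} {g : B⟦X⟧ →ₐ[ℂ⟦X⟧] R}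
    (hL : ∀ a b, L (a ⊗ʰ b) = f a * g b) (hfg : SuperCommute f g) (x y : (A ⊗ˢ B)⟦X⟧) :
    L (x * y) = L x * L y := by
  have key : ∀ (a : A⟦X⟧) (b : B⟦X⟧) (c : A⟦X⟧) (d : B⟦X⟧),
      L ((a ⊗ʰ b) * (c ⊗ʰ d)) = L (a ⊗ʰ b) * L (c ⊗ʰ d) := by
    intro a b c d
    refine hparity_induction c (fun c c' h h' => ?_) (fun c hc => ?_) (fun c hc => ?_)
    · rw [add_htmul, mul_add, map_add, h, h', map_add, mul_add]
    · rw [htmul_mul_of_even_right _ _ hc, hL, hL, hL, map_mul, map_mul, mul_assoc, mul_assoc,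
        ← mul_assoc (g b), hfg.even_left _ _ hc, mul_assoc]
    · refine hparity_induction b (fun b b' h h' => ?_) (fun b hb => ?_) (fun b hb => ?_)
      · rw [htmul_add, add_mul, map_add, h, h', map_add, add_mul]
      · rw [htmul_mul_of_even_left _ hb, hL, hL, hL, map_mul, map_mul, mul_assoc, mul_assoc,
          ← mul_assoc (g b), hfg.even_right _ _ hb, mul_assoc]
      · rw [htmul_mul_of_odd _ hb hc, map_neg, hL, hL, hL, map_mul, map_mul, mul_assoc (f a),
          mul_assoc (f a), ← mul_assoc (g b), hfg.odd _ _ hc hb, neg_mul, mul_neg, mul_assoc]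
  have h1 : ∀ (a : A) (b : B), L ∘ₗ LinearMap.mulLeft ℂ⟦X⟧ (C a ⊗ʰ C b) =
      LinearMap.mulLeft ℂ⟦X⟧ (L (C a ⊗ʰ C b)) ∘ₗ L := fun a b =>
    tensor_ext fun c d => key _ _ _ _
  have h2 : L ∘ₗ LinearMap.mulRight ℂ⟦X⟧ y = LinearMap.mulRight ℂ⟦X⟧ (L y) ∘ₗ L :=
    tensor_ext fun a b => DFunLike.congr_fun (h1 a b) y
  exact DFunLike.congr_fun h2 x

/-- A linear map on a completed tensor product that is multiplicative on the factors, as a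
homomorphism. -/
def tensorHom {R : Type*} [Ring R] [Algebra ℂ⟦X⟧ R] [Separated R]
    (L : (A ⊗ˢ B)⟦X⟧ →ₗ[ℂ⟦X⟧] R) (f : A⟦X⟧ →ₐ[ℂ⟦X⟧] R) (g : B⟦X⟧ →ₐ[ℂ⟦X⟧] R)
    (hL : ∀ a b, L (a ⊗ʰ b) = f a * g b) (hfg : SuperCommute f g) :
    (A ⊗ˢ B)⟦X⟧ →ₐ[ℂ⟦X⟧] R :=
  AlgHom.ofLinearMap L (by rw [← one_htmul_one, hL, map_one, map_one, mul_one])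
    (map_mul_of_superCommute L hL hfg)

/-- The inclusion of the left factor. -/
def inclLeft (A B : Type*) [Ring A] [Algebra ℂ A] [SuperAlgebra A] [Ring B] [Algebra ℂ B]
    [SuperAlgebra B] : A⟦X⟧ →ₐ[ℂ⟦X⟧] (A ⊗ˢ B)⟦X⟧ :=
  coeffHom (GradedTensorProduct.includeLeft (grading A) (grading B))

/-- The inclusion of the right factor. -/
def inclRight (A B : Type*) [Ring A] [Algebra ℂ A] [SuperAlgebra A] [Ring B] [Algebra ℂ B]
    [SuperAlgebra B] : B⟦X⟧ →ₐ[ℂ⟦X⟧] (A ⊗ˢ B)⟦X⟧ :=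
  coeffHom (GradedTensorProduct.includeRight (grading A) (grading B))

theorem inclLeft_apply (a : A⟦X⟧) : inclLeft A B a = a ⊗ʰ 1 := by
  refine DFunLike.congr_fun (linearMap_ext_C (L₁ := (inclLeft A B).toLinearMap)
    (L₂ := htmulLeft 1) fun a => ?_) a
  change inclLeft A B (C a) = C a ⊗ʰ 1
  rw [← map_one (C (R := B)), C_htmul_C, inclLeft, coeffHom_C]
  rfl

theorem inclRight_apply (b : B⟦X⟧) : inclRight A B b = 1 ⊗ʰ b := by
  refine DFunLike.congr_fun (linearMap_ext_C (L₁ := (inclRight A B).toLinearMap)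
    (L₂ := htmulRight 1) fun a => ?_) b
  change inclRight A B (C a) = 1 ⊗ʰ C a
  rw [← map_one (C (R := A)), C_htmul_C, inclRight, coeffHom_C]
  rfl

theorem superCommute_incl (F : A⟦X⟧ →ₐ[ℂ⟦X⟧] A'⟦X⟧) (G : B⟦X⟧ →ₐ[ℂ⟦X⟧] B'⟦X⟧)
    (hF : ∀ a, F (hparity a) = hparity (F a)) (hG : ∀ a, G (hparity a) = hparity (G a)) :
    SuperCommute ((inclLeft A' B').comp F) ((inclRight A' B').comp G) := by
  have hE : ∀ a, Even a → Even (F a) := fun a ha => by rw [Even, ← hF, ha]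
  have hE' : ∀ a, Even a → Even (G a) := fun a ha => by rw [Even, ← hG, ha]
  have hO : ∀ a, Odd a → Odd (F a) := fun a ha => by rw [Odd, ← hF, ha, map_neg]
  have hO' : ∀ a, Odd a → Odd (G a) := fun a ha => by rw [Odd, ← hG, ha, map_neg]
  constructor <;> intro a b <;>
    simp only [AlgHom.comp_apply, inclLeft_apply, inclRight_apply]
  · intro h
    rw [htmul_mul_of_even_right _ _ (hE _ h), htmul_mul_of_even_right _ _ Even.one]
    simp
  · intro h
    rw [htmul_mul_of_even_left _ (hE' _ h), htmul_mul_of_even_right _ _ Even.one]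
    simp
  · intro h h'
    rw [htmul_mul_of_odd _ (hO' _ h') (hO _ h), htmul_mul_of_even_right _ _ Even.one]
    simp

/-! ### The maps `F ⊗ id`, `id ⊗ F`, flip and associativity -/

theorem smap_tmul (f : A →ₗ[ℂ] A') (g : B →ₗ[ℂ] B') (a : A) (b : B) :
    smap f g (GradedTensorProduct.tmul ℂ a b) = GradedTensorProduct.tmul ℂ (f a) (g b) := rfl

/-- `mapLeft F`, as a linear map. -/
def mapLeftₗ (F : A⟦X⟧ →ₗ[ℂ] B⟦X⟧) : (A ⊗ˢ D)⟦X⟧ →ₗ[ℂ⟦X⟧] (B ⊗ˢ D)⟦X⟧ :=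
  extendₗ fun n => smap (component F n) LinearMap.id

/-- `mapRight F`, as a linear map. -/
def mapRightₗ (F : A⟦X⟧ →ₗ[ℂ] B⟦X⟧) : (D ⊗ˢ A)⟦X⟧ →ₗ[ℂ⟦X⟧] (D ⊗ˢ B)⟦X⟧ :=
  extendₗ fun n => smap LinearMap.id (component F n)

@[simp] theorem mapLeftₗ_apply (F : A⟦X⟧ →ₗ[ℂ] B⟦X⟧) (x : (A ⊗ˢ D)⟦X⟧) :
    mapLeftₗ F x = mapLeft F x := rfl

@[simp] theorem mapRightₗ_apply (F : A⟦X⟧ →ₗ[ℂ] B⟦X⟧) (x : (D ⊗ˢ A)⟦X⟧) :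
    mapRightₗ F x = mapRight F x := rfl

theorem mapLeft_C (F : A⟦X⟧ →ₗ[ℂ] B⟦X⟧) (a : A) (d : D) :
    mapLeft F (C a ⊗ʰ C d) = F (C a) ⊗ʰ C d := by
  rw [C_htmul_C, mapLeft, extend_C]
  ext n
  rw [PowerSeries.coeff_mk, smap_tmul, coeff_htmul, Finset.sum_eq_single (n, 0)]
  · simp [component_apply]
  · rintro ⟨i, j⟩ hij hne
    rw [Finset.HasAntidiagonal.mem_antidiagonal] at hij
    rcases j with _ | j
    · exact absurd (by simp at hij; rw [hij]) hne
    · simp [PowerSeries.coeff_succ_C, GradedTensorProduct.tmul]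
  · simp

theorem mapRight_C (F : A⟦X⟧ →ₗ[ℂ] B⟦X⟧) (d : D) (a : A) :
    mapRight F (C d ⊗ʰ C a) = C d ⊗ʰ F (C a) := by
  rw [C_htmul_C, mapRight, extend_C]
  ext n
  rw [PowerSeries.coeff_mk, smap_tmul, coeff_htmul, Finset.sum_eq_single (0, n)]
  · simp [component_apply]
  · rintro ⟨j, i⟩ hij hne
    rw [Finset.HasAntidiagonal.mem_antidiagonal] at hij
    rcases j with _ | j
    · exact absurd (by simp at hij; rw [hij]) hne
    · simp [PowerSeries.coeff_succ_C, GradedTensorProduct.tmul]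
  · simp

theorem mapLeft_htmul (F : A⟦X⟧ →ₗ[ℂ⟦X⟧] B⟦X⟧) (a : A⟦X⟧) (d : D⟦X⟧) :
    mapLeft (F.restrictScalars ℂ) (a ⊗ʰ d) = F a ⊗ʰ d := by
  refine htmul_ext (f := fun a d => mapLeftₗ (F.restrictScalars ℂ) (a ⊗ʰ d))
    (g := fun a d => F a ⊗ʰ d) ?_ ?_ ?_ ?_ ?_ a d
  · exact fun b => ⟨fun x y => by rw [add_htmul, map_add],
      fun r x => by rw [hsmul_htmul, map_smul]⟩
  · exact fun b => ⟨fun x y => by rw [htmul_add, map_add],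
      fun r x => by rw [htmul_hsmul, map_smul]⟩
  · exact fun b => ⟨fun x y => by rw [map_add, add_htmul],
      fun r x => by rw [map_smul, hsmul_htmul]⟩
  · exact fun b => ⟨fun x y => by rw [htmul_add],
      fun r x => by rw [htmul_hsmul]⟩
  · exact fun a d => mapLeft_C _ _ _

theorem mapRight_htmul (F : A⟦X⟧ →ₗ[ℂ⟦X⟧] B⟦X⟧) (d : D⟦X⟧) (a : A⟦X⟧) :
    mapRight (F.restrictScalars ℂ) (d ⊗ʰ a) = d ⊗ʰ F a := by
  refine htmul_ext (f := fun d a => mapRightₗ (F.restrictScalars ℂ) (d ⊗ʰ a))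
    (g := fun d a => d ⊗ʰ F a) ?_ ?_ ?_ ?_ ?_ d a
  · exact fun b => ⟨fun x y => by rw [add_htmul, map_add],
      fun r x => by rw [hsmul_htmul, map_smul]⟩
  · exact fun b => ⟨fun x y => by rw [htmul_add, map_add],
      fun r x => by rw [htmul_hsmul, map_smul]⟩
  · exact fun b => ⟨fun x y => by rw [add_htmul],
      fun r x => by rw [hsmul_htmul]⟩
  · exact fun b => ⟨fun x y => by rw [map_add, htmul_add],
      fun r x => by rw [map_smul, htmul_hsmul]⟩
  · exact fun a d => mapRight_C _ _ _

theorem htmul_eq_mul (a : A⟦X⟧) (b : B⟦X⟧) : a ⊗ʰ b = (a ⊗ʰ 1) * (1 ⊗ʰ b) := by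
  rw [htmul_mul_of_even_right _ _ Even.one, mul_one, one_mul]

/-- `F ⊗ id`, as a homomorphism. -/
def mapLeftHom (F : A⟦X⟧ →ₐ[ℂ⟦X⟧] B⟦X⟧) (hF : ∀ a, F (hparity a) = hparity (F a)) :
    (A ⊗ˢ D)⟦X⟧ →ₐ[ℂ⟦X⟧] (B ⊗ˢ D)⟦X⟧ :=
  tensorHom (mapLeftₗ (F.toLinearMap.restrictScalars ℂ)) ((inclLeft B D).comp F)
    ((inclRight B D).comp (AlgHom.id _ _))
    (fun a d => by
      rw [mapLeftₗ_apply, mapLeft_htmul, htmul_eq_mul, ← inclLeft_apply, ← inclRight_apply]; rfl)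
    (superCommute_incl F (AlgHom.id _ _) hF fun _ => rfl)

/-- `id ⊗ F`, as a homomorphism. -/
def mapRightHom (F : A⟦X⟧ →ₐ[ℂ⟦X⟧] B⟦X⟧) (hF : ∀ a, F (hparity a) = hparity (F a)) :
    (D ⊗ˢ A)⟦X⟧ →ₐ[ℂ⟦X⟧] (D ⊗ˢ B)⟦X⟧ :=
  tensorHom (mapRightₗ (F.toLinearMap.restrictScalars ℂ)) ((inclLeft D B).comp (AlgHom.id _ _))
    ((inclRight D B).comp F)
    (fun a d => by
      rw [mapRightₗ_apply, mapRight_htmul, htmul_eq_mul, ← inclLeft_apply, ← inclRight_apply]; rfl)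
    (superCommute_incl (AlgHom.id _ _) F (fun _ => rfl) hF)

theorem mapLeftHom_apply (F : A⟦X⟧ →ₐ[ℂ⟦X⟧] B⟦X⟧) (hF : ∀ a, F (hparity a) = hparity (F a))
    (x : (A ⊗ˢ D)⟦X⟧) : mapLeftHom F hF x = mapLeft (F.toLinearMap.restrictScalars ℂ) x := rfl

theorem mapRightHom_apply (F : A⟦X⟧ →ₐ[ℂ⟦X⟧] B⟦X⟧) (hF : ∀ a, F (hparity a) = hparity (F a))
    (x : (D ⊗ˢ A)⟦X⟧) : mapRightHom F hF x = mapRight (F.toLinearMap.restrictScalars ℂ) x := rfl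

/-- The tensor product of two even homomorphisms. -/
def smapHom (f : A →ₐ[ℂ] A') (g : B →ₐ[ℂ] B') (hf : ∀ a, f (parity a) = parity (f a))
    (hg : ∀ a, g (parity a) = parity (g a)) : (A ⊗ˢ B)⟦X⟧ →ₐ[ℂ⟦X⟧] (A' ⊗ˢ B')⟦X⟧ :=
  (mapLeftHom (coeffHom f) fun a => by ext; simp [hf]).comp
    (mapRightHom (coeffHom g) fun a => by ext; simp [hg])

theorem smapHom_htmul (f : A →ₐ[ℂ] A') (g : B →ₐ[ℂ] B') (hf : ∀ a, f (parity a) = parity (f a))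
    (hg : ∀ a, g (parity a) = parity (g a)) (a : A⟦X⟧) (b : B⟦X⟧) :
    smapHom f g hf hg (a ⊗ʰ b) = coeffHom f a ⊗ʰ coeffHom g b := by
  rw [smapHom, AlgHom.comp_apply, mapRightHom_apply, mapRight_htmul, mapLeftHom_apply,
    mapLeft_htmul]
  rfl

theorem smapHom_apply (f : A →ₐ[ℂ] A') (g : B →ₐ[ℂ] B') (hf : ∀ a, f (parity a) = parity (f a))
    (hg : ∀ a, g (parity a) = parity (g a)) (x : (A ⊗ˢ B)⟦X⟧) :
    smapHom f g hf hg x = coeffMap (smap f.toLinearMap g.toLinearMap) x := by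
  refine DFunLike.congr_fun (tensor_ext (L₁ := (smapHom f g hf hg).toLinearMap)
    (L₂ := coeffMapₗ (smap f.toLinearMap g.toLinearMap)) fun a b => ?_) x
  rw [AlgHom.toLinearMap_apply, smapHom_htmul, coeffMapₗ_apply, C_htmul_C, coeffMap_C, coeffHom_C,
    coeffHom_C, C_htmul_C]
  rfl

/-- The flip, as a homomorphism. -/
def flipHom (A : Type*) [Ring A] [Algebra ℂ A] [SuperAlgebra A] :
    (A ⊗ˢ A)⟦X⟧ →ₐ[ℂ⟦X⟧] (A ⊗ˢ A)⟦X⟧ :=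
  coeffHom (GradedTensorProduct.comm (grading A) (grading A)).toAlgHom

theorem flipHom_apply (x : (A ⊗ˢ A)⟦X⟧) : flipHom A x = coeffMap (flip A) x := rfl

theorem flipHom_of_even_left {a : A⟦X⟧} (ha : Even a) (b : A⟦X⟧) :
    flipHom A (a ⊗ʰ b) = b ⊗ʰ a := by
  ext n
  rw [flipHom_apply, coeff_coeffMap, coeff_htmul, map_sum, coeff_htmul,
    ← Finset.Nat.sum_antidiagonal_swap]
  exact Finset.sum_congr rfl fun p _ => flip_tmul_of_even_left (ha.coeff _) _

theorem flipHom_of_even_right (a : A⟦X⟧) {b : A⟦X⟧} (hb : Even b) :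
    flipHom A (a ⊗ʰ b) = b ⊗ʰ a := by
  ext n
  rw [flipHom_apply, coeff_coeffMap, coeff_htmul, map_sum, coeff_htmul,
    ← Finset.Nat.sum_antidiagonal_swap]
  exact Finset.sum_congr rfl fun p _ => flip_tmul_of_even_right _ (hb.coeff _)

theorem sassoc_tmul (a : A) (b : B) (d : D) :
    sassoc A B D (GradedTensorProduct.tmul ℂ (GradedTensorProduct.tmul ℂ a b : A ⊗ˢ B) d) =
      GradedTensorProduct.tmul ℂ a (GradedTensorProduct.tmul ℂ b d : B ⊗ˢ D) := rfl

theorem coeffMap_sassoc_htmul (a : A⟦X⟧) (b : B⟦X⟧) (d : D⟦X⟧) :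
    coeffMap (sassoc A B D) ((a ⊗ʰ b) ⊗ʰ d) = a ⊗ʰ (b ⊗ʰ d) := by
  refine htmul_ext (f := fun a b => coeffMapₗ (sassoc A B D) ((a ⊗ʰ b) ⊗ʰ d))
    (g := fun a b => a ⊗ʰ (b ⊗ʰ d)) ?_ ?_ ?_ ?_ ?_ a b
  · exact fun b => ⟨fun x y => by rw [add_htmul, add_htmul, map_add],
      fun r x => by rw [hsmul_htmul, hsmul_htmul, map_smul]⟩
  · exact fun b => ⟨fun x y => by rw [htmul_add, add_htmul, map_add],
      fun r x => by rw [htmul_hsmul, hsmul_htmul, map_smul]⟩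
  · exact fun b => ⟨fun x y => by rw [add_htmul], fun r x => by rw [hsmul_htmul]⟩
  · exact fun b => ⟨fun x y => by rw [add_htmul, htmul_add],
      fun r x => by rw [hsmul_htmul, htmul_hsmul]⟩
  intro a b
  refine ext_of_isLinearMap (f := fun d => coeffMapₗ (sassoc A B D) ((C a ⊗ʰ C b) ⊗ʰ d))
    (g := fun d => C a ⊗ʰ (C b ⊗ʰ d)) ?_ ?_ ?_ d
  · exact ⟨fun x y => by rw [htmul_add, map_add], fun r x => by rw [htmul_hsmul, map_smul]⟩
  · exact ⟨fun x y => by rw [htmul_add, htmul_add], fun r x => by rw [htmul_hsmul, htmul_hsmul]⟩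
  intro d
  simp only [C_htmul_C, coeffMapₗ_apply, coeffMap_C, sassoc_tmul]

theorem coeffMap_mulMap_htmul (a b : A⟦X⟧) : coeffMap (mulMap A) (a ⊗ʰ b) = a * b := by
  refine htmul_ext (f := fun a b => coeffMapₗ (mulMap A) (a ⊗ʰ b)) (g := fun a b => a * b)
    ?_ ?_ ?_ ?_ ?_ a b
  · exact fun b => ⟨fun x y => by rw [add_htmul, map_add],
      fun r x => by rw [hsmul_htmul, map_smul]⟩
  · exact fun b => ⟨fun x y => by rw [htmul_add, map_add],
      fun r x => by rw [htmul_hsmul, map_smul]⟩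
  · exact fun b => ⟨fun x y => by rw [add_mul], fun r x => by rw [smul_mul_assoc]⟩
  · exact fun b => ⟨fun x y => by rw [mul_add], fun r x => by rw [mul_smul_comm]⟩
  intro a b
  rw [C_htmul_C, coeffMapₗ_apply, coeffMap_C, ← map_mul]
  rfl

theorem inclLeft_parity (a : A⟦X⟧) :
    inclLeft A B (hparity a) = hparity (inclLeft A B a) := by
  rw [inclLeft_apply, inclLeft_apply, hparity_htmul]
  congr 1
  exact Even.one.symm

theorem inclRight_parity (b : B⟦X⟧) :
    inclRight A B (hparity b) = hparity (inclRight A B b) := by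
  rw [inclRight_apply, inclRight_apply, hparity_htmul]
  congr 1
  exact Even.one.symm

/-- The associativity isomorphism, as a homomorphism. -/
def sassocHom (A B D : Type*) [Ring A] [Algebra ℂ A] [SuperAlgebra A] [Ring B] [Algebra ℂ B]
    [SuperAlgebra B] [Ring D] [Algebra ℂ D] [SuperAlgebra D] :
    ((A ⊗ˢ B) ⊗ˢ D)⟦X⟧ →ₐ[ℂ⟦X⟧] (A ⊗ˢ (B ⊗ˢ D))⟦X⟧ :=
  have h : ∀ (x : (A ⊗ˢ B)⟦X⟧) (d : D⟦X⟧), coeffMapₗ (sassoc A B D) (x ⊗ʰ d) =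
      mapRightHom (inclLeft B D) inclLeft_parity x *
        ((inclRight A (B ⊗ˢ D)).comp (inclRight B D)) d := by
    intro x d
    refine DFunLike.congr_fun (tensor_ext (L₁ := coeffMapₗ (sassoc A B D) ∘ₗ htmulLeft d)
      (L₂ := LinearMap.mulRight ℂ⟦X⟧ (((inclRight A (B ⊗ˢ D)).comp (inclRight B D)) d) ∘ₗ
        (mapRightHom (inclLeft B D) inclLeft_parity).toLinearMap) fun a b => ?_) x
    change coeffMap (sassoc A B D) ((C a ⊗ʰ C b) ⊗ʰ d) =
      mapRightHom (inclLeft B D) inclLeft_parity (C a ⊗ʰ C b) *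
        ((inclRight A (B ⊗ˢ D)).comp (inclRight B D)) d
    rw [coeffMap_sassoc_htmul, mapRightHom_apply, mapRight_htmul, AlgHom.comp_apply,
      inclRight_apply, inclRight_apply, htmul_mul_of_even_right _ _ Even.one, mul_one,
      AlgHom.toLinearMap_apply, inclLeft_apply, htmul_mul_of_even_right _ _ Even.one, mul_one,
      one_mul]
  tensorHom (coeffMapₗ (sassoc A B D)) (mapRightHom (inclLeft B D) inclLeft_parity)
    ((inclRight A (B ⊗ˢ D)).comp (inclRight B D)) h (by
      have hr : ∀ d : D⟦X⟧, ((inclRight A (B ⊗ˢ D)).comp (inclRight B D)) d = 1 ⊗ʰ (1 ⊗ʰ d) :=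
        fun d => by rw [AlgHom.comp_apply, inclRight_apply, inclRight_apply]
      have hm : ∀ (a : A⟦X⟧) (b : B⟦X⟧),
          mapRightHom (D := A) (inclLeft B D) inclLeft_parity (a ⊗ʰ b) = a ⊗ʰ (b ⊗ʰ 1) :=
        fun a b => by
          rw [mapRightHom_apply, mapRight_htmul, AlgHom.toLinearMap_apply, inclLeft_apply]
      refine SuperCommute.of_parity (map_neg _) (map_add _) (fun x d hd => ?_) (fun x d hd => ?_)
      · refine DFunLike.congr_fun (tensor_ext
          (L₁ := LinearMap.mulLeft ℂ⟦X⟧ (((inclRight A (B ⊗ˢ D)).comp (inclRight B D)) d) ∘ₗ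
            (mapRightHom (inclLeft B D) inclLeft_parity).toLinearMap)
          (L₂ := LinearMap.mulRight ℂ⟦X⟧ (((inclRight A (B ⊗ˢ D)).comp (inclRight B D)) d) ∘ₗ
            (mapRightHom (inclLeft B D) inclLeft_parity).toLinearMap) fun a b => ?_) x
        simp only [LinearMap.comp_apply, LinearMap.mulLeft_apply, LinearMap.mulRight_apply,
          AlgHom.toLinearMap_apply, hr, hm]
        rw [htmul_mul_of_even_left _ (Even.one.htmul hd), htmul_mul_of_even_right _ _ Even.one,
          htmul_mul_of_even_left _ hd, htmul_mul_of_even_right _ _ Even.one]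
        simp
      · refine DFunLike.congr_fun (tensor_ext
          (L₁ := LinearMap.mulLeft ℂ⟦X⟧ (((inclRight A (B ⊗ˢ D)).comp (inclRight B D)) d) ∘ₗ
            (mapRightHom (inclLeft B D) inclLeft_parity).toLinearMap)
          (L₂ := LinearMap.mulRight ℂ⟦X⟧ (((inclRight A (B ⊗ˢ D)).comp (inclRight B D)) d) ∘ₗ
            (mapRightHom (inclLeft B D) inclLeft_parity).toLinearMap ∘ₗ
            (hparityHom (A ⊗ˢ B)).toLinearMap) fun a b => ?_) x
        simp only [LinearMap.comp_apply, LinearMap.mulLeft_apply, LinearMap.mulRight_apply,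
          AlgHom.toLinearMap_apply, hr, hparityHom_apply, hparity_htmul, hm]
        generalize (C a : A⟦X⟧) = a
        generalize (C b : B⟦X⟧) = b
        have hd' : Odd ((1 : B⟦X⟧) ⊗ʰ d) := Even.one.htmul_odd hd
        rw [htmul_mul_of_even_right _ _ Even.one, mul_one]
        refine hparity_induction a (fun a a' h h' => ?_) (fun a ha => ?_) (fun a ha => ?_)
        · have : hparity (a + a') = hparity a + hparity a' := map_add (hparityHom A) a a'
          rw [this, add_htmul, add_htmul, mul_add, h, h']
        · rw [ha, htmul_mul_of_even_right _ _ ha, one_mul]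
          congr 1
          refine hparity_induction b (fun a a' h h' => ?_) (fun a ha => ?_) (fun a ha => ?_)
          · have : hparity (a + a') = hparity a + hparity a' := map_add (hparityHom B) a a'
            rw [this, add_htmul, add_htmul, mul_add, add_mul, h, h']
          · rw [ha, htmul_mul_of_even_right _ _ ha, htmul_mul_of_even_right _ _ Even.one]
            simp
          · rw [ha, htmul_mul_of_odd _ hd ha, htmul_mul_of_even_right _ _ Even.one, neg_mul,
              neg_htmul]
            simp
        · rw [ha, htmul_mul_of_odd _ hd' ha, one_mul, neg_htmul]
          congr 2
          refine hparity_induction b (fun a a' h h' => ?_) (fun a ha => ?_) (fun a ha => ?_)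
          · have : hparity (a + a') = hparity a + hparity a' := map_add (hparityHom B) a a'
            rw [this, add_htmul, add_htmul, mul_add, add_mul, h, h']
          · rw [ha, htmul_mul_of_even_right _ _ ha, htmul_mul_of_even_right _ _ Even.one]
            simp
          · rw [ha, htmul_mul_of_odd _ hd ha, htmul_mul_of_even_right _ _ Even.one, neg_mul,
              neg_htmul]
            simp)

end Graded

/-! ## A smaller presentation of `U(sl(2|1))` -/

/-- Elements of an algebra that satisfy the relations of the generators `e₁`, `h₁`, `f₁`,
`n = h₂ + h₃`, `e₃`, `f₂` of `U(sl(2|1))`. -/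
structure Core {R : Type*} [Ring R] [Algebra ℂ R] (e1 h1 f1 n e3 f2 : R) : Prop where
  h1_f1 : h1 * f1 - f1 * h1 = (-2 : ℂ) • f1
  e1_f1 : e1 * f1 - f1 * e1 = h1
  n_f1 : n * f1 - f1 * n = 0
  n_e3 : n * e3 - e3 * n = -e3
  n_f2 : n * f2 - f2 * n = f2
  h1_e3 : h1 * e3 - e3 * h1 = e3
  h1_f2 : h1 * f2 - f2 * h1 = f2
  e3_e3 : e3 * e3 = 0
  f2_f2 : f2 * f2 = 0
  f2_e3 : f2 * e3 + e3 * f2 = e1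
  serre_e : f1 * (f1 * e3 - e3 * f1) - (f1 * e3 - e3 * f1) * f1 = 0
  serre_f : f1 * (f1 * f2 - f2 * f1) - (f1 * f2 - f2 * f1) * f1 = 0
  e2_f2 : (f1 * e3 - e3 * f1) * f2 + f2 * (f1 * e3 - e3 * f1) = (1 / 2 : ℂ) • (n - h1)

namespace Core

variable {R : Type*} [Ring R] [Algebra ℂ R] {e1 h1 f1 n e3 f2 : R} (c : Core e1 h1 f1 n e3 f2)

include c

theorem e1_e3 : e1 * e3 - e3 * e1 = 0 := by
  linear_combination (norm := noncomm_ring) e3 * c.f2_e3 - c.f2_e3 * e3 + f2 * c.e3_e3 - c.e3_e3 * f2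

theorem e1_f2 : e1 * f2 - f2 * e1 = 0 := by
  linear_combination (norm := noncomm_ring) f2 * c.f2_e3 - c.f2_e3 * f2 + e3 * c.f2_f2 - c.f2_f2 * e3

theorem n_e1 : n * e1 - e1 * n = 0 := by
  linear_combination (norm := noncomm_ring) c.f2_e3 * n - n * c.f2_e3 + f2 * c.n_e3 + c.n_e3 * f2 +
    c.n_f2 * e3 + e3 * c.n_f2

theorem h1_e1 : h1 * e1 - e1 * h1 = (2 : ℂ) • e1 := by
  linear_combination (norm := skip) c.f2_e3 * h1 - h1 * c.f2_e3 + f2 * c.h1_e3 + c.h1_e3 * f2 +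
    c.h1_f2 * e3 + e3 * c.h1_f2 + (2 : ℂ) • c.f2_e3
  simp only [mul_add, add_mul, mul_sub, sub_mul, mul_assoc, smul_mul_assoc, mul_smul_comm]
  module

theorem n_h1 : n * h1 - h1 * n = 0 := by
  linear_combination (norm := noncomm_ring) c.e1_f1 * n - n * c.e1_f1 + c.n_e1 * f1 - f1 * c.n_e1 +
    e1 * c.n_f1 - c.n_f1 * e1

theorem h1_e2 : h1 * (f1 * e3 - e3 * f1) - (f1 * e3 - e3 * f1) * h1 = -(f1 * e3 - e3 * f1) := by
  linear_combination (norm := skip) c.h1_f1 * e3 - e3 * c.h1_f1 + f1 * c.h1_e3 - c.h1_e3 * f1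
  simp only [mul_add, add_mul, mul_sub, sub_mul, mul_assoc, smul_mul_assoc, mul_smul_comm]
  module

theorem h1_f3 : h1 * (f2 * f1 - f1 * f2) - (f2 * f1 - f1 * f2) * h1 = -(f2 * f1 - f1 * f2) := by
  linear_combination (norm := skip) f2 * c.h1_f1 - c.h1_f1 * f2 - f1 * c.h1_f2 + c.h1_f2 * f1
  simp only [mul_add, add_mul, mul_sub, sub_mul, mul_assoc, smul_mul_assoc, mul_smul_comm]
  module

theorem n_e2 : n * (f1 * e3 - e3 * f1) - (f1 * e3 - e3 * f1) * n = -(f1 * e3 - e3 * f1) := by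
  linear_combination (norm := noncomm_ring) c.n_f1 * e3 - e3 * c.n_f1 + f1 * c.n_e3 - c.n_e3 * f1

theorem n_f3 : n * (f2 * f1 - f1 * f2) - (f2 * f1 - f1 * f2) * n = f2 * f1 - f1 * f2 := by
  linear_combination (norm := noncomm_ring) f2 * c.n_f1 - c.n_f1 * f2 - f1 * c.n_f2 + c.n_f2 * f1

theorem e1_e2 : e1 * (f1 * e3 - e3 * f1) - (f1 * e3 - e3 * f1) * e1 = e3 := by
  linear_combination (norm := noncomm_ring) c.e1_f1 * e3 - e3 * c.e1_f1 + f1 * c.e1_e3 -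
    c.e1_e3 * f1 + c.h1_e3

theorem f3_e1 : (f2 * f1 - f1 * f2) * e1 - e1 * (f2 * f1 - f1 * f2) = f2 := by
  linear_combination (norm := noncomm_ring) c.e1_f1 * f2 - f2 * c.e1_f1 + f1 * c.e1_f2 -
    c.e1_f2 * f1 + c.h1_f2

theorem e2_e3 : (f1 * e3 - e3 * f1) * e3 + e3 * (f1 * e3 - e3 * f1) = 0 := by
  linear_combination (norm := noncomm_ring) f1 * c.e3_e3 - c.e3_e3 * f1

theorem f2_f3 : f2 * (f2 * f1 - f1 * f2) + (f2 * f1 - f1 * f2) * f2 = 0 := by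
  linear_combination (norm := noncomm_ring) c.f2_f2 * f1 - f1 * c.f2_f2

theorem e2_e2 : (f1 * e3 - e3 * f1) * (f1 * e3 - e3 * f1) = 0 := by
  linear_combination (norm := skip) (1 / 2 : ℂ) • (f1 * c.e2_e3 - c.e2_e3 * f1 - c.serre_e * e3 -
    e3 * c.serre_e)
  simp only [mul_add, add_mul, mul_sub, sub_mul, mul_assoc, smul_mul_assoc, mul_smul_comm, mul_zero,
    zero_mul]
  module

theorem f3_f3 : (f2 * f1 - f1 * f2) * (f2 * f1 - f1 * f2) = 0 := by
  linear_combination (norm := skip) (1 / 2 : ℂ) • (c.f2_f3 * f1 - f1 * c.f2_f3 - c.serre_f * f2 -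
    f2 * c.serre_f)
  simp only [mul_add, add_mul, mul_sub, sub_mul, mul_assoc, smul_mul_assoc, mul_smul_comm, mul_zero,
    zero_mul]
  module

theorem e3_f3 : e3 * (f2 * f1 - f1 * f2) + (f2 * f1 - f1 * f2) * e3 = (1 / 2 : ℂ) • (n + h1) := by
  linear_combination (norm := skip) c.f2_e3 * f1 - f1 * c.f2_e3 + c.e1_f1 + c.e2_f2
  simp only [mul_add, add_mul, mul_sub, sub_mul, mul_assoc, smul_mul_assoc, mul_smul_comm]
  module

theorem f3_e2 : (f2 * f1 - f1 * f2) * (f1 * e3 - e3 * f1) +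
    (f1 * e3 - e3 * f1) * (f2 * f1 - f1 * f2) = f1 := by
  linear_combination (norm := skip) c.e2_f2 * f1 - f1 * c.e2_f2 + c.serre_e * f2 + f2 * c.serre_e +
    (1 / 2 : ℂ) • (c.n_f1 - c.h1_f1)
  simp only [mul_add, add_mul, mul_sub, sub_mul, mul_assoc, smul_mul_assoc, mul_smul_comm, zero_mul,
    mul_zero]
  module

omit c in
/-- The images of the generators of `U(sl(2|1))`. -/
def image (e1 h1 f1 n e3 f2 : R) : Gen → R
  | .h1 => h1
  | .h2 => (1 / 2 : ℂ) • (n - h1)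
  | .h3 => (1 / 2 : ℂ) • (n + h1)
  | .e1 => e1
  | .f1 => f1
  | .e2 => f1 * e3 - e3 * f1
  | .f2 => f2
  | .e3 => e3
  | .f3 => f2 * f1 - f1 * f2

theorem rel ⦃x y : FreeAlgebra ℂ Gen⦄ (h : Rel x y) :
    FreeAlgebra.lift ℂ (image e1 h1 f1 n e3 f2) x =
      FreeAlgebra.lift ℂ (image e1 h1 f1 n e3 f2) y := by
  have k1 := c.h1_f1
  have k2 := c.n_f1
  have k3 := c.n_e3
  have k4 := c.n_f2
  have k5 := c.h1_e3
  have k6 := c.h1_f2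
  have k7 := c.n_e1
  have k8 := c.h1_e1
  have k9 := c.n_h1
  have k10 := c.h1_e2
  have k11 := c.h1_f3
  have k12 := c.n_e2
  have k13 := c.n_f3
  have k14 := c.serre_e
  have k15 := c.serre_f
  have k16 := c.e1_e2
  have k17 := c.f3_e1
  have hs : ∀ (a b : R) (r : ℂ), (r • (n - a)) * b - b * (r • (n - a)) =
      r • ((n * b - b * n) - (a * b - b * a)) := fun a b r => by
    simp only [smul_mul_assoc, mul_smul_comm, sub_mul, mul_sub]; module
  have hs' : ∀ (a b : R) (r : ℂ), (r • (n + a)) * b - b * (r • (n + a)) =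
      r • ((n * b - b * n) + (a * b - b * a)) := fun a b r => by
    simp only [smul_mul_assoc, mul_smul_comm, add_mul, mul_add]; module
  have hr : ∀ (a b : R) (r : ℂ), b * (r • (n - a)) - (r • (n - a)) * b =
      -(r • ((n * b - b * n) - (a * b - b * a))) := fun a b r => by
    simp only [smul_mul_assoc, mul_smul_comm, sub_mul, mul_sub]; module
  have hr' : ∀ (a b : R) (r : ℂ), b * (r • (n + a)) - (r • (n + a)) * b =
      -(r • ((n * b - b * n) + (a * b - b * a))) := fun a b r => by
    simp only [smul_mul_assoc, mul_smul_comm, add_mul, mul_add]; module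
  have hn : h1 * h1 - h1 * h1 = 0 := sub_self _
  have hnn : (1 / 2 : ℂ) • (n - h1) * ((1 / 2 : ℂ) • (n + h1)) -
      (1 / 2 : ℂ) • (n + h1) * ((1 / 2 : ℂ) • (n - h1)) = 0 := by
    linear_combination (norm := skip) (1 / 2 : ℂ) • k9
    simp only [smul_mul_assoc, mul_smul_comm, sub_mul, mul_sub, add_mul, mul_add]
    module
  cases h
  case h2_h3 => simpa [gbr, gen, image, Gen.odd] using hnn
  case f2_f2 => simpa [gen, image, sq] using c.f2_f2
  case e3_e3 => simpa [gen, image, sq] using c.e3_e3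
  case e2_e2 => simpa [gen, image, sq] using c.e2_e2
  case f3_f3 => simpa [gen, image, sq] using c.f3_f3
  case e2_f2 => simpa [gbr, gen, image, Gen.odd] using c.e2_f2
  case e3_f3 => simpa [gbr, gen, image, Gen.odd] using c.e3_f3
  case e2_e3 => simpa [gbr, gen, image, Gen.odd] using c.e2_e3
  case f2_f3 => simpa [gbr, gen, image, Gen.odd] using c.f2_f3
  case f2_e3 => simpa [gbr, gen, image, Gen.odd] using c.f2_e3
  case f3_e2 => simpa [gbr, gen, image, Gen.odd] using c.f3_e2
  case e1_f1 => simpa [gbr, gen, image, Gen.odd] using c.e1_f1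
  case e1_f2 => simpa [gbr, gen, image, Gen.odd] using c.e1_f2
  case e1_e3 => simpa [gbr, gen, image, Gen.odd] using c.e1_e3
  case e2_f1 =>
    have := congrArg (fun x => -x) k14
    simpa only [gbr, gen, image, Gen.odd, map_sub, map_mul, FreeAlgebra.lift_ι_apply, neg_sub,
      neg_zero, map_zero, Bool.and_false, Bool.false_eq_true, if_false] using this
  case f3_f1 =>
    simp only [gbr, gen, image, Gen.odd, map_sub, map_mul, FreeAlgebra.lift_ι_apply,
      map_zero, Bool.and_false, Bool.false_eq_true, if_false]
    rw [← k15]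
    noncomm_ring
  all_goals
    simp only [gbr, gen, image, Gen.odd, map_sub, map_mul, map_neg, FreeAlgebra.lift_ι_apply,
      map_zero, map_smul, Bool.and_false, Bool.false_and, Bool.false_eq_true, if_false, hs, hs', hr,
      hr', k1, k2, k3, k4, k5, k6, k7, k8, k9, k10, k11, k12, k13, k16, k17, hn]
  all_goals try module

/-- The homomorphism from `U(sl(2|1))` given by a `Core`. -/
def lift : U →ₐ[ℂ] R := liftU (FreeAlgebra.lift ℂ (image e1 h1 f1 n e3 f2)) c.rel

theorem lift_u (x : Gen) : c.lift (u x) = image e1 h1 f1 n e3 f2 x := by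
  rw [lift, u, liftU_proj, gen, FreeAlgebra.lift_ι_apply]

end Core

/-- The grading element `h₂ + h₃`. -/
def un : U := u .h2 + u .h3

theorem rel_comm {x y : Gen} {w : FreeAlgebra ℂ Gen} (h : Rel (gbr x y) w)
    (hxy : (x.odd && y.odd) = false) : u x * u y - u y * u x = proj w := by
  have := proj_rel h
  rwa [gbr, hxy, if_neg (by simp), map_sub, map_mul, map_mul] at this

theorem rel_anticomm {x y : Gen} {w : FreeAlgebra ℂ Gen} (h : Rel (gbr x y) w)
    (hxy : (x.odd && y.odd) = true) : u x * u y + u y * u x = proj w := by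
  have := proj_rel h
  rwa [gbr, hxy, if_pos rfl, map_add, map_mul, map_mul] at this

/-! ## The super-Jordanian relations -/

theorem mul_assoc_of_eq {R : Type*} [Ring R] {a b r : R} (h : a * b = r) (x : R) :
    a * (b * x) = r * x := by
  rw [← mul_assoc, h]

/-- A minimal set of super-Jordanian relations, as straightening rules. -/
structure JCore {R : Type*} [Ring R] [Algebra ℂ R] (h T Tinv H1 F1 N E3 F2 E2 F3 : R) : Prop where
  h_comm : ∀ x, x * h = h * x
  T_Tinv : T * Tinv = 1
  Tinv_T : Tinv * T = 1
  H1_T : H1 * T = T * H1 + T * T - 1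
  F1_T : F1 * T = T * F1 - h * T * H1 - (1 / 2 : ℂ) • (h * T * T - h)
  F1_H1 : F1 * H1 = H1 * F1 + (T + Tinv) * F1 + (1 / 2 : ℂ) • (h * Tinv * H1 - h * T * H1) +
    (1 / 4 : ℂ) • (h * Tinv * Tinv - h * T * T)
  N_T : N * T = T * N
  H1_N : H1 * N = N * H1
  F1_N : F1 * N = N * F1
  N_E3 : N * E3 = E3 * N - E3
  N_F2 : N * F2 = F2 * N + F2
  H1_E3 : H1 * E3 = E3 * H1 + (1 / 2 : ℂ) • ((T + Tinv) * E3)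
  H1_F2 : H1 * F2 = F2 * H1 + (1 / 2 : ℂ) • ((T + Tinv) * F2)
  E3_T : E3 * T = T * E3
  F2_T : F2 * T = T * F2
  E3_E3 : E3 * E3 = 0
  F2_F2 : F2 * F2 = 0
  F2_E3 : h * (F2 * E3) = -(h * (E3 * F2)) + (1 / 2 : ℂ) • (T - Tinv)
  F1_E3 : F1 * E3 = E3 * F1 + E2
  F1_F2 : F1 * F2 = F2 * F1 - F3
  F1_E2 : F1 * E2 = E2 * F1 - ((1 / 4 : ℂ) • (h * (T - Tinv) * E2) +
    (1 / 2 : ℂ) • (h * (T - Tinv) * E3 * F1) - (1 / 4 : ℂ) • (h * h * E3 * H1 * H1) -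
    (3 / 8 : ℂ) • (h * h * (T + Tinv) * E3 * H1) - (1 / 2 : ℂ) • (h * h * E3) -
    (15 / 64 : ℂ) • (h * h * (T - Tinv) * (T - Tinv) * E3))
  F1_F3 : F1 * F3 = F3 * F1 - ((1 / 4 : ℂ) • (h * (T - Tinv) * F3) -
    (1 / 2 : ℂ) • (h * (T - Tinv) * F2 * F1) + (1 / 4 : ℂ) • (h * h * F2 * H1 * H1) +
    (3 / 8 : ℂ) • (h * h * (T + Tinv) * F2 * H1) + (1 / 2 : ℂ) • (h * h * F2) +
    (15 / 64 : ℂ) • (h * h * (T - Tinv) * (T - Tinv) * F2))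
  E2_F2 : E2 * F2 = -(F2 * E2) + (1 / 2 : ℂ) • N - (1 / 4 : ℂ) • ((T + Tinv) * H1) -
    (1 / 16 : ℂ) • ((T - Tinv) * (T - Tinv)) - (1 / 4 : ℂ) • (h * (T - Tinv) * E3 * F2)
  F3_E3 : F3 * E3 = -(E3 * F3) + (1 / 2 : ℂ) • N + (1 / 4 : ℂ) • ((T + Tinv) * H1) +
    (1 / 16 : ℂ) • ((T - Tinv) * (T - Tinv)) + (1 / 4 : ℂ) • (h * (T - Tinv) * F2 * E3)

namespace JCore

variable {R : Type*} [Ring R] [Algebra ℂ R] {h T Tinv H1 F1 N E3 F2 E2 F3 : R}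
  (c : JCore h T Tinv H1 F1 N E3 F2 E2 F3)

include c

theorem inv_rule {x y z : R} (hx : x * T = T * x + y) (hz : Tinv * y = z) :
    x * Tinv = Tinv * x - z * Tinv := by
  subst hz
  linear_combination (norm := skip) -(Tinv * hx * Tinv) + Tinv * x * c.T_Tinv - c.Tinv_T * x * Tinv
  noncomm_ring

theorem H1_Tinv : H1 * Tinv = Tinv * H1 + Tinv * Tinv - 1 := by
  rw [c.inv_rule (y := T * T - 1) (by rw [c.H1_T]; abel) rfl]
  simp only [mul_sub, sub_mul, mul_assoc, c.T_Tinv, mul_assoc_of_eq c.Tinv_T, one_mul, mul_one]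
  abel

theorem N_Tinv : N * Tinv = Tinv * N := by
  rw [c.inv_rule (y := 0) (by rw [c.N_T]; abel) rfl]; simp

theorem E3_Tinv : E3 * Tinv = Tinv * E3 := by
  rw [c.inv_rule (y := 0) (by rw [c.E3_T]; abel) rfl]; simp

theorem F2_Tinv : F2 * Tinv = Tinv * F2 := by
  rw [c.inv_rule (y := 0) (by rw [c.F2_T]; abel) rfl]; simp

theorem F1_Tinv : F1 * Tinv = Tinv * F1 + h * Tinv * H1 + (1 / 2 : ℂ) • (h * Tinv * Tinv - h) := by
  rw [c.inv_rule (y := - h * T * H1 - (1 / 2 : ℂ) • (h * T * T - h)) (by rw [c.F1_T]; noncomm_ring)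
    rfl]
  simp only [mul_add, add_mul, mul_sub, sub_mul, neg_mul, mul_neg, mul_assoc, smul_mul_assoc,
    mul_smul_comm, mul_one, one_mul, c.T_Tinv, c.Tinv_T, c.H1_Tinv, mul_assoc_of_eq c.Tinv_T,
    c.h_comm Tinv, mul_assoc_of_eq (c.h_comm Tinv)]
  module

/-- The symmetry `E₃ ↦ -F₂`, `F₂ ↦ -E₃`. -/
theorem symm : JCore h T Tinv H1 F1 (-N) (-F2) (-E3) F3 E2 where
  __ := c
  N_T := by simp [c.N_T]
  H1_N := by simp [c.H1_N]
  F1_N := by simp [c.F1_N]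
  N_E3 := by simp [c.N_F2, sub_eq_add_neg]
  N_F2 := by simp [c.N_E3]; abel
  H1_E3 := by simp [c.H1_F2]; abel
  H1_F2 := by simp [c.H1_E3]; abel
  E3_T := by simp [c.F2_T]
  F2_T := by simp [c.E3_T]
  E3_E3 := by simp [c.F2_F2]
  F2_F2 := by simp [c.E3_E3]
  F2_E3 := by
    simp only [neg_mul_neg]
    rw [c.F2_E3]; abel
  F1_E3 := by rw [mul_neg, neg_mul, c.F1_F2]; abel
  F1_F2 := by rw [mul_neg, neg_mul, c.F1_E3]; abel
  F1_E2 := by rw [c.F1_F3]; simp only [neg_mul, mul_neg]; module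
  F1_F3 := by rw [c.F1_E2]; simp only [neg_mul, mul_neg]; module
  E2_F2 := by
    simp only [neg_mul, mul_neg, c.F3_E3]
    module
  F3_E3 := by
    simp only [neg_mul, mul_neg, c.E2_F2]
    module

/-- The symmetry `h ↦ -h`, `T ↦ T⁻¹`. -/
theorem invert : JCore (-h) Tinv T H1 F1 N E3 F2 E2 F3 where
  __ := c
  h_comm x := by simp [c.h_comm]
  T_Tinv := c.Tinv_T
  Tinv_T := c.T_Tinv
  H1_T := c.H1_Tinv
  F1_T := by
    rw [c.F1_Tinv]; simp only [neg_mul, mul_neg]; module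
  F1_H1 := by rw [c.F1_H1]; simp only [neg_mul, mul_neg, add_mul]; module
  N_T := c.N_Tinv
  H1_E3 := by rw [c.H1_E3, add_comm T]
  H1_F2 := by rw [c.H1_F2, add_comm T]
  E3_T := c.E3_Tinv
  F2_T := c.F2_Tinv
  F2_E3 := by rw [neg_mul, c.F2_E3]; simp only [neg_mul]; module
  F1_E2 := by
    rw [c.F1_E2]; simp only [neg_mul, mul_neg, mul_sub, sub_mul, mul_add, add_mul, mul_assoc]; module
  F1_F3 := by
    rw [c.F1_F3]; simp only [neg_mul, mul_neg, mul_sub, sub_mul, mul_add, add_mul, mul_assoc]; module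
  E2_F2 := by
    rw [c.E2_F2]; simp only [neg_mul, mul_neg, mul_sub, sub_mul, mul_add, add_mul, mul_assoc]; module
  F3_E3 := by
    rw [c.F3_E3]; simp only [neg_mul, mul_neg, mul_sub, sub_mul, mul_add, add_mul, mul_assoc]; module

theorem E2_eq : E2 = F1 * E3 - E3 * F1 := by
  rw [c.F1_E3]; abel

theorem E2_T : E2 * T = T * E2 - (1 / 2 : ℂ) • (h * T * T * E3 + h * E3) := by
  linear_combination (norm := skip) F1 * c.E3_T - c.E3_T * F1
  simp only [mul_add, add_mul, mul_sub, sub_mul, neg_mul, mul_neg, mul_assoc, smul_mul_assoc,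
    mul_smul_comm, smul_add, smul_sub, smul_neg, mul_one, one_mul, mul_zero, zero_mul, smul_zero,
    add_zero, zero_add, sub_zero, zero_sub, neg_zero, neg_neg, sq, pow_succ, pow_zero, pow_one,
    c.T_Tinv, c.Tinv_T, c.H1_T, c.F1_T, c.F1_H1, c.N_T, c.H1_N, c.F1_N, c.N_E3, c.N_F2, c.H1_E3,
    c.H1_F2, c.F2_T, c.E3_E3, c.F2_F2, c.F1_E3, c.F1_F2, c.H1_Tinv, c.N_Tinv, c.E3_Tinv,
    c.F2_Tinv, c.F1_Tinv, c.h_comm T, c.h_comm Tinv, c.h_comm H1, c.h_comm F1, c.h_comm N,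
    c.h_comm E3, c.h_comm F2, c.h_comm E2, c.h_comm F3, mul_assoc_of_eq c.T_Tinv, mul_assoc_of_eq
    c.Tinv_T, mul_assoc_of_eq c.H1_T, mul_assoc_of_eq c.F1_T, mul_assoc_of_eq c.F1_H1,
    mul_assoc_of_eq c.N_T, mul_assoc_of_eq c.H1_N, mul_assoc_of_eq c.F1_N, mul_assoc_of_eq c.N_E3,
    mul_assoc_of_eq c.N_F2, mul_assoc_of_eq c.H1_E3, mul_assoc_of_eq c.H1_F2, mul_assoc_of_eq
    c.F2_T, mul_assoc_of_eq c.E3_E3, mul_assoc_of_eq c.F2_F2, mul_assoc_of_eq c.F1_E3,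
    mul_assoc_of_eq c.F1_F2, mul_assoc_of_eq c.H1_Tinv, mul_assoc_of_eq c.N_Tinv, mul_assoc_of_eq
    c.E3_Tinv, mul_assoc_of_eq c.F2_Tinv, mul_assoc_of_eq c.F1_Tinv, mul_assoc_of_eq (c.h_comm T),
    mul_assoc_of_eq (c.h_comm Tinv), mul_assoc_of_eq (c.h_comm H1), mul_assoc_of_eq (c.h_comm F1),
    mul_assoc_of_eq (c.h_comm N), mul_assoc_of_eq (c.h_comm E3), mul_assoc_of_eq (c.h_comm F2),
    mul_assoc_of_eq (c.h_comm E2), mul_assoc_of_eq (c.h_comm F3)]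
  simp only [mul_add, add_mul, mul_sub, sub_mul, neg_mul, mul_neg, mul_assoc, smul_mul_assoc,
    mul_smul_comm, smul_add, smul_sub, smul_neg, mul_one, one_mul, mul_zero, zero_mul, smul_zero,
    add_zero, zero_add, sub_zero, zero_sub, neg_zero, neg_neg, sq, pow_succ, pow_zero, pow_one,
    c.T_Tinv, c.Tinv_T, c.H1_T, c.F1_T, c.F1_H1, c.N_T, c.H1_N, c.F1_N, c.N_E3, c.N_F2, c.H1_E3,
    c.H1_F2, c.E3_T, c.F2_T, c.E3_E3, c.F2_F2, c.F1_E3, c.F1_F2, c.H1_Tinv, c.N_Tinv, c.E3_Tinv,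
    c.F2_Tinv, c.F1_Tinv, c.h_comm T, c.h_comm Tinv, c.h_comm H1, c.h_comm F1, c.h_comm N,
    c.h_comm E3, c.h_comm F2, c.h_comm E2, c.h_comm F3, mul_assoc_of_eq c.T_Tinv, mul_assoc_of_eq
    c.Tinv_T, mul_assoc_of_eq c.H1_T, mul_assoc_of_eq c.F1_T, mul_assoc_of_eq c.F1_H1,
    mul_assoc_of_eq c.N_T, mul_assoc_of_eq c.H1_N, mul_assoc_of_eq c.F1_N, mul_assoc_of_eq c.N_E3,
    mul_assoc_of_eq c.N_F2, mul_assoc_of_eq c.H1_E3, mul_assoc_of_eq c.H1_F2, mul_assoc_of_eq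
    c.E3_T, mul_assoc_of_eq c.F2_T, mul_assoc_of_eq c.E3_E3, mul_assoc_of_eq c.F2_F2,
    mul_assoc_of_eq c.F1_E3, mul_assoc_of_eq c.F1_F2, mul_assoc_of_eq c.H1_Tinv, mul_assoc_of_eq
    c.N_Tinv, mul_assoc_of_eq c.E3_Tinv, mul_assoc_of_eq c.F2_Tinv, mul_assoc_of_eq c.F1_Tinv,
    mul_assoc_of_eq (c.h_comm T), mul_assoc_of_eq (c.h_comm Tinv), mul_assoc_of_eq (c.h_comm H1),
    mul_assoc_of_eq (c.h_comm F1), mul_assoc_of_eq (c.h_comm N), mul_assoc_of_eq (c.h_comm E3),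
    mul_assoc_of_eq (c.h_comm F2), mul_assoc_of_eq (c.h_comm E2), mul_assoc_of_eq (c.h_comm F3)]
  module

theorem E2_Tinv : E2 * Tinv = Tinv * E2 + (1 / 2 : ℂ) • (h * Tinv * Tinv * E3 + h * E3) := by
  rw [c.invert.E2_T]
  simp only [neg_mul]
  module

theorem F3_T : F3 * T = T * F3 + (1 / 2 : ℂ) • (h * T * T * F2 + h * F2) := by
  rw [c.symm.E2_T]
  simp only [mul_neg]
  module

theorem F3_Tinv : F3 * Tinv = Tinv * F3 - (1 / 2 : ℂ) • (h * Tinv * Tinv * F2 + h * F2) := by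
  rw [c.symm.E2_Tinv]
  simp only [mul_neg]
  module

theorem N_E2 : N * E2 = E2 * N - E2 := by
  linear_combination (norm := skip) F1 * c.N_E3 - c.N_E3 * F1
  simp only [mul_add, add_mul, mul_sub, sub_mul, neg_mul, mul_neg, mul_assoc, smul_mul_assoc,
    mul_smul_comm, smul_add, smul_sub, smul_neg, mul_one, one_mul, mul_zero, zero_mul, smul_zero,
    add_zero, zero_add, sub_zero, zero_sub, neg_zero, neg_neg, sq, pow_succ, pow_zero, pow_one,
    c.T_Tinv, c.Tinv_T, c.H1_T, c.F1_T, c.F1_H1, c.N_T, c.H1_N, c.F1_N, c.N_F2, c.H1_E3, c.H1_F2,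
    c.E3_T, c.F2_T, c.E3_E3, c.F2_F2, c.F1_E3, c.F1_F2, c.H1_Tinv, c.N_Tinv, c.E3_Tinv, c.F2_Tinv,
    c.F1_Tinv, c.h_comm T, c.h_comm Tinv, c.h_comm H1, c.h_comm F1, c.h_comm N, c.h_comm E3,
    c.h_comm F2, c.h_comm E2, c.h_comm F3, mul_assoc_of_eq c.T_Tinv, mul_assoc_of_eq c.Tinv_T,
    mul_assoc_of_eq c.H1_T, mul_assoc_of_eq c.F1_T, mul_assoc_of_eq c.F1_H1, mul_assoc_of_eq
    c.N_T, mul_assoc_of_eq c.H1_N, mul_assoc_of_eq c.F1_N, mul_assoc_of_eq c.N_F2, mul_assoc_of_eq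
    c.H1_E3, mul_assoc_of_eq c.H1_F2, mul_assoc_of_eq c.E3_T, mul_assoc_of_eq c.F2_T,
    mul_assoc_of_eq c.E3_E3, mul_assoc_of_eq c.F2_F2, mul_assoc_of_eq c.F1_E3, mul_assoc_of_eq
    c.F1_F2, mul_assoc_of_eq c.H1_Tinv, mul_assoc_of_eq c.N_Tinv, mul_assoc_of_eq c.E3_Tinv,
    mul_assoc_of_eq c.F2_Tinv, mul_assoc_of_eq c.F1_Tinv, mul_assoc_of_eq (c.h_comm T),
    mul_assoc_of_eq (c.h_comm Tinv), mul_assoc_of_eq (c.h_comm H1), mul_assoc_of_eq (c.h_comm F1),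
    mul_assoc_of_eq (c.h_comm N), mul_assoc_of_eq (c.h_comm E3), mul_assoc_of_eq (c.h_comm F2),
    mul_assoc_of_eq (c.h_comm E2), mul_assoc_of_eq (c.h_comm F3)]
  simp only [mul_add, add_mul, mul_sub, sub_mul, neg_mul, mul_neg, mul_assoc, smul_mul_assoc,
    mul_smul_comm, smul_add, smul_sub, smul_neg, mul_one, one_mul, mul_zero, zero_mul, smul_zero,
    add_zero, zero_add, sub_zero, zero_sub, neg_zero, neg_neg, sq, pow_succ, pow_zero, pow_one,
    c.T_Tinv, c.Tinv_T, c.H1_T, c.F1_T, c.F1_H1, c.N_T, c.H1_N, c.F1_N, c.N_E3, c.N_F2, c.H1_E3,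
    c.H1_F2, c.E3_T, c.F2_T, c.E3_E3, c.F2_F2, c.F1_E3, c.F1_F2, c.H1_Tinv, c.N_Tinv, c.E3_Tinv,
    c.F2_Tinv, c.F1_Tinv, c.h_comm T, c.h_comm Tinv, c.h_comm H1, c.h_comm F1, c.h_comm N,
    c.h_comm E3, c.h_comm F2, c.h_comm E2, c.h_comm F3, mul_assoc_of_eq c.T_Tinv, mul_assoc_of_eq
    c.Tinv_T, mul_assoc_of_eq c.H1_T, mul_assoc_of_eq c.F1_T, mul_assoc_of_eq c.F1_H1,
    mul_assoc_of_eq c.N_T, mul_assoc_of_eq c.H1_N, mul_assoc_of_eq c.F1_N, mul_assoc_of_eq c.N_E3,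
    mul_assoc_of_eq c.N_F2, mul_assoc_of_eq c.H1_E3, mul_assoc_of_eq c.H1_F2, mul_assoc_of_eq
    c.E3_T, mul_assoc_of_eq c.F2_T, mul_assoc_of_eq c.E3_E3, mul_assoc_of_eq c.F2_F2,
    mul_assoc_of_eq c.F1_E3, mul_assoc_of_eq c.F1_F2, mul_assoc_of_eq c.H1_Tinv, mul_assoc_of_eq
    c.N_Tinv, mul_assoc_of_eq c.E3_Tinv, mul_assoc_of_eq c.F2_Tinv, mul_assoc_of_eq c.F1_Tinv,
    mul_assoc_of_eq (c.h_comm T), mul_assoc_of_eq (c.h_comm Tinv), mul_assoc_of_eq (c.h_comm H1),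
    mul_assoc_of_eq (c.h_comm F1), mul_assoc_of_eq (c.h_comm N), mul_assoc_of_eq (c.h_comm E3),
    mul_assoc_of_eq (c.h_comm F2), mul_assoc_of_eq (c.h_comm E2), mul_assoc_of_eq (c.h_comm F3)]
  module

theorem N_F3 : N * F3 = F3 * N + F3 := by
  have := c.symm.N_E2
  rw [neg_mul, mul_neg] at this
  rw [← neg_inj, this]; abel

theorem H1_E2 : H1 * E2 = E2 * H1 - (1 / 2 : ℂ) • (E2 * T + E2 * Tinv) -
    (1 / 4 : ℂ) • (h * (H1 * (T - Tinv) + (T - Tinv) * H1) * E3) := by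
  linear_combination (norm := skip) F1 * c.H1_E3 - c.H1_E3 * F1
  simp only [mul_add, add_mul, mul_sub, sub_mul, neg_mul, mul_neg, mul_assoc, smul_mul_assoc,
    mul_smul_comm, smul_add, smul_sub, smul_neg, mul_one, one_mul, mul_zero, zero_mul, smul_zero,
    add_zero, zero_add, sub_zero, zero_sub, neg_zero, neg_neg, sq, pow_succ, pow_zero, pow_one,
    c.T_Tinv, c.Tinv_T, c.H1_T, c.F1_T, c.F1_H1, c.N_T, c.H1_N, c.F1_N, c.N_E3, c.N_F2, c.H1_F2,
    c.E3_T, c.F2_T, c.E3_E3, c.F2_F2, c.F1_E3, c.F1_F2, c.H1_Tinv, c.N_Tinv, c.E3_Tinv, c.F2_Tinv,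
    c.F1_Tinv, c.h_comm T, c.h_comm Tinv, c.h_comm H1, c.h_comm F1, c.h_comm N, c.h_comm E3,
    c.h_comm F2, c.h_comm E2, c.h_comm F3, c.E2_T, c.E2_Tinv, mul_assoc_of_eq c.T_Tinv,
    mul_assoc_of_eq c.Tinv_T, mul_assoc_of_eq c.H1_T, mul_assoc_of_eq c.F1_T, mul_assoc_of_eq
    c.F1_H1, mul_assoc_of_eq c.N_T, mul_assoc_of_eq c.H1_N, mul_assoc_of_eq c.F1_N,
    mul_assoc_of_eq c.N_E3, mul_assoc_of_eq c.N_F2, mul_assoc_of_eq c.H1_F2, mul_assoc_of_eq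
    c.E3_T, mul_assoc_of_eq c.F2_T, mul_assoc_of_eq c.E3_E3, mul_assoc_of_eq c.F2_F2,
    mul_assoc_of_eq c.F1_E3, mul_assoc_of_eq c.F1_F2, mul_assoc_of_eq c.H1_Tinv, mul_assoc_of_eq
    c.N_Tinv, mul_assoc_of_eq c.E3_Tinv, mul_assoc_of_eq c.F2_Tinv, mul_assoc_of_eq c.F1_Tinv,
    mul_assoc_of_eq (c.h_comm T), mul_assoc_of_eq (c.h_comm Tinv), mul_assoc_of_eq (c.h_comm H1),
    mul_assoc_of_eq (c.h_comm F1), mul_assoc_of_eq (c.h_comm N), mul_assoc_of_eq (c.h_comm E3),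
    mul_assoc_of_eq (c.h_comm F2), mul_assoc_of_eq (c.h_comm E2), mul_assoc_of_eq (c.h_comm F3),
    mul_assoc_of_eq c.E2_T, mul_assoc_of_eq c.E2_Tinv]
  simp only [mul_add, add_mul, mul_sub, sub_mul, neg_mul, mul_neg, mul_assoc, smul_mul_assoc,
    mul_smul_comm, smul_add, smul_sub, smul_neg, mul_one, one_mul, mul_zero, zero_mul, smul_zero,
    add_zero, zero_add, sub_zero, zero_sub, neg_zero, neg_neg, sq, pow_succ, pow_zero, pow_one,
    c.T_Tinv, c.Tinv_T, c.H1_T, c.F1_T, c.F1_H1, c.N_T, c.H1_N, c.F1_N, c.N_E3, c.N_F2, c.H1_E3,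
    c.H1_F2, c.E3_T, c.F2_T, c.E3_E3, c.F2_F2, c.F1_E3, c.F1_F2, c.H1_Tinv, c.N_Tinv, c.E3_Tinv,
    c.F2_Tinv, c.F1_Tinv, c.h_comm T, c.h_comm Tinv, c.h_comm H1, c.h_comm F1, c.h_comm N,
    c.h_comm E3, c.h_comm F2, c.h_comm E2, c.h_comm F3, c.E2_T, c.E2_Tinv, mul_assoc_of_eq
    c.T_Tinv, mul_assoc_of_eq c.Tinv_T, mul_assoc_of_eq c.H1_T, mul_assoc_of_eq c.F1_T,
    mul_assoc_of_eq c.F1_H1, mul_assoc_of_eq c.N_T, mul_assoc_of_eq c.H1_N, mul_assoc_of_eq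
    c.F1_N, mul_assoc_of_eq c.N_E3, mul_assoc_of_eq c.N_F2, mul_assoc_of_eq c.H1_E3,
    mul_assoc_of_eq c.H1_F2, mul_assoc_of_eq c.E3_T, mul_assoc_of_eq c.F2_T, mul_assoc_of_eq
    c.E3_E3, mul_assoc_of_eq c.F2_F2, mul_assoc_of_eq c.F1_E3, mul_assoc_of_eq c.F1_F2,
    mul_assoc_of_eq c.H1_Tinv, mul_assoc_of_eq c.N_Tinv, mul_assoc_of_eq c.E3_Tinv,
    mul_assoc_of_eq c.F2_Tinv, mul_assoc_of_eq c.F1_Tinv, mul_assoc_of_eq (c.h_comm T),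
    mul_assoc_of_eq (c.h_comm Tinv), mul_assoc_of_eq (c.h_comm H1), mul_assoc_of_eq (c.h_comm F1),
    mul_assoc_of_eq (c.h_comm N), mul_assoc_of_eq (c.h_comm E3), mul_assoc_of_eq (c.h_comm F2),
    mul_assoc_of_eq (c.h_comm E2), mul_assoc_of_eq (c.h_comm F3), mul_assoc_of_eq c.E2_T,
    mul_assoc_of_eq c.E2_Tinv]
  module

theorem E2_E3 : E2 * E3 = -(E3 * E2) := by
  rw [c.E2_eq]
  linear_combination (norm := noncomm_ring) F1 * c.E3_E3 - c.E3_E3 * F1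

theorem H1_F3 : H1 * F3 = F3 * H1 - (1 / 2 : ℂ) • (F3 * T + F3 * Tinv) +
    (1 / 4 : ℂ) • (h * (H1 * (T - Tinv) + (T - Tinv) * H1) * F2) := by
  rw [c.symm.H1_E2, mul_neg]
  module

theorem F3_F2 : F3 * F2 = -(F2 * F3) := by
  have := c.symm.E2_E3
  rw [neg_mul, mul_neg, neg_neg] at this
  rw [← this, neg_neg]

theorem E2_E2 : E2 * E2 = (1 / 4 : ℂ) • (h * (T - Tinv) * E3 * E2) := by
  linear_combination (norm := skip) (1 / 2 : ℂ) • (F1 * c.E2_E3 - c.E2_E3 * F1)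
  simp only [mul_add, add_mul, mul_sub, sub_mul, neg_mul, mul_neg, mul_assoc, smul_mul_assoc,
    mul_smul_comm, smul_add, smul_sub, smul_neg, mul_one, one_mul, mul_zero, zero_mul, smul_zero,
    add_zero, zero_add, sub_zero, zero_sub, neg_zero, neg_neg, sq, pow_succ, pow_zero, pow_one,
    c.T_Tinv, c.Tinv_T, c.H1_T, c.F1_T, c.F1_H1, c.N_T, c.H1_N, c.F1_N, c.N_E3, c.N_F2, c.H1_E3,
    c.H1_F2, c.E3_T, c.F2_T, c.E3_E3, c.F2_F2, c.F1_E3, c.F1_F2, c.H1_Tinv, c.N_Tinv, c.E3_Tinv,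
    c.F2_Tinv, c.F1_Tinv, c.H1_E2, c.N_E2, c.N_F3, c.E2_T, c.E2_Tinv, c.F3_T, c.F3_Tinv, c.F1_E2,
    c.F1_F3, c.h_comm T, c.h_comm Tinv, c.h_comm H1, c.h_comm F1, c.h_comm N, c.h_comm E3,
    c.h_comm F2, c.h_comm E2, c.h_comm F3, mul_assoc_of_eq c.T_Tinv, mul_assoc_of_eq c.Tinv_T,
    mul_assoc_of_eq c.H1_T, mul_assoc_of_eq c.F1_T, mul_assoc_of_eq c.F1_H1, mul_assoc_of_eq
    c.N_T, mul_assoc_of_eq c.H1_N, mul_assoc_of_eq c.F1_N, mul_assoc_of_eq c.N_E3, mul_assoc_of_eq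
    c.N_F2, mul_assoc_of_eq c.H1_E3, mul_assoc_of_eq c.H1_F2, mul_assoc_of_eq c.E3_T,
    mul_assoc_of_eq c.F2_T, mul_assoc_of_eq c.E3_E3, mul_assoc_of_eq c.F2_F2, mul_assoc_of_eq
    c.F1_E3, mul_assoc_of_eq c.F1_F2, mul_assoc_of_eq c.H1_Tinv, mul_assoc_of_eq c.N_Tinv,
    mul_assoc_of_eq c.E3_Tinv, mul_assoc_of_eq c.F2_Tinv, mul_assoc_of_eq c.F1_Tinv,
    mul_assoc_of_eq c.H1_E2, mul_assoc_of_eq c.N_E2, mul_assoc_of_eq c.N_F3, mul_assoc_of_eq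
    c.E2_T, mul_assoc_of_eq c.E2_Tinv, mul_assoc_of_eq c.F3_T, mul_assoc_of_eq c.F3_Tinv,
    mul_assoc_of_eq c.F1_E2, mul_assoc_of_eq c.F1_F3, mul_assoc_of_eq (c.h_comm T),
    mul_assoc_of_eq (c.h_comm Tinv), mul_assoc_of_eq (c.h_comm H1), mul_assoc_of_eq (c.h_comm F1),
    mul_assoc_of_eq (c.h_comm N), mul_assoc_of_eq (c.h_comm E3), mul_assoc_of_eq (c.h_comm F2),
    mul_assoc_of_eq (c.h_comm E2), mul_assoc_of_eq (c.h_comm F3)]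
  simp only [mul_add, add_mul, mul_sub, sub_mul, neg_mul, mul_neg, mul_assoc, smul_mul_assoc,
    mul_smul_comm, smul_add, smul_sub, smul_neg, mul_one, one_mul, mul_zero, zero_mul, smul_zero,
    add_zero, zero_add, sub_zero, zero_sub, neg_zero, neg_neg, sq, pow_succ, pow_zero, pow_one,
    c.T_Tinv, c.Tinv_T, c.H1_T, c.F1_T, c.F1_H1, c.N_T, c.H1_N, c.F1_N, c.N_E3, c.N_F2, c.H1_E3,
    c.H1_F2, c.E3_T, c.F2_T, c.E3_E3, c.F2_F2, c.F1_E3, c.F1_F2, c.H1_Tinv, c.N_Tinv, c.E3_Tinv,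
    c.F2_Tinv, c.F1_Tinv, c.H1_E2, c.N_E2, c.N_F3, c.E2_T, c.E2_Tinv, c.F3_T, c.F3_Tinv, c.F1_E2,
    c.F1_F3, c.h_comm T, c.h_comm Tinv, c.h_comm H1, c.h_comm F1, c.h_comm N, c.h_comm E3,
    c.h_comm F2, c.h_comm E2, c.h_comm F3, c.E2_E3, mul_assoc_of_eq c.T_Tinv, mul_assoc_of_eq
    c.Tinv_T, mul_assoc_of_eq c.H1_T, mul_assoc_of_eq c.F1_T, mul_assoc_of_eq c.F1_H1,
    mul_assoc_of_eq c.N_T, mul_assoc_of_eq c.H1_N, mul_assoc_of_eq c.F1_N, mul_assoc_of_eq c.N_E3,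
    mul_assoc_of_eq c.N_F2, mul_assoc_of_eq c.H1_E3, mul_assoc_of_eq c.H1_F2, mul_assoc_of_eq
    c.E3_T, mul_assoc_of_eq c.F2_T, mul_assoc_of_eq c.E3_E3, mul_assoc_of_eq c.F2_F2,
    mul_assoc_of_eq c.F1_E3, mul_assoc_of_eq c.F1_F2, mul_assoc_of_eq c.H1_Tinv, mul_assoc_of_eq
    c.N_Tinv, mul_assoc_of_eq c.E3_Tinv, mul_assoc_of_eq c.F2_Tinv, mul_assoc_of_eq c.F1_Tinv,
    mul_assoc_of_eq c.H1_E2, mul_assoc_of_eq c.N_E2, mul_assoc_of_eq c.N_F3, mul_assoc_of_eq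
    c.E2_T, mul_assoc_of_eq c.E2_Tinv, mul_assoc_of_eq c.F3_T, mul_assoc_of_eq c.F3_Tinv,
    mul_assoc_of_eq c.F1_E2, mul_assoc_of_eq c.F1_F3, mul_assoc_of_eq (c.h_comm T),
    mul_assoc_of_eq (c.h_comm Tinv), mul_assoc_of_eq (c.h_comm H1), mul_assoc_of_eq (c.h_comm F1),
    mul_assoc_of_eq (c.h_comm N), mul_assoc_of_eq (c.h_comm E3), mul_assoc_of_eq (c.h_comm F2),
    mul_assoc_of_eq (c.h_comm E2), mul_assoc_of_eq (c.h_comm F3), mul_assoc_of_eq c.E2_E3]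
  module

theorem F3_F3 : F3 * F3 = -((1 / 4 : ℂ) • (h * (T - Tinv) * F2 * F3)) := by
  rw [c.symm.E2_E2, mul_neg, neg_mul, smul_neg]

set_option maxHeartbeats 1000000 in
theorem F3_E2 : F3 * E2 = -(E2 * F3) + F1 - (1 / 4 : ℂ) • (h * (T - Tinv) * F2 * E2) +
    (1 / 4 : ℂ) • (h * (T - Tinv) * E3 * F3) - (1 / 8 : ℂ) • (h * (T - Tinv) * H1 ^ 2) -
    (1 / 8 : ℂ) • (h * (T ^ 2 - Tinv ^ 2) * H1) - (1 / 16 : ℂ) • (h * H1 * (T ^ 2 - Tinv ^ 2)) +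
    (7 / 128 : ℂ) • (h * (T - Tinv) ^ 3) := by
  obtain ⟨e, hF⟩ : ∃ e, F2 * E3 = -(E3 * F2) + e := ⟨F2 * E3 + E3 * F2, by abel⟩
  have hFe : e = F2 * E3 + E3 * F2 := by rw [hF]; abel
  have he : h * e = (1 / 2 : ℂ) • (T - Tinv) := by rw [hFe, mul_add, c.F2_E3]; abel
  have heT : T * e = e * T := by
    rw [hFe, mul_add, add_mul, mul_assoc, mul_assoc, c.E3_T, c.F2_T, ← mul_assoc, ← mul_assoc,
      ← mul_assoc, ← mul_assoc, c.E3_T, c.F2_T]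
  have heTi : Tinv * e = e * Tinv := by
    rw [hFe, mul_add, add_mul, mul_assoc, mul_assoc, c.E3_Tinv, c.F2_Tinv, ← mul_assoc, ← mul_assoc,
      ← mul_assoc, ← mul_assoc, c.E3_Tinv, c.F2_Tinv]
  have heE : E3 * e = e * E3 := by
    simp only [hFe, mul_add, add_mul, mul_assoc, c.E3_E3, mul_assoc_of_eq c.E3_E3, mul_zero, zero_mul]
    abel
  have heF : F2 * e = e * F2 := by
    simp only [hFe, mul_add, add_mul, mul_assoc, c.F2_F2, mul_assoc_of_eq c.F2_F2, mul_zero, zero_mul]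
    abel
  linear_combination (norm := skip) c.E2_F2 * F1 - F1 * c.E2_F2
  simp only [mul_add, add_mul, mul_sub, sub_mul, neg_mul, mul_neg, mul_assoc, smul_mul_assoc,
    mul_smul_comm, smul_add, smul_sub, smul_neg, mul_one, one_mul, mul_zero, zero_mul, smul_zero,
    add_zero, zero_add, sub_zero, zero_sub, neg_zero, neg_neg, sq, pow_succ, pow_zero, pow_one,
    c.T_Tinv, c.Tinv_T, c.H1_T, c.F1_T, c.F1_H1, c.N_T, c.H1_N, c.F1_N, c.N_E3, c.N_F2, c.H1_E3,
    c.H1_F2, c.E3_T, c.F2_T, c.E3_E3, c.F2_F2, c.F1_E3, c.F1_F2, c.H1_Tinv, c.N_Tinv, c.E3_Tinv,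
    c.F2_Tinv, c.F1_Tinv, c.H1_E2, c.N_E2, c.N_F3, c.E2_T, c.E2_Tinv, c.F3_T, c.F3_Tinv, c.F1_E2,
    c.F1_F3, c.H1_F3, c.E2_E3, c.F3_F2, c.E2_E2, c.F3_F3, c.F3_E3, c.h_comm T, c.h_comm Tinv,
    c.h_comm H1, c.h_comm F1, c.h_comm N, c.h_comm E3, c.h_comm F2, c.h_comm E2, c.h_comm F3,
    mul_assoc_of_eq c.T_Tinv, mul_assoc_of_eq c.Tinv_T, mul_assoc_of_eq c.H1_T, mul_assoc_of_eq
    c.F1_T, mul_assoc_of_eq c.F1_H1, mul_assoc_of_eq c.N_T, mul_assoc_of_eq c.H1_N,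
    mul_assoc_of_eq c.F1_N, mul_assoc_of_eq c.N_E3, mul_assoc_of_eq c.N_F2, mul_assoc_of_eq
    c.H1_E3, mul_assoc_of_eq c.H1_F2, mul_assoc_of_eq c.E3_T, mul_assoc_of_eq c.F2_T,
    mul_assoc_of_eq c.E3_E3, mul_assoc_of_eq c.F2_F2, mul_assoc_of_eq c.F1_E3, mul_assoc_of_eq
    c.F1_F2, mul_assoc_of_eq c.H1_Tinv, mul_assoc_of_eq c.N_Tinv, mul_assoc_of_eq c.E3_Tinv,
    mul_assoc_of_eq c.F2_Tinv, mul_assoc_of_eq c.F1_Tinv, mul_assoc_of_eq c.H1_E2, mul_assoc_of_eq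
    c.N_E2, mul_assoc_of_eq c.N_F3, mul_assoc_of_eq c.E2_T, mul_assoc_of_eq c.E2_Tinv,
    mul_assoc_of_eq c.F3_T, mul_assoc_of_eq c.F3_Tinv, mul_assoc_of_eq c.F1_E2, mul_assoc_of_eq
    c.F1_F3, mul_assoc_of_eq c.H1_F3, mul_assoc_of_eq c.E2_E3, mul_assoc_of_eq c.F3_F2,
    mul_assoc_of_eq c.E2_E2, mul_assoc_of_eq c.F3_F3, mul_assoc_of_eq c.F3_E3, mul_assoc_of_eq
    (c.h_comm T), mul_assoc_of_eq (c.h_comm Tinv), mul_assoc_of_eq (c.h_comm H1), mul_assoc_of_eq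
    (c.h_comm F1), mul_assoc_of_eq (c.h_comm N), mul_assoc_of_eq (c.h_comm E3), mul_assoc_of_eq
    (c.h_comm F2), mul_assoc_of_eq (c.h_comm E2), mul_assoc_of_eq (c.h_comm F3)]
  simp only [mul_add, add_mul, mul_sub, sub_mul, neg_mul, mul_neg, mul_assoc, smul_mul_assoc,
    mul_smul_comm, smul_add, smul_sub, smul_neg, mul_one, one_mul, mul_zero, zero_mul, smul_zero,
    add_zero, zero_add, sub_zero, zero_sub, neg_zero, neg_neg, sq, pow_succ, pow_zero, pow_one,
    c.T_Tinv, c.Tinv_T, c.H1_T, c.F1_T, c.F1_H1, c.N_T, c.H1_N, c.F1_N, c.N_E3, c.N_F2, c.H1_E3,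
    c.H1_F2, c.E3_T, c.F2_T, c.E3_E3, c.F2_F2, c.F1_E3, c.F1_F2, c.H1_Tinv, c.N_Tinv, c.E3_Tinv,
    c.F2_Tinv, c.F1_Tinv, c.H1_E2, c.N_E2, c.N_F3, c.E2_T, c.E2_Tinv, c.F3_T, c.F3_Tinv, c.F1_E2,
    c.F1_F3, c.H1_F3, c.E2_E3, c.F3_F2, c.E2_E2, c.F3_F3, c.F3_E3, c.E2_F2, c.h_comm T, c.h_comm
    Tinv, c.h_comm H1, c.h_comm F1, c.h_comm N, c.h_comm E3, c.h_comm F2, c.h_comm E2, c.h_comm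
    F3, c.h_comm e, hF, he, heT, heTi, heE, heF, mul_assoc_of_eq c.T_Tinv, mul_assoc_of_eq
    c.Tinv_T, mul_assoc_of_eq c.H1_T, mul_assoc_of_eq c.F1_T, mul_assoc_of_eq c.F1_H1,
    mul_assoc_of_eq c.N_T, mul_assoc_of_eq c.H1_N, mul_assoc_of_eq c.F1_N, mul_assoc_of_eq c.N_E3,
    mul_assoc_of_eq c.N_F2, mul_assoc_of_eq c.H1_E3, mul_assoc_of_eq c.H1_F2, mul_assoc_of_eq
    c.E3_T, mul_assoc_of_eq c.F2_T, mul_assoc_of_eq c.E3_E3, mul_assoc_of_eq c.F2_F2,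
    mul_assoc_of_eq c.F1_E3, mul_assoc_of_eq c.F1_F2, mul_assoc_of_eq c.H1_Tinv, mul_assoc_of_eq
    c.N_Tinv, mul_assoc_of_eq c.E3_Tinv, mul_assoc_of_eq c.F2_Tinv, mul_assoc_of_eq c.F1_Tinv,
    mul_assoc_of_eq c.H1_E2, mul_assoc_of_eq c.N_E2, mul_assoc_of_eq c.N_F3, mul_assoc_of_eq
    c.E2_T, mul_assoc_of_eq c.E2_Tinv, mul_assoc_of_eq c.F3_T, mul_assoc_of_eq c.F3_Tinv,
    mul_assoc_of_eq c.F1_E2, mul_assoc_of_eq c.F1_F3, mul_assoc_of_eq c.H1_F3, mul_assoc_of_eq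
    c.E2_E3, mul_assoc_of_eq c.F3_F2, mul_assoc_of_eq c.E2_E2, mul_assoc_of_eq c.F3_F3,
    mul_assoc_of_eq c.F3_E3, mul_assoc_of_eq c.E2_F2, mul_assoc_of_eq (c.h_comm T),
    mul_assoc_of_eq (c.h_comm Tinv), mul_assoc_of_eq (c.h_comm H1), mul_assoc_of_eq (c.h_comm F1),
    mul_assoc_of_eq (c.h_comm N), mul_assoc_of_eq (c.h_comm E3), mul_assoc_of_eq (c.h_comm F2),
    mul_assoc_of_eq (c.h_comm E2), mul_assoc_of_eq (c.h_comm F3), mul_assoc_of_eq (c.h_comm e),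
    mul_assoc_of_eq hF, mul_assoc_of_eq he, mul_assoc_of_eq heT, mul_assoc_of_eq heTi,
    mul_assoc_of_eq heE, mul_assoc_of_eq heF]
  module

set_option maxHeartbeats 4000000 in
theorem deformed : DeformedRelations h
    { H1 := H1, T := T, Tinv := Tinv, F1 := F1, E2 := E2, F2 := F2, E3 := E3, F3 := F3
      H2 := (1 / 2 : ℂ) • N - (1 / 4 : ℂ) • ((T + Tinv) * H1)
      H3 := (1 / 2 : ℂ) • N + (1 / 4 : ℂ) • ((T + Tinv) * H1) } := by
  obtain ⟨e, hF⟩ : ∃ e, F2 * E3 = -(E3 * F2) + e := ⟨F2 * E3 + E3 * F2, by abel⟩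
  have hFe : e = F2 * E3 + E3 * F2 := by rw [hF]; abel
  have he : h * e = (1 / 2 : ℂ) • (T - Tinv) := by rw [hFe, mul_add, c.F2_E3]; abel
  have heT : T * e = e * T := by
    rw [hFe, mul_add, add_mul, mul_assoc, mul_assoc, c.E3_T, c.F2_T, ← mul_assoc, ← mul_assoc,
      ← mul_assoc, ← mul_assoc, c.E3_T, c.F2_T]
  have heTi : Tinv * e = e * Tinv := by
    rw [hFe, mul_add, add_mul, mul_assoc, mul_assoc, c.E3_Tinv, c.F2_Tinv, ← mul_assoc, ← mul_assoc,
      ← mul_assoc, ← mul_assoc, c.E3_Tinv, c.F2_Tinv]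
  have heE : E3 * e = e * E3 := by
    simp only [hFe, mul_add, add_mul, mul_assoc, c.E3_E3, mul_assoc_of_eq c.E3_E3, mul_zero, zero_mul]
    abel
  have heF : F2 * e = e * F2 := by
    simp only [hFe, mul_add, add_mul, mul_assoc, c.F2_F2, mul_assoc_of_eq c.F2_F2, mul_zero, zero_mul]
    abel
  have six : ∀ x : R, 6 * x = (6 : ℂ) • x := fun x => by
    rw [Algebra.smul_def, map_ofNat]
  constructor
  case T_Tinv => exact c.T_Tinv
  case Tinv_T => exact c.Tinv_T
  all_goals simp only [Ring.lie_def]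
  all_goals
    simp only [mul_add, add_mul, mul_sub, sub_mul, neg_mul, mul_neg, mul_assoc, smul_mul_assoc,
      mul_smul_comm, smul_add, smul_sub, smul_neg, mul_one, one_mul, mul_zero, zero_mul,
      smul_zero, add_zero, zero_add, sub_zero, zero_sub, neg_zero, neg_neg, six, sq, pow_succ,
      pow_zero, pow_one, c.T_Tinv, c.Tinv_T, c.H1_T, c.F1_T, c.F1_H1, c.N_T, c.H1_N, c.F1_N,
      c.N_E3, c.N_F2, c.H1_E3, c.H1_F2, c.E3_T, c.F2_T, c.E3_E3, c.F2_F2, c.F1_E3, c.F1_F2,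
      c.H1_Tinv, c.N_Tinv, c.E3_Tinv, c.F2_Tinv, c.F1_Tinv, c.H1_E2, c.N_E2, c.N_F3, c.E2_T,
      c.E2_Tinv, c.F3_T, c.F3_Tinv, c.F1_E2, c.F1_F3, c.H1_F3, c.E2_E3, c.F3_F2, c.E2_E2, c.F3_F3,
      c.F3_E3, c.E2_F2, c.F3_E2, c.h_comm T, c.h_comm Tinv, c.h_comm H1, c.h_comm F1, c.h_comm N,
      c.h_comm E3, c.h_comm F2, c.h_comm E2, c.h_comm F3, c.h_comm e, hF, he, heT, heTi, heE, heF,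
      mul_assoc_of_eq c.T_Tinv, mul_assoc_of_eq c.Tinv_T, mul_assoc_of_eq c.H1_T, mul_assoc_of_eq
      c.F1_T, mul_assoc_of_eq c.F1_H1, mul_assoc_of_eq c.N_T, mul_assoc_of_eq c.H1_N,
      mul_assoc_of_eq c.F1_N, mul_assoc_of_eq c.N_E3, mul_assoc_of_eq c.N_F2, mul_assoc_of_eq
      c.H1_E3, mul_assoc_of_eq c.H1_F2, mul_assoc_of_eq c.E3_T, mul_assoc_of_eq c.F2_T,
      mul_assoc_of_eq c.E3_E3, mul_assoc_of_eq c.F2_F2, mul_assoc_of_eq c.F1_E3, mul_assoc_of_eq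
      c.F1_F2, mul_assoc_of_eq c.H1_Tinv, mul_assoc_of_eq c.N_Tinv, mul_assoc_of_eq c.E3_Tinv,
      mul_assoc_of_eq c.F2_Tinv, mul_assoc_of_eq c.F1_Tinv, mul_assoc_of_eq c.H1_E2,
      mul_assoc_of_eq c.N_E2, mul_assoc_of_eq c.N_F3, mul_assoc_of_eq c.E2_T, mul_assoc_of_eq
      c.E2_Tinv, mul_assoc_of_eq c.F3_T, mul_assoc_of_eq c.F3_Tinv, mul_assoc_of_eq c.F1_E2,
      mul_assoc_of_eq c.F1_F3, mul_assoc_of_eq c.H1_F3, mul_assoc_of_eq c.E2_E3, mul_assoc_of_eq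
      c.F3_F2, mul_assoc_of_eq c.E2_E2, mul_assoc_of_eq c.F3_F3, mul_assoc_of_eq c.F3_E3,
      mul_assoc_of_eq c.E2_F2, mul_assoc_of_eq c.F3_E2, mul_assoc_of_eq (c.h_comm T),
      mul_assoc_of_eq (c.h_comm Tinv), mul_assoc_of_eq (c.h_comm H1), mul_assoc_of_eq (c.h_comm
      F1), mul_assoc_of_eq (c.h_comm N), mul_assoc_of_eq (c.h_comm E3), mul_assoc_of_eq (c.h_comm
      F2), mul_assoc_of_eq (c.h_comm E2), mul_assoc_of_eq (c.h_comm F3), mul_assoc_of_eq (c.h_comm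
      e), mul_assoc_of_eq hF, mul_assoc_of_eq he, mul_assoc_of_eq heT, mul_assoc_of_eq heTi,
      mul_assoc_of_eq heE, mul_assoc_of_eq heF]
  all_goals module

end JCore

set_option maxHeartbeats 4000000 in
/-- The nonlinear map from the classical to the super-Jordanian generators; `p` stands for
`√(1 + h² e₁²)`. -/
theorem JCore.of_core {R : Type*} [Ring R] [Algebra ℂ R] {h p q e h1 f1 n e3 f2 : R}
    (c : Core e h1 f1 n e3 f2) (hc : ∀ x, x * h = h * x)
    (pp : p * p = 1 + h * e * (h * e)) (pq : p * q = 1) (qp : q * p = 1) (e_p : p * e = e * p)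
    (e3p : e3 * p = p * e3) (f2p : f2 * p = p * f2) (np : n * p = p * n)
    (h1_p : h1 * p = p * h1 + (2 : ℂ) • (p - q))
    (f1_p : f1 * p = p * f1 - h * (h * e) * (q * h1 + q * (q * q))) :
    JCore h (h * e + p) (-(h * e) + p) (p * h1)
      (f1 - (1 / 4 : ℂ) • (h * (h * e) * (h1 * h1 - 1))) n e3 f2
      (f1 * e3 - e3 * f1 - (1 / 4 : ℂ) • (h * (h * e) * e3 * ((2 : ℂ) • h1 + 1)))
      (f2 * f1 - f1 * f2 + (1 / 4 : ℂ) • (h * (h * e) * f2 * ((2 : ℂ) • h1 + 1))) := by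
  have inv : ∀ {x y z : R}, x * p = p * x + y → z = y * q → x * q = q * x - q * z := by
    intro x y z h1 h2
    subst h2
    linear_combination (norm := skip) -(q * h1 * q) + q * x * pq - qp * x * q
    noncomm_ring
  have inv0 : ∀ {x : R}, x * p = p * x → x * q = q * x := by
    intro x h1
    rw [inv (y := 0) (by rw [h1]; abel) rfl]; simp
  have e_q := inv0 e_p.symm
  have e3q := inv0 e3p
  have f2q := inv0 f2p
  have nq := inv0 np
  have h1_q := inv h1_p (z := (2 : ℂ) • (1 - q * q)) (by
    rw [smul_mul_assoc, sub_mul, pq])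
  rw [eq_comm] at e_q
  have h1_e3 : h1 * e3 = e3 * h1 + e3 := by linear_combination (norm := abel) c.h1_e3
  have h1_f2 : h1 * f2 = f2 * h1 + f2 := by linear_combination (norm := abel) c.h1_f2
  have n_e3 : n * e3 = e3 * n - e3 := by linear_combination (norm := abel) c.n_e3
  have n_f2 : n * f2 = f2 * n + f2 := by linear_combination (norm := abel) c.n_f2
  have n_e : n * e = e * n := by linear_combination (norm := abel) c.n_e1
  have h1_n : h1 * n = n * h1 := by linear_combination (norm := abel) -c.n_h1
  have f1_n : f1 * n = n * f1 := by linear_combination (norm := abel) -c.n_f1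
  have h1_e : h1 * e = e * h1 + (2 : ℂ) • e := by linear_combination (norm := abel) c.h1_e1
  have h1_f1 : f1 * h1 = h1 * f1 + (2 : ℂ) • f1 := by linear_combination (norm := module) -c.h1_f1
  have f1_e : f1 * e = e * f1 - h1 := by linear_combination (norm := abel) -c.e1_f1
  have f2_e3 : f2 * e3 = -(e3 * f2) + e := by linear_combination (norm := abel) c.f2_e3
  have e3_e : e3 * e = e * e3 := by linear_combination (norm := abel) -c.e1_e3
  have f2_e : f2 * e = e * f2 := by linear_combination (norm := abel) -c.e1_f2
  obtain ⟨k, hk⟩ : ∃ k, k = h * e := ⟨_, rfl⟩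
  have hE : h * e = k := hk.symm
  have of_e : ∀ {x : R}, x * e = e * x → x * k = k * x := fun {x} hx => by
    rw [hk, ← mul_assoc, hc, mul_assoc, hx, mul_assoc]
  have kp := of_e e_p
  have kq := of_e e_q
  have e3_k := of_e e3_e
  have f2_k := of_e f2_e
  have n_k := of_e n_e
  have ke : k * e = e * k := (of_e rfl).symm
  have h1_k : h1 * k = k * h1 + (2 : ℂ) • k := by
    rw [hk, ← mul_assoc, hc, mul_assoc, h1_e, mul_add, mul_smul_comm, mul_assoc]
  have f1_k : f1 * k = k * f1 - h * h1 := by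
    rw [hk, ← mul_assoc, hc, mul_assoc, f1_e, mul_sub, mul_assoc]
  simp only [← hk] at pp f1_p ⊢
  have kkq : k * (k * q) = p - q := by
    linear_combination (norm := skip) p * pq - pp * q
    noncomm_ring
  obtain ⟨e2, he2⟩ : ∃ e2, e2 = f1 * e3 - e3 * f1 := ⟨_, rfl⟩
  obtain ⟨f3, hf3⟩ : ∃ f3, f3 = f2 * f1 - f1 * f2 := ⟨_, rfl⟩
  have f1_e3 : f1 * e3 = e3 * f1 + e2 := by rw [he2]; abel
  have f1_f2 : f1 * f2 = f2 * f1 - f3 := by rw [hf3]; abel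
  have f1_e2 : f1 * e2 = e2 * f1 := by rw [he2, ← sub_eq_zero, c.serre_e]
  have f1_f3 : f1 * f3 = f3 * f1 := by
    have := c.serre_f
    rw [← neg_inj, ← sub_eq_zero, hf3, ← this]; noncomm_ring
  have e2_f2 : e2 * f2 = -(f2 * e2) + (1 / 2 : ℂ) • (n - h1) := by
    rw [he2]; linear_combination (norm := abel) c.e2_f2
  have f3_e3 : f3 * e3 = -(e3 * f3) + (1 / 2 : ℂ) • (n + h1) := by
    rw [hf3]; linear_combination (norm := abel) c.e3_f3
  have e2_e : e2 * e = e * e2 - e3 := by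
    rw [he2]; linear_combination (norm := abel) -c.e1_e2
  have f3_e : f3 * e = e * f3 + f2 := by
    rw [hf3]; linear_combination (norm := abel) c.f3_e1
  have e2_k : e2 * k = k * e2 - h * e3 := by
    rw [hk, ← mul_assoc, hc, mul_assoc, e2_e, mul_sub, mul_assoc]
  have f3_k : f3 * k = k * f3 + h * f2 := by
    rw [hk, ← mul_assoc, hc, mul_assoc, f3_e, mul_add, mul_assoc]
  have h1_e2 : h1 * e2 = e2 * h1 - e2 := by
    rw [he2]; linear_combination (norm := abel) c.h1_e2
  have h1_f3 : h1 * f3 = f3 * h1 - f3 := by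
    rw [hf3]; linear_combination (norm := abel) c.h1_f3
  have n_e2 : n * e2 = e2 * n - e2 := by
    rw [he2]; linear_combination (norm := abel) c.n_e2
  have n_f3 : n * f3 = f3 * n + f3 := by
    rw [hf3]; linear_combination (norm := abel) c.n_f3
  simp only [← he2, ← hf3]
  constructor
  case h_comm => exact hc
  all_goals
    simp only [mul_add, add_mul, mul_sub, sub_mul, neg_mul, mul_neg, mul_assoc, smul_mul_assoc,
      mul_smul_comm, smul_add, smul_sub, smul_neg, mul_one, one_mul, mul_zero, zero_mul,
      smul_zero, add_zero, zero_add, sub_zero, zero_sub, neg_zero, neg_neg, sq, pow_succ,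
      pow_zero, pow_one, pp, pq, qp, e_p, e_q, kp, kq, kkq, ke, h1_p, h1_q, f1_p, e3p, e3q, f2p,
      f2q, np, nq, hE, h1_e, h1_k, f1_k, f1_e, e3_k, f2_k, n_k, h1_f1, f1_n, h1_n, n_e3, n_f2,
      h1_e3, h1_f2, c.e3_e3, c.f2_f2, f2_e3, e3_e, f2_e, n_e, f1_e3, f1_f2, f1_e2, f1_f3, e2_f2,
      f3_e3, e2_k, f3_k, e2_e, f3_e, h1_e2, h1_f3, n_e2, n_f3, hc e, hc k, hc p, hc q, hc e3, hc
      f2, hc e2, hc f3, hc n, hc h1, hc f1, mul_assoc_of_eq pp, mul_assoc_of_eq pq,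
      mul_assoc_of_eq qp, mul_assoc_of_eq e_p, mul_assoc_of_eq e_q, mul_assoc_of_eq kp,
      mul_assoc_of_eq kq, mul_assoc_of_eq kkq, mul_assoc_of_eq ke, mul_assoc_of_eq h1_p,
      mul_assoc_of_eq h1_q, mul_assoc_of_eq f1_p, mul_assoc_of_eq e3p, mul_assoc_of_eq e3q,
      mul_assoc_of_eq f2p, mul_assoc_of_eq f2q, mul_assoc_of_eq np, mul_assoc_of_eq nq,
      mul_assoc_of_eq hE, mul_assoc_of_eq h1_e, mul_assoc_of_eq h1_k, mul_assoc_of_eq f1_k,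
      mul_assoc_of_eq f1_e, mul_assoc_of_eq e3_k, mul_assoc_of_eq f2_k, mul_assoc_of_eq n_k,
      mul_assoc_of_eq h1_f1, mul_assoc_of_eq f1_n, mul_assoc_of_eq h1_n, mul_assoc_of_eq n_e3,
      mul_assoc_of_eq n_f2, mul_assoc_of_eq h1_e3, mul_assoc_of_eq h1_f2, mul_assoc_of_eq c.e3_e3,
      mul_assoc_of_eq c.f2_f2, mul_assoc_of_eq f2_e3, mul_assoc_of_eq e3_e, mul_assoc_of_eq f2_e,
      mul_assoc_of_eq n_e, mul_assoc_of_eq f1_e3, mul_assoc_of_eq f1_f2, mul_assoc_of_eq f1_e2,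
      mul_assoc_of_eq f1_f3, mul_assoc_of_eq e2_f2, mul_assoc_of_eq f3_e3, mul_assoc_of_eq e2_k,
      mul_assoc_of_eq f3_k, mul_assoc_of_eq e2_e, mul_assoc_of_eq f3_e, mul_assoc_of_eq h1_e2,
      mul_assoc_of_eq h1_f3, mul_assoc_of_eq n_e2, mul_assoc_of_eq n_f3, mul_assoc_of_eq (hc e),
      mul_assoc_of_eq (hc k), mul_assoc_of_eq (hc p), mul_assoc_of_eq (hc q), mul_assoc_of_eq (hc
      e3), mul_assoc_of_eq (hc f2), mul_assoc_of_eq (hc e2), mul_assoc_of_eq (hc f3),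
      mul_assoc_of_eq (hc n), mul_assoc_of_eq (hc h1), mul_assoc_of_eq (hc f1)]
  all_goals try module

section Calculus

variable {A : Type*} [Ring A] [Algebra ℂ A]

theorem binomial_half_sq :
    PowerSeries.binomialSeries ℂ (1 / 2 : ℂ) * PowerSeries.binomialSeries ℂ (1 / 2 : ℂ) =
      1 + X := by
  rw [← PowerSeries.binomialSeries_add, show (1 / 2 + 1 / 2 : ℂ) = ((1 : ℕ) : ℂ) by norm_num,
    PowerSeries.binomialSeries_nat, pow_one]

theorem binomial_half_mul :
    PowerSeries.binomialSeries ℂ (1 / 2 : ℂ) * PowerSeries.binomialSeries ℂ (-1 / 2 : ℂ) = 1 := by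
  rw [← PowerSeries.binomialSeries_add, show (1 / 2 + -1 / 2 : ℂ) = ((0 : ℕ) : ℂ) by norm_num,
    PowerSeries.binomialSeries_nat, pow_zero]

theorem two_mul_C_half : (2 : ℂ⟦X⟧) * C (1 / 2 : ℂ) = 1 := by
  rw [← map_ofNat (C (R := ℂ)) 2, ← map_mul]
  norm_num

theorem derivative_binomial_half :
    d⁄dX ℂ (PowerSeries.binomialSeries ℂ (1 / 2 : ℂ)) =
      (1 / 2 : ℂ) • PowerSeries.binomialSeries ℂ (-1 / 2 : ℂ) := by
  have h := congrArg (d⁄dX ℂ) binomial_half_sq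
  rw [Derivation.leibniz, map_add, PowerSeries.derivative_X, PowerSeries.derivative_one,
    smul_eq_mul, zero_add] at h
  have h2 := binomial_half_mul
  rw [PowerSeries.smul_eq_C_mul]
  set s := PowerSeries.binomialSeries ℂ (1 / 2 : ℂ)
  set q := PowerSeries.binomialSeries ℂ (-1 / 2 : ℂ)
  linear_combination C (1 / 2 : ℂ) * q * h - 2 * C (1 / 2 : ℂ) * d⁄dX ℂ s * h2 -
    d⁄dX ℂ s * two_mul_C_half

theorem derivative_binomial_neg_half :
    d⁄dX ℂ (PowerSeries.binomialSeries ℂ (-1 / 2 : ℂ)) =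
      (-1 / 2 : ℂ) • PowerSeries.binomialSeries ℂ (-1 / 2 : ℂ) ^ 3 := by
  have h := congrArg (d⁄dX ℂ) binomial_half_mul
  rw [Derivation.leibniz, PowerSeries.derivative_one, derivative_binomial_half, smul_eq_mul,
    smul_eq_mul, PowerSeries.smul_eq_C_mul] at h
  have h2 := binomial_half_mul
  rw [PowerSeries.smul_eq_C_mul, show (-1 / 2 : ℂ) = -(1 / 2) by norm_num, map_neg]
  rw [show (-1 / 2 : ℂ) = -(1 / 2) by norm_num] at h h2
  set s := PowerSeries.binomialSeries ℂ (1 / 2 : ℂ)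
  set q := PowerSeries.binomialSeries ℂ (-(1 / 2) : ℂ)
  linear_combination q * h - d⁄dX ℂ q * h2

theorem hpow_half_mul_of_comm_two {a x y z : A⟦X⟧} (ha : coeff 0 a = 1) (hx : a * x = x * a + y)
    (hy : a * y = y * a + z) (hz : a * z = z * a) :
    hpow a (1 / 2) * x = x * hpow a (1 / 2) + (1 / 2 : ℂ) • (y * hpow a (-1 / 2)) -
      (1 / 8 : ℂ) • (z * hpow a (-1 / 2) ^ 3) := by
  have h := subst_mul_of_comm_two (x := x) (y := y) (z := z) (coeff_zero_sub_one ha)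
    (by rw [sub_mul, hx]; noncomm_ring) (by rw [sub_mul, hy]; noncomm_ring)
    (by rw [sub_mul, hz]; noncomm_ring) (PowerSeries.binomialSeries ℂ (1 / 2 : ℂ))
  have h3 : ∀ (c : ℂ) f, subst (c • f) (a - 1) = c • subst f (a - 1) :=
    map_smul (substₗ (a - 1))
  rw [hpow, h, derivative_binomial_half, Derivation.map_smul, derivative_binomial_neg_half, h3, h3,
    h3, ← substHom_apply _ (coeff_zero_sub_one ha) (_ ^ 3), map_pow]
  simp only [mul_smul_comm, hpow, substHom_apply]
  module

theorem hlog_mul_of_comm_two {a b x y z : A⟦X⟧} (ha : coeff 0 a = 1) (hb : b * a = 1)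
    (hx : a * x = x * a + y) (hy : a * y = y * a + z) (hz : a * z = z * a) :
    hlog a * x = x * hlog a + y * b - (1 / 2 : ℂ) • (z * (b * b)) := by
  have h := subst_mul_of_comm_two (x := x) (y := y) (z := z) (coeff_zero_sub_one ha)
    (by rw [sub_mul, hx]; noncomm_ring) (by rw [sub_mul, hy]; noncomm_ring)
    (by rw [sub_mul, hz]; noncomm_ring) (PowerSeries.log ℂ)
  have h1 := one_add_X_mul_derivative_log
  have h2 : d⁄dX ℂ (d⁄dX ℂ (PowerSeries.log ℂ)) =
      (-1 : ℂ) • (d⁄dX ℂ (PowerSeries.log ℂ) * d⁄dX ℂ (PowerSeries.log ℂ)) := by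
    have := congrArg (d⁄dX ℂ) h1
    rw [Derivation.leibniz, map_add, PowerSeries.derivative_X, PowerSeries.derivative_one,
      smul_eq_mul, smul_eq_mul] at this
    rw [neg_one_smul]
    linear_combination d⁄dX ℂ (PowerSeries.log ℂ) * this -
      d⁄dX ℂ (d⁄dX ℂ (PowerSeries.log ℂ)) * h1
  have h3 : subst (d⁄dX ℂ (PowerSeries.log ℂ)) (a - 1) = b := by
    have := congrArg (substHom _ (coeff_zero_sub_one ha)) h1
    rw [map_mul, map_add, map_one, substHom_apply, substHom_apply,
      subst_X (coeff_zero_sub_one ha), add_sub_cancel] at this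
    exact (left_inv_eq_right_inv hb this).symm
  have h4 : ∀ (c : ℂ) f, subst (c • f) (a - 1) = c • subst f (a - 1) :=
    map_smul (substₗ (a - 1))
  rw [hlog, h, h2, h4, subst_mul (coeff_zero_sub_one ha), h3]
  simp only [mul_smul_comm]
  module

theorem hIn_mul (a : A⟦X⟧) : hIn A⟦X⟧ * a = hbar • a := (Algebra.smul_def _ _).symm

theorem mul_hIn (a : A⟦X⟧) : a * hIn A⟦X⟧ = hIn A⟦X⟧ * a := (Algebra.commutes _ _).symm

theorem Core.map {R S : Type*} [Ring R] [Algebra ℂ R] [Ring S] [Algebra ℂ S] (φ : R →ₐ[ℂ] S)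
    {e1 h1 f1 n e3 f2 : R} (c : Core e1 h1 f1 n e3 f2) :
    Core (φ e1) (φ h1) (φ f1) (φ n) (φ e3) (φ f2) where
  h1_f1 := by simp only [← map_mul, ← map_sub, ← map_smul, c.h1_f1]
  e1_f1 := by simp only [← map_mul, ← map_sub, c.e1_f1]
  n_f1 := by simp only [← map_mul, ← map_sub, c.n_f1, map_zero]
  n_e3 := by simp only [← map_mul, ← map_sub, ← map_neg, c.n_e3]
  n_f2 := by simp only [← map_mul, ← map_sub, c.n_f2]
  h1_e3 := by simp only [← map_mul, ← map_sub, c.h1_e3]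
  h1_f2 := by simp only [← map_mul, ← map_sub, c.h1_f2]
  e3_e3 := by simp only [← map_mul, c.e3_e3, map_zero]
  f2_f2 := by simp only [← map_mul, c.f2_f2, map_zero]
  f2_e3 := by simp only [← map_mul, ← map_add, c.f2_e3]
  serre_e := by simp only [← map_mul, ← map_sub, c.serre_e, map_zero]
  serre_f := by simp only [← map_mul, ← map_sub, c.serre_f, map_zero]
  e2_f2 := by simp only [← map_mul, ← map_sub, ← map_add, ← map_smul, c.e2_f2]

/-- Constant series. -/
def constHom (A : Type*) [Ring A] [Algebra ℂ A] : A →ₐ[ℂ] A⟦X⟧ where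
  __ := C (R := A)
  commutes' r := by
    change C (algebraMap ℂ A r) = _
    rw [PowerSeries.algebraMap_apply]

section Sqrt

variable {e : A}

theorem coeff_zero_sqrt_arg (e : A) : coeff 0 (1 + hbar ^ 2 • C (e ^ 2) : A⟦X⟧) = 1 := by
  rw [map_add, sq hbar, mul_smul, coeff_zero_hbar_smul]
  simp

theorem sqrt_arg (e : A) :
    (1 + hbar ^ 2 • C (e ^ 2) : A⟦X⟧) = 1 + hIn A⟦X⟧ * C e * (hIn A⟦X⟧ * C e) := by
  rw [hIn_mul, smul_mul_assoc, mul_smul_comm, smul_smul, sq, sq, map_mul]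

theorem coeff_zero_TSeries (e : A) : coeff 0 (TSeries e) = 1 := by
  rw [TSeries, map_add, coeff_zero_hbar_smul, sqrtSeries, coeff_zero_hpow, zero_add]

theorem sqrtSeries_mul_of_commute {x : A⟦X⟧} (h : C e * x = x * C e) :
    x * sqrtSeries e = sqrtSeries e * x := by
  refine (subst_commute (coeff_zero_sub_one (coeff_zero_sqrt_arg e)) ?_ _).symm
  rw [add_sub_cancel_left, smul_mul_assoc, mul_smul_comm, sq e, map_mul, mul_assoc, h, ← mul_assoc, h,
    mul_assoc]

/-- The super-Jordanian relations hold for the nonlinear map. -/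
theorem JCore.series {e h1 f1 n e3 f2 : A} (c : Core e h1 f1 n e3 f2) :
    JCore (hIn A⟦X⟧) (TSeries e) (TinvSeries e) (sqrtSeries e * C h1)
      (C f1 - (1 / 4 : ℂ) • (hIn A⟦X⟧ * (hIn A⟦X⟧ * C e) * (C h1 * C h1 - 1))) (C n) (C e3) (C f2)
      (C f1 * C e3 - C e3 * C f1 -
        (1 / 4 : ℂ) • (hIn A⟦X⟧ * (hIn A⟦X⟧ * C e) * C e3 * ((2 : ℂ) • C h1 + 1)))
      (C f2 * C f1 - C f1 * C f2 +
        (1 / 4 : ℂ) • (hIn A⟦X⟧ * (hIn A⟦X⟧ * C e) * C f2 * ((2 : ℂ) • C h1 + 1))) := by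
  have c' : Core (C e : A⟦X⟧) (C h1) (C f1) (C n) (C e3) (C f2) := c.map (constHom A)
  have ha := coeff_zero_sqrt_arg e
  set p := sqrtSeries e with hp
  set q := hpow (1 + hbar ^ 2 • C (e ^ 2) : A⟦X⟧) (-1 / 2) with hq
  have pq : p * q = 1 := by
    have := hpow_mul_neg ha (1 / 2)
    rwa [show (-(1 / 2) : ℂ) = -1 / 2 by norm_num] at this
  have qp : q * p = 1 := by
    have := hpow_mul_neg ha (-1 / 2)
    rwa [show (-(-1 / 2) : ℂ) = 1 / 2 by norm_num] at this
  have pp : p * p = 1 + hIn A⟦X⟧ * C e * (hIn A⟦X⟧ * C e) := by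
    rw [← sqrt_arg, ← sq, hp, sqrtSeries, hpow_half_sq ha]
  have hT : TSeries e = hIn A⟦X⟧ * C e + p := by rw [hIn_mul, TSeries]
  have hTi : TinvSeries e = -(hIn A⟦X⟧ * C e) + p := by rw [hIn_mul, TinvSeries]
  rw [hT, hTi]
  have hh : C h1 * C e = C e * C h1 + (2 : ℂ) • (C e : A⟦X⟧) := by
    linear_combination (norm := abel) c'.h1_e1
  have hf : C f1 * C e = C e * C f1 - (C h1 : A⟦X⟧) := by
    linear_combination (norm := abel) -c'.e1_f1
  have hc := mul_hIn (A := A)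
  have ep : (C e : A⟦X⟧) * p = p * C e := sqrtSeries_mul_of_commute rfl
  have eq : (C e : A⟦X⟧) * q = q * C e := by
    linear_combination (norm := noncomm_ring) -(q * ep * q) - qp * C e * q + q * C e * pq
  have kpq : hIn A⟦X⟧ * C e * (hIn A⟦X⟧ * C e) * q = p - q := by
    linear_combination (norm := noncomm_ring) p * pq - pp * q
  have asc : hIn A⟦X⟧ * C e * (hIn A⟦X⟧ * C e) = hIn A⟦X⟧ * hIn A⟦X⟧ * (C e * C e) := by
    rw [mul_assoc, ← mul_assoc (C e), hc, ← mul_assoc, ← mul_assoc, ← mul_assoc]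
  have hh1 := hpow_half_mul_of_comm_two (a := (1 + hbar ^ 2 • C (e ^ 2) : A⟦X⟧)) (x := C h1)
    (y := (-4 : ℂ) • (hIn A⟦X⟧ * C e * (hIn A⟦X⟧ * C e))) (z := 0) ha (by
      rw [sqrt_arg, asc]
      simp only [mul_add, add_mul, mul_sub, sub_mul, mul_assoc, mul_one, one_mul, hh, hc (C h1),
        mul_assoc_of_eq hh, mul_assoc_of_eq (hc (C h1)), smul_mul_assoc, mul_smul_comm, smul_add]
      module) (by
      rw [sqrt_arg]
      simp only [mul_add, add_mul, smul_mul_assoc, mul_smul_comm, mul_one, one_mul, add_zero,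
        smul_add]) (by
      simp)
  have hf1 := hpow_half_mul_of_comm_two (a := (1 + hbar ^ 2 • C (e ^ 2) : A⟦X⟧)) (x := C f1)
    (y := hIn A⟦X⟧ * hIn A⟦X⟧ * ((2 : ℂ) • (C e * C h1) + (2 : ℂ) • C e))
    (z := (-8 : ℂ) • (hIn A⟦X⟧ * hIn A⟦X⟧ * hIn A⟦X⟧ * hIn A⟦X⟧ * (C e * (C e * C e)))) ha (by
      rw [sqrt_arg, asc]
      simp only [mul_add, add_mul, mul_sub, sub_mul, mul_assoc, mul_one, one_mul, hh, hc (C f1),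
        hf, mul_assoc_of_eq hf, hc (C h1),
        mul_assoc_of_eq hh, mul_assoc_of_eq (hc (C f1)), mul_assoc_of_eq (hc (C h1)),
        smul_mul_assoc, mul_smul_comm, smul_add]
      module) (by
      rw [sqrt_arg, asc]
      simp only [mul_add, add_mul, mul_sub, sub_mul, mul_assoc, mul_one, one_mul, hh, hc (C e),
        hc (C h1), mul_assoc_of_eq (hc (C e)),
        mul_assoc_of_eq hh, mul_assoc_of_eq (hc (C h1)),
        smul_mul_assoc, mul_smul_comm, smul_add]
      module) (by
      rw [sqrt_arg, asc]
      simp only [mul_add, add_mul, mul_sub, sub_mul, mul_assoc, mul_one, one_mul, hc (C e),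
        mul_assoc_of_eq (hc (C e)), smul_mul_assoc, mul_smul_comm, smul_add])
  rw [← hq] at hh1 hf1
  change p * C h1 = C h1 * p + _ - _ at hh1
  change p * C f1 = C f1 * p + _ - _ at hf1
  have h1_p : C h1 * p = p * C h1 + (2 : ℂ) • (p - q) := by
    rw [hh1, smul_mul_assoc, kpq]
    simp only [zero_mul, smul_zero]
    module
  have h1_q : C h1 * q = q * C h1 - (2 : ℂ) • (q - q * q * q) := by
    linear_combination (norm := skip) -(q * h1_p * q) + q * C h1 * pq - qp * C h1 * q -
      (2 : ℂ) • (qp * q)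
    simp only [mul_add, add_mul, mul_sub, sub_mul, mul_assoc, smul_mul_assoc, mul_smul_comm,
      mul_one, one_mul]
    module
  refine JCore.of_core c' hc pp pq qp ep.symm ?_ ?_ ?_ h1_p ?_
  · exact sqrtSeries_mul_of_commute (by linear_combination (norm := abel) c'.e1_e3)
  · exact sqrtSeries_mul_of_commute (by linear_combination (norm := abel) c'.e1_f2)
  · exact sqrtSeries_mul_of_commute (by linear_combination (norm := abel) -c'.n_e1)
  · have hz : hIn A⟦X⟧ * hIn A⟦X⟧ * hIn A⟦X⟧ * hIn A⟦X⟧ * (C e * (C e * C e)) * q ^ 3 =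
        hIn A⟦X⟧ * (hIn A⟦X⟧ * C e) * (q - q * q * q) := by
      have : hIn A⟦X⟧ * hIn A⟦X⟧ * hIn A⟦X⟧ * hIn A⟦X⟧ * (C e * (C e * C e)) * q ^ 3 =
          hIn A⟦X⟧ * (hIn A⟦X⟧ * C e) * (hIn A⟦X⟧ * C e * (hIn A⟦X⟧ * C e) * q) * q * q := by
        simp only [mul_assoc, hc (C e), mul_assoc_of_eq (hc (C e)), pow_succ, pow_zero, one_mul]
      rw [this, kpq, mul_assoc, mul_assoc, ← mul_assoc (p - q), sub_mul, pq, sub_mul, one_mul]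
    rw [smul_mul_assoc, hz] at hf1
    simp only [mul_add, add_mul, mul_sub, sub_mul, mul_assoc, h1_q, smul_mul_assoc, mul_smul_comm,
      smul_add, smul_sub, mul_assoc_of_eq h1_q] at hf1 ⊢
    linear_combination (norm := module) -hf1

end Sqrt

end Calculus

open Gen in
theorem core_u : Core (u e1) (u h1) (u f1) un (u e3) (u f2) := by
  have f1e3 : u f1 * u e3 - u e3 * u f1 = u e2 := rel_comm .f1_e3 rfl
  have f2f1 : u f2 * u f1 - u f1 * u f2 = u f3 := rel_comm .f2_f1 rfl
  have e2f1 : u e2 * u f1 - u f1 * u e2 = 0 := by rw [rel_comm .e2_f1 rfl, map_zero]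
  have f3f1 : u f3 * u f1 - u f1 * u f3 = 0 := by rw [rel_comm .f3_f1 rfl, map_zero]
  have h2f1 : u h2 * u f1 - u f1 * u h2 = u f1 := rel_comm .h2_f1 rfl
  have h3f1 : u h3 * u f1 - u f1 * u h3 = -u f1 := by rw [rel_comm .h3_f1 rfl, map_neg]; rfl
  have h2e3 : u h2 * u e3 - u e3 * u h2 = -u e3 := by rw [rel_comm .h2_e3 rfl, map_neg]; rfl
  have h3e3 : u h3 * u e3 - u e3 * u h3 = 0 := by rw [rel_comm .h3_e3 rfl, map_zero]
  have h2f2 : u h2 * u f2 - u f2 * u h2 = 0 := by rw [rel_comm .h2_f2 rfl, map_zero]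
  have h3f2 : u h3 * u f2 - u f2 * u h3 = u f2 := rel_comm .h3_f2 rfl
  have e2f2 : u e2 * u f2 + u f2 * u e2 = u h2 := rel_anticomm .e2_f2 rfl
  have e3f3 : u e3 * u f3 + u f3 * u e3 = u h3 := rel_anticomm .e3_f3 rfl
  have f2e3 : u f2 * u e3 + u e3 * u f2 = u e1 := rel_anticomm .f2_e3 rfl
  have e1f1 : u e1 * u f1 - u f1 * u e1 = u h1 := rel_comm .e1_f1 rfl
  have e3e3 : u e3 * u e3 = 0 := by
    have := proj_rel Rel.e3_e3
    rwa [map_pow, map_zero, sq] at this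
  have f2f2 : u f2 * u f2 = 0 := by
    have := proj_rel Rel.f2_f2
    rwa [map_pow, map_zero, sq] at this
  have hh : u h3 - u h2 = u h1 := by
    rw [← e3f3, ← e2f2, ← e1f1, ← f2e3, ← f2f1, ← f1e3]
    noncomm_ring
  refine ⟨?_, e1f1, ?_, ?_, ?_, rel_comm .h1_e3 rfl, rel_comm .h1_f2 rfl, e3e3, f2f2, f2e3, ?_, ?_, ?_⟩
  · rw [rel_comm .h1_f1 rfl, map_smul]; rfl
  · rw [un]; linear_combination (norm := noncomm_ring) h2f1 + h3f1
  · rw [un]; linear_combination (norm := noncomm_ring) h2e3 + h3e3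
  · rw [un]; linear_combination (norm := noncomm_ring) h2f2 + h3f2
  · rw [f1e3]; linear_combination (norm := noncomm_ring) -e2f1
  · linear_combination (norm := skip) f3f1
    simp only [← f2f1]
    noncomm_ring
  · rw [f1e3, e2f2, un, ← hh]; module

theorem u_h2 : u .h2 = (1 / 2 : ℂ) • (un - u .h1) := by
  rw [← core_u.e2_f2]
  have f1e3 : u .f1 * u .e3 - u .e3 * u .f1 = u .e2 := rel_comm .f1_e3 rfl
  rw [f1e3]
  exact (rel_anticomm .e2_f2 rfl).symm

theorem u_h3 : u .h3 = (1 / 2 : ℂ) • (un + u .h1) := by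
  have := u_h2
  have h : u .h3 = un - u .h2 := by rw [un]; abel
  rw [h, this]; module

theorem u_e2 : u .e2 = u .f1 * u .e3 - u .e3 * u .f1 := (rel_comm .f1_e3 rfl).symm

theorem u_f3 : u .f3 = u .f2 * u .f1 - u .f1 * u .f2 := (rel_comm .f2_f1 rfl).symm

theorem TSeries_add_TinvSeries {A : Type*} [Ring A] [Algebra ℂ A] (e : A) :
    TSeries e + TinvSeries e = (2 : ℂ) • sqrtSeries e := by
  rw [TSeries, TinvSeries, two_smul]; abel

theorem sqrtSeries_mul_self {A : Type*} [Ring A] [Algebra ℂ A] (e : A) :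
    sqrtSeries e * sqrtSeries e = 1 + hbar ^ 2 • C (e ^ 2) := by
  rw [← sq, sqrtSeries, hpow_half_sq (coeff_zero_sqrt_arg e)]

theorem hIn_mul_hIn_mul {A : Type*} [Ring A] [Algebra ℂ A] (a : A⟦X⟧) :
    hIn A⟦X⟧ * (hIn A⟦X⟧ * a) = hbar ^ 2 • a := by
  rw [hIn_mul, hIn_mul, smul_smul, sq]

theorem half_TSeries_mul {A : Type*} [Ring A] [Algebra ℂ A] (e : A) (x : A⟦X⟧) :
    (1 / 2 : ℂ) • ((TSeries e + TinvSeries e) * x) = sqrtSeries e * x := by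
  rw [TSeries_add_TinvSeries, smul_mul_assoc, smul_smul]
  norm_num

theorem jcore : JCore (hIn U⟦X⟧) jordanGens.T jordanGens.Tinv jordanGens.H1 jordanGens.F1 (C un)
    jordanGens.E3 jordanGens.F2 jordanGens.E2 jordanGens.F3 := by
  have := JCore.series core_u
  simp only [hIn_mul_hIn_mul, smul_mul_assoc] at this
  simp only [jordanGens, half_TSeries_mul]
  convert this using 1
  · rw [map_mul, map_sub, sq (u .h1), map_mul, map_one]
  · rw [u_e2, map_sub, map_mul, map_mul, map_mul, map_mul, map_add, map_one, C_smul]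
  · rw [u_f3, map_sub, map_mul, map_mul, map_mul, map_mul, map_add, map_one, C_smul]

theorem jordan_H2 : jordanGens.H2 =
    (1 / 2 : ℂ) • C un - (1 / 4 : ℂ) • ((jordanGens.T + jordanGens.Tinv) * jordanGens.H1) := by
  have h1 : jordanGens.T + jordanGens.Tinv = (2 : ℂ) • sqrtSeries (u .e1) :=
    TSeries_add_TinvSeries _
  have h2 : jordanGens.H1 = sqrtSeries (u .e1) * C (u .h1) := half_TSeries_mul _ _
  have h3 : jordanGens.H2 = C (u .h2) - (1 / 2 : ℂ) • hbar ^ 2 • C (u .e1 ^ 2 * u .h1) := rfl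
  rw [h1, h2, h3, smul_mul_assoc, ← mul_assoc, sqrtSeries_mul_self, u_h2, C_smul, map_sub, add_mul,
    one_mul, map_mul, smul_mul_assoc, smul_smul, smul_add, smul_sub]
  norm_num
  abel

theorem jordan_H3 : jordanGens.H3 =
    (1 / 2 : ℂ) • C un + (1 / 4 : ℂ) • ((jordanGens.T + jordanGens.Tinv) * jordanGens.H1) := by
  have h1 : jordanGens.T + jordanGens.Tinv = (2 : ℂ) • sqrtSeries (u .e1) :=
    TSeries_add_TinvSeries _
  have h2 : jordanGens.H1 = sqrtSeries (u .e1) * C (u .h1) := half_TSeries_mul _ _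
  have h3 : jordanGens.H3 = C (u .h3) + (1 / 2 : ℂ) • hbar ^ 2 • C (u .e1 ^ 2 * u .h1) := rfl
  rw [h1, h2, h3, smul_mul_assoc, ← mul_assoc, sqrtSeries_mul_self, u_h3, C_smul, map_add, add_mul,
    one_mul, map_mul, smul_mul_assoc, smul_smul, smul_add, smul_add]
  norm_num
  abel

theorem deformedRelations_jordanGens : DeformedRelations (hIn U⟦X⟧) jordanGens := by
  have := jcore.deformed
  rwa [← jordan_H2, ← jordan_H3] at this

section Reduced

variable {R : Type*} [Ring R] [Algebra ℂ R]

theorem JCore.of_deformed {h : R} {g : Gens R} (d : DeformedRelations h g)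
    (hc : ∀ x, x * h = h * x) (tf : ∀ x : R, h * x = 0 → x = 0) :
    JCore h g.T g.Tinv g.H1 g.F1 (g.H2 + g.H3) g.E3 g.F2 g.E2 g.F3 := by
  obtain ⟨T_Tinv, Tinv_T, H1_T, H1_Tinv, T_F1, Tinv_F1, H1_F1, H1_H2, H1_H3, H2_H3, H1_E2, H1_F2,
    H1_E3, H1_F3, H2_T, H2_Tinv, H2_F1, H2_E2, H2_F2, H2_E3, H2_F3, H3_T, H3_Tinv, H3_F1, H3_E2,
    H3_F2, H3_E3, H3_F3, E2_F2, E3_F3, T_F2, Tinv_F2, E2_F1, E2_sq, F2_sq, E3_sq, F3_sq, T_E2,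
    Tinv_E2, F2_F1, T_E3, Tinv_E3, F3_F1, E2_E3, F2_F3, F1_E3, T_F3, Tinv_F3, F2_E3, F3_E2⟩ := d
  simp only [Ring.lie_def] at *
  have H1T : g.H1 * g.T = g.T * g.H1 + g.T * g.T - 1 := by
    linear_combination (norm := noncomm_ring) H1_T
  have H1Tinv : g.H1 * g.Tinv = g.Tinv * g.H1 + g.Tinv * g.Tinv - 1 := by
    linear_combination (norm := noncomm_ring) H1_Tinv
  have F1T : g.F1 * g.T = g.T * g.F1 - h * g.T * g.H1 - (1 / 2 : ℂ) • (h * g.T * g.T - h) := by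
    linear_combination (norm := skip) -T_F1 - (1 / 2 : ℂ) • (h * H1T)
    simp only [mul_add, mul_sub, mul_one, mul_assoc]
    module
  have F1Tinv : g.F1 * g.Tinv =
      g.Tinv * g.F1 + h * g.Tinv * g.H1 + (1 / 2 : ℂ) • (h * g.Tinv * g.Tinv - h) := by
    linear_combination (norm := skip) -Tinv_F1 + (1 / 2 : ℂ) • (h * H1Tinv)
    simp only [mul_add, mul_sub, mul_one, mul_assoc]
    module
  have six : ∀ x : R, 6 * x = (6 : ℂ) • x := fun x => by rw [Algebra.smul_def, map_ofNat]
  have E3F2 : h * (g.E3 * g.F2) = -(h * (g.F2 * g.E3)) + (1 / 2 : ℂ) • (g.T - g.Tinv) := by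
    rw [← F2_E3]; noncomm_ring
  have H23 : g.H2 - g.H3 = -((1 / 2 : ℂ) • ((g.T + g.Tinv) * g.H1)) := by
    rw [← sub_eq_zero]
    refine tf _ ?_
    linear_combination (norm := skip) g.F1 * F2_E3 - F2_E3 * g.F1 -
      hc g.F1 * (g.F2 * g.E3 + g.E3 * g.F2) + h * F2_F1 * g.E3 + h * g.E3 * F2_F1 -
      h * g.F2 * F1_E3 - h * F1_E3 * g.F2 - h * E2_F2 + h * E3_F3 +
      (1 / 4 : ℂ) • (h * (g.T - g.Tinv) * F2_E3)
    simp only [mul_add, add_mul, mul_sub, sub_mul, neg_mul, mul_neg, mul_assoc, smul_mul_assoc,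
      mul_smul_comm, smul_add, smul_sub, smul_neg, mul_one, one_mul, mul_zero, zero_mul,
      smul_zero, add_zero, zero_add, sub_zero, zero_sub, neg_zero, neg_neg, sq, pow_succ,
      pow_zero, pow_one, F1T, F1Tinv, H1T, H1Tinv, T_Tinv, Tinv_T, hc g.T, hc g.Tinv, hc g.H1,
      mul_assoc_of_eq F1T, mul_assoc_of_eq F1Tinv, mul_assoc_of_eq H1T, mul_assoc_of_eq H1Tinv,
      mul_assoc_of_eq T_Tinv, mul_assoc_of_eq Tinv_T, mul_assoc_of_eq (hc g.T), mul_assoc_of_eq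
      (hc g.Tinv), mul_assoc_of_eq (hc g.H1)]
    module
  constructor
  case h_comm => exact hc
  case H1_T => exact H1T
  case F1_T => exact F1T
  case T_Tinv => exact T_Tinv
  case Tinv_T => exact Tinv_T
  case E3_E3 => rw [← sq, E3_sq]
  case F2_F2 => rw [← sq, F2_sq]
  case E3_T => linear_combination (norm := abel) -T_E3
  case F2_T => linear_combination (norm := abel) -T_F2
  case F1_E3 => linear_combination (norm := abel) F1_E3
  case F1_F2 => linear_combination (norm := abel) -F2_F1
  case F2_E3 => linear_combination (norm := noncomm_ring) F2_E3
  case N_T => linear_combination (norm := skip) H2_T + H3_T; noncomm_ring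
  case H1_N => linear_combination (norm := skip) H1_H2 + H1_H3; noncomm_ring
  case F1_N => linear_combination (norm := skip) -H2_F1 - H3_F1; noncomm_ring
  case H1_E3 => linear_combination (norm := abel) H1_E3
  case H1_F2 => linear_combination (norm := abel) H1_F2
  case F1_E2 => linear_combination (norm := skip) -E2_F1; simp only [sq, mul_assoc]; abel
  case F1_F3 => linear_combination (norm := skip) -F3_F1; simp only [sq, mul_assoc]; abel
  case F1_H1 =>
    linear_combination (norm := skip) -H1_F1
    simp only [mul_add, add_mul, mul_sub, sub_mul, neg_mul, mul_neg, mul_assoc, smul_mul_assoc,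
      mul_smul_comm, smul_add, smul_sub, smul_neg, mul_one, one_mul, mul_zero, zero_mul,
      smul_zero, add_zero, zero_add, sub_zero, zero_sub, neg_zero, neg_neg, sq, pow_succ,
      pow_zero, pow_one, F1T, F1Tinv, mul_assoc_of_eq F1T, mul_assoc_of_eq F1Tinv]
    module
  case N_E3 =>
    linear_combination (norm := skip) H2_E3 + H3_E3
    simp only [mul_add, add_mul, mul_sub, sub_mul, neg_mul, mul_neg, mul_assoc, smul_mul_assoc,
      mul_smul_comm, smul_add, smul_sub, smul_neg, mul_one, one_mul, mul_zero, zero_mul,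
      smul_zero, add_zero, zero_add, sub_zero, zero_sub, neg_zero, neg_neg, sq, pow_succ,
      pow_zero, pow_one, six, T_Tinv, Tinv_T, mul_assoc_of_eq T_Tinv, mul_assoc_of_eq Tinv_T]
    module
  case N_F2 =>
    linear_combination (norm := skip) H2_F2 + H3_F2
    simp only [mul_add, add_mul, mul_sub, sub_mul, neg_mul, mul_neg, mul_assoc, smul_mul_assoc,
      mul_smul_comm, smul_add, smul_sub, smul_neg, mul_one, one_mul, mul_zero, zero_mul,
      smul_zero, add_zero, zero_add, sub_zero, zero_sub, neg_zero, neg_neg, sq, pow_succ,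
      pow_zero, pow_one, six, T_Tinv, Tinv_T, mul_assoc_of_eq T_Tinv, mul_assoc_of_eq Tinv_T]
    module
  case E2_F2 =>
    linear_combination (norm := skip) E2_F2 + (1 / 2 : ℂ) • H23
    simp only [sq]
    module
  case F3_E3 =>
    linear_combination (norm := skip) E3_F3 - (1 / 2 : ℂ) • H23
    simp only [sq]
    module

theorem JCore.jordan_H2 {h : R} {g : Gens R} (d : DeformedRelations h g)
    (hc : ∀ x, x * h = h * x) (tf : ∀ x : R, h * x = 0 → x = 0) :
    g.H2 = (1 / 2 : ℂ) • (g.H2 + g.H3) - (1 / 4 : ℂ) • ((g.T + g.Tinv) * g.H1) := by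
  have c := JCore.of_deformed d hc tf
  have h1 := c.E2_F2
  have h2 := d.E2_F2
  rw [h1] at h2
  linear_combination (norm := skip) -h2
  simp only [sq]
  module

set_option maxHeartbeats 1000000 in
theorem JCore.core_aux {h T Tinv H1 F1 N E3 F2 E2 F3 e q : R}
    (c : JCore h T Tinv H1 F1 N E3 F2 E2 F3) (tf : ∀ x : R, h * x = 0 → x = 0)
    (hFe : e = F2 * E3 + E3 * F2)
    (pq : (T + Tinv) * q = 2) (qp : q * (T + Tinv) = 2) :
    let f1 := F1 + (1 / 4 : ℂ) • (h * (h * e) * (q * H1 * (q * H1) - 1))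
    (f1 * (f1 * F2 - F2 * f1) - (f1 * F2 - F2 * f1) * f1 = 0 → Core e (q * H1) f1 N E3 F2) ∧
      f1 * (f1 * E3 - E3 * f1) - (f1 * E3 - E3 * f1) * f1 = 0 := by
  intro f1
  have hF : F2 * E3 = -(E3 * F2) + e := by rw [hFe]; abel
  have he : h * e = (1 / 2 : ℂ) • (T - Tinv) := by rw [hFe, mul_add, c.F2_E3]; abel
  have heT : T * e = e * T := by
    rw [hFe, mul_add, add_mul, mul_assoc, mul_assoc, c.E3_T, c.F2_T, ← mul_assoc, ← mul_assoc,
      ← mul_assoc, ← mul_assoc, c.E3_T, c.F2_T]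
  have heTi : Tinv * e = e * Tinv := by
    rw [hFe, mul_add, add_mul, mul_assoc, mul_assoc, c.E3_Tinv, c.F2_Tinv, ← mul_assoc, ← mul_assoc,
      ← mul_assoc, ← mul_assoc, c.E3_Tinv, c.F2_Tinv]
  have heE : E3 * e = e * E3 := by
    simp only [hFe, mul_add, add_mul, mul_assoc, c.E3_E3, mul_assoc_of_eq c.E3_E3, mul_zero, zero_mul]
    abel
  have heF : F2 * e = e * F2 := by
    simp only [hFe, mul_add, add_mul, mul_assoc, c.F2_F2, mul_assoc_of_eq c.F2_F2, mul_zero, zero_mul]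
    abel
  have inv : ∀ {x y z : R}, x * (T + Tinv) = (T + Tinv) * x + y → q * y * q = z →
      x * q = q * x - (1 / 2 : ℂ) • z := by
    intro x y z h1 h2
    subst h2
    have h3 : q * (x * (T + Tinv)) * q = (2 : ℂ) • (q * x) := by
      rw [mul_assoc, mul_assoc, pq, ← mul_assoc, two_smul, mul_two]
    have h4 : q * ((T + Tinv) * x) * q = (2 : ℂ) • (x * q) := by
      rw [← mul_assoc, qp, two_mul, add_mul, two_smul]
    rw [h1, mul_add, add_mul, h4] at h3
    linear_combination (norm := module) (1 / 2 : ℂ) • h3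
  have inv0 : ∀ {x : R}, x * T = T * x → x * Tinv = Tinv * x → x * q = q * x := by
    intro x h1 h2
    rw [inv (y := 0) (by rw [mul_add, h1, h2, add_mul, add_zero]) rfl]; simp
  have qT : q * T = T * q := (inv0 rfl (by rw [c.T_Tinv, c.Tinv_T])).symm
  have qTinv : q * Tinv = Tinv * q := (inv0 (by rw [c.T_Tinv, c.Tinv_T]) rfl).symm
  have Tiq : Tinv * q = 2 - T * q := by rw [← pq]; noncomm_ring
  have TTq : T * (T * q) = 2 * T - q := by
    have : T * (Tinv * q) = q := by rw [← mul_assoc, c.T_Tinv, one_mul]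
    rw [Tiq] at this
    linear_combination (norm := noncomm_ring) -this
  rw [Tiq] at qTinv
  have two : (2 : R) = (2 : ℂ) • 1 := by rw [Algebra.smul_def, map_ofNat, mul_one]
  rw [two] at qTinv Tiq TTq
  have TTq1 : ∀ x, T * (T * (q * x)) = ((2 : ℂ) • 1 * T - q) * x := fun x => by
    rw [← TTq]; simp only [mul_assoc]
  have e_q : q * e = e * q := (inv0 heT.symm heTi.symm).symm
  have E3_q : E3 * q = q * E3 := inv0 c.E3_T c.E3_Tinv
  have F2_q : F2 * q = q * F2 := inv0 c.F2_T c.F2_Tinv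
  have N_q : N * q = q * N := inv0 c.N_T c.N_Tinv
  have H1_q : H1 * q = q * H1 - (2 : ℂ) • 1 + (2 : ℂ) • (q * q) := by
    rw [inv (y := T * T + Tinv * Tinv - (2 : ℂ) • 1) (by
      rw [mul_add, c.H1_T, c.H1_Tinv]; simp only [add_mul]; module) rfl]
    simp only [mul_add, add_mul, mul_sub, sub_mul, neg_mul, mul_neg, mul_assoc, smul_mul_assoc,
      mul_smul_comm, smul_add, smul_sub, smul_neg, mul_one, one_mul, mul_zero, zero_mul,
      smul_zero, add_zero, zero_add, sub_zero, zero_sub, neg_zero, neg_neg, sq, pow_succ,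
      pow_zero, pow_one, qT, qTinv, Tiq, TTq, c.T_Tinv, c.Tinv_T, mul_assoc_of_eq qT,
      mul_assoc_of_eq qTinv, mul_assoc_of_eq Tiq, mul_assoc_of_eq TTq, mul_assoc_of_eq c.T_Tinv,
      mul_assoc_of_eq c.Tinv_T]
    module
  have F1_q : F1 * q = q * F1 + h * (T * q - (1 : ℂ) • 1) * (q * H1 - (1 : ℂ) • 1 + (2 : ℂ) • (q * q)) := by
    rw [inv (y := h * Tinv * H1 - h * T * H1 +
      (1 / 2 : ℂ) • (h * Tinv * Tinv - h * T * T)) (by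
      rw [mul_add, c.F1_T, c.F1_Tinv]
      simp only [add_mul, mul_add, mul_sub, sub_mul, mul_assoc]
      module) rfl]
    simp only [mul_add, add_mul, mul_sub, sub_mul, neg_mul, mul_neg, mul_assoc, smul_mul_assoc,
      mul_smul_comm, smul_add, smul_sub, smul_neg, mul_one, one_mul, mul_zero, zero_mul,
      smul_zero, add_zero, zero_add, sub_zero, zero_sub, neg_zero, neg_neg, sq, pow_succ,
      pow_zero, pow_one, TTq1, qT, qTinv, Tiq, TTq, c.T_Tinv, c.Tinv_T, c.h_comm q, c.h_comm T,
      c.h_comm Tinv, c.h_comm H1, c.h_comm F1, H1_q, c.H1_T, c.H1_Tinv, c.F1_H1, c.F1_T,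
      c.F1_Tinv, c.E3_T, c.E3_Tinv, E3_q, mul_assoc_of_eq qT, mul_assoc_of_eq qTinv,
      mul_assoc_of_eq Tiq, mul_assoc_of_eq TTq, mul_assoc_of_eq c.T_Tinv, mul_assoc_of_eq
      c.Tinv_T, mul_assoc_of_eq (c.h_comm q), mul_assoc_of_eq (c.h_comm T), mul_assoc_of_eq
      (c.h_comm Tinv), mul_assoc_of_eq (c.h_comm H1), mul_assoc_of_eq (c.h_comm F1),
      mul_assoc_of_eq H1_q, mul_assoc_of_eq c.H1_T, mul_assoc_of_eq c.H1_Tinv, mul_assoc_of_eq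
      c.F1_H1, mul_assoc_of_eq c.F1_T, mul_assoc_of_eq c.F1_Tinv, mul_assoc_of_eq c.E3_T,
      mul_assoc_of_eq c.E3_Tinv, mul_assoc_of_eq E3_q]
    module
  obtain ⟨k, hk⟩ : ∃ k, k = (1 / 2 : ℂ) • (T - Tinv) := ⟨_, rfl⟩
  obtain ⟨h1, hh1⟩ : ∃ h1, h1 = q * H1 := ⟨_, rfl⟩
  have H1_eq : H1 = (1 / 2 : ℂ) • ((T + Tinv) * h1) := by
    rw [hh1, ← mul_assoc, pq, two, smul_mul_assoc, one_mul, smul_smul]; norm_num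
  have h1_k : h1 * k = k * h1 + (2 : ℂ) • k := by
    rw [hh1, hk]
    simp only [mul_add, add_mul, mul_sub, sub_mul, neg_mul, mul_neg, mul_assoc, smul_mul_assoc,
      mul_smul_comm, smul_add, smul_sub, smul_neg, mul_one, one_mul, mul_zero, zero_mul,
      smul_zero, add_zero, zero_add, sub_zero, zero_sub, neg_zero, neg_neg, sq, pow_succ,
      pow_zero, pow_one, TTq1, qT, qTinv, Tiq, TTq, c.T_Tinv, c.Tinv_T, c.h_comm q, c.h_comm T,
      c.h_comm Tinv, c.h_comm H1, c.h_comm F1, H1_q, c.H1_T, c.H1_Tinv, c.F1_H1, c.F1_T,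
      c.F1_Tinv, c.E3_T, c.E3_Tinv, E3_q, mul_assoc_of_eq qT, mul_assoc_of_eq qTinv,
      mul_assoc_of_eq Tiq, mul_assoc_of_eq TTq, mul_assoc_of_eq c.T_Tinv, mul_assoc_of_eq
      c.Tinv_T, mul_assoc_of_eq (c.h_comm q), mul_assoc_of_eq (c.h_comm T), mul_assoc_of_eq
      (c.h_comm Tinv), mul_assoc_of_eq (c.h_comm H1), mul_assoc_of_eq (c.h_comm F1),
      mul_assoc_of_eq H1_q, mul_assoc_of_eq c.H1_T, mul_assoc_of_eq c.H1_Tinv, mul_assoc_of_eq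
      c.F1_H1, mul_assoc_of_eq c.F1_T, mul_assoc_of_eq c.F1_Tinv, mul_assoc_of_eq c.E3_T,
      mul_assoc_of_eq c.E3_Tinv, mul_assoc_of_eq E3_q]
    module
  have F1_h1 : F1 * h1 = h1 * F1 + (2 : ℂ) • F1 + h * k * (h1 * h1 - 1) := by
    rw [hh1, hk]
    simp only [mul_add, add_mul, mul_sub, sub_mul, neg_mul, mul_neg, mul_assoc, smul_mul_assoc,
      mul_smul_comm, smul_add, smul_sub, smul_neg, mul_one, one_mul, mul_zero, zero_mul,
      smul_zero, add_zero, zero_add, sub_zero, zero_sub, neg_zero, neg_neg, sq, pow_succ,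
      pow_zero, pow_one, TTq1, qT, qTinv, Tiq, TTq, c.T_Tinv, c.Tinv_T, c.h_comm q, c.h_comm T,
      c.h_comm Tinv, c.h_comm H1, c.h_comm F1, H1_q, c.H1_T, c.H1_Tinv, c.F1_H1, c.F1_T,
      c.F1_Tinv, c.E3_T, c.E3_Tinv, E3_q, F1_q, mul_assoc_of_eq qT, mul_assoc_of_eq qTinv,
      mul_assoc_of_eq Tiq, mul_assoc_of_eq TTq, mul_assoc_of_eq c.T_Tinv, mul_assoc_of_eq
      c.Tinv_T, mul_assoc_of_eq (c.h_comm q), mul_assoc_of_eq (c.h_comm T), mul_assoc_of_eq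
      (c.h_comm Tinv), mul_assoc_of_eq (c.h_comm H1), mul_assoc_of_eq (c.h_comm F1),
      mul_assoc_of_eq H1_q, mul_assoc_of_eq c.H1_T, mul_assoc_of_eq c.H1_Tinv, mul_assoc_of_eq
      c.F1_H1, mul_assoc_of_eq c.F1_T, mul_assoc_of_eq c.F1_Tinv, mul_assoc_of_eq c.E3_T,
      mul_assoc_of_eq c.E3_Tinv, mul_assoc_of_eq E3_q, mul_assoc_of_eq F1_q]
    module
  have F1_k : F1 * k = k * F1 - h * ((1 + k * k) * h1 + k * k) := by
    rw [hh1, hk]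
    simp only [mul_add, add_mul, mul_sub, sub_mul, neg_mul, mul_neg, mul_assoc, smul_mul_assoc,
      mul_smul_comm, smul_add, smul_sub, smul_neg, mul_one, one_mul, mul_zero, zero_mul,
      smul_zero, add_zero, zero_add, sub_zero, zero_sub, neg_zero, neg_neg, sq, pow_succ,
      pow_zero, pow_one, TTq1, qT, qTinv, Tiq, TTq, c.T_Tinv, c.Tinv_T, c.h_comm q, c.h_comm T,
      c.h_comm Tinv, c.h_comm H1, c.h_comm F1, H1_q, c.H1_T, c.H1_Tinv, c.F1_H1, c.F1_T,
      c.F1_Tinv, c.E3_T, c.E3_Tinv, E3_q, F1_q, mul_assoc_of_eq qT, mul_assoc_of_eq qTinv,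
      mul_assoc_of_eq Tiq, mul_assoc_of_eq TTq, mul_assoc_of_eq c.T_Tinv, mul_assoc_of_eq
      c.Tinv_T, mul_assoc_of_eq (c.h_comm q), mul_assoc_of_eq (c.h_comm T), mul_assoc_of_eq
      (c.h_comm Tinv), mul_assoc_of_eq (c.h_comm H1), mul_assoc_of_eq (c.h_comm F1),
      mul_assoc_of_eq H1_q, mul_assoc_of_eq c.H1_T, mul_assoc_of_eq c.H1_Tinv, mul_assoc_of_eq
      c.F1_H1, mul_assoc_of_eq c.F1_T, mul_assoc_of_eq c.F1_Tinv, mul_assoc_of_eq c.E3_T,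
      mul_assoc_of_eq c.E3_Tinv, mul_assoc_of_eq E3_q, mul_assoc_of_eq F1_q]
    module
  have H1H1 : H1 * H1 = h1 * h1 + k * k * h1 * h1 + (2 : ℂ) • (k * k * h1) := by
    rw [hh1, hk]
    simp only [mul_add, add_mul, mul_sub, sub_mul, neg_mul, mul_neg, mul_assoc, smul_mul_assoc,
      mul_smul_comm, smul_add, smul_sub, smul_neg, mul_one, one_mul, mul_zero, zero_mul,
      smul_zero, add_zero, zero_add, sub_zero, zero_sub, neg_zero, neg_neg, sq, pow_succ,
      pow_zero, pow_one, TTq1, qT, qTinv, Tiq, TTq, c.T_Tinv, c.Tinv_T, c.h_comm q, c.h_comm T,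
      c.h_comm Tinv, c.h_comm H1, c.h_comm F1, H1_q, c.H1_T, c.H1_Tinv, c.F1_H1, c.F1_T,
      c.F1_Tinv, c.E3_T, c.E3_Tinv, E3_q, F1_q, mul_assoc_of_eq qT, mul_assoc_of_eq qTinv,
      mul_assoc_of_eq Tiq, mul_assoc_of_eq TTq, mul_assoc_of_eq c.T_Tinv, mul_assoc_of_eq
      c.Tinv_T, mul_assoc_of_eq (c.h_comm q), mul_assoc_of_eq (c.h_comm T), mul_assoc_of_eq
      (c.h_comm Tinv), mul_assoc_of_eq (c.h_comm H1), mul_assoc_of_eq (c.h_comm F1),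
      mul_assoc_of_eq H1_q, mul_assoc_of_eq c.H1_T, mul_assoc_of_eq c.H1_Tinv, mul_assoc_of_eq
      c.F1_H1, mul_assoc_of_eq c.F1_T, mul_assoc_of_eq c.F1_Tinv, mul_assoc_of_eq c.E3_T,
      mul_assoc_of_eq c.E3_Tinv, mul_assoc_of_eq E3_q, mul_assoc_of_eq F1_q]
    module
  have pH1 : (T + Tinv) * H1 = (2 : ℂ) • (h1 + k * k * h1) := by
    rw [hh1, hk]
    simp only [mul_add, add_mul, mul_sub, sub_mul, neg_mul, mul_neg, mul_assoc, smul_mul_assoc,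
      mul_smul_comm, smul_add, smul_sub, smul_neg, mul_one, one_mul, mul_zero, zero_mul,
      smul_zero, add_zero, zero_add, sub_zero, zero_sub, neg_zero, neg_neg, sq, pow_succ,
      pow_zero, pow_one, TTq1, qT, qTinv, Tiq, TTq, c.T_Tinv, c.Tinv_T, c.h_comm q, c.h_comm T,
      c.h_comm Tinv, c.h_comm H1, c.h_comm F1, H1_q, c.H1_T, c.H1_Tinv, c.F1_H1, c.F1_T,
      c.F1_Tinv, c.E3_T, c.E3_Tinv, E3_q, F1_q, mul_assoc_of_eq qT, mul_assoc_of_eq qTinv,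
      mul_assoc_of_eq Tiq, mul_assoc_of_eq TTq, mul_assoc_of_eq c.T_Tinv, mul_assoc_of_eq
      c.Tinv_T, mul_assoc_of_eq (c.h_comm q), mul_assoc_of_eq (c.h_comm T), mul_assoc_of_eq
      (c.h_comm Tinv), mul_assoc_of_eq (c.h_comm H1), mul_assoc_of_eq (c.h_comm F1),
      mul_assoc_of_eq H1_q, mul_assoc_of_eq c.H1_T, mul_assoc_of_eq c.H1_Tinv, mul_assoc_of_eq
      c.F1_H1, mul_assoc_of_eq c.F1_T, mul_assoc_of_eq c.F1_Tinv, mul_assoc_of_eq c.E3_T,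
      mul_assoc_of_eq c.E3_Tinv, mul_assoc_of_eq E3_q, mul_assoc_of_eq F1_q]
    module
  have E3_k : E3 * k = k * E3 := by
    rw [hk]; simp only [mul_smul_comm, smul_mul_assoc, mul_sub, sub_mul, c.E3_T, c.E3_Tinv]
  have F2_k : F2 * k = k * F2 := by
    rw [hk]; simp only [mul_smul_comm, smul_mul_assoc, mul_sub, sub_mul, c.F2_T, c.F2_Tinv]
  have N_k : N * k = k * N := by
    rw [hk]; simp only [mul_smul_comm, smul_mul_assoc, mul_sub, sub_mul, c.N_T, c.N_Tinv]
  have e_k : k * e = e * k := by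
    rw [hk]; simp only [mul_smul_comm, smul_mul_assoc, mul_sub, sub_mul, heT, heTi]
  have h1_E3 : h1 * E3 = E3 * h1 + E3 := by
    have : q * (T * E3) + q * (Tinv * E3) = (2 : ℂ) • E3 := by
      rw [← mul_assoc, ← mul_assoc, ← add_mul, ← mul_add, qp, two, smul_mul_assoc, one_mul]
    rw [hh1, mul_assoc, c.H1_E3, mul_add, mul_smul_comm, add_mul, mul_add, this, ← mul_assoc, ← E3_q,
      mul_assoc, smul_smul]
    norm_num
  have h1_F2 : h1 * F2 = F2 * h1 + F2 := by
    have : q * (T * F2) + q * (Tinv * F2) = (2 : ℂ) • F2 := by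
      rw [← mul_assoc, ← mul_assoc, ← add_mul, ← mul_add, qp, two, smul_mul_assoc, one_mul]
    rw [hh1, mul_assoc, c.H1_F2, mul_add, mul_smul_comm, add_mul, mul_add, this, ← mul_assoc, ← F2_q,
      mul_assoc, smul_smul]
    norm_num
  have h1_N : h1 * N = N * h1 := by
    rw [hh1, mul_assoc, c.H1_N, ← mul_assoc, ← N_q, mul_assoc]
  have N_e : N * e = e * N := by
    rw [hFe]
    simp only [mul_add, add_mul, mul_sub, sub_mul, neg_mul, mul_neg, mul_assoc, smul_mul_assoc,
      mul_smul_comm, smul_add, smul_sub, smul_neg, mul_one, one_mul, mul_zero, zero_mul,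
      smul_zero, add_zero, zero_add, sub_zero, zero_sub, neg_zero, neg_neg, sq, pow_succ,
      pow_zero, pow_one, c.N_E3, c.N_F2, mul_assoc_of_eq c.N_E3, mul_assoc_of_eq c.N_F2]
    module
  have F1_E2 : F1 * E2 = E2 * F1 - ((1 / 2 : ℂ) • (h * k * E2) + h * k * E3 * F1 -
      (1 / 4 : ℂ) • (h * h * E3 * (h1 * h1 + k * k * h1 * h1 + (2 : ℂ) • (k * k * h1))) -
      (3 / 4 : ℂ) • (h * h * E3 * (h1 + k * k * h1)) - (1 / 2 : ℂ) • (h * h * E3) -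
      (15 / 16 : ℂ) • (h * h * k * k * E3)) := by
    have hp : (T + Tinv) * E3 * H1 = (2 : ℂ) • (E3 * (h1 + k * k * h1)) := by
      rw [← mul_smul_comm, ← pH1, ← mul_assoc, mul_add E3, c.E3_T, c.E3_Tinv, add_mul]
    have hD : T - Tinv = (2 : ℂ) • k := by rw [hk, smul_smul]; norm_num
    rw [c.F1_E2, ← H1H1, hD]
    simp only [mul_assoc] at hp ⊢
    rw [hp]
    simp only [smul_mul_assoc, mul_smul_comm]
    module
  have E2_F2 : E2 * F2 = -(F2 * E2) + (1 / 2 : ℂ) • N - (1 / 2 : ℂ) • (h1 + k * k * h1) -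
      (1 / 4 : ℂ) • (k * k) - (1 / 2 : ℂ) • (h * k * E3 * F2) := by
    have hD : T - Tinv = (2 : ℂ) • k := by rw [hk, smul_smul]; norm_num
    rw [c.E2_F2, pH1, hD]
    simp only [smul_mul_assoc, mul_smul_comm]
    module
  have F1_E3 := c.F1_E3
  have E2_k : E2 * k = k * E2 - h * (1 + k * k) * E3 := by
    rw [c.E2_eq]
    linear_combination (norm := skip) F1 * E3_k + F1_k * E3 - E3 * F1_k - E3_k * F1
    simp only [mul_add, add_mul, mul_sub, sub_mul, neg_mul, mul_neg, mul_assoc, smul_mul_assoc,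
      mul_smul_comm, smul_add, smul_sub, smul_neg, mul_one, one_mul, mul_zero, zero_mul,
      smul_zero, add_zero, zero_add, sub_zero, zero_sub, neg_zero, neg_neg, sq, pow_succ,
      pow_zero, pow_one, h1_E3, E3_k, c.h_comm E3, c.h_comm k, mul_assoc_of_eq h1_E3,
      mul_assoc_of_eq E3_k, mul_assoc_of_eq (c.h_comm E3), mul_assoc_of_eq (c.h_comm k)]
    module
  rw [← hk] at he
  have h_e := c.h_comm e
  have h_k := c.h_comm k
  have h_E3 := c.h_comm E3
  have h_F2 := c.h_comm F2
  have h_E2 := c.h_comm E2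
  have h_N := c.h_comm N
  have h_h1 := c.h_comm h1
  have h_F1 := c.h_comm F1
  have h1_E2 : h1 * E2 = E2 * h1 - E2 - h * k * ((2 : ℂ) • (E3 * h1) + E3) := by
    rw [c.E2_eq]
    linear_combination (norm := skip) E3 * F1_h1 - F1_h1 * E3 + F1 * h1_E3 - h1_E3 * F1
    simp only [mul_add, add_mul, mul_sub, sub_mul, neg_mul, mul_neg, mul_assoc, smul_mul_assoc,
      mul_smul_comm, smul_add, smul_sub, smul_neg, mul_one, one_mul, mul_zero, zero_mul,
      smul_zero, add_zero, zero_add, sub_zero, zero_sub, neg_zero, neg_neg, sq, pow_succ,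
      pow_zero, pow_one, h1_E3, E3_k, c.h_comm E3, c.h_comm k, mul_assoc_of_eq h1_E3,
      mul_assoc_of_eq E3_k, mul_assoc_of_eq (c.h_comm E3), mul_assoc_of_eq (c.h_comm k)]
    module
  have h1_e : h1 * e = e * h1 + (2 : ℂ) • e := by
    have h3 : ∀ x y, h * (x * y) = x * (h * y) := fun x y => by
      rw [← mul_assoc, ← mul_assoc, c.h_comm]
    refine sub_eq_zero.1 (tf _ ?_)
    rw [mul_sub, mul_add, h3, ← mul_assoc h e, mul_smul_comm, he, h1_k, sub_self]
  have hhe : h * (h * e) = h * k := by rw [he]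
  have hf1 : f1 = F1 + (1 / 4 : ℂ) • (h * k * (h1 * h1 - 1)) := by rw [hh1, ← hhe]
  rw [hf1, ← hh1]
  clear_value f1
  refine ⟨fun hs => ?_, ?_⟩
  · constructor
    case e1_f1 =>
      refine sub_eq_zero.1 (tf _ ?_)
      have : ∀ x, h * (e * x - x * e - h1) = h * e * x - x * (h * e) - h * h1 := fun x => by
        simp only [mul_sub, ← mul_assoc, c.h_comm]
      rw [this, he]
      simp only [mul_add, add_mul, mul_sub, sub_mul, neg_mul, mul_neg, mul_assoc, smul_mul_assoc,
        mul_smul_comm, smul_add, smul_sub, smul_neg, mul_one, one_mul, mul_zero, zero_mul,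
        smul_zero, add_zero, zero_add, sub_zero, zero_sub, neg_zero, neg_neg, sq, pow_succ,
        pow_zero, pow_one, h1_k, F1_h1, F1_k, E3_k, F2_k, N_k, e_k, h1_E3, h1_F2, h1_N, N_e,
        F1_E2, c.F1_N, E2_F2, F1_E3, h_e, h_k, h_E3, h_F2, h_E2, h_N, h_h1, h_F1, c.N_E3, c.N_F2,
        hF, c.E3_E3, c.F2_F2, c.E2_E3, c.N_E2, h1_E2, E2_k, h1_e, heE, heF, mul_assoc_of_eq h1_k,
        mul_assoc_of_eq F1_h1, mul_assoc_of_eq F1_k, mul_assoc_of_eq E3_k, mul_assoc_of_eq F2_k,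
        mul_assoc_of_eq N_k, mul_assoc_of_eq e_k, mul_assoc_of_eq h1_E3, mul_assoc_of_eq h1_F2,
        mul_assoc_of_eq h1_N, mul_assoc_of_eq N_e, mul_assoc_of_eq F1_E2, mul_assoc_of_eq c.F1_N,
        mul_assoc_of_eq E2_F2, mul_assoc_of_eq F1_E3, mul_assoc_of_eq h_e, mul_assoc_of_eq h_k,
        mul_assoc_of_eq h_E3, mul_assoc_of_eq h_F2, mul_assoc_of_eq h_E2, mul_assoc_of_eq h_N,
        mul_assoc_of_eq h_h1, mul_assoc_of_eq h_F1, mul_assoc_of_eq c.N_E3, mul_assoc_of_eq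
        c.N_F2, mul_assoc_of_eq hF, mul_assoc_of_eq c.E3_E3, mul_assoc_of_eq c.F2_F2,
        mul_assoc_of_eq c.E2_E3, mul_assoc_of_eq c.N_E2, mul_assoc_of_eq h1_E2, mul_assoc_of_eq
        E2_k, mul_assoc_of_eq h1_e, mul_assoc_of_eq heE, mul_assoc_of_eq heF]
      module
    case f2_e3 => exact hFe.symm
    case serre_f => exact hs
    case e3_e3 => exact c.E3_E3
    case f2_f2 => exact c.F2_F2
    all_goals
      simp only [mul_add, add_mul, mul_sub, sub_mul, neg_mul, mul_neg, mul_assoc, smul_mul_assoc,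
        mul_smul_comm, smul_add, smul_sub, smul_neg, mul_one, one_mul, mul_zero, zero_mul,
        smul_zero, add_zero, zero_add, sub_zero, zero_sub, neg_zero, neg_neg, sq, pow_succ,
        pow_zero, pow_one, h1_k, F1_h1, F1_k, E3_k, F2_k, N_k, e_k, h1_E3, h1_F2, h1_N, N_e,
        F1_E2, c.F1_N, E2_F2, F1_E3, he, h_e, h_k, h_E3, h_F2, h_E2, h_N, h_h1, h_F1, c.N_E3,
        c.N_F2, hF, c.E3_E3, c.F2_F2, c.E2_E3, c.N_E2, h1_E2, E2_k, h1_e, heE, heF,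
        mul_assoc_of_eq h1_k, mul_assoc_of_eq F1_h1, mul_assoc_of_eq F1_k, mul_assoc_of_eq E3_k,
        mul_assoc_of_eq F2_k, mul_assoc_of_eq N_k, mul_assoc_of_eq e_k, mul_assoc_of_eq h1_E3,
        mul_assoc_of_eq h1_F2, mul_assoc_of_eq h1_N, mul_assoc_of_eq N_e, mul_assoc_of_eq F1_E2,
        mul_assoc_of_eq c.F1_N, mul_assoc_of_eq E2_F2, mul_assoc_of_eq F1_E3, mul_assoc_of_eq he,
        mul_assoc_of_eq h_e, mul_assoc_of_eq h_k, mul_assoc_of_eq h_E3, mul_assoc_of_eq h_F2,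
        mul_assoc_of_eq h_E2, mul_assoc_of_eq h_N, mul_assoc_of_eq h_h1, mul_assoc_of_eq h_F1,
        mul_assoc_of_eq c.N_E3, mul_assoc_of_eq c.N_F2, mul_assoc_of_eq hF, mul_assoc_of_eq
        c.E3_E3, mul_assoc_of_eq c.F2_F2, mul_assoc_of_eq c.E2_E3, mul_assoc_of_eq c.N_E2,
        mul_assoc_of_eq h1_E2, mul_assoc_of_eq E2_k, mul_assoc_of_eq h1_e, mul_assoc_of_eq heE,
        mul_assoc_of_eq heF]
    all_goals module
  ·
    simp only [mul_add, add_mul, mul_sub, sub_mul, neg_mul, mul_neg, mul_assoc, smul_mul_assoc,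
      mul_smul_comm, smul_add, smul_sub, smul_neg, mul_one, one_mul, mul_zero, zero_mul,
      smul_zero, add_zero, zero_add, sub_zero, zero_sub, neg_zero, neg_neg, sq, pow_succ,
      pow_zero, pow_one, h1_k, F1_h1, F1_k, E3_k, F2_k, N_k, e_k, h1_E3, h1_F2, h1_N, N_e, F1_E2,
      c.F1_N, E2_F2, F1_E3, he, h_e, h_k, h_E3, h_F2, h_E2, h_N, h_h1, h_F1, c.N_E3, c.N_F2, hF,
      c.E3_E3, c.F2_F2, c.E2_E3, c.N_E2, h1_E2, E2_k, h1_e, heE, heF, mul_assoc_of_eq h1_k,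
      mul_assoc_of_eq F1_h1, mul_assoc_of_eq F1_k, mul_assoc_of_eq E3_k, mul_assoc_of_eq F2_k,
      mul_assoc_of_eq N_k, mul_assoc_of_eq e_k, mul_assoc_of_eq h1_E3, mul_assoc_of_eq h1_F2,
      mul_assoc_of_eq h1_N, mul_assoc_of_eq N_e, mul_assoc_of_eq F1_E2, mul_assoc_of_eq c.F1_N,
      mul_assoc_of_eq E2_F2, mul_assoc_of_eq F1_E3, mul_assoc_of_eq he, mul_assoc_of_eq h_e,
      mul_assoc_of_eq h_k, mul_assoc_of_eq h_E3, mul_assoc_of_eq h_F2, mul_assoc_of_eq h_E2,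
      mul_assoc_of_eq h_N, mul_assoc_of_eq h_h1, mul_assoc_of_eq h_F1, mul_assoc_of_eq c.N_E3,
      mul_assoc_of_eq c.N_F2, mul_assoc_of_eq hF, mul_assoc_of_eq c.E3_E3, mul_assoc_of_eq
      c.F2_F2, mul_assoc_of_eq c.E2_E3, mul_assoc_of_eq c.N_E2, mul_assoc_of_eq h1_E2,
      mul_assoc_of_eq E2_k, mul_assoc_of_eq h1_e, mul_assoc_of_eq heE, mul_assoc_of_eq heF]
    module

/-- The inverse of the nonlinear map. -/
theorem JCore.core {h T Tinv H1 F1 N E3 F2 E2 F3 e q : R}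
    (c : JCore h T Tinv H1 F1 N E3 F2 E2 F3) (tf : ∀ x : R, h * x = 0 → x = 0)
    (he : e = F2 * E3 + E3 * F2) (pq : (T + Tinv) * q = 2) (qp : q * (T + Tinv) = 2) :
    Core e (q * H1) (F1 + (1 / 4 : ℂ) • (h * (h * e) * (q * H1 * (q * H1) - 1))) N E3 F2 := by
  refine (c.core_aux tf he pq qp).1 ?_
  have := (c.symm.core_aux tf (e := e) (by rw [he]; simp only [neg_mul_neg]; abel) pq qp).2
  simp only [mul_neg, neg_mul, ← neg_sub', sub_neg_eq_add, neg_add_eq_sub] at this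
  generalize F1 + (1 / 4 : ℂ) • (h * (h * e) * (q * H1 * (q * H1) - 1)) = f at this ⊢
  rw [← neg_inj, neg_zero, ← this]
  noncomm_ring

end Reduced

/-! ## Topological generation and homomorphisms to complete algebras -/

open Gen in
theorem u_induction {P : U → Prop} (hc : ∀ r : ℂ, P (algebraMap ℂ U r))
    (hadd : ∀ a b, P a → P b → P (a + b)) (hmul : ∀ a b, P a → P b → P (a * b))
    (he3 : P (u e3)) (hf2 : P (u f2)) (hf1 : P (u f1)) (a : U) : P a := by
  have hs : ∀ (r : ℂ) a, P a → P (r • a) := fun r a h => by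
    rw [Algebra.smul_def]; exact hmul _ _ (hc r) h
  have hsub : ∀ a b, P a → P b → P (a - b) := fun a b ha hb => by
    have := hadd _ _ ha (hs (-1) b hb)
    rwa [neg_one_smul, ← sub_eq_add_neg] at this
  have he1 : P (u e1) := by
    rw [← core_u.f2_e3]; exact hadd _ _ (hmul _ _ hf2 he3) (hmul _ _ he3 hf2)
  have hh1 : P (u h1) := by
    rw [← core_u.e1_f1]; exact hsub _ _ (hmul _ _ he1 hf1) (hmul _ _ hf1 he1)
  have he2 : P (u e2) := by
    rw [u_e2]; exact hsub _ _ (hmul _ _ hf1 he3) (hmul _ _ he3 hf1)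
  have hf3 : P (u f3) := by
    rw [u_f3]; exact hsub _ _ (hmul _ _ hf2 hf1) (hmul _ _ hf1 hf2)
  have hn : P un := by
    have : un = (2 : ℂ) • (u e2 * u f2 + u f2 * u e2) + u h1 := by
      rw [u_e2, core_u.e2_f2]; module
    rw [this]
    exact hadd _ _ (hs _ _ (hadd _ _ (hmul _ _ he2 hf2) (hmul _ _ hf2 he2))) hh1
  have hgen : ∀ x, P (u x) := by
    intro x
    cases x
    case h2 => rw [u_h2]; exact hs _ _ (hsub _ _ hn hh1)
    case h3 => rw [u_h3]; exact hs _ _ (hadd _ _ hn hh1)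
    all_goals assumption
  obtain ⟨a, rfl⟩ := proj_surjective a
  induction a using FreeAlgebra.induction with
  | grade0 r => rw [AlgHom.commutes]; exact hc r
  | grade1 x => exact hgen x
  | mul a b ha hb => rw [map_mul]; exact hmul _ _ ha hb
  | add a b ha hb => rw [map_add]; exact hadd _ _ ha hb

theorem linearMap_ext_gens {N : Type*} [AddCommGroup N] [Module ℂ⟦X⟧ N] [Separated N]
    {L₁ L₂ : U⟦X⟧ →ₗ[ℂ⟦X⟧] N} {x y z : U⟦X⟧} (hx : coeff 0 x = u .e3) (hy : coeff 0 y = u .f2)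
    (hz : coeff 0 z = u .f1) (h1 : L₁ 1 = L₂ 1)
    (hmul : ∀ a b, L₁ a = L₂ a → L₁ b = L₂ b → L₁ (a * b) = L₂ (a * b))
    (h_x : L₁ x = L₂ x) (h_y : L₁ y = L₂ y) (h_z : L₁ z = L₂ z) : L₁ = L₂ := by
  refine eq_of_submodule_dense (LinearMap.eqLocus L₁ L₂) (fun m => ?_) fun s hs => hs
  have : ∃ s ∈ LinearMap.eqLocus L₁ L₂, coeff 0 s = coeff 0 m := by
    refine u_induction (P := fun a => ∃ s ∈ LinearMap.eqLocus L₁ L₂, coeff 0 s = a) ?_ ?_ ?_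
      ⟨x, h_x, hx⟩ ⟨y, h_y, hy⟩ ⟨z, h_z, hz⟩ _
    · intro r
      refine ⟨(C r : ℂ⟦X⟧) • 1, Submodule.smul_mem _ _ h1, ?_⟩
      rw [Algebra.smul_def, mul_one]
      change coeff 0 (PowerSeries.map _ (C r)) = _
      simp
    · rintro a b ⟨s, hs, rfl⟩ ⟨t, ht, rfl⟩
      exact ⟨s + t, Submodule.add_mem _ hs ht, map_add _ _ _⟩
    · rintro a b ⟨s, hs, rfl⟩ ⟨t, ht, rfl⟩
      refine ⟨s * t, hmul s t hs ht, ?_⟩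
      simp
  obtain ⟨s, hs, h⟩ := this
  obtain ⟨b, hb⟩ := exists_hbar_smul (a := m - s) (by rw [map_sub, h, sub_self])
  exact ⟨s, hs, b, by rw [← hb]; abel⟩

theorem algHom_ext_gens {R : Type*} [Ring R] [Algebra ℂ⟦X⟧ R] [Separated R]
    {f g : U⟦X⟧ →ₐ[ℂ⟦X⟧] R} {x y z : U⟦X⟧} (hx : coeff 0 x = u .e3) (hy : coeff 0 y = u .f2)
    (hz : coeff 0 z = u .f1) (h_x : f x = g x) (h_y : f y = g y) (h_z : f z = g z) : f = g :=
  AlgHom.toLinearMap_injective (linearMap_ext_gens hx hy hz (by simp) (by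
    intro a b ha hb
    simp only [AlgHom.toLinearMap_apply, map_mul] at *
    rw [ha, hb]) h_x h_y h_z)

theorem coeff_zero_jordan_E3 : coeff 0 jordanGens.E3 = u .e3 := by simp [jordanGens]

theorem coeff_zero_jordan_F2 : coeff 0 jordanGens.F2 = u .f2 := by simp [jordanGens]

theorem coeff_zero_jordan_F1 : coeff 0 jordanGens.F1 = u .f1 := by
  simp only [jordanGens, map_sub, PowerSeries.coeff_smul, sq hbar, mul_smul, coeff_zero_hbar_smul]
  simp

theorem algHom_ext_jordan {R : Type*} [Ring R] [Algebra ℂ⟦X⟧ R] [Separated R]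
    {f g : U⟦X⟧ →ₐ[ℂ⟦X⟧] R} (h_E3 : f jordanGens.E3 = g jordanGens.E3)
    (h_F2 : f jordanGens.F2 = g jordanGens.F2) (h_F1 : f jordanGens.F1 = g jordanGens.F1) : f = g :=
  algHom_ext_gens coeff_zero_jordan_E3 coeff_zero_jordan_F2 coeff_zero_jordan_F1 h_E3 h_F2 h_F1

section Complete

variable {B : Type*} [AddCommGroup B] [Module ℂ⟦X⟧ B] [hB : IsAdicComplete (Ideal.span {hbar}) B]

theorem exists_adicSum (x : ℕ → B) :
    ∃ s : B, ∀ n, ∃ b, s = ∑ k ∈ Finset.range n, hbar ^ k • x k + hbar ^ n • b := by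
  obtain ⟨s, hs⟩ := IsPrecomplete.prec hB.toIsPrecomplete
    (f := fun n => ∑ k ∈ Finset.range n, hbar ^ k • x k) (by
      intro m n hmn
      obtain ⟨d, rfl⟩ := Nat.exists_eq_add_of_le hmn
      rw [SModEq.comm, SModEq.sub_mem, mem_span_hbar_pow_smul_top]
      refine ⟨∑ k ∈ Finset.range d, hbar ^ k • x (m + k), ?_⟩
      rw [Finset.sum_range_add, add_sub_cancel_left, Finset.smul_sum]
      exact Finset.sum_congr rfl fun k _ => by rw [smul_smul, pow_add])
  refine ⟨s, fun n => ?_⟩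
  have := hs n
  rw [SModEq.comm, SModEq.sub_mem, mem_span_hbar_pow_smul_top] at this
  obtain ⟨b, hb⟩ := this
  exact ⟨b, by rw [← hb]; abel⟩

/-- The sum `∑ₖ hᵏ xₖ` in a complete module. -/
def adicSum (x : ℕ → B) : B := (exists_adicSum x).choose

theorem adicSum_spec (x : ℕ → B) (n : ℕ) :
    ∃ b, adicSum x = ∑ k ∈ Finset.range n, hbar ^ k • x k + hbar ^ n • b :=
  (exists_adicSum x).choose_spec n

theorem eq_adicSum {x : ℕ → B} {s : B}
    (h : ∀ n, ∃ b, s = ∑ k ∈ Finset.range n, hbar ^ k • x k + hbar ^ n • b) : s = adicSum x := by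
  have : Separated B := hB.toIsHausdorff
  refine eq_of_forall_pow fun n => ?_
  obtain ⟨b, hb⟩ := h n
  obtain ⟨c, hc⟩ := adicSum_spec x n
  exact ⟨b - c, by rw [hb, hc, smul_sub]; abel⟩

end Complete

section CompleteAlgebra

variable {A B : Type*} [Ring A] [Algebra ℂ A] [Ring B] [Algebra ℂ B] [Algebra ℂ⟦X⟧ B]
  [IsScalarTower ℂ ℂ⟦X⟧ B] [hB : IsAdicComplete (Ideal.span {hbar}) B]

/-- The extension of a homomorphism `A → B` to `A⟦h⟧`, for a complete algebra `B`. -/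
def completeLift (f : A →ₐ[ℂ] B) : A⟦X⟧ →ₐ[ℂ⟦X⟧] B :=
  haveI : Separated B := hB.toIsHausdorff
  have hC : ∀ a, adicSum (fun n => f (coeff n (C a : A⟦X⟧))) = f a := fun a => by
    refine (eq_adicSum fun n => ?_).symm
    cases n with
    | zero => exact ⟨f a, by simp⟩
    | succ n =>
      refine ⟨0, ?_⟩
      rw [Finset.sum_range_succ', Finset.sum_eq_zero]
      · simp
      · intro k _
        rw [PowerSeries.coeff_succ_C, map_zero, smul_zero]
  homOfLinear
    (ofHbar
      { toFun := fun a => adicSum fun n => f (coeff n a)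
        map_add' := fun a b => by
          refine (eq_adicSum fun n => ?_).symm
          obtain ⟨s, hs⟩ := adicSum_spec (fun n => f (coeff n a)) n
          obtain ⟨t, ht⟩ := adicSum_spec (fun n => f (coeff n b)) n
          refine ⟨s + t, ?_⟩
          rw [hs, ht, smul_add]
          simp only [map_add, smul_add, Finset.sum_add_distrib]
          abel
        map_smul' := fun c a => by
          refine (eq_adicSum fun n => ?_).symm
          obtain ⟨s, hs⟩ := adicSum_spec (fun n => f (coeff n a)) n
          refine ⟨c • s, ?_⟩
          rw [hs, RingHom.id_apply, smul_add, Finset.smul_sum, smul_comm c (hbar ^ n)]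
          congr 1
          refine Finset.sum_congr rfl fun k _ => ?_
          rw [PowerSeries.coeff_smul, map_smul, smul_comm] }
      (fun a => by
        refine (eq_adicSum fun n => ?_).symm
        cases n with
        | zero => exact ⟨hbar • adicSum fun n => f (coeff n a), by simp⟩
        | succ n =>
          obtain ⟨s, hs⟩ := adicSum_spec (fun n => f (coeff n a)) n
          refine ⟨s, ?_⟩
          change hbar • (adicSum fun n => f (coeff n a)) = _
          rw [hs, Finset.sum_range_succ', smul_add, Finset.smul_sum, coeff_zero_hbar_smul, map_zero,
            smul_zero, add_zero, smul_smul, ← pow_succ']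
          congr 1
          refine Finset.sum_congr rfl fun k _ => ?_
          rw [smul_smul, ← pow_succ', coeff_succ_hbar_smul]))
    (by
      rw [← map_one (C (R := A))]
      exact (hC 1).trans (map_one f))
    (fun a b => by
      rw [← map_mul]
      exact (hC _).trans ((map_mul f a b).trans (congrArg₂ _ (hC a).symm (hC b).symm)))

theorem completeLift_C (f : A →ₐ[ℂ] B) (a : A) : completeLift f (C a) = f a := by
  refine (eq_adicSum fun n => ?_).symm
  cases n with
  | zero => exact ⟨f a, by simp⟩
  | succ n =>
    refine ⟨0, ?_⟩
    rw [Finset.sum_range_succ', Finset.sum_eq_zero]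
    · simp
    · intro k _
      rw [PowerSeries.coeff_succ_C, map_zero, smul_zero]

theorem exists_inverse (b : B) : ∃ q, (1 + hbar • b) * q = 1 ∧ q * (1 + hbar • b) = 1 := by
  have : Separated B := hB.toIsHausdorff
  have hb : ∀ k, hbar ^ k • (-b) ^ k = (-(hbar • b)) ^ k := fun k => by
    rw [← smul_neg, smul_pow]
  refine ⟨adicSum fun k => (-b) ^ k, ?_, ?_⟩ <;> refine eq_of_forall_pow fun n => ?_ <;>
    obtain ⟨s, hs⟩ := adicSum_spec (fun k => (-b) ^ k) n
  · refine ⟨(1 + hbar • b) * s - (-b) ^ n, ?_⟩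
    have := mul_neg_geom_sum (-(hbar • b)) n
    rw [sub_neg_eq_add] at this
    rw [hs, mul_add, smul_sub, hb, mul_smul_comm]
    simp only [hb]
    rw [this]
    abel
  · refine ⟨s * (1 + hbar • b) - (-b) ^ n, ?_⟩
    have := geom_sum_mul_neg (-(hbar • b)) n
    rw [sub_neg_eq_add] at this
    rw [hs, add_mul, smul_sub, hb, smul_mul_assoc]
    simp only [hb]
    rw [this]
    abel

end CompleteAlgebra

/-- Square roots that are `1` modulo `h` are unique. -/
theorem eq_of_mul_self_eq {B : Type*} [Ring B] [Algebra ℂ B] [Algebra ℂ⟦X⟧ B]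
    [IsScalarTower ℂ ℂ⟦X⟧ B] [Separated B] (tf : ∀ b : B, hbar • b = 0 → b = 0) {x y x' y' : B}
    (hx : x = 1 + hbar • x') (hy : y = 1 + hbar • y') (h : x * x = y * y) : x = y := by
  rw [← sub_eq_zero]
  refine eq_zero_of_step (fun m => (2 : ℂ) • m + hbar • (y' * m + m * y' + (x' - y') * m) = 0) ?_ ?_
  · intro m hm
    have h2 : m = hbar • ((-1 / 2 : ℂ) • (y' * m + m * y' + (x' - y') * m)) := by
      rw [smul_comm]
      rw [← eq_neg_iff_add_eq_zero, eq_comm, neg_eq_iff_eq_neg] at hm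
      rw [hm, smul_neg, smul_smul]
      norm_num
    refine ⟨_, ?_, h2⟩
    generalize (-1 / 2 : ℂ) • (y' * m + m * y' + (x' - y') * m) = m' at h2
    refine tf _ ?_
    rw [← hm, h2]
    simp only [smul_add, mul_smul_comm, smul_mul_assoc]
    rw [smul_comm hbar (2 : ℂ)]
  · have : x - y = hbar • (x' - y') := by rw [hx, hy, smul_sub]; abel
    have h3 : hbar • (y' * (x - y) + (x - y) * y' + (x' - y') * (x - y)) =
        (y - 1) * (x - y) + (x - y) * (y - 1) + (x - y) * (x - y) := by
      rw [smul_add, smul_add, ← smul_mul_assoc, ← mul_smul_comm, ← smul_mul_assoc, ← this, hy]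
      simp
    rw [h3, two_smul]
    linear_combination (norm := noncomm_ring) h

theorem exists_sqrtSeries_eq {A : Type*} [Ring A] [Algebra ℂ A] (e : A) :
    ∃ x, sqrtSeries e = 1 + hbar • x := by
  obtain ⟨x, hx⟩ := exists_hbar_smul (a := sqrtSeries e - 1)
    (coeff_zero_sub_one (coeff_zero_hpow _ _))
  exact ⟨x, by rw [← hx]; abel⟩

theorem jordan_T : jordanGens.T = sqrtSeries (u .e1) + hbar • C (u .e1) := add_comm _ _

theorem jordan_Tinv : jordanGens.Tinv = sqrtSeries (u .e1) - hbar • C (u .e1) := by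
  rw [sub_eq_add_neg]; exact add_comm _ _

theorem jordan_H1 : jordanGens.H1 = sqrtSeries (u .e1) * C (u .h1) := half_TSeries_mul _ _

theorem jordan_F1 : jordanGens.F1 =
    C (u .f1) - (1 / 4 : ℂ) • hbar ^ 2 • (C (u .e1) * (C (u .h1) * C (u .h1) - 1)) := by
  change C (u .f1) - (1 / 4 : ℂ) • hbar ^ 2 • C (u .e1 * (u .h1 ^ 2 - 1)) = _
  rw [map_mul, map_sub, sq (u .h1), map_mul, map_one]

theorem Gens.ext_jordan {R : Type*} [Ring R] [Algebra ℂ R] {h : R} {g g' : Gens R}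
    (d : DeformedRelations h g) (d' : DeformedRelations h g') (hc : ∀ x, x * h = h * x)
    (tf : ∀ x : R, h * x = 0 → x = 0) (hT : g.T = g'.T) (hTi : g.Tinv = g'.Tinv)
    (hH : g.H1 = g'.H1) (hF : g.F1 = g'.F1) (hN : g.H2 + g.H3 = g'.H2 + g'.H3)
    (hE3 : g.E3 = g'.E3) (hF2 : g.F2 = g'.F2) : g = g' := by
  have h2 : g.H2 = g'.H2 := by
    rw [JCore.jordan_H2 d hc tf, JCore.jordan_H2 d' hc tf, hN, hT, hTi, hH]
  have h3 : g.H3 = g'.H3 := by rw [h2] at hN; exact add_left_cancel hN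
  have hE2 : g.E2 = g'.E2 := by rw [← d.F1_E3, ← d'.F1_E3, hF, hE3]
  have hF3 : g.F3 = g'.F3 := by rw [← d.F2_F1, ← d'.F2_F1, hF, hF2]
  cases g; cases g'
  simp_all

theorem DeformedRelations.map {R S : Type*} [Ring R] [Algebra ℂ R] [Ring S] [Algebra ℂ S]
    {h : R} {g : Gens R} (d : DeformedRelations h g) (φ : R →ₐ[ℂ] S) :
    DeformedRelations (φ h) (g.map φ) := by
  obtain ⟨T_Tinv, Tinv_T, H1_T, H1_Tinv, T_F1, Tinv_F1, H1_F1, H1_H2, H1_H3, H2_H3, H1_E2, H1_F2,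
    H1_E3, H1_F3, H2_T, H2_Tinv, H2_F1, H2_E2, H2_F2, H2_E3, H2_F3, H3_T, H3_Tinv, H3_F1, H3_E2,
    H3_F2, H3_E3, H3_F3, E2_F2, E3_F3, T_F2, Tinv_F2, E2_F1, E2_sq, F2_sq, E3_sq, F3_sq, T_E2,
    Tinv_E2, F2_F1, T_E3, Tinv_E3, F3_F1, E2_E3, F2_F3, F1_E3, T_F3, Tinv_F3, F2_E3, F3_E2⟩ := d
  constructor <;> simp only [Gens.map, Ring.lie_def] at * <;>
    simp only [← map_mul, ← map_add, ← map_sub, ← map_neg, ← map_smul, ← map_pow, ← map_one φ,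
      ← map_ofNat φ, ← map_zero φ] <;> apply congrArg <;> assumption

theorem existsUnique_lift {B : Type*} [Ring B] [Algebra ℂ B] [Algebra ℂ⟦X⟧ B]
    [IsScalarTower ℂ ℂ⟦X⟧ B] [hB : IsAdicComplete (Ideal.span {(hbar : ℂ⟦X⟧)}) B]
    (tf : ∀ b : B, hbar • b = 0 → b = 0) (g : Gens B) (d : DeformedRelations (hIn B) g)
    (hT : ∃ b : B, g.T = 1 + hbar • b) :
    ∃! ψ : U⟦X⟧ →ₐ[ℂ⟦X⟧] B, jordanGens.map ψ = g := by
  have : Separated B := hB.toIsHausdorff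
  have hm : ∀ x : B, hIn B * x = hbar • x := fun x => (Algebra.smul_def _ _).symm
  have hc : ∀ x, x * hIn B = hIn B * x := fun x => (Algebra.commutes _ _).symm
  have tf' : ∀ x : B, hIn B * x = 0 → x = 0 := fun x hx => tf x (by rwa [← hm])
  obtain ⟨b, hb⟩ := hT
  have c := JCore.of_deformed d hc tf'
  obtain ⟨q, hq1, hq2⟩ := exists_inverse ((1 / 2 : ℂ) • (b - b * g.Tinv))
  have hTi : g.Tinv = 1 - hbar • (b * g.Tinv) := by
    have := c.T_Tinv
    rw [hb, add_mul, one_mul, smul_mul_assoc] at this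
    rw [eq_sub_iff_add_eq, this]
  set y' := (1 / 2 : ℂ) • (b - b * g.Tinv) with hy'
  have hp : g.T + g.Tinv = (2 : ℂ) • (1 + hbar • y') := by
    rw [hy', smul_comm hbar, smul_add, smul_smul, hb]
    nth_rw 1 [hTi]
    rw [smul_sub]
    norm_num
    rw [two_smul ℂ (1 : B)]
    abel
  have two : (2 : B) = (2 : ℂ) • 1 := by rw [Algebra.smul_def, map_ofNat, mul_one]
  have c' := c.core tf' rfl (q := q) (by rw [hp, smul_mul_assoc, hq1, two])
    (by rw [hp, mul_smul_comm, hq2, two])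
  set e := g.F2 * g.E3 + g.E3 * g.F2 with he
  have hk : hbar • e = (1 / 2 : ℂ) • (g.T - g.Tinv) := by
    rw [← hm, he]; exact d.F2_E3
  let ψ := completeLift c'.lift
  have ψC : ∀ a, ψ (C a) = c'.lift a := completeLift_C _
  have ψe : ψ (C (u .e1)) = e := by rw [ψC, Core.lift_u]; rfl
  have ψh : ψ (C (u .h1)) = q * g.H1 := by rw [ψC, Core.lift_u]; rfl
  have ψf : ψ (C (u .f1)) =
      g.F1 + (1 / 4 : ℂ) • (hIn B * (hIn B * e) * (q * g.H1 * (q * g.H1) - 1)) := by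
    rw [ψC, Core.lift_u]; rfl
  have ψE3 : ψ (C (u .e3)) = g.E3 := by rw [ψC, Core.lift_u]; rfl
  have ψF2 : ψ (C (u .f2)) = g.F2 := by rw [ψC, Core.lift_u]; rfl
  have hsm : ∀ (r : ℂ) x, ψ (r • x) = r • ψ x := fun r x =>
    map_smul (ψ.toLinearMap.restrictScalars ℂ) r x
  have ψn : ψ (C un) = g.H2 + g.H3 := by
    rw [ψC, un, map_add, Core.lift_u, Core.lift_u]
    change (1 / 2 : ℂ) • (g.H2 + g.H3 - q * g.H1) + (1 / 2 : ℂ) • (g.H2 + g.H3 + q * g.H1) = _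
    module
  have ψp : ψ (sqrtSeries (u .e1)) = 1 + hbar • y' := by
    obtain ⟨x, hx⟩ := exists_sqrtSeries_eq (u .e1)
    refine eq_of_mul_self_eq tf (x' := ψ x) (by rw [hx, map_add, map_one, map_smul]) rfl ?_
    have h1 : 1 + hbar • y' = (1 / 2 : ℂ) • (g.T + g.Tinv) := by
      rw [hp, smul_smul]; norm_num
    rw [← map_mul, sqrtSeries_mul_self, map_add, map_one, map_smul, sq (u .e1), map_mul C,
      map_mul ψ, ψe, h1, sq hbar, mul_smul, ← mul_smul_comm, ← smul_mul_assoc, hk]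
    simp only [smul_mul_assoc, mul_smul_comm, add_mul, mul_add, sub_mul, mul_sub, c.T_Tinv, c.Tinv_T]
    module
  have hψ : jordanGens.map ψ = g := by
    have hh : (ψ.restrictScalars ℂ) (hIn U⟦X⟧) = hIn B := ψ.commutes _
    have dψ := deformedRelations_jordanGens.map (ψ.restrictScalars ℂ)
    rw [hh] at dψ
    have h1 : 1 + hbar • y' = (1 / 2 : ℂ) • (g.T + g.Tinv) := by
      rw [hp, smul_smul]; norm_num
    refine Gens.ext_jordan dψ d hc tf' ?_ ?_ ?_ ?_ ?_ ?_ ?_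
    · change ψ jordanGens.T = _
      rw [jordan_T, map_add, map_smul, ψp, ψe, hk, h1]; module
    · change ψ jordanGens.Tinv = _
      rw [jordan_Tinv, map_sub, map_smul, ψp, ψe, hk, h1]; module
    · change ψ jordanGens.H1 = _
      rw [jordan_H1, map_mul, ψp, ψh, ← mul_assoc, hq1, one_mul]
    · change ψ jordanGens.F1 = _
      rw [jordan_F1, map_sub, hsm, map_smul, map_mul, map_sub, map_mul, map_one, ψh, ψe, ψf, hm, hm,
        smul_mul_assoc, smul_mul_assoc, smul_smul, ← sq]
      abel
    · change ψ jordanGens.H2 + ψ jordanGens.H3 = _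
      rw [← map_add, ← ψn, jordan_H2, jordan_H3]
      congr 1
      module
    · exact ψE3
    · exact ψF2
  refine ⟨ψ, hψ, fun ψ' hψ' => ?_⟩
  rw [← hψ] at hψ'
  exact algHom_ext_jordan (congrArg Gens.E3 hψ') (congrArg Gens.F2 hψ') (congrArg Gens.F1 hψ')

/-! ## The grading and the automorphism -/

theorem parity_u (x : Gen) : SuperAlgebra.parity (u x) = if x.odd then -u x else u x := by
  change liftU signHom signHom_rel (u x) = _
  rw [u, liftU_proj, signHom_gen]
  rfl

theorem parity_e3 : SuperAlgebra.parity (u .e3) = -u .e3 := parity_u .e3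

theorem parity_f2 : SuperAlgebra.parity (u .f2) = -u .f2 := parity_u .f2

theorem parity_f1 : SuperAlgebra.parity (u .f1) = u .f1 := parity_u .f1

theorem parity_h1 : SuperAlgebra.parity (u .h1) = u .h1 := parity_u .h1

theorem parity_e1 : SuperAlgebra.parity (u .e1) = u .e1 := parity_u .e1

theorem parity_un : SuperAlgebra.parity un = un := by
  rw [un, map_add, parity_u, parity_u]; rfl

section EvenOdd

variable {A : Type*} [Ring A] [Algebra ℂ A] [SuperAlgebra A]

theorem Even.C {a : A} (h : SuperAlgebra.parity a = a) : Even (C a : A⟦X⟧) := by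
  rw [Even, hparity_C, h]

theorem Odd.C {a : A} (h : SuperAlgebra.parity a = -a) : Odd (C a : A⟦X⟧) := by
  rw [Odd, hparity_C, h, map_neg]

theorem even_sqrtSeries {e : A} (h : SuperAlgebra.parity e = e) : Even (sqrtSeries e) :=
  Even.hpow (Even.one.add (Even.hsmul (Even.C (by rw [map_pow, h])) _)) (coeff_zero_sqrt_arg e) _

theorem even_TSeries {e : A} (h : SuperAlgebra.parity e = e) : Even (TSeries e) :=
  ((Even.C h).hsmul _).add (even_sqrtSeries h)

theorem even_TinvSeries {e : A} (h : SuperAlgebra.parity e = e) : Even (TinvSeries e) :=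
  ((Even.C h).hsmul _).neg.add (even_sqrtSeries h)

end EvenOdd

theorem even_T : Even jordanGens.T := even_TSeries parity_e1

theorem even_Tinv : Even jordanGens.Tinv := even_TinvSeries parity_e1

theorem even_H1 : Even jordanGens.H1 := by
  rw [jordan_H1]; exact (even_sqrtSeries parity_e1).mul (Even.C parity_h1)

theorem even_F1 : Even jordanGens.F1 := by
  rw [jordan_F1]
  exact (Even.C parity_f1).sub ((((Even.C parity_e1).mul
    (((Even.C parity_h1).mul (Even.C parity_h1)).sub Even.one)).hsmul _).csmul _)

theorem odd_E3 : Odd jordanGens.E3 := Odd.C parity_e3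

theorem odd_F2 : Odd jordanGens.F2 := Odd.C parity_f2

theorem isParity_jordan : IsParity jordanGens hparity where
  T := even_T
  Tinv := even_Tinv
  H1 := even_H1
  F1 := even_F1
  H2 := by
    rw [jordan_H2]
    exact ((Even.C parity_un).csmul _).sub (((even_T.add even_Tinv).mul even_H1).csmul _)
  H3 := by
    rw [jordan_H3]
    exact ((Even.C parity_un).csmul _).add (((even_T.add even_Tinv).mul even_H1).csmul _)
  E2 := by
    rw [jcore.E2_eq]
    exact (even_F1.mul_odd odd_E3).sub (odd_E3.mul_even even_F1)
  F2 := odd_F2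
  E3 := odd_E3
  F3 := by
    rw [jcore.symm.E2_eq]
    exact (even_F1.mul_odd odd_F2.neg).sub (odd_F2.neg.mul_even even_F1)

theorem eq_hparity (π : U⟦X⟧ →ₐ[ℂ⟦X⟧] U⟦X⟧) (h : IsParity jordanGens π) (a : U⟦X⟧) :
    π a = hparity a := by
  have : π = hparityHom U := algHom_ext_jordan (h.E3.trans isParity_jordan.E3.symm)
    (h.F2.trans isParity_jordan.F2.symm) (h.F1.trans isParity_jordan.F1.symm)
  rw [this]
  rfl

/-- The symmetry of the relations of `Core`. -/
theorem Core.symm {R : Type*} [Ring R] [Algebra ℂ R] {e1 h1 f1 n e3 f2 : R}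
    (c : Core e1 h1 f1 n e3 f2) : Core e1 h1 f1 (-n) (-f2) (-e3) where
  h1_f1 := c.h1_f1
  e1_f1 := c.e1_f1
  n_f1 := by linear_combination (norm := noncomm_ring) -c.n_f1
  n_e3 := by linear_combination (norm := noncomm_ring) c.n_f2
  n_f2 := by linear_combination (norm := noncomm_ring) c.n_e3
  h1_e3 := by linear_combination (norm := noncomm_ring) -c.h1_f2
  h1_f2 := by linear_combination (norm := noncomm_ring) -c.h1_e3
  e3_e3 := by rw [neg_mul_neg, c.f2_f2]
  f2_f2 := by rw [neg_mul_neg, c.e3_e3]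
  f2_e3 := by rw [neg_mul_neg, neg_mul_neg, add_comm, c.f2_e3]
  serre_e := by linear_combination (norm := noncomm_ring) -c.serre_f
  serre_f := by linear_combination (norm := noncomm_ring) -c.serre_e
  e2_f2 := by
    linear_combination (norm := skip) -c.e3_f3
    simp only [mul_neg, neg_mul, mul_sub, sub_mul, smul_add, smul_sub, smul_neg]
    abel

/-- The classical automorphism that `Φ` extends. -/
def phi : U →ₐ[ℂ] U := core_u.symm.lift

/-- The automorphism `Φ`, as a homomorphism. -/
def PhiHom : U⟦X⟧ →ₐ[ℂ⟦X⟧] U⟦X⟧ := coeffHom phi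

theorem PhiHom_u (x : Gen) :
    PhiHom (C (u x)) = C (Core.image (u .e1) (u .h1) (u .f1) (-un) (-u .f2) (-u .e3) x) := by
  rw [PhiHom, coeffHom_C, phi, Core.lift_u]

theorem PhiHom_sqrt : PhiHom (sqrtSeries (u .e1)) = sqrtSeries (u .e1) := by
  rw [sqrtSeries, algHom_hpow _ (coeff_zero_sqrt_arg _), map_add, map_one, map_smul, map_pow,
    map_pow, PhiHom_u]
  rfl

theorem isPhi_PhiHom : IsPhi jordanGens PhiHom := by
  have he : PhiHom (C (u .e1)) = C (u .e1) := PhiHom_u .e1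
  have hh : PhiHom (C (u .h1)) = C (u .h1) := PhiHom_u .h1
  have hf : PhiHom (C (u .f1)) = C (u .f1) := PhiHom_u .f1
  have he3 : PhiHom jordanGens.E3 = -jordanGens.F2 := (PhiHom_u .e3).trans (map_neg _ _)
  have hf2 : PhiHom jordanGens.F2 = -jordanGens.E3 := (PhiHom_u .f2).trans (map_neg _ _)
  have hn : PhiHom (C un) = -C un := by
    have h : Core.image (u .e1) (u .h1) (u .f1) (-un) (-u .f2) (-u .e3) .h2 +
        Core.image (u .e1) (u .h1) (u .f1) (-un) (-u .f2) (-u .e3) .h3 = -un := by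
      simp only [Core.image]; module
    rw [un, map_add, map_add, PhiHom_u, PhiHom_u, ← map_add, h, map_neg, un, map_add]
  have hT : PhiHom jordanGens.T = jordanGens.T := by
    rw [jordan_T, map_add, map_smul, PhiHom_sqrt, he]
  have hTi : PhiHom jordanGens.Tinv = jordanGens.Tinv := by
    rw [jordan_Tinv, map_sub, map_smul, PhiHom_sqrt, he]
  have hH1 : PhiHom jordanGens.H1 = jordanGens.H1 := by
    rw [jordan_H1, map_mul, PhiHom_sqrt, hh]
  have hsm : ∀ (r : ℂ) x, PhiHom (r • x) = r • PhiHom x := fun r x =>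
    map_smul (PhiHom.toLinearMap.restrictScalars ℂ) r x
  have hF1 : PhiHom jordanGens.F1 = jordanGens.F1 := by
    rw [jordan_F1, map_sub, hsm, map_smul, map_mul, map_sub, map_mul, map_one, hh, he, hf]
  exact
    { T := hT
      Tinv := hTi
      F1 := hF1
      H1 := hH1
      E2 := by rw [jcore.E2_eq, map_sub, map_mul, map_mul, hF1, he3, jcore.symm.E2_eq]
      F2 := hf2
      H2 := by
        rw [jordan_H2, map_sub, hsm, hsm, map_mul, map_add, hT, hTi, hH1, hn, jordan_H3]; module
      E3 := he3
      F3 := by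
        rw [jcore.symm.E2_eq, map_sub, map_mul, map_mul, hF1, map_neg, hf2, neg_neg, jcore.E2_eq]
      H3 := by
        rw [jordan_H3, map_add, hsm, hsm, map_mul, map_add, hT, hTi, hH1, hn, jordan_H2]; module }

theorem PhiHom_PhiHom : PhiHom.comp PhiHom = AlgHom.id ℂ⟦X⟧ U⟦X⟧ := by
  have h := isPhi_PhiHom
  refine algHom_ext_jordan ?_ ?_ ?_ <;> simp [h.E3, h.F2, h.F1]

theorem existsUnique_isPhi : ∃! Φ : U⟦X⟧ ≃ₐ[ℂ⟦X⟧] U⟦X⟧, IsPhi jordanGens Φ := by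
  refine ⟨AlgEquiv.ofAlgHom PhiHom PhiHom PhiHom_PhiHom PhiHom_PhiHom, isPhi_PhiHom,
    fun Ψ hΨ => ?_⟩
  have : (Ψ : U⟦X⟧ →ₐ[ℂ⟦X⟧] U⟦X⟧) = PhiHom :=
    algHom_ext_jordan (hΨ.E3.trans isPhi_PhiHom.E3.symm) (hΨ.F2.trans isPhi_PhiHom.F2.symm)
      (hΨ.F1.trans isPhi_PhiHom.F1.symm)
  exact AlgEquiv.ext fun a => DFunLike.congr_fun this a

section Primed

variable {R : Type*} [Ring R] [Algebra ℂ R]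

theorem JCore.primed_e2 {h T Tinv H1 F1 N E3 F2 E2 F3 σ : R}
    (c : JCore h T Tinv H1 F1 N E3 F2 E2 F3) (ss : σ * σ = Tinv) (Ts : T * σ = σ * T)
    (H1s : H1 * σ = σ * H1 - (1 / 2 : ℂ) • (σ * T - σ * Tinv))
    (F1s : F1 * σ = σ * F1 + h * σ * ((1 / 2 : ℂ) • H1 - (1 / 8 : ℂ) • (T - Tinv))) :
    let f1 := T * F1 - (1 / 2 : ℂ) • (h * (T * H1) * (T * H1)) - (1 / 8 : ℂ) • (h * (T * T - 1))
    f1 * (σ * E3) - σ * E3 * f1 = σ * T * E2 - (1 / 2 : ℂ) • (h * σ * T * E3 * H1) +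
      (1 / 8 : ℂ) • (h * σ * T * T * E3 - h * σ * E3) := by
  intro f1
  have Tis : Tinv * σ = σ * Tinv := by
    rw [← ss, mul_assoc]
  simp only [f1]
  simp only [mul_add, add_mul, mul_sub, sub_mul, neg_mul, mul_neg, mul_assoc, smul_mul_assoc,
    mul_smul_comm, smul_add, smul_sub, smul_neg, mul_one, one_mul, mul_zero, zero_mul, smul_zero,
    add_zero, zero_add, sub_zero, zero_sub, neg_zero, neg_neg, sq, pow_succ, pow_zero, pow_one,
    c.T_Tinv, c.Tinv_T, c.H1_T, c.F1_T, c.F1_H1, c.N_T, c.H1_N, c.F1_N, c.N_E3, c.N_F2, c.H1_E3,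
    c.H1_F2, c.E3_T, c.F2_T, c.E3_E3, c.F2_F2, c.F1_E3, c.F1_F2, c.H1_Tinv, c.N_Tinv, c.E3_Tinv,
    c.F2_Tinv, c.F1_Tinv, c.H1_E2, c.N_E2, c.N_F3, c.E2_T, c.E2_Tinv, c.F3_T, c.F3_Tinv, c.F1_E2,
    c.F1_F3, c.H1_F3, c.E2_E3, c.F3_F2, c.E2_E2, c.F3_F3, c.F3_E3, c.E2_F2, c.F3_E2, c.h_comm T,
    c.h_comm Tinv, c.h_comm H1, c.h_comm F1, c.h_comm N, c.h_comm E3, c.h_comm F2, c.h_comm E2,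
    c.h_comm F3, c.h_comm σ, Ts, Tis, ss, H1s, F1s, mul_assoc_of_eq c.T_Tinv,
    mul_assoc_of_eq c.Tinv_T, mul_assoc_of_eq c.H1_T, mul_assoc_of_eq c.F1_T, mul_assoc_of_eq
    c.F1_H1, mul_assoc_of_eq c.N_T, mul_assoc_of_eq c.H1_N, mul_assoc_of_eq c.F1_N,
    mul_assoc_of_eq c.N_E3, mul_assoc_of_eq c.N_F2, mul_assoc_of_eq c.H1_E3, mul_assoc_of_eq
    c.H1_F2, mul_assoc_of_eq c.E3_T, mul_assoc_of_eq c.F2_T, mul_assoc_of_eq c.E3_E3,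
    mul_assoc_of_eq c.F2_F2, mul_assoc_of_eq c.F1_E3, mul_assoc_of_eq c.F1_F2, mul_assoc_of_eq
    c.H1_Tinv, mul_assoc_of_eq c.N_Tinv, mul_assoc_of_eq c.E3_Tinv, mul_assoc_of_eq c.F2_Tinv,
    mul_assoc_of_eq c.F1_Tinv, mul_assoc_of_eq c.H1_E2, mul_assoc_of_eq c.N_E2, mul_assoc_of_eq
    c.N_F3, mul_assoc_of_eq c.E2_T, mul_assoc_of_eq c.E2_Tinv, mul_assoc_of_eq c.F3_T,
    mul_assoc_of_eq c.F3_Tinv, mul_assoc_of_eq c.F1_E2, mul_assoc_of_eq c.F1_F3, mul_assoc_of_eq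
    c.H1_F3, mul_assoc_of_eq c.E2_E3, mul_assoc_of_eq c.F3_F2, mul_assoc_of_eq c.E2_E2,
    mul_assoc_of_eq c.F3_F3, mul_assoc_of_eq c.F3_E3, mul_assoc_of_eq c.E2_F2, mul_assoc_of_eq
    c.F3_E2, mul_assoc_of_eq (c.h_comm T), mul_assoc_of_eq (c.h_comm Tinv), mul_assoc_of_eq
    (c.h_comm H1), mul_assoc_of_eq (c.h_comm F1), mul_assoc_of_eq (c.h_comm N), mul_assoc_of_eq
    (c.h_comm E3), mul_assoc_of_eq (c.h_comm F2), mul_assoc_of_eq (c.h_comm E2), mul_assoc_of_eq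
    (c.h_comm F3), mul_assoc_of_eq (c.h_comm σ), mul_assoc_of_eq Ts, mul_assoc_of_eq Tis,
    mul_assoc_of_eq ss,
    mul_assoc_of_eq H1s, mul_assoc_of_eq F1s]
  module

set_option maxHeartbeats 1000000 in
theorem JCore.primed_serre {h T Tinv H1 F1 N E3 F2 E2 F3 σ : R}
    (c : JCore h T Tinv H1 F1 N E3 F2 E2 F3) (ss : σ * σ = Tinv) (Ts : T * σ = σ * T)
    (E3s : E3 * σ = σ * E3)
    (H1s : H1 * σ = σ * H1 - (1 / 2 : ℂ) • (σ * T - σ * Tinv))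
    (F1s : F1 * σ = σ * F1 + h * σ * ((1 / 2 : ℂ) • H1 - (1 / 8 : ℂ) • (T - Tinv))) :
    let f1 := T * F1 - (1 / 2 : ℂ) • (h * (T * H1) * (T * H1)) - (1 / 8 : ℂ) • (h * (T * T - 1))
    f1 * (f1 * (σ * E3) - σ * E3 * f1) - (f1 * (σ * E3) - σ * E3 * f1) * f1 = 0 := by
  intro f1
  have hg : f1 * (σ * E3) - σ * E3 * f1 = σ * T * E2 - (1 / 2 : ℂ) • (h * σ * T * E3 * H1) +
      (1 / 8 : ℂ) • (h * σ * T * T * E3 - h * σ * E3) := c.primed_e2 ss Ts H1s F1s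
  rw [hg]
  have Tis : Tinv * σ = σ * Tinv := by
    rw [← ss, mul_assoc]
  have E2s : E2 * σ = σ * E2 + (1 / 4 : ℂ) • (h * σ * (T + Tinv) * E3) := by
    rw [c.E2_eq]
    simp only [mul_add, add_mul, mul_sub, sub_mul, neg_mul, mul_neg, mul_assoc, smul_mul_assoc,
      mul_smul_comm, smul_add, smul_sub, smul_neg, mul_one, one_mul, mul_zero, zero_mul,
      smul_zero, add_zero, zero_add, sub_zero, zero_sub, neg_zero, neg_neg, sq, pow_succ,
      pow_zero, pow_one, c.T_Tinv, c.Tinv_T, c.H1_T, c.F1_T, c.F1_H1, c.N_T, c.H1_N, c.F1_N,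
      c.N_E3, c.N_F2, c.H1_E3, c.H1_F2, c.E3_T, c.F2_T, c.E3_E3, c.F2_F2, c.F1_F2, c.H1_Tinv,
      c.N_Tinv, c.E3_Tinv, c.F2_Tinv, c.F1_Tinv, c.H1_E2, c.N_E2, c.N_F3, c.E2_T, c.E2_Tinv,
      c.F3_T, c.F3_Tinv, c.F1_E2, c.F1_F3, c.H1_F3, c.E2_E3, c.F3_F2, c.E2_E2, c.F3_F3, c.F3_E3,
      c.E2_F2, c.F3_E2, c.h_comm T, c.h_comm Tinv, c.h_comm H1, c.h_comm F1, c.h_comm N, c.h_comm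
      E3, c.h_comm F2, c.h_comm E2, c.h_comm F3, c.h_comm σ, Ts, Tis, ss, E3s, H1s, F1s,
      mul_assoc_of_eq c.T_Tinv, mul_assoc_of_eq c.Tinv_T, mul_assoc_of_eq c.H1_T, mul_assoc_of_eq
      c.F1_T, mul_assoc_of_eq c.F1_H1, mul_assoc_of_eq c.N_T, mul_assoc_of_eq c.H1_N,
      mul_assoc_of_eq c.F1_N, mul_assoc_of_eq c.N_E3, mul_assoc_of_eq c.N_F2, mul_assoc_of_eq
      c.H1_E3, mul_assoc_of_eq c.H1_F2, mul_assoc_of_eq c.E3_T, mul_assoc_of_eq c.F2_T,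
      mul_assoc_of_eq c.E3_E3, mul_assoc_of_eq c.F2_F2, mul_assoc_of_eq c.F1_F2, mul_assoc_of_eq
      c.H1_Tinv, mul_assoc_of_eq c.N_Tinv, mul_assoc_of_eq c.E3_Tinv, mul_assoc_of_eq c.F2_Tinv,
      mul_assoc_of_eq c.F1_Tinv, mul_assoc_of_eq c.H1_E2, mul_assoc_of_eq c.N_E2, mul_assoc_of_eq
      c.N_F3, mul_assoc_of_eq c.E2_T, mul_assoc_of_eq c.E2_Tinv, mul_assoc_of_eq c.F3_T,
      mul_assoc_of_eq c.F3_Tinv, mul_assoc_of_eq c.F1_E2, mul_assoc_of_eq c.F1_F3, mul_assoc_of_eq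
      c.H1_F3, mul_assoc_of_eq c.E2_E3, mul_assoc_of_eq c.F3_F2, mul_assoc_of_eq c.E2_E2,
      mul_assoc_of_eq c.F3_F3, mul_assoc_of_eq c.F3_E3, mul_assoc_of_eq c.E2_F2, mul_assoc_of_eq
      c.F3_E2, mul_assoc_of_eq (c.h_comm T), mul_assoc_of_eq (c.h_comm Tinv), mul_assoc_of_eq
      (c.h_comm H1), mul_assoc_of_eq (c.h_comm F1), mul_assoc_of_eq (c.h_comm N), mul_assoc_of_eq
      (c.h_comm E3), mul_assoc_of_eq (c.h_comm F2), mul_assoc_of_eq (c.h_comm E2), mul_assoc_of_eq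
      (c.h_comm F3), mul_assoc_of_eq (c.h_comm σ), mul_assoc_of_eq Ts, mul_assoc_of_eq Tis,
      mul_assoc_of_eq ss, mul_assoc_of_eq E3s,
      mul_assoc_of_eq H1s, mul_assoc_of_eq F1s]
    module
  simp only [f1]
  simp only [mul_add, add_mul, mul_sub, sub_mul, neg_mul, mul_neg, mul_assoc, smul_mul_assoc,
    mul_smul_comm, smul_add, smul_sub, smul_neg, mul_one, one_mul, mul_zero, zero_mul, smul_zero,
    add_zero, zero_add, sub_zero, zero_sub, neg_zero, neg_neg, sq, pow_succ, pow_zero, pow_one,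
    c.T_Tinv, c.Tinv_T, c.H1_T, c.F1_T, c.F1_H1, c.N_T, c.H1_N, c.F1_N, c.N_E3, c.N_F2, c.H1_E3,
    c.H1_F2, c.E3_T, c.F2_T, c.E3_E3, c.F2_F2, c.F1_E3, c.F1_F2, c.H1_Tinv, c.N_Tinv, c.E3_Tinv,
    c.F2_Tinv, c.F1_Tinv, c.H1_E2, c.N_E2, c.N_F3, c.E2_T, c.E2_Tinv, c.F3_T, c.F3_Tinv, c.F1_E2,
    c.F1_F3, c.H1_F3, c.E2_E3, c.F3_F2, c.E2_E2, c.F3_F3, c.F3_E3, c.E2_F2, c.F3_E2, c.h_comm T,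
    c.h_comm Tinv, c.h_comm H1, c.h_comm F1, c.h_comm N, c.h_comm E3, c.h_comm F2, c.h_comm E2,
    c.h_comm F3, c.h_comm σ, Ts, Tis, ss, E3s, H1s, F1s, E2s, mul_assoc_of_eq c.T_Tinv,
    mul_assoc_of_eq c.Tinv_T, mul_assoc_of_eq c.H1_T, mul_assoc_of_eq c.F1_T, mul_assoc_of_eq
    c.F1_H1, mul_assoc_of_eq c.N_T, mul_assoc_of_eq c.H1_N, mul_assoc_of_eq c.F1_N,
    mul_assoc_of_eq c.N_E3, mul_assoc_of_eq c.N_F2, mul_assoc_of_eq c.H1_E3, mul_assoc_of_eq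
    c.H1_F2, mul_assoc_of_eq c.E3_T, mul_assoc_of_eq c.F2_T, mul_assoc_of_eq c.E3_E3,
    mul_assoc_of_eq c.F2_F2, mul_assoc_of_eq c.F1_E3, mul_assoc_of_eq c.F1_F2, mul_assoc_of_eq
    c.H1_Tinv, mul_assoc_of_eq c.N_Tinv, mul_assoc_of_eq c.E3_Tinv, mul_assoc_of_eq c.F2_Tinv,
    mul_assoc_of_eq c.F1_Tinv, mul_assoc_of_eq c.H1_E2, mul_assoc_of_eq c.N_E2, mul_assoc_of_eq
    c.N_F3, mul_assoc_of_eq c.E2_T, mul_assoc_of_eq c.E2_Tinv, mul_assoc_of_eq c.F3_T,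
    mul_assoc_of_eq c.F3_Tinv, mul_assoc_of_eq c.F1_E2, mul_assoc_of_eq c.F1_F3, mul_assoc_of_eq
    c.H1_F3, mul_assoc_of_eq c.E2_E3, mul_assoc_of_eq c.F3_F2, mul_assoc_of_eq c.E2_E2,
    mul_assoc_of_eq c.F3_F3, mul_assoc_of_eq c.F3_E3, mul_assoc_of_eq c.E2_F2, mul_assoc_of_eq
    c.F3_E2, mul_assoc_of_eq (c.h_comm T), mul_assoc_of_eq (c.h_comm Tinv), mul_assoc_of_eq
    (c.h_comm H1), mul_assoc_of_eq (c.h_comm F1), mul_assoc_of_eq (c.h_comm N), mul_assoc_of_eq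
    (c.h_comm E3), mul_assoc_of_eq (c.h_comm F2), mul_assoc_of_eq (c.h_comm E2), mul_assoc_of_eq
    (c.h_comm F3), mul_assoc_of_eq (c.h_comm σ), mul_assoc_of_eq Ts, mul_assoc_of_eq Tis,
    mul_assoc_of_eq ss, mul_assoc_of_eq E3s,
    mul_assoc_of_eq H1s, mul_assoc_of_eq F1s, mul_assoc_of_eq E2s]
  module

set_option maxHeartbeats 1000000 in
theorem JCore.primed {h T Tinv H1 F1 N E3 F2 E2 F3 σ : R}
    (c : JCore h T Tinv H1 F1 N E3 F2 E2 F3) (ss : σ * σ = Tinv) (Ts : T * σ = σ * T)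
    (Ns : N * σ = σ * N) (E3s : E3 * σ = σ * E3) (F2s : F2 * σ = σ * F2)
    (H1s : H1 * σ = σ * H1 - (1 / 2 : ℂ) • (σ * T - σ * Tinv))
    (F1s : F1 * σ = σ * F1 + h * σ * ((1 / 2 : ℂ) • H1 - (1 / 8 : ℂ) • (T - Tinv)))
    (tf : ∀ x : R, h * x = 0 → x = 0) :
    Core (Tinv * (F2 * E3 + E3 * F2)) (T * H1)
      (T * F1 - (1 / 2 : ℂ) • (h * (T * H1) * (T * H1)) - (1 / 8 : ℂ) • (h * (T * T - 1))) N
      (σ * E3) (σ * F2) := by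
  obtain ⟨f1, hf1⟩ : ∃ f1, f1 = T * F1 - (1 / 2 : ℂ) • (h * (T * H1) * (T * H1)) -
    (1 / 8 : ℂ) • (h * (T * T - 1)) := ⟨_, rfl⟩
  rw [← hf1]
  obtain ⟨e, hFe⟩ : ∃ e, e = F2 * E3 + E3 * F2 := ⟨_, rfl⟩
  rw [← hFe]
  have hF : F2 * E3 = -(E3 * F2) + e := by rw [hFe]; abel
  have he : h * e = (1 / 2 : ℂ) • (T - Tinv) := by rw [hFe, mul_add, c.F2_E3]; abel
  have heT : T * e = e * T := by
    rw [hFe, mul_add, add_mul, mul_assoc, mul_assoc, c.E3_T, c.F2_T, ← mul_assoc, ← mul_assoc,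
      ← mul_assoc, ← mul_assoc, c.E3_T, c.F2_T]
  have heTi : Tinv * e = e * Tinv := by
    rw [hFe, mul_add, add_mul, mul_assoc, mul_assoc, c.E3_Tinv, c.F2_Tinv, ← mul_assoc, ← mul_assoc,
      ← mul_assoc, ← mul_assoc, c.E3_Tinv, c.F2_Tinv]
  have heE : E3 * e = e * E3 := by
    simp only [hFe, mul_add, add_mul, mul_assoc, c.E3_E3, mul_assoc_of_eq c.E3_E3, mul_zero, zero_mul]
    abel
  have heF : F2 * e = e * F2 := by
    simp only [hFe, mul_add, add_mul, mul_assoc, c.F2_F2, mul_assoc_of_eq c.F2_F2, mul_zero, zero_mul]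
    abel
  have Tis : Tinv * σ = σ * Tinv := by
    rw [← ss, mul_assoc]
  have E2s : E2 * σ = σ * E2 + (1 / 4 : ℂ) • (h * σ * (T + Tinv) * E3) := by
    rw [c.E2_eq]
    simp only [mul_add, add_mul, mul_sub, sub_mul, neg_mul, mul_neg, mul_assoc, smul_mul_assoc,
      mul_smul_comm, smul_add, smul_sub, smul_neg, mul_one, one_mul, mul_zero, zero_mul,
      smul_zero, add_zero, zero_add, sub_zero, zero_sub, neg_zero, neg_neg, sq, pow_succ,
      pow_zero, pow_one, c.T_Tinv, c.Tinv_T, c.H1_T, c.F1_T, c.F1_H1, c.N_T, c.H1_N, c.F1_N,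
      c.N_E3, c.N_F2, c.H1_E3, c.H1_F2, c.E3_T, c.F2_T, c.E3_E3, c.F2_F2, c.F1_F2, c.H1_Tinv,
      c.N_Tinv, c.E3_Tinv, c.F2_Tinv, c.F1_Tinv, c.H1_E2, c.N_E2, c.N_F3, c.E2_T, c.E2_Tinv,
      c.F3_T, c.F3_Tinv, c.F1_E2, c.F1_F3, c.H1_F3, c.E2_E3, c.F3_F2, c.E2_E2, c.F3_F3, c.F3_E3,
      c.E2_F2, c.F3_E2, c.h_comm T, c.h_comm Tinv, c.h_comm H1, c.h_comm F1, c.h_comm N, c.h_comm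
      E3, c.h_comm F2, c.h_comm E2, c.h_comm F3, c.h_comm σ, Ts, Tis, ss, Ns, E3s, F2s, H1s, F1s,
      mul_assoc_of_eq c.T_Tinv, mul_assoc_of_eq c.Tinv_T, mul_assoc_of_eq c.H1_T, mul_assoc_of_eq
      c.F1_T, mul_assoc_of_eq c.F1_H1, mul_assoc_of_eq c.N_T, mul_assoc_of_eq c.H1_N,
      mul_assoc_of_eq c.F1_N, mul_assoc_of_eq c.N_E3, mul_assoc_of_eq c.N_F2, mul_assoc_of_eq
      c.H1_E3, mul_assoc_of_eq c.H1_F2, mul_assoc_of_eq c.E3_T, mul_assoc_of_eq c.F2_T,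
      mul_assoc_of_eq c.E3_E3, mul_assoc_of_eq c.F2_F2, mul_assoc_of_eq c.F1_F2, mul_assoc_of_eq
      c.H1_Tinv, mul_assoc_of_eq c.N_Tinv, mul_assoc_of_eq c.E3_Tinv, mul_assoc_of_eq c.F2_Tinv,
      mul_assoc_of_eq c.F1_Tinv, mul_assoc_of_eq c.H1_E2, mul_assoc_of_eq c.N_E2, mul_assoc_of_eq
      c.N_F3, mul_assoc_of_eq c.E2_T, mul_assoc_of_eq c.E2_Tinv, mul_assoc_of_eq c.F3_T,
      mul_assoc_of_eq c.F3_Tinv, mul_assoc_of_eq c.F1_E2, mul_assoc_of_eq c.F1_F3, mul_assoc_of_eq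
      c.H1_F3, mul_assoc_of_eq c.E2_E3, mul_assoc_of_eq c.F3_F2, mul_assoc_of_eq c.E2_E2,
      mul_assoc_of_eq c.F3_F3, mul_assoc_of_eq c.F3_E3, mul_assoc_of_eq c.E2_F2, mul_assoc_of_eq
      c.F3_E2, mul_assoc_of_eq (c.h_comm T), mul_assoc_of_eq (c.h_comm Tinv), mul_assoc_of_eq
      (c.h_comm H1), mul_assoc_of_eq (c.h_comm F1), mul_assoc_of_eq (c.h_comm N), mul_assoc_of_eq
      (c.h_comm E3), mul_assoc_of_eq (c.h_comm F2), mul_assoc_of_eq (c.h_comm E2), mul_assoc_of_eq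
      (c.h_comm F3), mul_assoc_of_eq (c.h_comm σ), mul_assoc_of_eq Ts, mul_assoc_of_eq Tis,
      mul_assoc_of_eq ss, mul_assoc_of_eq Ns, mul_assoc_of_eq E3s, mul_assoc_of_eq F2s,
      mul_assoc_of_eq H1s, mul_assoc_of_eq F1s]
    module
  have e_s : e * σ = σ * e := by
    rw [hFe]; simp only [add_mul, mul_add, mul_assoc, E3s, F2s, mul_assoc_of_eq E3s, mul_assoc_of_eq F2s]
  have e_N : N * e = e * N := by
    rw [hFe]
    simp only [mul_add, add_mul, mul_sub, sub_mul, mul_assoc, c.N_E3, c.N_F2, mul_assoc_of_eq c.N_E3, mul_assoc_of_eq c.N_F2]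
    abel
  have serre : f1 * (f1 * (σ * E3) - σ * E3 * f1) - (f1 * (σ * E3) - σ * E3 * f1) * f1 = 0 := by
    rw [hf1]; exact c.primed_serre ss Ts E3s H1s F1s
  have serre' : f1 * (f1 * (σ * -F2) - σ * -F2 * f1) - (f1 * (σ * -F2) - σ * -F2 * f1) * f1 = 0 := by
    rw [hf1]; exact c.symm.primed_serre ss Ts (by simp [F2s]) H1s F1s
  have hg : f1 * (σ * E3) - σ * E3 * f1 = σ * T * E2 - (1 / 2 : ℂ) • (h * σ * T * E3 * H1) +
      (1 / 8 : ℂ) • (h * σ * T * T * E3 - h * σ * E3) := by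
    rw [hf1]; exact c.primed_e2 ss Ts H1s F1s
  constructor
  case serre_e => exact serre
  case serre_f =>
    linear_combination (norm := skip) -serre'
    simp only [mul_neg, neg_mul, mul_sub, sub_mul]
    module
  case e2_f2 =>
    rw [hg]
    simp only [mul_add, add_mul, mul_sub, sub_mul, neg_mul, mul_neg, mul_assoc, smul_mul_assoc,
      mul_smul_comm, smul_add, smul_sub, smul_neg, mul_one, one_mul, mul_zero, zero_mul,
      smul_zero, add_zero, zero_add, sub_zero, zero_sub, neg_zero, neg_neg, sq, pow_succ,
      pow_zero, pow_one, c.T_Tinv, c.Tinv_T, c.H1_T, c.F1_T, c.F1_H1, c.N_T, c.H1_N, c.F1_N,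
      c.N_E3, c.N_F2, c.H1_E3, c.H1_F2, c.E3_T, c.F2_T, c.E3_E3, c.F2_F2, c.F1_E3, c.F1_F2,
      c.H1_Tinv, c.N_Tinv, c.E3_Tinv, c.F2_Tinv, c.F1_Tinv, c.H1_E2, c.N_E2, c.N_F3, c.E2_T,
      c.E2_Tinv, c.F3_T, c.F3_Tinv, c.F1_E2, c.F1_F3, c.H1_F3, c.E2_E3, c.F3_F2, c.E2_E2, c.F3_F3,
      c.F3_E3, c.E2_F2, c.F3_E2, c.h_comm T, c.h_comm Tinv, c.h_comm H1, c.h_comm F1, c.h_comm N,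
      c.h_comm E3, c.h_comm F2, c.h_comm E2, c.h_comm F3, c.h_comm e, c.h_comm σ, Ts, Tis, ss, Ns,
      E3s, F2s, H1s, F1s, E2s, e_s, heT, heTi, heE, heF, he, hF, e_N, mul_assoc_of_eq c.T_Tinv,
      mul_assoc_of_eq c.Tinv_T, mul_assoc_of_eq c.H1_T, mul_assoc_of_eq c.F1_T, mul_assoc_of_eq
      c.F1_H1, mul_assoc_of_eq c.N_T, mul_assoc_of_eq c.H1_N, mul_assoc_of_eq c.F1_N,
      mul_assoc_of_eq c.N_E3, mul_assoc_of_eq c.N_F2, mul_assoc_of_eq c.H1_E3, mul_assoc_of_eq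
      c.H1_F2, mul_assoc_of_eq c.E3_T, mul_assoc_of_eq c.F2_T, mul_assoc_of_eq c.E3_E3,
      mul_assoc_of_eq c.F2_F2, mul_assoc_of_eq c.F1_E3, mul_assoc_of_eq c.F1_F2, mul_assoc_of_eq
      c.H1_Tinv, mul_assoc_of_eq c.N_Tinv, mul_assoc_of_eq c.E3_Tinv, mul_assoc_of_eq c.F2_Tinv,
      mul_assoc_of_eq c.F1_Tinv, mul_assoc_of_eq c.H1_E2, mul_assoc_of_eq c.N_E2, mul_assoc_of_eq
      c.N_F3, mul_assoc_of_eq c.E2_T, mul_assoc_of_eq c.E2_Tinv, mul_assoc_of_eq c.F3_T,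
      mul_assoc_of_eq c.F3_Tinv, mul_assoc_of_eq c.F1_E2, mul_assoc_of_eq c.F1_F3, mul_assoc_of_eq
      c.H1_F3, mul_assoc_of_eq c.E2_E3, mul_assoc_of_eq c.F3_F2, mul_assoc_of_eq c.E2_E2,
      mul_assoc_of_eq c.F3_F3, mul_assoc_of_eq c.F3_E3, mul_assoc_of_eq c.E2_F2, mul_assoc_of_eq
      c.F3_E2, mul_assoc_of_eq (c.h_comm T), mul_assoc_of_eq (c.h_comm Tinv), mul_assoc_of_eq
      (c.h_comm H1), mul_assoc_of_eq (c.h_comm F1), mul_assoc_of_eq (c.h_comm N), mul_assoc_of_eq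
      (c.h_comm E3), mul_assoc_of_eq (c.h_comm F2), mul_assoc_of_eq (c.h_comm E2), mul_assoc_of_eq
      (c.h_comm F3), mul_assoc_of_eq (c.h_comm e), mul_assoc_of_eq (c.h_comm σ), mul_assoc_of_eq
      Ts, mul_assoc_of_eq Tis, mul_assoc_of_eq ss, mul_assoc_of_eq Ns, mul_assoc_of_eq E3s,
      mul_assoc_of_eq F2s, mul_assoc_of_eq H1s, mul_assoc_of_eq F1s, mul_assoc_of_eq E2s,
      mul_assoc_of_eq e_s, mul_assoc_of_eq heT, mul_assoc_of_eq heTi, mul_assoc_of_eq heE,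
      mul_assoc_of_eq heF, mul_assoc_of_eq he, mul_assoc_of_eq hF, mul_assoc_of_eq e_N]
    module
  case e1_f1 =>
    refine sub_eq_zero.1 (tf _ ?_)
    have : ∀ x, h * (Tinv * e * x - x * (Tinv * e) - T * H1) =
        Tinv * (h * e) * x - x * (Tinv * (h * e)) - h * (T * H1) := fun x => by
      simp only [mul_sub, mul_assoc, c.h_comm x, mul_assoc_of_eq (c.h_comm x), mul_assoc_of_eq (c.h_comm Tinv)]
    rw [this, he]
    rw [hf1]
    simp only [mul_add, add_mul, mul_sub, sub_mul, neg_mul, mul_neg, mul_assoc, smul_mul_assoc,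
      mul_smul_comm, smul_add, smul_sub, smul_neg, mul_one, one_mul, mul_zero, zero_mul,
      smul_zero, add_zero, zero_add, sub_zero, zero_sub, neg_zero, neg_neg, sq, pow_succ,
      pow_zero, pow_one, c.T_Tinv, c.Tinv_T, c.H1_T, c.F1_T, c.F1_H1, c.N_T, c.H1_N, c.F1_N,
      c.N_E3, c.N_F2, c.H1_E3, c.H1_F2, c.E3_T, c.F2_T, c.E3_E3, c.F2_F2, c.F1_E3, c.F1_F2,
      c.H1_Tinv, c.N_Tinv, c.E3_Tinv, c.F2_Tinv, c.F1_Tinv, c.H1_E2, c.N_E2, c.N_F3, c.E2_T,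
      c.E2_Tinv, c.F3_T, c.F3_Tinv, c.F1_E2, c.F1_F3, c.H1_F3, c.E2_E3, c.F3_F2, c.E2_E2, c.F3_F3,
      c.F3_E3, c.E2_F2, c.F3_E2, c.h_comm T, c.h_comm Tinv, c.h_comm H1, c.h_comm F1, c.h_comm N,
      c.h_comm E3, c.h_comm F2, c.h_comm E2, c.h_comm F3, c.h_comm e, c.h_comm σ, Ts, Tis, ss, Ns,
      E3s, F2s, H1s, F1s, E2s, e_s, heT, heTi, heE, heF, hF, e_N, mul_assoc_of_eq c.T_Tinv,
      mul_assoc_of_eq c.Tinv_T, mul_assoc_of_eq c.H1_T, mul_assoc_of_eq c.F1_T, mul_assoc_of_eq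
      c.F1_H1, mul_assoc_of_eq c.N_T, mul_assoc_of_eq c.H1_N, mul_assoc_of_eq c.F1_N,
      mul_assoc_of_eq c.N_E3, mul_assoc_of_eq c.N_F2, mul_assoc_of_eq c.H1_E3, mul_assoc_of_eq
      c.H1_F2, mul_assoc_of_eq c.E3_T, mul_assoc_of_eq c.F2_T, mul_assoc_of_eq c.E3_E3,
      mul_assoc_of_eq c.F2_F2, mul_assoc_of_eq c.F1_E3, mul_assoc_of_eq c.F1_F2, mul_assoc_of_eq
      c.H1_Tinv, mul_assoc_of_eq c.N_Tinv, mul_assoc_of_eq c.E3_Tinv, mul_assoc_of_eq c.F2_Tinv,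
      mul_assoc_of_eq c.F1_Tinv, mul_assoc_of_eq c.H1_E2, mul_assoc_of_eq c.N_E2, mul_assoc_of_eq
      c.N_F3, mul_assoc_of_eq c.E2_T, mul_assoc_of_eq c.E2_Tinv, mul_assoc_of_eq c.F3_T,
      mul_assoc_of_eq c.F3_Tinv, mul_assoc_of_eq c.F1_E2, mul_assoc_of_eq c.F1_F3, mul_assoc_of_eq
      c.H1_F3, mul_assoc_of_eq c.E2_E3, mul_assoc_of_eq c.F3_F2, mul_assoc_of_eq c.E2_E2,
      mul_assoc_of_eq c.F3_F3, mul_assoc_of_eq c.F3_E3, mul_assoc_of_eq c.E2_F2, mul_assoc_of_eq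
      c.F3_E2, mul_assoc_of_eq (c.h_comm T), mul_assoc_of_eq (c.h_comm Tinv), mul_assoc_of_eq
      (c.h_comm H1), mul_assoc_of_eq (c.h_comm F1), mul_assoc_of_eq (c.h_comm N), mul_assoc_of_eq
      (c.h_comm E3), mul_assoc_of_eq (c.h_comm F2), mul_assoc_of_eq (c.h_comm E2), mul_assoc_of_eq
      (c.h_comm F3), mul_assoc_of_eq (c.h_comm e), mul_assoc_of_eq (c.h_comm σ), mul_assoc_of_eq
      Ts, mul_assoc_of_eq Tis, mul_assoc_of_eq ss, mul_assoc_of_eq Ns, mul_assoc_of_eq E3s,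
      mul_assoc_of_eq F2s, mul_assoc_of_eq H1s, mul_assoc_of_eq F1s, mul_assoc_of_eq E2s,
      mul_assoc_of_eq e_s, mul_assoc_of_eq heT, mul_assoc_of_eq heTi, mul_assoc_of_eq heE,
      mul_assoc_of_eq heF, mul_assoc_of_eq hF, mul_assoc_of_eq e_N]
    module
  all_goals try rw [hf1]
  all_goals
    simp only [mul_add, add_mul, mul_sub, sub_mul, neg_mul, mul_neg, mul_assoc, smul_mul_assoc,
      mul_smul_comm, smul_add, smul_sub, smul_neg, mul_one, one_mul, mul_zero, zero_mul,
      smul_zero, add_zero, zero_add, sub_zero, zero_sub, neg_zero, neg_neg, sq, pow_succ,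
      pow_zero, pow_one, c.T_Tinv, c.Tinv_T, c.H1_T, c.F1_T, c.F1_H1, c.N_T, c.H1_N, c.F1_N,
      c.N_E3, c.N_F2, c.H1_E3, c.H1_F2, c.E3_T, c.F2_T, c.E3_E3, c.F2_F2, c.F1_E3, c.F1_F2,
      c.H1_Tinv, c.N_Tinv, c.E3_Tinv, c.F2_Tinv, c.F1_Tinv, c.H1_E2, c.N_E2, c.N_F3, c.E2_T,
      c.E2_Tinv, c.F3_T, c.F3_Tinv, c.F1_E2, c.F1_F3, c.H1_F3, c.E2_E3, c.F3_F2, c.E2_E2, c.F3_F3,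
      c.F3_E3, c.E2_F2, c.F3_E2, c.h_comm T, c.h_comm Tinv, c.h_comm H1, c.h_comm F1, c.h_comm N,
      c.h_comm E3, c.h_comm F2, c.h_comm E2, c.h_comm F3, c.h_comm e, c.h_comm σ, Ts, Tis, ss, Ns,
      E3s, F2s, H1s, F1s, E2s, e_s, heT, heTi, heE, heF, he, hF, e_N, mul_assoc_of_eq c.T_Tinv,
      mul_assoc_of_eq c.Tinv_T, mul_assoc_of_eq c.H1_T, mul_assoc_of_eq c.F1_T, mul_assoc_of_eq
      c.F1_H1, mul_assoc_of_eq c.N_T, mul_assoc_of_eq c.H1_N, mul_assoc_of_eq c.F1_N,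
      mul_assoc_of_eq c.N_E3, mul_assoc_of_eq c.N_F2, mul_assoc_of_eq c.H1_E3, mul_assoc_of_eq
      c.H1_F2, mul_assoc_of_eq c.E3_T, mul_assoc_of_eq c.F2_T, mul_assoc_of_eq c.E3_E3,
      mul_assoc_of_eq c.F2_F2, mul_assoc_of_eq c.F1_E3, mul_assoc_of_eq c.F1_F2, mul_assoc_of_eq
      c.H1_Tinv, mul_assoc_of_eq c.N_Tinv, mul_assoc_of_eq c.E3_Tinv, mul_assoc_of_eq c.F2_Tinv,
      mul_assoc_of_eq c.F1_Tinv, mul_assoc_of_eq c.H1_E2, mul_assoc_of_eq c.N_E2, mul_assoc_of_eq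
      c.N_F3, mul_assoc_of_eq c.E2_T, mul_assoc_of_eq c.E2_Tinv, mul_assoc_of_eq c.F3_T,
      mul_assoc_of_eq c.F3_Tinv, mul_assoc_of_eq c.F1_E2, mul_assoc_of_eq c.F1_F3, mul_assoc_of_eq
      c.H1_F3, mul_assoc_of_eq c.E2_E3, mul_assoc_of_eq c.F3_F2, mul_assoc_of_eq c.E2_E2,
      mul_assoc_of_eq c.F3_F3, mul_assoc_of_eq c.F3_E3, mul_assoc_of_eq c.E2_F2, mul_assoc_of_eq
      c.F3_E2, mul_assoc_of_eq (c.h_comm T), mul_assoc_of_eq (c.h_comm Tinv), mul_assoc_of_eq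
      (c.h_comm H1), mul_assoc_of_eq (c.h_comm F1), mul_assoc_of_eq (c.h_comm N), mul_assoc_of_eq
      (c.h_comm E3), mul_assoc_of_eq (c.h_comm F2), mul_assoc_of_eq (c.h_comm E2), mul_assoc_of_eq
      (c.h_comm F3), mul_assoc_of_eq (c.h_comm e), mul_assoc_of_eq (c.h_comm σ), mul_assoc_of_eq
      Ts, mul_assoc_of_eq Tis, mul_assoc_of_eq ss, mul_assoc_of_eq Ns, mul_assoc_of_eq E3s,
      mul_assoc_of_eq F2s, mul_assoc_of_eq H1s, mul_assoc_of_eq F1s, mul_assoc_of_eq E2s,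
      mul_assoc_of_eq e_s, mul_assoc_of_eq heT, mul_assoc_of_eq heTi, mul_assoc_of_eq heE,
      mul_assoc_of_eq heF, mul_assoc_of_eq he, mul_assoc_of_eq hF, mul_assoc_of_eq e_N]
  all_goals module

end Primed

section Root

variable {A : Type*} [Ring A] [Algebra ℂ A] {h T Tinv H1 F1 N E3 F2 E2 F3 : A⟦X⟧}

theorem coeff_zero_mul_eq (a b : A⟦X⟧) : coeff 0 (a * b) = coeff 0 a * coeff 0 b := by
  simp

theorem hpow_neg_half_mul_half {a : A⟦X⟧} (ha : coeff 0 a = 1) :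
    hpow a (-1 / 2) * hpow a (1 / 2) = 1 := by
  rw [← hpow_add ha, ← hpow_zero ha]; norm_num

theorem hpow_half_mul_neg_half {a : A⟦X⟧} (ha : coeff 0 a = 1) :
    hpow a (1 / 2) * hpow a (-1 / 2) = 1 := by
  rw [← hpow_add ha, ← hpow_zero ha]; norm_num

theorem hpow_half_mul_half {a : A⟦X⟧} (ha : coeff 0 a = 1) :
    hpow a (1 / 2) * hpow a (1 / 2) = a := by
  rw [← sq, hpow_half_sq ha]

theorem hpow_commute {a x : A⟦X⟧} (ha : coeff 0 a = 1) (h : x * a = a * x) (r : ℂ) :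
    x * hpow a r = hpow a r * x :=
  (subst_commute (coeff_zero_sub_one ha) (by rw [sub_mul, mul_sub, h, one_mul, mul_one]) _).symm

theorem hlog_commute {a x : A⟦X⟧} (ha : coeff 0 a = 1) (h : x * a = a * x) :
    x * hlog a = hlog a * x :=
  (subst_commute (coeff_zero_sub_one ha) (by rw [sub_mul, mul_sub, h, one_mul, mul_one]) _).symm

namespace JCore

variable (c : JCore h T Tinv H1 F1 N E3 F2 E2 F3) (hT : coeff 0 T = 1)

include c hT

theorem neg_half_sq : hpow T (-1 / 2) * hpow T (-1 / 2) = Tinv := by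
  have h1 := hpow_half_mul_neg_half hT
  have h2 := hpow_neg_half_mul_half hT
  have h3 := hpow_half_mul_half hT
  have : T * (hpow T (-1 / 2) * hpow T (-1 / 2)) = 1 := by
    rw [← mul_assoc]; nth_rw 1 [← h3]; rw [mul_assoc (hpow T (1 / 2)), h1, mul_one, h1]
  rw [← one_mul (_ * _), ← c.Tinv_T, mul_assoc, this, mul_one]

theorem half_eq : hpow T (1 / 2) = hpow T (-1 / 2) * T := by
  nth_rw 3 [← hpow_half_mul_half hT]
  rw [← mul_assoc, hpow_neg_half_mul_half hT, one_mul]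

theorem T_neg_half : T * hpow T (-1 / 2) = hpow T (-1 / 2) * T := hpow_commute hT rfl _

theorem N_neg_half : N * hpow T (-1 / 2) = hpow T (-1 / 2) * N := hpow_commute hT c.N_T _

theorem E3_neg_half : E3 * hpow T (-1 / 2) = hpow T (-1 / 2) * E3 := hpow_commute hT c.E3_T _

theorem F2_neg_half : F2 * hpow T (-1 / 2) = hpow T (-1 / 2) * F2 := hpow_commute hT c.F2_T _

theorem Tinv_neg_half : Tinv * hpow T (-1 / 2) = hpow T (-1 / 2) * Tinv :=
  hpow_commute hT (by rw [c.T_Tinv, c.Tinv_T]) _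

theorem H1_neg_half : H1 * hpow T (-1 / 2) = hpow T (-1 / 2) * H1 -
    (1 / 2 : ℂ) • (hpow T (-1 / 2) * T - hpow T (-1 / 2) * Tinv) := by
  have h1 := hpow_half_mul_of_comm_two (x := H1) (y := 1 - T * T) (z := 0) hT
    (by rw [c.H1_T]; abel) (by noncomm_ring) (by simp)
  have h2 := c.neg_half_sq hT
  have h3 := c.T_neg_half hT
  have h4 := hpow_half_mul_neg_half hT
  have h5 := hpow_neg_half_mul_half hT
  set σ := hpow T (-1 / 2)
  set ρ := hpow T (1 / 2)
  have h6 : Tinv * σ = σ * Tinv := by rw [← h2, mul_assoc]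
  linear_combination (norm := skip) σ * h1 * σ - h5 * H1 * σ + σ * H1 * h4
  simp only [mul_add, add_mul, mul_sub, sub_mul, mul_assoc, smul_mul_assoc, mul_smul_comm, h2, h3,
    mul_assoc_of_eq h3, mul_one, one_mul, zero_mul, smul_zero, mul_zero, h6, mul_assoc_of_eq h2,
    mul_assoc_of_eq h6, mul_assoc_of_eq c.Tinv_T, mul_assoc_of_eq c.T_Tinv, c.T_Tinv, c.Tinv_T]
  module

theorem F1_neg_half : F1 * hpow T (-1 / 2) = hpow T (-1 / 2) * F1 +
    h * hpow T (-1 / 2) * ((1 / 2 : ℂ) • H1 - (1 / 8 : ℂ) • (T - Tinv)) := by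
  have h1 := hpow_half_mul_of_comm_two (x := F1) (y := h * T * H1 + (1 / 2 : ℂ) • (h * T * T - h))
    (z := h * T - h * T * T * T) hT (by rw [c.F1_T]; module) (by
      simp only [mul_add, add_mul, mul_sub, sub_mul, mul_assoc, smul_mul_assoc, mul_smul_comm,
        c.H1_T, mul_assoc_of_eq c.H1_T, c.h_comm T, mul_assoc_of_eq (c.h_comm T), one_mul, mul_one]
      module) (by
      simp only [mul_sub, sub_mul, mul_assoc, c.h_comm T, mul_assoc_of_eq (c.h_comm T)])
  have h2 := c.neg_half_sq hT
  have h3 := c.T_neg_half hT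
  have h4 := hpow_half_mul_neg_half hT
  have h5 := hpow_neg_half_mul_half hT
  have h7 := c.H1_neg_half hT
  set σ := hpow T (-1 / 2)
  set ρ := hpow T (1 / 2)
  have h6 : Tinv * σ = σ * Tinv := by rw [← h2, mul_assoc]
  linear_combination (norm := skip) σ * h1 * σ - h5 * F1 * σ + σ * F1 * h4
  simp only [mul_add, add_mul, mul_sub, sub_mul, mul_assoc, smul_mul_assoc, mul_smul_comm, h2, h3,
    mul_assoc_of_eq h3, mul_one, one_mul, h6, mul_assoc_of_eq h2, pow_succ, pow_zero, h7,
    c.h_comm T, c.h_comm σ, c.h_comm Tinv, c.h_comm H1, mul_assoc_of_eq (c.h_comm T),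
    mul_assoc_of_eq (c.h_comm σ), mul_assoc_of_eq (c.h_comm H1), mul_assoc_of_eq h7,
    mul_assoc_of_eq h6, smul_sub, smul_add, mul_assoc_of_eq c.H1_T, c.H1_Tinv,
    c.T_Tinv, c.Tinv_T, mul_assoc_of_eq c.T_Tinv, mul_assoc_of_eq c.Tinv_T]
  module

theorem log_F1 : hlog T * F1 = F1 * hlog T + h * H1 := by
  rw [hlog_mul_of_comm_two (x := F1) (y := h * T * H1 + (1 / 2 : ℂ) • (h * T * T - h))
    (z := h * T - h * T * T * T) hT c.Tinv_T (by rw [c.F1_T]; module) (by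
      simp only [mul_add, add_mul, mul_sub, sub_mul, mul_assoc, smul_mul_assoc, mul_smul_comm,
        c.H1_T, mul_assoc_of_eq c.H1_T, c.h_comm T, mul_assoc_of_eq (c.h_comm T), one_mul, mul_one]
      module) (by
      simp only [mul_sub, sub_mul, mul_assoc, c.h_comm T, mul_assoc_of_eq (c.h_comm T)])]
  simp only [mul_add, add_mul, mul_sub, sub_mul, mul_assoc, smul_mul_assoc, mul_smul_comm, mul_one,
    one_mul, c.H1_Tinv, c.T_Tinv, c.Tinv_T, mul_assoc_of_eq c.T_Tinv]
  module

theorem log_H1 : hlog T * H1 = H1 * hlog T - (T - Tinv) := by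
  rw [hlog_mul_of_comm_two (x := H1) (y := 1 - T * T) (z := 0) hT c.Tinv_T
    (by rw [c.H1_T]; abel) (by noncomm_ring) (by simp)]
  simp only [sub_mul, mul_assoc, c.T_Tinv, one_mul, mul_one, zero_mul, smul_zero]
  abel

theorem coeff_zero_Tinv : coeff 0 Tinv = 1 := by
  have := congrArg (coeff 0) c.T_Tinv
  rwa [coeff_zero_mul_eq, hT, one_mul, PowerSeries.coeff_zero_one] at this

/-- Generators on which the coproduct becomes primitive after a twist. -/
theorem core_primed (tf : ∀ x : A⟦X⟧, h * x = 0 → x = 0) :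
    Core (Tinv * (F2 * E3 + E3 * F2)) (T * H1)
      (T * F1 - (1 / 2 : ℂ) • (h * (T * H1) * (T * H1)) - (1 / 8 : ℂ) • (h * (T * T - 1))) N
      (hpow T (-1 / 2) * E3) (hpow T (-1 / 2) * F2) :=
  c.primed (c.neg_half_sq hT) (c.T_neg_half hT) (c.N_neg_half hT) (c.E3_neg_half hT)
    (c.F2_neg_half hT) (c.H1_neg_half hT) (c.F1_neg_half hT) tf

end JCore

end Root

theorem coeff_zero_jordan_T : coeff 0 jordanGens.T = 1 := coeff_zero_TSeries _

theorem hIn_torsionFree (x : U⟦X⟧) (hx : hIn U⟦X⟧ * x = 0) : x = 0 :=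
  hbar_smul_injective (by rw [← hIn_mul, hx, smul_zero])

/-- An endomorphism of `U⟦h⟧` given by a family of generators that reduces to the classical one. -/
theorem Core.bijective {e1 h1 f1 n e3 f2 : U⟦X⟧} (c : Core e1 h1 f1 n e3 f2)
    (he3 : coeff 0 e3 = u .e3) (hf2 : coeff 0 f2 = u .f2) (hf1 : coeff 0 f1 = u .f1) :
    Function.Bijective (liftHom c.lift) := by
  refine bijective_of_id_mod (liftHom c.lift).toLinearMap fun a => ?_
  have h0 : ∀ a, coeff 0 (c.lift a) = a := by
    intro a
    induction a using u_induction with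
    | hc r => rw [AlgHom.commutes, PowerSeries.algebraMap_apply]; simp
    | hadd a b ha hb => rw [map_add, map_add, ha, hb]
    | hmul a b ha hb => rw [map_mul, coeff_zero_mul_eq, ha, hb]
    | he3 => rw [c.lift_u]; exact he3
    | hf2 => rw [c.lift_u]; exact hf2
    | hf1 => rw [c.lift_u]; exact hf1
  conv_lhs => rw [exists_decomp a]
  rw [AlgHom.toLinearMap_apply, map_add, map_smul, map_add, coeff_zero_hbar_smul, add_zero, liftHom_C, h0]

theorem Core.liftHom_image {B : Type*} [Ring B] [Algebra ℂ B] {e1 h1 f1 n e3 f2 : B⟦X⟧}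
    (c : Core e1 h1 f1 n e3 f2) : liftHom c.lift (C (u .e1)) = e1 ∧
      liftHom c.lift (C (u .h1)) = h1 ∧ liftHom c.lift (C (u .f1)) = f1 ∧
      liftHom c.lift (C un) = n ∧ liftHom c.lift (C (u .e3)) = e3 ∧
      liftHom c.lift (C (u .f2)) = f2 := by
  refine ⟨?_, ?_, ?_, ?_, ?_, ?_⟩
  case refine_4 =>
    rw [un, map_add, map_add, liftHom_C, liftHom_C, c.lift_u, c.lift_u]
    simp only [Core.image]; module
  all_goals rw [liftHom_C, c.lift_u]; rfl

/-! ## The twist -/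

section Twist

variable {A : Type*} [Ring A] [Algebra ℂ A] [SuperAlgebra A]

theorem hexp_one_htmul {y : A⟦X⟧} (hy : coeff 0 y = 0) :
    hexp ((1 : A⟦X⟧) ⊗ʰ y) = (1 : A⟦X⟧) ⊗ʰ hexp y := by
  rw [← inclRight_apply, ← inclRight_apply, algHom_hexp _ hy]

theorem coeff_zero_htmul_of_right (x : A⟦X⟧) {y : A⟦X⟧} (hy : coeff 0 y = 0) :
    coeff 0 (x ⊗ʰ y) = 0 := by
  obtain ⟨y', rfl⟩ := exists_hbar_smul hy
  rw [htmul_hsmul, coeff_zero_hbar_smul]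

theorem coeff_zero_neg {a : A⟦X⟧} (h : coeff 0 a = 0) : coeff 0 (-a) = 0 := by
  rw [map_neg, h, neg_zero]

variable {K L : A⟦X⟧} (hK : Even K) (hL : Even L) (hL0 : coeff 0 L = 0)

include hK hL hL0

/-- The action of the twist on an eigenvector of `ad K` in the first factor. -/
theorem twist_mul_left {x w : A⟦X⟧} (r : ℂ) (hx : K * x = x * K + r • x) (hw : hexp (-(r • L)) = w) :
    hexp (-(K ⊗ʰ L)) * (x ⊗ʰ (1 : A⟦X⟧)) = (x ⊗ʰ w) * hexp (-(K ⊗ʰ L)) := by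
  have h0 : coeff 0 (-(K ⊗ʰ L)) = 0 := coeff_zero_neg (coeff_zero_htmul_of_right K hL0)
  have h1 : coeff 0 (-(r • L)) = 0 :=
    coeff_zero_neg (by rw [PowerSeries.coeff_smul, hL0, smul_zero])
  have h2 : coeff 0 ((1 : A⟦X⟧) ⊗ʰ (-(r • L))) = 0 := coeff_zero_htmul_of_right _ h1
  rw [hexp_intertwine (b := (1 : A⟦X⟧) ⊗ʰ (-(r • L)) + -(K ⊗ʰ L)) h0
    (by rw [map_add, h2, h0, add_zero])]
  · rw [hexp_add h2 h0, hexp_one_htmul h1, hw, ← mul_assoc, htmul_mul_of_even_left _ Even.one, mul_one,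
      one_mul]
    rw [htmul_neg, htmul_csmul, neg_mul_neg, neg_mul_neg, smul_mul_assoc, mul_smul_comm,
      htmul_mul_of_even_left _ hL, htmul_mul_of_even_left _ hL, one_mul, mul_one]
  · rw [neg_mul, htmul_mul_of_even_left _ hL, hx, mul_add, mul_neg, htmul_mul_of_even_left _ Even.one,
      htmul_mul_of_even_left _ Even.one, add_htmul, csmul_htmul, one_mul, one_mul, mul_one, mul_one,
      htmul_neg, htmul_csmul]
    abel

theorem twist_mul_right_of_commute {x : A⟦X⟧} (hx : L * x = x * L) :
    hexp (-(K ⊗ʰ L)) * ((1 : A⟦X⟧) ⊗ʰ x) = ((1 : A⟦X⟧) ⊗ʰ x) * hexp (-(K ⊗ʰ L)) := by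
  have h0 : coeff 0 (-(K ⊗ʰ L)) = 0 := coeff_zero_neg (coeff_zero_htmul_of_right K hL0)
  refine hexp_intertwine h0 h0 ?_
  rw [neg_mul, mul_neg, htmul_mul_of_even_left _ hL, htmul_mul_of_even_right _ _ hK, hx, one_mul,
    mul_one]

theorem twist_mul_right {x y z : A⟦X⟧} (hx : L * x = x * L + y) (hy : L * y = y * L + z)
    (hz : L * z = z * L) :
    hexp (-(K ⊗ʰ L)) * ((1 : A⟦X⟧) ⊗ʰ x) =
      ((1 : A⟦X⟧) ⊗ʰ x - K ⊗ʰ y + (1 / 2 : ℂ) • ((K * K) ⊗ʰ z)) * hexp (-(K ⊗ʰ L)) := by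
  have h0 : coeff 0 (-(K ⊗ʰ L)) = 0 := coeff_zero_neg (coeff_zero_htmul_of_right K hL0)
  rw [hexp_mul_of_comm_two (x := (1 : A⟦X⟧) ⊗ʰ x) (y := -(K ⊗ʰ y)) (z := (K * K) ⊗ʰ z) h0]
  · simp only [sub_mul, add_mul, smul_mul_assoc, neg_mul, sub_eq_add_neg]
  · rw [neg_mul, mul_neg, htmul_mul_of_even_left _ hL, htmul_mul_of_even_right _ _ hK, hx, one_mul,
      mul_one, htmul_add, neg_add]
  · rw [neg_mul_neg, neg_mul_neg, htmul_mul_of_even_left _ hL, htmul_mul_of_even_right _ _ hK, hy,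
      htmul_add]
  · rw [neg_mul, mul_neg, htmul_mul_of_even_left _ hL, htmul_mul_of_even_right _ _ hK, hz, mul_assoc]

theorem twist_mul_cancel : hexp (-(K ⊗ʰ L)) * hexp (K ⊗ʰ L) = 1 :=
  hexp_neg_mul (coeff_zero_htmul_of_right K hL0)

theorem twist_cancel_mul : hexp (K ⊗ʰ L) * hexp (-(K ⊗ʰ L)) = 1 :=
  hexp_mul_neg (coeff_zero_htmul_of_right K hL0)

end Twist

/-- Conjugation by an invertible element. -/
def conjHom {B : Type*} [Ring B] [Algebra ℂ⟦X⟧ B] (a b : B) (hab : a * b = 1) (hba : b * a = 1) :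
    B →ₐ[ℂ⟦X⟧] B :=
  AlgHom.ofLinearMap (LinearMap.mulLeft ℂ⟦X⟧ a ∘ₗ LinearMap.mulRight ℂ⟦X⟧ b)
    (by simp [hab]) (by
      intro x y
      simp only [LinearMap.comp_apply, LinearMap.mulLeft_apply, LinearMap.mulRight_apply, mul_assoc,
        mul_assoc_of_eq hba, one_mul])

theorem conjHom_apply {B : Type*} [Ring B] [Algebra ℂ⟦X⟧ B] {a b : B} (hab : a * b = 1)
    (hba : b * a = 1) (x : B) : conjHom a b hab hba x = a * (x * b) := rfl

theorem conjHom_of_mul_eq {B : Type*} [Ring B] [Algebra ℂ⟦X⟧ B] {a b : B} (hab : a * b = 1)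
    (hba : b * a = 1) {x y : B} (h : a * x = y * a) : conjHom a b hab hba x = y := by
  rw [conjHom_apply, ← mul_assoc, h, mul_assoc, hab, mul_one]

/-- The primitive coproduct. -/
theorem Core.tensor {A : Type*} [Ring A] [Algebra ℂ A] [SuperAlgebra A] {e1 h1 f1 n e3 f2 : A⟦X⟧}
    (c : Core e1 h1 f1 n e3 f2) (hh1 : Even h1) (hf1 : Even f1) (hn : Even n) (he3 : Odd e3)
    (hf2 : Odd f2) :
    Core (e1 ⊗ʰ (1 : A⟦X⟧) + (1 : A⟦X⟧) ⊗ʰ e1) (h1 ⊗ʰ (1 : A⟦X⟧) + (1 : A⟦X⟧) ⊗ʰ h1)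
      (f1 ⊗ʰ (1 : A⟦X⟧) + (1 : A⟦X⟧) ⊗ʰ f1) (n ⊗ʰ (1 : A⟦X⟧) + (1 : A⟦X⟧) ⊗ʰ n)
      (e3 ⊗ʰ (1 : A⟦X⟧) + (1 : A⟦X⟧) ⊗ʰ e3) (f2 ⊗ʰ (1 : A⟦X⟧) + (1 : A⟦X⟧) ⊗ʰ f2) := by
  have he1 : Even e1 := by rw [← c.f2_e3]; exact (hf2.mul he3).add (he3.mul hf2)
  have h1' : Even (1 : A⟦X⟧) := Even.one
  have prim : ∀ {x y : A⟦X⟧}, Even y → (x ⊗ʰ (1 : A⟦X⟧) + (1 : A⟦X⟧) ⊗ʰ x) *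
      (y ⊗ʰ (1 : A⟦X⟧) + (1 : A⟦X⟧) ⊗ʰ y) =
      (x * y) ⊗ʰ (1 : A⟦X⟧) + (1 : A⟦X⟧) ⊗ʰ (x * y) + (x ⊗ʰ y + y ⊗ʰ x) := by
    intro x y hy
    rw [mul_add, add_mul, add_mul, htmul_mul_of_even_left _ h1', htmul_mul_of_even_right _ _ hy,
      htmul_mul_of_even_left _ h1', htmul_mul_of_even_right _ _ h1']
    simp only [one_mul, mul_one]
    abel
  have prim' : ∀ {x y : A⟦X⟧}, Even x → (x ⊗ʰ (1 : A⟦X⟧) + (1 : A⟦X⟧) ⊗ʰ x) *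
      (y ⊗ʰ (1 : A⟦X⟧) + (1 : A⟦X⟧) ⊗ʰ y) =
      (x * y) ⊗ʰ (1 : A⟦X⟧) + (1 : A⟦X⟧) ⊗ʰ (x * y) + (x ⊗ʰ y + y ⊗ʰ x) := by
    intro x y hy
    rw [mul_add, add_mul, add_mul, htmul_mul_of_even_left _ h1', htmul_mul_of_even_left _ hy,
      htmul_mul_of_even_left _ h1', htmul_mul_of_even_right _ _ h1']
    simp only [one_mul, mul_one]
    abel
  have prim2 : ∀ {x y : A⟦X⟧}, Odd x → Odd y → (x ⊗ʰ (1 : A⟦X⟧) + (1 : A⟦X⟧) ⊗ʰ x) *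
      (y ⊗ʰ (1 : A⟦X⟧) + (1 : A⟦X⟧) ⊗ʰ y) =
      (x * y) ⊗ʰ (1 : A⟦X⟧) + (1 : A⟦X⟧) ⊗ʰ (x * y) + (x ⊗ʰ y - y ⊗ʰ x) := by
    intro x y hx hy
    rw [mul_add, add_mul, add_mul, htmul_mul_of_even_left _ h1', htmul_mul_of_odd _ hx hy,
      htmul_mul_of_even_left _ h1', htmul_mul_of_even_right _ _ h1']
    simp only [one_mul, mul_one]
    abel
  have comm : ∀ {x y z : A⟦X⟧}, Even x → x * y - y * x = z →
      (x ⊗ʰ (1 : A⟦X⟧) + (1 : A⟦X⟧) ⊗ʰ x) * (y ⊗ʰ (1 : A⟦X⟧) + (1 : A⟦X⟧) ⊗ʰ y) -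
      (y ⊗ʰ (1 : A⟦X⟧) + (1 : A⟦X⟧) ⊗ʰ y) * (x ⊗ʰ (1 : A⟦X⟧) + (1 : A⟦X⟧) ⊗ʰ x) =
      z ⊗ʰ (1 : A⟦X⟧) + (1 : A⟦X⟧) ⊗ʰ z := by
    intro x y z hx h
    rw [prim hx, prim' hx, ← h, sub_htmul, htmul_sub]; abel
  have acomm : ∀ {x y z : A⟦X⟧}, Odd x → Odd y → x * y + y * x = z →
      (x ⊗ʰ (1 : A⟦X⟧) + (1 : A⟦X⟧) ⊗ʰ x) * (y ⊗ʰ (1 : A⟦X⟧) + (1 : A⟦X⟧) ⊗ʰ y) +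
      (y ⊗ʰ (1 : A⟦X⟧) + (1 : A⟦X⟧) ⊗ʰ y) * (x ⊗ʰ (1 : A⟦X⟧) + (1 : A⟦X⟧) ⊗ʰ x) =
      z ⊗ʰ (1 : A⟦X⟧) + (1 : A⟦X⟧) ⊗ʰ z := by
    intro x y z hx hy h
    rw [prim2 hx hy, prim2 hy hx, ← h, add_htmul, htmul_add]; abel
  have zero : (0 : A⟦X⟧) ⊗ʰ (1 : A⟦X⟧) + (1 : A⟦X⟧) ⊗ʰ (0 : A⟦X⟧) = 0 := by
    have := csmul_htmul (0 : ℂ) (1 : A⟦X⟧) (1 : A⟦X⟧)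
    have h := htmul_csmul (0 : ℂ) (1 : A⟦X⟧) (1 : A⟦X⟧)
    rw [zero_smul, zero_smul] at this h
    rw [this, h, add_zero]
  refine ⟨?_, comm he1 c.e1_f1, ?_, ?_, comm hn c.n_f2, comm hh1 c.h1_e3, comm hh1 c.h1_f2, ?_, ?_,
    acomm hf2 he3 c.f2_e3, ?_, ?_, ?_⟩
  · rw [comm hh1 c.h1_f1, csmul_htmul, htmul_csmul, smul_add]
  · rw [comm hn c.n_f1, zero]
  · rw [comm hn c.n_e3, neg_htmul, htmul_neg, neg_add]
  · rw [prim2 he3 he3, c.e3_e3, sub_self, add_zero, zero]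
  · rw [prim2 hf2 hf2, c.f2_f2, sub_self, add_zero, zero]
  · rw [comm hf1 rfl, comm hf1 c.serre_e, zero]
  · rw [comm hf1 rfl, comm hf1 c.serre_f, zero]
  · rw [comm hf1 rfl, acomm ((hf1.mul_odd he3).sub (he3.mul_even hf1)) hf2 c.e2_f2, csmul_htmul,
      htmul_csmul, ← smul_add, sub_htmul, htmul_sub]
    congr 1; abel

/-! ## Twisted generators -/

/-- The element `T`. -/
def jT : U⟦X⟧ := jordanGens.T
/-- The element `T⁻¹`. -/
def jTi : U⟦X⟧ := jordanGens.Tinv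
/-- The element `H₁`. -/
def jH1 : U⟦X⟧ := jordanGens.H1
/-- The element `F₁`. -/
def jF1 : U⟦X⟧ := jordanGens.F1
/-- The element `E₃`. -/
def jE3 : U⟦X⟧ := jordanGens.E3
/-- The element `F₂`. -/
def jF2 : U⟦X⟧ := jordanGens.F2
/-- The element `E₂`. -/
def jE2 : U⟦X⟧ := jordanGens.E2
/-- The element `F₃`. -/
def jF3 : U⟦X⟧ := jordanGens.F3
/-- The element `H₂ + H₃`. -/
def jN : U⟦X⟧ := C un
/-- The element `T ^ (-1/2)`. -/
def jS : U⟦X⟧ := hpow jT (-1 / 2)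
/-- The element `T ^ (1/2)`. -/
def jR : U⟦X⟧ := hpow jT (1 / 2)
/-- The logarithm of `T`. -/
def jL : U⟦X⟧ := hlog jT
/-- The element `T H₁`. -/
def jK : U⟦X⟧ := jT * jH1
/-- A twisted lowering operator. -/
def twF1 : U⟦X⟧ := jT * jF1 - (1 / 2 : ℂ) • (hIn U⟦X⟧ * jK * jK) -
  (1 / 8 : ℂ) • (hIn U⟦X⟧ * (jT * jT - 1))
/-- A twisted raising operator. -/
def twE1 : U⟦X⟧ := jTi * (jF2 * jE3 + jE3 * jF2)
/-- A twisted odd generator. -/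
def twE3 : U⟦X⟧ := jS * jE3
/-- A twisted odd generator. -/
def twF2 : U⟦X⟧ := jS * jF2

theorem jc : JCore (hIn U⟦X⟧) jT jTi jH1 jF1 jN jE3 jF2 jE2 jF3 := jcore

theorem jT0 : coeff 0 jT = 1 := coeff_zero_jordan_T

theorem jL0 : coeff 0 jL = 0 := coeff_zero_hlog _

theorem core_tw : Core twE1 jK twF1 jN twE3 twF2 := jc.core_primed jT0 hIn_torsionFree

theorem even_jT : Even jT := even_T
theorem even_jTi : Even jTi := even_Tinv
theorem even_jH1 : Even jH1 := even_H1
theorem even_jF1 : Even jF1 := even_F1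
theorem odd_jE3 : Odd jE3 := odd_E3
theorem odd_jF2 : Odd jF2 := odd_F2
theorem even_jN : Even jN := Even.C parity_un
theorem even_jS : Even jS := even_jT.hpow jT0 _
theorem even_jR : Even jR := even_jT.hpow jT0 _
theorem even_jL : Even jL := even_jT.hlog jT0
theorem even_jK : Even jK := even_jT.mul even_jH1
theorem odd_twE3 : Odd twE3 := even_jS.mul_odd odd_jE3
theorem odd_twF2 : Odd twF2 := even_jS.mul_odd odd_jF2

theorem even_hIn : Even (hIn U⟦X⟧) := by
  have h : hIn U⟦X⟧ = hbar • 1 := by rw [← hIn_mul, mul_one]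
  rw [h]; exact Even.one.hsmul _

theorem even_twF1 : Even twF1 :=
  ((even_jT.mul even_jF1).sub (((even_hIn.mul even_jK).mul even_jK).csmul _)).sub
    ((even_hIn.mul ((even_jT.mul even_jT).sub Even.one)).csmul _)

theorem jS_jS : jS * jS = jTi := jc.neg_half_sq jT0
theorem jR_jR : jR * jR = jT := hpow_half_mul_half jT0
theorem jR_jS : jR * jS = 1 := hpow_half_mul_neg_half jT0
theorem jR_eq : jR = jS * jT := jc.half_eq jT0
theorem jT_jS : jT * jS = jS * jT := jc.T_neg_half jT0
theorem jTi_jS : jTi * jS = jS * jTi := jc.Tinv_neg_half jT0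
theorem jE3_jS : jE3 * jS = jS * jE3 := jc.E3_neg_half jT0
theorem jF2_jS : jF2 * jS = jS * jF2 := jc.F2_neg_half jT0
theorem jL_jT : jL * jT = jT * jL := (hlog_commute jT0 rfl).symm
theorem jL_jE3 : jL * jE3 = jE3 * jL := (hlog_commute jT0 jc.E3_T).symm
theorem jL_jF2 : jL * jF2 = jF2 * jL := (hlog_commute jT0 jc.F2_T).symm
theorem jL_jN : jL * jN = jN * jL := (hlog_commute jT0 jc.N_T).symm
theorem jL_jS : jL * jS = jS * jL := (hlog_commute jT0 jT_jS.symm).symm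

theorem jL_jK : jL * jK = jK * jL - (jT * jT - 1) := by
  rw [jK, ← mul_assoc, jL_jT, mul_assoc, jL, jc.log_H1 jT0]
  simp only [mul_sub, jc.T_Tinv, mul_assoc]

theorem jL_twE3 : jL * twE3 = twE3 * jL := by
  rw [twE3, ← mul_assoc, jL_jS, mul_assoc, jL_jE3, mul_assoc]

theorem jL_twF2 : jL * twF2 = twF2 * jL := by
  rw [twF2, ← mul_assoc, jL_jS, mul_assoc, jL_jF2, mul_assoc]

theorem jL_twE1 : jL * twE1 = twE1 * jL := by
  rw [← core_tw.f2_e3]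
  simp only [mul_add, add_mul, mul_assoc, jL_twE3, jL_twF2, mul_assoc_of_eq jL_twE3,
    mul_assoc_of_eq jL_twF2]

theorem jL_twF1 : jL * twF1 = twF1 * jL +
    (1 / 2 : ℂ) • (hIn U⟦X⟧ * (jK * (jT * jT) + jT * jT * jK)) := by
  have h1 := jc.log_F1 jT0
  have h2 := jL_jK
  have h3 := jL_jT
  have h4 : jT * jH1 = jK := rfl
  rw [twF1]
  change jL * jF1 = jF1 * jL + _ at h1
  simp only [mul_add, add_mul, mul_sub, sub_mul, mul_assoc, smul_mul_assoc, mul_smul_comm, h3,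
    mul_assoc_of_eq h3, h1, jc.h_comm jT, jc.h_comm jL, jc.h_comm jK,
    mul_assoc_of_eq (jc.h_comm jT), mul_assoc_of_eq (jc.h_comm jK), mul_assoc_of_eq (jc.h_comm jL), h2, mul_assoc_of_eq h2,
    mul_one, one_mul, h4]
  module

theorem jL_comm_two : jL * ((1 / 2 : ℂ) • (hIn U⟦X⟧ * (jK * (jT * jT) + jT * jT * jK))) =
    (1 / 2 : ℂ) • (hIn U⟦X⟧ * (jK * (jT * jT) + jT * jT * jK)) * jL -
    hIn U⟦X⟧ * (jT * jT * (jT * jT - 1)) := by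
  have h2 := jL_jK
  have h3 := jL_jT
  simp only [mul_add, add_mul, mul_sub, sub_mul, mul_assoc, smul_mul_assoc, mul_smul_comm, h3,
    mul_assoc_of_eq h3, mul_assoc_of_eq (jc.h_comm jL), h2, mul_assoc_of_eq h2,
    mul_one, one_mul]
  module

theorem jL_comm_three : jL * -(hIn U⟦X⟧ * (jT * jT * (jT * jT - 1))) =
    -(hIn U⟦X⟧ * (jT * jT * (jT * jT - 1))) * jL := by
  have h3 := jL_jT
  simp only [mul_neg, neg_mul, mul_sub, sub_mul, mul_assoc, h3, mul_assoc_of_eq h3,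
    mul_assoc_of_eq (jc.h_comm jL), mul_one]

theorem hexp_jL : hexp jL = jT := hexp_hlog jT0

theorem hexp_neg_jL : hexp (-jL) = jTi := by
  refine left_inv_eq_right_inv (a := jT) ?_ jc.T_Tinv
  rw [← hexp_jL]
  exact hexp_neg_mul jL0

theorem hexp_two_jL : hexp (-((-2 : ℂ) • jL)) = jT * jT := by
  have : -((-2 : ℂ) • jL) = jL + jL := by module
  rw [this, hexp_add jL0 jL0 rfl, hexp_jL]

theorem two_hIn_twE1 : (2 : ℂ) • (hIn U⟦X⟧ * twE1) = 1 - jTi * jTi := by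
  have h := jc.F2_E3
  have h2 : hIn U⟦X⟧ * twE1 = jTi * (hIn U⟦X⟧ * (jF2 * jE3) + hIn U⟦X⟧ * (jE3 * jF2)) := by
    rw [twE1, ← mul_assoc, ← mul_hIn, mul_assoc, mul_add]
  rw [h2, h, add_comm (-_), add_assoc, neg_add_cancel, add_zero, mul_smul_comm, mul_sub, jc.Tinv_T]
  module

/-! ## The change of generators -/

theorem coeff_zero_jS : coeff 0 jS = 1 := coeff_zero_hpow _ _

theorem coeff_zero_twE3 : coeff 0 twE3 = u .e3 := by
  rw [twE3, coeff_zero_mul_eq, coeff_zero_jS, one_mul]; exact coeff_zero_jordan_E3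

theorem coeff_zero_twF2 : coeff 0 twF2 = u .f2 := by
  rw [twF2, coeff_zero_mul_eq, coeff_zero_jS, one_mul]; exact coeff_zero_jordan_F2

theorem coeff_zero_hIn_mul {A : Type*} [Ring A] [Algebra ℂ A] (a : A⟦X⟧) :
    coeff 0 (hIn A⟦X⟧ * a) = 0 := by
  rw [hIn_mul, coeff_zero_hbar_smul]

theorem coeff_zero_twF1 : coeff 0 twF1 = u .f1 := by
  rw [twF1, map_sub, map_sub, PowerSeries.coeff_smul, PowerSeries.coeff_smul, mul_assoc,
    coeff_zero_hIn_mul, coeff_zero_hIn_mul, coeff_zero_mul_eq, jT0, one_mul, smul_zero, smul_zero,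
    sub_zero, sub_zero]
  exact coeff_zero_jordan_F1

/-- The automorphism of `U⟦h⟧` that takes the classical generators to the twisted ones. -/
def theta : U⟦X⟧ ≃ₐ[ℂ⟦X⟧] U⟦X⟧ :=
  AlgEquiv.ofBijective (liftHom core_tw.lift)
    (core_tw.bijective coeff_zero_twE3 coeff_zero_twF2 coeff_zero_twF1)

/-- The homomorphism that takes prescribed values on the twisted generators. -/
def Core.twHom {B : Type*} [Ring B] [Algebra ℂ B] {e1 h1 f1 n e3 f2 : B⟦X⟧}
    (c : Core e1 h1 f1 n e3 f2) : U⟦X⟧ →ₐ[ℂ⟦X⟧] B⟦X⟧ :=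
  (liftHom c.lift).comp theta.symm.toAlgHom

theorem Core.twHom_tw {B : Type*} [Ring B] [Algebra ℂ B] {e1 h1 f1 n e3 f2 : B⟦X⟧}
    (c : Core e1 h1 f1 n e3 f2) : c.twHom twE1 = e1 ∧ c.twHom jK = h1 ∧ c.twHom twF1 = f1 ∧
      c.twHom jN = n ∧ c.twHom twE3 = e3 ∧ c.twHom twF2 = f2 := by
  have key : ∀ {x y} {b : B⟦X⟧}, liftHom core_tw.lift x = y → liftHom c.lift x = b → c.twHom y = b := by
    intro x y b hy hb
    subst hy
    change liftHom c.lift (theta.symm (theta x)) = b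
    rw [AlgEquiv.symm_apply_apply, hb]
  obtain ⟨a1, a2, a3, a4, a5, a6⟩ := core_tw.liftHom_image
  obtain ⟨b1, b2, b3, b4, b5, b6⟩ := c.liftHom_image
  exact ⟨key a1 b1, key a2 b2, key a3 b3, key a4 b4, key a5 b5, key a6 b6⟩

theorem algHom_ext_tw {R : Type*} [Ring R] [Algebra ℂ⟦X⟧ R] [Separated R]
    {f g : U⟦X⟧ →ₐ[ℂ⟦X⟧] R} (h_E3 : f twE3 = g twE3) (h_F2 : f twF2 = g twF2)
    (h_F1 : f twF1 = g twF1) : f = g :=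
  algHom_ext_gens coeff_zero_twE3 coeff_zero_twF2 coeff_zero_twF1 h_E3 h_F2 h_F1

/-! ## The coproduct -/

/-- The twist. -/
def tF : (U ⊗ˢ U)⟦X⟧ := hexp (-(jK ⊗ʰ jL))
/-- The inverse of the twist. -/
def tFi : (U ⊗ˢ U)⟦X⟧ := hexp (jK ⊗ʰ jL)

theorem tF_tFi : tF * tFi = 1 := twist_mul_cancel even_jK even_jL jL0
theorem tFi_tF : tFi * tF = 1 := twist_cancel_mul even_jK even_jL jL0

theorem core_tensor : Core (twE1 ⊗ʰ (1 : U⟦X⟧) + (1 : U⟦X⟧) ⊗ʰ twE1)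
    (jK ⊗ʰ (1 : U⟦X⟧) + (1 : U⟦X⟧) ⊗ʰ jK) (twF1 ⊗ʰ (1 : U⟦X⟧) + (1 : U⟦X⟧) ⊗ʰ twF1)
    (jN ⊗ʰ (1 : U⟦X⟧) + (1 : U⟦X⟧) ⊗ʰ jN) (twE3 ⊗ʰ (1 : U⟦X⟧) + (1 : U⟦X⟧) ⊗ʰ twE3)
    (twF2 ⊗ʰ (1 : U⟦X⟧) + (1 : U⟦X⟧) ⊗ʰ twF2) :=
  core_tw.tensor even_jK even_twF1 even_jN odd_twE3 odd_twF2

/-- The coproduct for which the twisted generators are primitive. -/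
def Delta0 : U⟦X⟧ →ₐ[ℂ⟦X⟧] (U ⊗ˢ U)⟦X⟧ := core_tensor.twHom

/-- The coproduct. -/
def Delta : U⟦X⟧ →ₐ[ℂ⟦X⟧] (U ⊗ˢ U)⟦X⟧ := (conjHom tF tFi tF_tFi tFi_tF).comp Delta0

theorem Delta_of {x : U⟦X⟧} {y z : (U ⊗ˢ U)⟦X⟧}
    (h0 : Delta0 x = x ⊗ʰ (1 : U⟦X⟧) + (1 : U⟦X⟧) ⊗ʰ x) (h1 : tF * (x ⊗ʰ (1 : U⟦X⟧)) = y * tF)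
    (h2 : tF * ((1 : U⟦X⟧) ⊗ʰ x) = z * tF) : Delta x = y + z := by
  rw [Delta, AlgHom.comp_apply, h0, map_add, conjHom_of_mul_eq _ _ h1, conjHom_of_mul_eq _ _ h2]

theorem Delta_twE3 : Delta twE3 = twE3 ⊗ʰ jTi + (1 : U⟦X⟧) ⊗ʰ twE3 :=
  Delta_of core_tensor.twHom_tw.2.2.2.2.1
    (twist_mul_left even_jK even_jL jL0 1 (by
      rw [one_smul]; linear_combination (norm := abel) core_tw.h1_e3) (by rw [one_smul, hexp_neg_jL]))
    (twist_mul_right_of_commute even_jK even_jL jL0 jL_twE3)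

theorem Delta_twF2 : Delta twF2 = twF2 ⊗ʰ jTi + (1 : U⟦X⟧) ⊗ʰ twF2 :=
  Delta_of core_tensor.twHom_tw.2.2.2.2.2
    (twist_mul_left even_jK even_jL jL0 1 (by
      rw [one_smul]; linear_combination (norm := abel) core_tw.h1_f2) (by rw [one_smul, hexp_neg_jL]))
    (twist_mul_right_of_commute even_jK even_jL jL0 jL_twF2)

theorem Delta_twE1 : Delta twE1 = twE1 ⊗ʰ (jTi * jTi) + (1 : U⟦X⟧) ⊗ʰ twE1 :=
  Delta_of core_tensor.twHom_tw.1
    (twist_mul_left even_jK even_jL jL0 2 (by linear_combination (norm := abel) core_tw.h1_e1) (by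
      have : -((2 : ℂ) • jL) = -jL + -jL := by module
      rw [this, hexp_add (coeff_zero_neg jL0) (coeff_zero_neg jL0) rfl, hexp_neg_jL]))
    (twist_mul_right_of_commute even_jK even_jL jL0 jL_twE1)

theorem Delta_jN : Delta jN = jN ⊗ʰ (1 : U⟦X⟧) + (1 : U⟦X⟧) ⊗ʰ jN :=
  Delta_of core_tensor.twHom_tw.2.2.2.1
    (twist_mul_left even_jK even_jL jL0 0 (by
      rw [zero_smul, add_zero]; exact (sub_eq_zero.1 core_tw.n_h1).symm)
      (by rw [zero_smul, neg_zero, hexp_zero]))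
    (twist_mul_right_of_commute even_jK even_jL jL0 jL_jN)

theorem Delta_jK : Delta jK = jK ⊗ʰ (jT * jT) + (1 : U⟦X⟧) ⊗ʰ jK := by
  rw [Delta_of core_tensor.twHom_tw.2.1
    (twist_mul_left (w := 1) even_jK even_jL jL0 0 (by rw [zero_smul, add_zero])
      (by rw [zero_smul, neg_zero, hexp_zero]))
    (twist_mul_right (x := jK) (y := -(jT * jT - 1)) (z := (0 : ℂ) • 1) even_jK even_jL jL0
      (by rw [jL_jK, sub_eq_add_neg]) (by
        rw [zero_smul, add_zero]
        simp only [mul_neg, neg_mul, mul_sub, sub_mul, ← mul_assoc, jL_jT, mul_one, one_mul]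
        simp only [mul_assoc, jL_jT]) (by simp)), htmul_neg, htmul_sub, htmul_csmul]
  module

theorem Delta_twF1 : Delta twF1 = twF1 ⊗ʰ (jT * jT) + ((1 : U⟦X⟧) ⊗ʰ twF1 -
    jK ⊗ʰ ((1 / 2 : ℂ) • (hIn U⟦X⟧ * (jK * (jT * jT) + jT * jT * jK))) +
    (1 / 2 : ℂ) • ((jK * jK) ⊗ʰ (-(hIn U⟦X⟧ * (jT * jT * (jT * jT - 1)))))) :=
  Delta_of core_tensor.twHom_tw.2.2.1
    (twist_mul_left even_jK even_jL jL0 (-2) (by linear_combination (norm := abel) core_tw.h1_f1)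
      hexp_two_jL)
    (twist_mul_right even_jK even_jL jL0 jL_twF1 (by rw [jL_comm_two, sub_eq_add_neg]) jL_comm_three)

theorem exists_of_coeff_zero_eq_one {A : Type*} [Ring A] [Algebra ℂ A] {a : A⟦X⟧}
    (h : coeff 0 a = 1) : ∃ b, a = 1 + hbar • b := by
  obtain ⟨b, hb⟩ := exists_hbar_smul (a := a - 1) (by rw [map_sub, h, PowerSeries.coeff_zero_one, sub_self])
  exact ⟨b, by rw [← hb]; abel⟩

theorem sqrt_unique {A : Type*} [Ring A] [Algebra ℂ A] {a b : A⟦X⟧} (ha : coeff 0 a = 1)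
    (hb : coeff 0 b = 1) (h : a * a = b * b) : a = b := by
  obtain ⟨x, hx⟩ := exists_of_coeff_zero_eq_one ha
  obtain ⟨y, hy⟩ := exists_of_coeff_zero_eq_one hb
  exact eq_of_mul_self_eq (fun b hb => hbar_smul_injective (by rw [hb, smul_zero])) hx hy h

theorem coeff_zero_algHom {A B : Type*} [Ring A] [Algebra ℂ A] [Ring B] [Algebra ℂ B]
    (f : A⟦X⟧ →ₗ[ℂ⟦X⟧] B⟦X⟧) (h1 : f 1 = 1) {a : A⟦X⟧} (ha : coeff 0 a = 1) : coeff 0 (f a) = 1 := by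
  obtain ⟨b, rfl⟩ := exists_of_coeff_zero_eq_one ha
  rw [map_add, h1, map_smul, map_add, coeff_zero_hbar_smul, add_zero, PowerSeries.coeff_zero_one]

theorem coeff_zero_htmul_one {A B : Type*} [Ring A] [Algebra ℂ A] [SuperAlgebra A] [Ring B]
    [Algebra ℂ B] [SuperAlgebra B] {a : A⟦X⟧} {b : B⟦X⟧} (ha : coeff 0 a = 1) (hb : coeff 0 b = 1) :
    coeff 0 (a ⊗ʰ b) = 1 := by
  rw [coeff_zero_htmul, ha, hb]; rfl

theorem coeff_zero_jTi : coeff 0 jTi = 1 := jc.coeff_zero_Tinv jT0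

theorem htmul_hIn_mul {A B : Type*} [Ring A] [Algebra ℂ A] [SuperAlgebra A] [Ring B]
    [Algebra ℂ B] [SuperAlgebra B] (a : A⟦X⟧) (b : B⟦X⟧) :
    a ⊗ʰ (hIn B⟦X⟧ * b) = hbar • (a ⊗ʰ b) := by
  rw [hIn_mul, htmul_hsmul]

theorem hIn_mul_htmul {A B : Type*} [Ring A] [Algebra ℂ A] [SuperAlgebra A] [Ring B]
    [Algebra ℂ B] [SuperAlgebra B] (a : A⟦X⟧) (b : B⟦X⟧) :
    (hIn A⟦X⟧ * a) ⊗ʰ b = hbar • (a ⊗ʰ b) := by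
  rw [hIn_mul, hsmul_htmul]

theorem Delta_jTi : Delta jTi = jTi ⊗ʰ jTi := by
  refine sqrt_unique (coeff_zero_algHom Delta.toLinearMap (map_one Delta) coeff_zero_jTi)
    (coeff_zero_htmul_one coeff_zero_jTi coeff_zero_jTi) ?_
  have h : jTi * jTi = 1 - (2 : ℂ) • hbar • twE1 := by
    rw [← hIn_mul, two_hIn_twE1]; abel
  have hs : ∀ (r : ℂ) x, Delta (r • x) = r • Delta x := fun r x =>
    map_smul (Delta.toLinearMap.restrictScalars ℂ) r x
  have h3 : (1 - jTi * jTi) ⊗ʰ (jTi * jTi) = (2 : ℂ) • hbar • (twE1 ⊗ʰ (jTi * jTi)) := by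
    rw [← two_hIn_twE1, csmul_htmul, hIn_mul_htmul]
  have h4 : (1 : U⟦X⟧) ⊗ʰ (1 - jTi * jTi) = (2 : ℂ) • hbar • ((1 : U⟦X⟧) ⊗ʰ twE1) := by
    rw [← two_hIn_twE1, htmul_csmul, htmul_hIn_mul]
  rw [sub_htmul] at h3
  rw [htmul_sub, one_htmul_one] at h4
  rw [← map_mul, h, map_sub, map_one, hs, map_smul, Delta_twE1, smul_add, smul_add, ← h3, ← h4,
    htmul_mul_of_even_left _ even_jTi]
  abel

theorem Delta_jS : Delta jS = jS ⊗ʰ jS := by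
  refine sqrt_unique (coeff_zero_algHom Delta.toLinearMap (map_one Delta) coeff_zero_jS)
    (coeff_zero_htmul_one coeff_zero_jS coeff_zero_jS) ?_
  rw [← map_mul, jS_jS, Delta_jTi, htmul_mul_of_even_left _ even_jS, jS_jS]

theorem Delta_jT : Delta jT = jT ⊗ʰ jT := by
  refine left_inv_eq_right_inv (a := Delta jTi) (by rw [← map_mul, jc.T_Tinv, map_one]) ?_
  rw [Delta_jTi, htmul_mul_of_even_left _ even_jTi, jc.Tinv_T, one_htmul_one]

theorem Delta_jR : Delta jR = jR ⊗ʰ jR := by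
  rw [jR_eq, map_mul, Delta_jS, Delta_jT, htmul_mul_of_even_left _ even_jS]

theorem Delta_jE3 : Delta jE3 = jE3 ⊗ʰ jS + jR ⊗ʰ jE3 := by
  have h : jE3 = jR * twE3 := by rw [twE3, ← mul_assoc, jR_jS, one_mul]
  rw [h, map_mul, Delta_jR, Delta_twE3, mul_add, htmul_mul_of_even_left _ even_jR,
    htmul_mul_of_even_left _ even_jR, ← h, mul_one, jR_eq, mul_assoc, jc.T_Tinv, mul_one, ← jR_eq]

theorem Delta_jF2 : Delta jF2 = jF2 ⊗ʰ jS + jR ⊗ʰ jF2 := by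
  have h : jF2 = jR * twF2 := by rw [twF2, ← mul_assoc, jR_jS, one_mul]
  rw [h, map_mul, Delta_jR, Delta_twF2, mul_add, htmul_mul_of_even_left _ even_jR,
    htmul_mul_of_even_left _ even_jR, ← h, mul_one, jR_eq, mul_assoc, jc.T_Tinv, mul_one, ← jR_eq]

theorem Delta_jH1 : Delta jH1 = jH1 ⊗ʰ jT + jTi ⊗ʰ jH1 := by
  have h : jH1 = jTi * jK := by rw [jK, ← mul_assoc, jc.Tinv_T, one_mul]
  rw [h, map_mul, Delta_jTi, Delta_jK, mul_add, htmul_mul_of_even_left _ even_jTi,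
    htmul_mul_of_even_left _ even_jTi, ← h, mul_one, ← mul_assoc, jc.Tinv_T, one_mul]

theorem Delta_jF1 : Delta jF1 = jF1 ⊗ʰ jT + jTi ⊗ʰ jF1 := by
  have h0 : jT * jF1 = twF1 + (1 / 2 : ℂ) • hbar • (jK * jK) + (1 / 8 : ℂ) • hbar • (jT * jT - 1) := by
    rw [twF1, ← hIn_mul, ← hIn_mul, mul_assoc]; abel
  have hs : ∀ (r : ℂ) x, Delta (r • x) = r • Delta x := fun r x =>
    map_smul (Delta.toLinearMap.restrictScalars ℂ) r x
  have h1 : Delta (jT * jF1) = (jT * jF1) ⊗ʰ (jT * jT) + (1 : U⟦X⟧) ⊗ʰ (jT * jF1) := by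
    rw [h0]
    simp only [map_add, hs, map_smul, map_mul, map_sub, map_one, Delta_twF1, Delta_jK, Delta_jT]
    have e1 : Even (1 : U⟦X⟧) := Even.one
    have e2 := even_jK
    have e3 := even_jT
    have e4 := even_jT.mul even_jT
    simp only [mul_add, add_mul, htmul_mul_of_even_right _ _ e2, htmul_mul_of_even_left _ e2,
      htmul_mul_of_even_right _ _ e3, htmul_mul_of_even_left _ e4, htmul_mul_of_even_right _ _ e1,
      one_mul, mul_one, htmul_hIn_mul, htmul_csmul, csmul_htmul, htmul_neg, add_htmul, htmul_add,
      hsmul_htmul, htmul_hsmul, sub_htmul, htmul_sub, mul_sub, mul_assoc, smul_sub, smul_add,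
      smul_neg, one_htmul_one]
    simp only [← hIn_mul, mul_smul_comm, mul_add, mul_sub]
    module
  have h2 : jF1 = jTi * (jT * jF1) := by rw [← mul_assoc, jc.Tinv_T, one_mul]
  have h3 : jT = jTi * (jT * jT) := by rw [← mul_assoc, jc.Tinv_T, one_mul]
  rw [h2, map_mul, h1, Delta_jTi, mul_add, htmul_mul_of_even_left _ even_jTi,
    htmul_mul_of_even_left _ even_jTi, ← h2, ← h3, mul_one]

theorem jF1_jS : jF1 * jS = jS * jF1 + (1 / 4 : ℂ) • (hIn U⟦X⟧ * (jS * jH1 + jH1 * jS)) := by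
  have h1 := jc.F1_neg_half jT0
  have h2 := jc.H1_neg_half jT0
  change jF1 * jS = jS * jF1 + hIn U⟦X⟧ * jS * _ at h1
  change jH1 * jS = jS * jH1 - (1 / 2 : ℂ) • (jS * jT - jS * jTi) at h2
  rw [h1, h2]
  simp only [mul_add, mul_sub, mul_assoc, mul_smul_comm]
  module

theorem jF1_jR : jF1 * jR = jR * jF1 - (1 / 4 : ℂ) • (hIn U⟦X⟧ * (jR * jH1 + jH1 * jR)) := by
  have h1 := jF1_jS
  have h2 := jc.H1_neg_half jT0
  change jH1 * jS = jS * jH1 - (1 / 2 : ℂ) • (jS * jT - jS * jTi) at h2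
  rw [jR_eq, ← mul_assoc, h1, h2]
  simp only [mul_add, add_mul, mul_sub, sub_mul, mul_assoc, mul_smul_comm, smul_mul_assoc, jc.F1_T,
    jc.H1_T, jc.h_comm jS, mul_assoc_of_eq (jc.h_comm jS), mul_assoc_of_eq h2, jc.Tinv_T, mul_one]
  module

theorem Delta_comm {x y : U⟦X⟧} (hT : x * jT = jT * x) (hy : y = jF1 * x - x * jF1) (h : Delta x = x ⊗ʰ jS + jR ⊗ʰ x) :
    Delta y = y ⊗ʰ jR + jS ⊗ʰ y +
      (1 / 4 : ℂ) • hbar • ((jTi * x) ⊗ʰ (jS * jH1 + jH1 * jS)) -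
      (1 / 4 : ℂ) • hbar • ((jR * jH1 + jH1 * jR) ⊗ʰ (jT * x)) := by
  have e1 := even_jT
  have e2 := even_jTi
  have e3 := even_jS
  have e4 := even_jR
  have e5 := even_jF1
  have hTi : x * jTi = jTi * x := by
    have : x = jTi * (jT * x) := by rw [← mul_assoc, jc.Tinv_T, one_mul]
    nth_rw 1 [this]
    rw [← hT]
    simp only [mul_assoc, jc.T_Tinv, mul_one]
  have hTS : jT * jS = jR := by rw [jT_jS, jR_eq]
  have hST : jS * jT = jR := jR_eq.symm
  have hTR : jTi * jR = jS := by rw [← hTS, ← mul_assoc, jc.Tinv_T, one_mul]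
  have hRT : jR * jTi = jS := by rw [← hST, mul_assoc, jc.T_Tinv, mul_one]
  rw [hy, map_sub, map_mul, map_mul, h, Delta_jF1]
  simp only [mul_add, add_mul, htmul_mul_of_even_left _ e1, htmul_mul_of_even_left _ e3,
    htmul_mul_of_even_left _ e5, htmul_mul_of_even_right _ _ e4, htmul_mul_of_even_right _ _ e5,
    htmul_mul_of_even_right _ _ e2, hT, hTS, hST, hTR, hRT, hTi]
  rw [jF1_jS, jF1_jR, sub_htmul, htmul_add, sub_htmul, htmul_sub, csmul_htmul, htmul_csmul, hIn_mul,
    hIn_mul, hsmul_htmul, htmul_hsmul]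
  abel

theorem Delta_jE2 : Delta jE2 = jE2 ⊗ʰ jR + jS ⊗ʰ jE2 +
      (1 / 4 : ℂ) • hbar • ((jTi * jE3) ⊗ʰ (jS * jH1 + jH1 * jS)) -
      (1 / 4 : ℂ) • hbar • ((jR * jH1 + jH1 * jR) ⊗ʰ (jT * jE3)) :=
  Delta_comm jc.E3_T jc.E2_eq Delta_jE3

theorem Delta_jF3 : Delta jF3 = jF3 ⊗ʰ jR + jS ⊗ʰ jF3 -
      (1 / 4 : ℂ) • hbar • ((jTi * jF2) ⊗ʰ (jS * jH1 + jH1 * jS)) +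
      (1 / 4 : ℂ) • hbar • ((jR * jH1 + jH1 * jR) ⊗ʰ (jT * jF2)) := by
  rw [Delta_comm (x := -jF2) (by rw [neg_mul, jc.F2_T, mul_neg]) jc.symm.E2_eq (by
      rw [map_neg, Delta_jF2, neg_htmul, htmul_neg, neg_add]), mul_neg, mul_neg, neg_htmul, htmul_neg,
      smul_neg, smul_neg, smul_neg, smul_neg]
  abel

theorem Delta_PH1 : Delta ((jT + jTi) * jH1) = ((jT + jTi) * jH1) ⊗ʰ (1 : U⟦X⟧) +
    (1 : U⟦X⟧) ⊗ʰ ((jT + jTi) * jH1) - (jT * jH1) ⊗ʰ (1 - jT ^ 2) -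
    (1 - jTi ^ 2) ⊗ʰ (jTi * jH1) := by
  have e1 := even_jT
  have e2 := even_jTi
  rw [map_mul, map_add, Delta_jT, Delta_jTi, Delta_jH1]
  simp only [mul_add, add_mul, htmul_mul_of_even_left _ e1, htmul_mul_of_even_left _ e2,
    jc.Tinv_T, jc.T_Tinv, sq, add_htmul, htmul_add, sub_htmul, htmul_sub]
  abel

theorem jH2_eq : jordanGens.H2 = (1 / 2 : ℂ) • jN - (1 / 4 : ℂ) • ((jT + jTi) * jH1) := jordan_H2

theorem jH3_eq : jordanGens.H3 = (1 / 2 : ℂ) • jN + (1 / 4 : ℂ) • ((jT + jTi) * jH1) := jordan_H3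

theorem csmul_map {A B : Type*} [Ring A] [Algebra ℂ A] [Ring B] [Algebra ℂ B]
    (f : A⟦X⟧ →ₗ[ℂ⟦X⟧] B⟦X⟧) (r : ℂ) (x : A⟦X⟧) : f (r • x) = r • f x :=
  map_smul (f.restrictScalars ℂ) r x

theorem Delta_H2 : Delta jordanGens.H2 = jordanGens.H2 ⊗ʰ (1 : U⟦X⟧) + (1 : U⟦X⟧) ⊗ʰ jordanGens.H2 +
    (1 / 4 : ℂ) • ((jT * jH1) ⊗ʰ (1 - jT ^ 2)) +
    (1 / 4 : ℂ) • ((1 - jTi ^ 2) ⊗ʰ (jTi * jH1)) := by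
  have hs : ∀ (r : ℂ) x, Delta (r • x) = r • Delta x := csmul_map Delta.toLinearMap
  rw [jH2_eq, map_sub, hs, hs, Delta_PH1, Delta_jN, sub_htmul (_ • _), htmul_sub _ (_ • _), csmul_htmul,
    htmul_csmul, csmul_htmul, htmul_csmul]
  module

theorem Delta_H3 : Delta jordanGens.H3 = jordanGens.H3 ⊗ʰ (1 : U⟦X⟧) + (1 : U⟦X⟧) ⊗ʰ jordanGens.H3 -
    (1 / 4 : ℂ) • ((jT * jH1) ⊗ʰ (1 - jT ^ 2)) -
    (1 / 4 : ℂ) • ((1 - jTi ^ 2) ⊗ʰ (jTi * jH1)) := by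
  have hs : ∀ (r : ℂ) x, Delta (r • x) = r • Delta x := csmul_map Delta.toLinearMap
  rw [jH3_eq, map_add, hs, hs, Delta_PH1, Delta_jN, add_htmul (_ • _), htmul_add _ (_ • _), csmul_htmul,
    htmul_csmul, csmul_htmul, htmul_csmul]
  module

theorem Delta_hparity (a : U⟦X⟧) : Delta (hparity a) = hparity (Delta a) := by
  have : Delta.comp (hparityHom U) = (hparityHom (U ⊗ˢ U)).comp Delta := by
    have h : ∀ {x}, Odd x → Delta x = x ⊗ʰ jS + jR ⊗ʰ x →
        Delta (hparity x) = hparity (Delta x) := fun {x} hx hD => by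
      rw [hx, map_neg, hD]
      exact ((hx.htmul_even even_jS).add (even_jR.htmul_odd hx)).symm
    refine algHom_ext_jordan (h odd_jE3 Delta_jE3) (h odd_jF2 Delta_jF2) ?_
    change Delta (hparity jF1) = hparity (Delta jF1)
    rw [even_jF1, Delta_jF1]
    exact ((even_jF1.htmul even_jT).add (even_jTi.htmul even_jF1)).symm
  exact DFunLike.congr_fun this a

theorem coassoc_of {x a b : U⟦X⟧} (ha : Delta a = a ⊗ʰ a) (hb : Delta b = b ⊗ʰ b)
    (hx : Delta x = x ⊗ʰ a + b ⊗ʰ x) :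
    sassocHom U U U (mapLeftHom Delta Delta_hparity (Delta x)) =
      mapRightHom Delta Delta_hparity (Delta x) := by
  have hl : ∀ a d : U⟦X⟧, mapLeftHom Delta Delta_hparity (a ⊗ʰ d) = Delta a ⊗ʰ d :=
    mapLeft_htmul Delta.toLinearMap
  have hr : ∀ a d : U⟦X⟧, mapRightHom Delta Delta_hparity (a ⊗ʰ d) = a ⊗ʰ Delta d :=
    mapRight_htmul Delta.toLinearMap
  have hs : ∀ a b d : U⟦X⟧, sassocHom U U U ((a ⊗ʰ b) ⊗ʰ d) = a ⊗ʰ (b ⊗ʰ d) := coeffMap_sassoc_htmul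
  rw [hx]
  simp only [map_add, hl, hr, hx, ha, hb, add_htmul, htmul_add, hs]
  abel

theorem Delta_coassoc (a : U⟦X⟧) : sassocHom U U U (mapLeftHom Delta Delta_hparity (Delta a)) =
    mapRightHom Delta Delta_hparity (Delta a) := by
  have : (sassocHom U U U).comp ((mapLeftHom Delta Delta_hparity).comp Delta) =
      (mapRightHom Delta Delta_hparity).comp Delta :=
    algHom_ext_jordan (coassoc_of Delta_jS Delta_jR Delta_jE3)
      (coassoc_of Delta_jS Delta_jR Delta_jF2) (coassoc_of Delta_jT Delta_jTi Delta_jF1)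
  exact DFunLike.congr_fun this a

/-! ## The counit -/

theorem core_zero : Core (0 : ℂ) 0 0 0 0 0 := by
  constructor <;> simp

/-- The counit of the enveloping algebra. -/
def eps0 : U →ₐ[ℂ] ℂ := core_zero.lift

theorem eps0_u (x : Gen) : eps0 (u x) = 0 := by
  rw [eps0, Core.lift_u]
  cases x <;> simp [Core.image]

/-- The counit. -/
def eps := coeffHom eps0

theorem eps_C_u (x : Gen) : eps (C (u x)) = 0 := by
  rw [eps, coeffHom_C, eps0_u, map_zero]

theorem eps_jE3 : eps jE3 = 0 := eps_C_u .e3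

theorem eps_jF2 : eps jF2 = 0 := eps_C_u .f2

theorem eps_csmul (r : ℂ) (x : U⟦X⟧) : eps (r • x) = r • eps x := csmul_map eps.toLinearMap r x

theorem eps_jF1 : eps jF1 = 0 := by
  have : jF1 = C (u .f1) - (1 / 4 : ℂ) • hbar ^ 2 • (C (u .e1) * (C (u .h1) ^ 2 - 1)) := by
    rw [← map_pow, ← map_one C, ← map_sub, ← map_mul]; rfl
  rw [this, map_sub, eps_csmul, map_smul, map_mul, eps_C_u, eps_C_u, zero_mul, smul_zero, smul_zero,
    sub_zero]

theorem eps_jTi : eps jTi = 1 := by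
  have h := congrArg eps jc.F2_E3
  have h2 := congrArg eps jc.T_Tinv
  simp only [map_mul, map_add, map_neg, map_sub, eps_jE3, eps_jF2, mul_zero, neg_zero, zero_add,
    eps_csmul, map_one] at h h2
  have h3 : eps jT = eps jTi := by
    rw [← sub_eq_zero]
    exact (smul_eq_zero.1 h.symm).resolve_left (by norm_num)
  refine sqrt_unique (coeff_zero_algHom eps.toLinearMap (map_one eps) coeff_zero_jTi)
    PowerSeries.coeff_zero_one ?_
  rw [h3] at h2
  rw [h2, one_mul]

theorem eps_jT : eps jT = 1 := by
  have h2 := congrArg eps jc.T_Tinv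
  rwa [map_mul, eps_jTi, mul_one, map_one] at h2

theorem eps_jS : eps jS = 1 := by
  refine sqrt_unique (coeff_zero_algHom eps.toLinearMap (map_one eps) coeff_zero_jS)
    PowerSeries.coeff_zero_one ?_
  rw [← map_mul, jS_jS, eps_jTi, mul_one]

theorem eps_jR : eps jR = 1 := by
  rw [jR_eq, map_mul, eps_jT, eps_jS, mul_one]

theorem eps_hparity (a : U⟦X⟧) : eps (hparity a) = eps a := by
  have : eps.comp (hparityHom U) = eps := by
    refine algHom_ext_jordan ?_ ?_ ?_
    · change eps (hparity jE3) = eps jE3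
      rw [odd_jE3, map_neg, eps_jE3, neg_zero]
    · change eps (hparity jF2) = eps jF2
      rw [odd_jF2, map_neg, eps_jF2, neg_zero]
    · change eps (hparity jF1) = eps jF1
      rw [even_jF1]
  exact DFunLike.congr_fun this a

theorem hparity_complex (a : ℂ⟦X⟧) : hparity a = a := by
  ext n
  rw [hparity, coeff_coeffMap]; rfl

theorem eps_hparity' (a : U⟦X⟧) : eps (hparity a) = hparity (eps a) := by
  rw [eps_hparity, hparity_complex]

theorem eps_jH1 : eps jH1 = 0 := by
  have h : hIn U⟦X⟧ * jH1 = jTi * (jT * jF1 - jF1 * jT - (1 / 2 : ℂ) • (hIn U⟦X⟧ * jT * jT - hIn U⟦X⟧)) := by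
    rw [jc.F1_T]
    have : jT * jF1 - (jT * jF1 - hIn U⟦X⟧ * jT * jH1 -
      (1 / 2 : ℂ) • (hIn U⟦X⟧ * jT * jT - hIn U⟦X⟧)) -
      (1 / 2 : ℂ) • (hIn U⟦X⟧ * jT * jT - hIn U⟦X⟧) = hIn U⟦X⟧ * (jT * jH1) := by
      rw [mul_assoc (hIn _) jT jH1]; abel
    rw [this, ← mul_assoc jTi, jc.h_comm, mul_assoc, ← mul_assoc jTi, jc.Tinv_T, one_mul]
  have h2 := congrArg eps h
  rw [hIn_mul, map_smul, map_mul, map_sub, map_sub, map_mul, map_mul, eps_csmul, map_sub, map_mul,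
    map_mul, eps_jF1, eps_jT, eps_jTi] at h2
  simp only [mul_one, sub_self, zero_mul, mul_zero, smul_zero, sub_zero] at h2
  exact hbar_smul_injective (h2.trans (smul_zero _).symm)

theorem eps_jN : eps jN = 0 := by
  rw [jN, un, map_add, map_add, eps_C_u, eps_C_u, add_zero]

theorem counit_left_of {x a b : U⟦X⟧} (hb : eps b = 1) (h0 : eps x = 0)
    (hx : Delta x = x ⊗ʰ a + b ⊗ʰ x) : mapLeftHom eps eps_hparity' (Delta x) = inclRight ℂ U x := by
  have hl : ∀ a d : U⟦X⟧, mapLeftHom eps eps_hparity' (a ⊗ʰ d) = eps a ⊗ʰ d :=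
    mapLeft_htmul eps.toLinearMap
  have h : (0 : ℂ⟦X⟧) ⊗ʰ a = 0 := (htmulLeft a).map_zero
  rw [hx, map_add, hl, hl, h0, hb, h, zero_add, inclRight_apply]

theorem counit_right_of {x a b : U⟦X⟧} (ha : eps a = 1) (h0 : eps x = 0)
    (hx : Delta x = x ⊗ʰ a + b ⊗ʰ x) : mapRightHom eps eps_hparity' (Delta x) = inclLeft U ℂ x := by
  have hl : ∀ a d : U⟦X⟧, mapRightHom eps eps_hparity' (a ⊗ʰ d) = a ⊗ʰ eps d :=
    mapRight_htmul eps.toLinearMap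
  have h : b ⊗ʰ (0 : ℂ⟦X⟧) = 0 := (htmulRight b).map_zero
  rw [hx, map_add, hl, hl, h0, ha, h, add_zero, inclLeft_apply]

theorem Delta_counit_left (a : U⟦X⟧) :
    mapLeftHom eps eps_hparity' (Delta a) = (1 : ℂ⟦X⟧) ⊗ʰ a := by
  have : (mapLeftHom eps eps_hparity').comp Delta = inclRight ℂ U :=
    algHom_ext_jordan (counit_left_of eps_jR eps_jE3 Delta_jE3)
      (counit_left_of eps_jR eps_jF2 Delta_jF2) (counit_left_of eps_jTi eps_jF1 Delta_jF1)
  rw [← inclRight_apply, ← this]; rfl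

theorem Delta_counit_right (a : U⟦X⟧) :
    mapRightHom eps eps_hparity' (Delta a) = a ⊗ʰ (1 : ℂ⟦X⟧) := by
  have : (mapRightHom eps eps_hparity').comp Delta = inclLeft U ℂ :=
    algHom_ext_jordan (counit_right_of eps_jS eps_jE3 Delta_jE3)
      (counit_right_of eps_jS eps_jF2 Delta_jF2) (counit_right_of eps_jT eps_jF1 Delta_jF1)
  rw [← inclLeft_apply, ← this]; rfl

/-- The counit, as a homomorphism for the standard algebra structure of `ℂ⟦h⟧`. -/
def counitHom : U⟦X⟧ →ₐ[ℂ⟦X⟧] ℂ⟦X⟧ where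
  __ := eps.toRingHom
  commutes' r := by
    change eps (algebraMap ℂ⟦X⟧ U⟦X⟧ r) = r
    rw [AlgHom.commutes]
    ext n
    change coeff n (PowerSeries.map (algebraMap ℂ ℂ) r) = _
    simp

/-! ## The antipode -/

open MulOpposite in
/-- The anti-automorphism that multiplies odd generators by `-i` and even ones by `-1`. -/
theorem Core.op {R : Type*} [Ring R] [Algebra ℂ R] {e1 h1 f1 n e3 f2 : R}
    (c : Core e1 h1 f1 n e3 f2) : Core (MulOpposite.op (-e1)) (MulOpposite.op (-h1))
      (MulOpposite.op (-f1)) (MulOpposite.op (-n)) (MulOpposite.op (-Complex.I • e3))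
      (MulOpposite.op (-Complex.I • f2)) := by
  have hI : Complex.I * Complex.I = -1 := Complex.I_mul_I
  have key : ∀ {x y : R}, x = y → MulOpposite.op x = MulOpposite.op y := fun h => congrArg _ h
  constructor <;> simp only [← op_mul, ← op_add, ← op_sub, ← op_smul, ← op_neg, ← op_zero] <;>
    refine key ?_ <;>
    simp only [neg_mul, mul_neg, neg_neg, smul_mul_assoc, mul_smul_comm, neg_smul, smul_neg,
      smul_smul, hI, mul_sub, sub_mul, mul_add, add_mul, one_smul, ← mul_assoc]
  · linear_combination (norm := module) -c.h1_f1
  · linear_combination (norm := module) -c.e1_f1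
  · linear_combination (norm := module) -c.n_f1
  · linear_combination (norm := module) -Complex.I • c.n_e3
  · linear_combination (norm := module) -Complex.I • c.n_f2
  · linear_combination (norm := module) -Complex.I • c.h1_e3
  · linear_combination (norm := module) -Complex.I • c.h1_f2
  · linear_combination (norm := module) -c.e3_e3
  · linear_combination (norm := module) -c.f2_f2
  · linear_combination (norm := module) -c.f2_e3
  · have h := c.serre_e
    simp only [mul_sub, sub_mul, ← mul_assoc] at h
    linear_combination (norm := module) -Complex.I • h
  · have h := c.serre_f
    simp only [mul_sub, sub_mul, ← mul_assoc] at h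
    linear_combination (norm := module) -Complex.I • h
  · have h := c.e2_f2
    simp only [mul_sub, sub_mul, ← mul_assoc] at h
    linear_combination (norm := skip) -h
    match_scalars <;> first | ring1 | linear_combination hI | linear_combination -hI

/-- An anti-automorphism of the classical enveloping algebra. -/
def anti0 : U →ₗ[ℂ] U :=
  (MulOpposite.opLinearEquiv ℂ).symm.toLinearMap ∘ₗ core_u.op.lift.toLinearMap

theorem anti0_mul (a b : U) : anti0 (a * b) = anti0 b * anti0 a := by
  change MulOpposite.unop (core_u.op.lift (a * b)) = _
  rw [map_mul, MulOpposite.unop_mul]; rfl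

theorem anti0_one : anti0 1 = 1 := by
  change MulOpposite.unop (core_u.op.lift 1) = _
  rw [map_one, MulOpposite.unop_one]

theorem anti0_u (x : Gen) : anti0 (u x) = MulOpposite.unop (Core.image (MulOpposite.op (-u .e1))
    (MulOpposite.op (-u .h1)) (MulOpposite.op (-u .f1)) (MulOpposite.op (-un))
    (MulOpposite.op (-Complex.I • u .e3)) (MulOpposite.op (-Complex.I • u .f2)) x) := by
  change MulOpposite.unop (core_u.op.lift (u x)) = _
  rw [Core.lift_u]

theorem coeffMap_anti {A B : Type*} [Ring A] [Algebra ℂ A] [Ring B] [Algebra ℂ B] {f : A →ₗ[ℂ] B}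
    (hf : ∀ a b, f (a * b) = f b * f a) (a b : A⟦X⟧) :
    coeffMap f (a * b) = coeffMap f b * coeffMap f a := by
  ext n
  rw [coeff_coeffMap, PowerSeries.coeff_mul, PowerSeries.coeff_mul, map_sum,
    ← Finset.Nat.sum_antidiagonal_swap]
  refine Finset.sum_congr rfl fun ij _ => ?_
  rw [hf, coeff_coeffMap, coeff_coeffMap]; rfl

theorem hpow_jTi : hpow jTi (-1 / 2) = jR := by
  refine sqrt_unique (coeff_zero_hpow _ _) (coeff_zero_hpow _ _) ?_
  rw [jc.invert.neg_half_sq coeff_zero_jTi, jR_jR]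

theorem core_inv : Core (jT * (jF2 * jE3 + jE3 * jF2)) (jTi * jH1)
    (jTi * jF1 + (1 / 2 : ℂ) • (hIn U⟦X⟧ * (jTi * jH1) * (jTi * jH1)) +
      (1 / 8 : ℂ) • (hIn U⟦X⟧ * (jTi * jTi - 1))) jN (jR * jE3) (jR * jF2) := by
  have h := jc.invert.core_primed coeff_zero_jTi (fun x hx => hIn_torsionFree x (by
    rwa [neg_mul, neg_eq_zero] at hx))
  rw [hpow_jTi] at h
  convert h using 1
  simp only [neg_mul]
  module

theorem TT_TiTi : (jT * jT) * (jTi * jTi) = 1 := by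
  rw [mul_assoc, ← mul_assoc jT jTi, jc.T_Tinv, one_mul, jc.T_Tinv]

theorem TiTi_TT : (jTi * jTi) * (jT * jT) = 1 := by
  rw [mul_assoc, ← mul_assoc jTi jT, jc.Tinv_T, one_mul, jc.Tinv_T]

/-- The antipode, up to signs. -/
def anti : U⟦X⟧ →ₗ[ℂ⟦X⟧] U⟦X⟧ :=
  ((conjHom (jT * jT) (jTi * jTi) TT_TiTi TiTi_TT).comp (liftHom core_inv.lift)).toLinearMap ∘ₗ
    coeffMapₗ anti0 ∘ₗ theta.symm.toLinearMap

theorem anti_mul (a b : U⟦X⟧) : anti (a * b) = anti b * anti a := by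
  change conjHom _ _ TT_TiTi TiTi_TT (liftHom core_inv.lift (coeffMap anti0 (theta.symm (a * b)))) = _
  rw [map_mul, coeffMap_anti anti0_mul, map_mul, map_mul]
  rfl

theorem anti_one : anti 1 = 1 := by
  change conjHom _ _ TT_TiTi TiTi_TT (liftHom core_inv.lift (coeffMap anti0 (theta.symm 1))) = _
  have h : coeffMap anti0 1 = 1 := by
    rw [← map_one (C (R := U)), coeffMap_C, anti0_one]
  rw [map_one theta.symm, h, map_one (liftHom _), map_one (conjHom _ _ _ _)]

theorem anti_csmul (r : ℂ) (x : U⟦X⟧) : anti (r • x) = r • anti x := csmul_map anti r x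

theorem anti_of {x : U} {y z y' : U⟦X⟧} (h : liftHom core_tw.lift (C x) = y)
    (hz : liftHom core_inv.lift (C (anti0 x)) = z) (hy : (jT * jT) * (z * (jTi * jTi)) = y') :
    anti y = y' := by
  subst h
  change conjHom _ _ TT_TiTi TiTi_TT (liftHom core_inv.lift (coeffMap anti0
    (theta.symm (theta (C x))))) = _
  rw [AlgEquiv.symm_apply_apply, coeffMap_C, hz, conjHom_apply, hy]

theorem TT_conj {x : U⟦X⟧} (h : x * jTi = jTi * x) : (jT * jT) * (x * (jTi * jTi)) = x := by
  rw [← mul_assoc x, h, mul_assoc jTi, h, ← mul_assoc jTi, ← mul_assoc, TT_TiTi, one_mul]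

theorem jR_jTi : jR * jTi = jTi * jR := by
  rw [jR_eq, mul_assoc, jc.T_Tinv, ← mul_assoc, jTi_jS, mul_assoc, jc.Tinv_T]

theorem anti_twE3 : anti twE3 = -Complex.I • (jR * jE3) :=
  anti_of core_tw.liftHom_image.2.2.2.2.1 (z := -Complex.I • (jR * jE3)) (by
    rw [anti0_u]
    change liftHom core_inv.lift (C (-Complex.I • u .e3)) = _
    rw [C_smul]
    exact (csmul_map (liftHom core_inv.lift).toLinearMap _ _).trans
      (congrArg _ core_inv.liftHom_image.2.2.2.2.1))
    (TT_conj (by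
      rw [smul_mul_assoc, mul_smul_comm, mul_assoc, jc.E3_Tinv, ← mul_assoc, jR_jTi, mul_assoc]))

theorem anti_twF2 : anti twF2 = -Complex.I • (jR * jF2) :=
  anti_of core_tw.liftHom_image.2.2.2.2.2 (z := -Complex.I • (jR * jF2)) (by
    rw [anti0_u]
    change liftHom core_inv.lift (C (-Complex.I • u .f2)) = _
    rw [C_smul]
    exact (csmul_map (liftHom core_inv.lift).toLinearMap _ _).trans
      (congrArg _ core_inv.liftHom_image.2.2.2.2.2))
    (TT_conj (by
      rw [smul_mul_assoc, mul_smul_comm, mul_assoc, jc.F2_Tinv, ← mul_assoc, jR_jTi, mul_assoc]))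

theorem anti_twE1 : anti twE1 = -(jT * (jF2 * jE3 + jE3 * jF2)) :=
  anti_of core_tw.liftHom_image.1 (z := -(jT * (jF2 * jE3 + jE3 * jF2))) (by
    rw [anti0_u]
    change liftHom core_inv.lift (C (-u .e1)) = _
    rw [map_neg, map_neg, core_inv.liftHom_image.1])
    (TT_conj (by
      simp only [neg_mul, mul_neg, mul_add, add_mul, mul_assoc, jc.E3_Tinv, jc.F2_Tinv,
        mul_assoc_of_eq jc.E3_Tinv, mul_assoc_of_eq jc.F2_Tinv, mul_assoc_of_eq jc.T_Tinv,
        mul_assoc_of_eq jc.Tinv_T]))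

theorem anti_jN : anti jN = -jN :=
  anti_of core_tw.liftHom_image.2.2.2.1 (z := -jN) (by
    have h : anti0 un = -un := by
      rw [un, map_add, anti0_u, anti0_u]
      simp only [Core.image, un, MulOpposite.unop_smul, MulOpposite.unop_add, MulOpposite.unop_sub,
        MulOpposite.unop_op]
      module
    rw [h, map_neg, map_neg, core_inv.liftHom_image.2.2.2.1])
    (TT_conj (by rw [neg_mul, mul_neg, jc.N_Tinv]))

theorem anti_jK : anti jK = -(jT * jH1 * (jTi * jTi)) :=
  anti_of core_tw.liftHom_image.2.1 (z := -(jTi * jH1)) (by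
    rw [anti0_u]
    change liftHom core_inv.lift (C (-u .h1)) = _
    rw [map_neg, map_neg, core_inv.liftHom_image.2.1])
    (by simp only [neg_mul, mul_neg, mul_assoc, mul_assoc_of_eq jc.T_Tinv, one_mul])

theorem anti_twF1 : anti twF1 = -(jT * jF1 * (jTi * jTi) +
    (1 / 2 : ℂ) • (hIn U⟦X⟧ * (jT * (jH1 * (jTi * (jH1 * (jTi * jTi)))))) +
      (1 / 8 : ℂ) • (hIn U⟦X⟧ * (jTi * jTi - 1))) :=
  anti_of core_tw.liftHom_image.2.2.1 (z := -(jTi * jF1 +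
    (1 / 2 : ℂ) • (hIn U⟦X⟧ * (jTi * jH1) * (jTi * jH1)) +
      (1 / 8 : ℂ) • (hIn U⟦X⟧ * (jTi * jTi - 1)))) (by
    rw [anti0_u]
    change liftHom core_inv.lift (C (-u .f1)) = _
    rw [map_neg, map_neg, core_inv.liftHom_image.2.2.1])
    (by
      simp only [neg_mul, mul_neg, mul_add, add_mul, mul_sub, sub_mul, mul_smul_comm, smul_mul_assoc,
        mul_assoc, mul_assoc_of_eq (jc.h_comm jT), mul_assoc_of_eq jc.T_Tinv, one_mul, mul_one,
        jc.T_Tinv])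

theorem anti_jTi : anti jTi = jT := by
  refine sqrt_unique (coeff_zero_algHom anti anti_one coeff_zero_jTi) jT0 ?_
  have h : jTi * jTi = 1 - (2 : ℂ) • hbar • twE1 := by
    rw [← hIn_mul, two_hIn_twE1]; abel
  have h2 := jc.F2_E3
  rw [← anti_mul, h, map_sub, anti_one, anti_csmul, map_smul, anti_twE1, ← hIn_mul, mul_neg,
    ← mul_assoc, ← jc.h_comm, mul_assoc, mul_add, h2, add_comm (-_), add_assoc, neg_add_cancel,
    add_zero, mul_smul_comm, mul_sub, jc.T_Tinv]
  module

theorem anti_jS : anti jS = jR := by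
  refine sqrt_unique (coeff_zero_algHom anti anti_one coeff_zero_jS) (coeff_zero_hpow _ _) ?_
  rw [← anti_mul, jS_jS, anti_jTi, jR_jR]

theorem anti_jT : anti jT = jTi := by
  refine (left_inv_eq_right_inv (a := anti jTi) ?_ ?_)
  · rw [← anti_mul, jc.Tinv_T, anti_one]
  · rw [anti_jTi, jc.T_Tinv]

theorem anti_jR : anti jR = jS := by
  rw [jR_eq, anti_mul, anti_jT, anti_jS, jR_eq, ← mul_assoc, jTi_jS, mul_assoc, jc.Tinv_T, mul_one]

theorem anti_jH1 : anti jH1 = -(jT * jH1 * jTi) := by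
  have h : jH1 = jTi * jK := by rw [jK, ← mul_assoc, jc.Tinv_T, one_mul]
  rw [h, anti_mul, anti_jTi, anti_jK, ← h]
  simp only [neg_mul, mul_assoc, jc.Tinv_T, mul_one]

theorem anti_jF1 : anti jF1 = -(jT * jF1 * jTi) := by
  have h0 : jT * jF1 = twF1 + (1 / 2 : ℂ) • hbar • (jK * jK) + (1 / 8 : ℂ) • hbar • (jT * jT - 1) := by
    rw [twF1, ← hIn_mul, ← hIn_mul, mul_assoc]; abel
  have h1 : anti (jT * jF1) = -(jT * jF1 * (jTi * jTi)) := by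
    refine (congrArg anti h0).trans ?_
    simp only [map_add, map_sub, anti_csmul, map_smul, anti_twF1, anti_mul, anti_jK, anti_jT, anti_one]
    simp only [← hIn_mul, neg_mul, mul_neg, neg_neg, mul_assoc, mul_assoc_of_eq jc.Tinv_T, one_mul]
    module
  have h2 : jF1 = jTi * (jT * jF1) := by rw [← mul_assoc, jc.Tinv_T, one_mul]
  rw [h2, anti_mul, h1, anti_jTi, ← h2]
  simp only [neg_mul, mul_assoc, jc.Tinv_T, mul_one]

/-- The map that fixes even elements and multiplies odd elements by `-i`. -/
def kap : U⟦X⟧ →ₗ[ℂ⟦X⟧] U⟦X⟧ where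
  toFun a := (1 / 2 : ℂ) • (a + hparity a) - (Complex.I / 2) • (a - hparity a)
  map_add' a b := by
    have h : hparity (a + b) = hparity a + hparity b := map_add (hparityHom U) a b
    rw [h]; module
  map_smul' r a := by
    have h : hparity (r • a) = r • hparity a := map_smul (hparityHom U) r a
    rw [h, RingHom.id_apply, ← smul_add, ← smul_sub, smul_comm _ r, smul_comm _ r, ← smul_sub]

theorem kap_even {a : U⟦X⟧} (ha : Even a) : kap a = a := by
  change (1 / 2 : ℂ) • (a + hparity a) - (Complex.I / 2) • (a - hparity a) = a
  rw [ha]; module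

theorem kap_odd {a : U⟦X⟧} (ha : Odd a) : kap a = -Complex.I • a := by
  change (1 / 2 : ℂ) • (a + hparity a) - (Complex.I / 2) • (a - hparity a) = _
  rw [ha]; module

theorem hparity_mul (a b : U⟦X⟧) : hparity (a * b) = hparity a * hparity b :=
  map_mul (hparityHom U) a b

theorem kap_even_mul {a : U⟦X⟧} (ha : Even a) (b : U⟦X⟧) : kap (a * b) = a * kap b := by
  change (1 / 2 : ℂ) • (a * b + hparity (a * b)) - (Complex.I / 2) • (a * b - hparity (a * b)) =
    a * ((1 / 2 : ℂ) • (b + hparity b) - (Complex.I / 2) • (b - hparity b))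
  rw [hparity_mul, ha]
  simp only [mul_add, mul_sub, mul_smul_comm]

theorem kap_odd_mul {a : U⟦X⟧} (ha : Odd a) (b : U⟦X⟧) :
    kap (a * b) = -Complex.I • (a * kap (hparity b)) := by
  induction b using hparity_induction with
  | hadd b c hb hc =>
    have h : hparity (b + c) = hparity b + hparity c := map_add (hparityHom U) b c
    rw [h, map_add, mul_add, map_add, hb, hc, mul_add, smul_add]
  | h0 b hb => rw [hb, kap_even hb, kap_odd (ha.mul_even hb)]
  | h1 b hb =>
    rw [hb, map_neg, kap_odd hb, kap_even (ha.mul hb), mul_neg, mul_smul_comm, smul_neg, smul_smul,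
      neg_mul_neg, Complex.I_mul_I, neg_one_smul, neg_neg]

/-- The antipode. -/
def S : U⟦X⟧ →ₗ[ℂ⟦X⟧] U⟦X⟧ := anti ∘ₗ kap

theorem S_even {a : U⟦X⟧} (ha : Even a) : S a = anti a := by
  change anti (kap a) = _
  rw [kap_even ha]

theorem S_odd {a : U⟦X⟧} (ha : Odd a) : S a = -Complex.I • anti a := by
  change anti (kap a) = _
  rw [kap_odd ha, anti_csmul]

theorem S_even_mul {a : U⟦X⟧} (ha : Even a) (b : U⟦X⟧) : S (a * b) = S b * S a := by
  rw [S_even ha]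
  change anti (kap _) = anti (kap _) * _
  rw [kap_even_mul ha, anti_mul]

theorem S_odd_mul {a : U⟦X⟧} (ha : Odd a) (b : U⟦X⟧) : S (a * b) = S (hparity b) * S a := by
  rw [S_odd ha]
  change anti (kap _) = anti (kap _) * _
  rw [kap_odd_mul ha, anti_csmul, anti_mul, mul_smul_comm]

theorem S_mul_even (a : U⟦X⟧) {b : U⟦X⟧} (hb : Even b) : S (a * b) = S b * S a := by
  induction a using hparity_induction with
  | hadd a c ha hc => rw [add_mul, map_add, map_add, mul_add, ha, hc]
  | h0 a ha => rw [S_even_mul ha]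
  | h1 a ha => rw [S_odd_mul ha, hb]

theorem S_mul_odd (a : U⟦X⟧) {b : U⟦X⟧} (hb : Odd b) : S (a * b) = S b * S (hparity a) := by
  induction a using hparity_induction with
  | hadd a c ha hc =>
    have h : hparity (a + c) = hparity a + hparity c := map_add (hparityHom U) a c
    rw [add_mul, map_add, h, map_add, mul_add, ha, hc]
  | h0 a ha => rw [S_even_mul ha, ha]
  | h1 a ha => rw [S_odd_mul ha, hb, ha, map_neg, map_neg, neg_mul, mul_neg]

theorem S_one : S 1 = 1 := by rw [S_even Even.one, anti_one]

theorem S_csmul (r : ℂ) (a : U⟦X⟧) : S (r • a) = r • S a := csmul_map S r a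

theorem S_jT : S jT = jTi := by rw [S_even even_jT, anti_jT]

theorem S_jTi : S jTi = jT := by rw [S_even even_jTi, anti_jTi]

theorem S_jS : S jS = jR := by rw [S_even even_jS, anti_jS]

theorem S_jR : S jR = jS := by rw [S_even even_jR, anti_jR]

theorem S_jH1 : S jH1 = -(jT * jH1 * jTi) := by rw [S_even even_jH1, anti_jH1]

theorem S_jF1 : S jF1 = -(jT * jF1 * jTi) := by rw [S_even even_jF1, anti_jF1]

theorem S_jN : S jN = -jN := by rw [S_even even_jN, anti_jN]

theorem S_jE3 : S jE3 = -jE3 := by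
  have h : jE3 = jR * twE3 := by rw [twE3, ← mul_assoc, jR_jS, one_mul]
  rw [h, S_even_mul even_jR, S_odd odd_twE3, anti_twE3, smul_smul, neg_mul_neg, Complex.I_mul_I, S_jR,
    neg_one_smul, ← h, neg_mul, mul_assoc, jE3_jS, ← mul_assoc, jR_jS, one_mul]

theorem S_jF2 : S jF2 = -jF2 := by
  have h : jF2 = jR * twF2 := by rw [twF2, ← mul_assoc, jR_jS, one_mul]
  rw [h, S_even_mul even_jR, S_odd odd_twF2, anti_twF2, smul_smul, neg_mul_neg, Complex.I_mul_I, S_jR,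
    neg_one_smul, ← h, neg_mul, mul_assoc, jF2_jS, ← mul_assoc, jR_jS, one_mul]

theorem S_jE2 : S jE2 = -jE2 - (1 / 2 : ℂ) • hbar • ((jT + jTi) * jE3) := by
  have h : S jE2 = -(jT * jE2 * jTi) := by
    rw [jc.E2_eq, map_sub, S_even_mul even_jF1, S_mul_even _ even_jF1, S_jE3, S_jF1]
    simp only [neg_mul, mul_neg, neg_neg, mul_sub, sub_mul, mul_assoc, ← jc.E3_Tinv]
    simp only [mul_assoc_of_eq jc.E3_T, mul_assoc]
    abel
  rw [h, mul_assoc, jc.E2_Tinv, ← hIn_mul]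
  simp only [mul_add, add_mul, mul_smul_comm, mul_assoc, mul_assoc_of_eq jc.T_Tinv, one_mul,
    mul_assoc_of_eq (jc.h_comm jT)]
  module

theorem S_jF3 : S jF3 = -jF3 + (1 / 2 : ℂ) • hbar • ((jT + jTi) * jF2) := by
  have h : S jF3 = -(jT * jF3 * jTi) := by
    have h2 : jF3 = jF1 * -jF2 - -jF2 * jF1 := jc.symm.E2_eq
    rw [h2, map_sub, S_even_mul even_jF1, S_mul_even _ even_jF1, map_neg, S_jF2, S_jF1]
    simp only [neg_mul, mul_neg, neg_neg, mul_sub, sub_mul, mul_assoc, ← jc.F2_Tinv]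
    simp only [mul_assoc_of_eq jc.F2_T, mul_assoc]
    abel
  rw [h, mul_assoc, jc.F3_Tinv, ← hIn_mul]
  simp only [mul_add, mul_sub, add_mul, mul_smul_comm, mul_assoc, mul_assoc_of_eq jc.T_Tinv, one_mul,
    mul_assoc_of_eq (jc.h_comm jT)]
  module

theorem S_PH1 : S ((jT + jTi) * jH1) =
    -((jT + jTi) * jH1) - (2 : ℂ) • (jTi * jTi - 1) := by
  rw [S_even_mul (even_jT.add even_jTi), S_jH1, map_add, S_jT, S_jTi]
  have h := jc.H1_Tinv
  simp only [mul_add, add_mul, neg_mul, mul_assoc, h, jc.H1_T, jc.Tinv_T, mul_one, mul_sub,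
    mul_assoc_of_eq h, sub_mul, one_mul, mul_assoc_of_eq jc.T_Tinv, jc.T_Tinv]
  module

theorem S_H2 : S jordanGens.H2 = -jordanGens.H2 + (1 / 2 : ℂ) • (jTi ^ 2 - 1) := by
  rw [jH2_eq, map_sub, S_csmul, S_csmul, S_PH1, S_jN, sq]
  module

theorem S_H3 : S jordanGens.H3 = -jordanGens.H3 - (1 / 2 : ℂ) • (jTi ^ 2 - 1) := by
  rw [jH3_eq, map_add, S_csmul, S_csmul, S_PH1, S_jN, sq]
  module

instance separated_hom {M N : Type*} [AddCommGroup M] [Module ℂ⟦X⟧ M] [AddCommGroup N]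
    [Module ℂ⟦X⟧ N] [hN : Separated N] : Separated (M →ₗ[ℂ⟦X⟧] N) :=
  separated_iff.2 fun f hf => LinearMap.ext fun m => separated_iff.1 hN _ fun n => by
    obtain ⟨g, rfl⟩ := hf n
    exact ⟨g m, rfl⟩

section Convolution

variable {A : Type*} [Ring A] [Algebra ℂ A] [SuperAlgebra A]

/-- The map `a ⊗ b ↦ F a * b`. -/
def mulLeft (F : A⟦X⟧ →ₗ[ℂ⟦X⟧] A⟦X⟧) : (A ⊗ˢ A)⟦X⟧ →ₗ[ℂ⟦X⟧] A⟦X⟧ :=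
  coeffMapₗ (mulMap A) ∘ₗ mapLeftₗ (F.restrictScalars ℂ)

/-- The map `a ⊗ b ↦ a * F b`. -/
def mulRight (F : A⟦X⟧ →ₗ[ℂ⟦X⟧] A⟦X⟧) : (A ⊗ˢ A)⟦X⟧ →ₗ[ℂ⟦X⟧] A⟦X⟧ :=
  coeffMapₗ (mulMap A) ∘ₗ mapRightₗ (F.restrictScalars ℂ)

theorem mulLeft_htmul (F : A⟦X⟧ →ₗ[ℂ⟦X⟧] A⟦X⟧) (a b : A⟦X⟧) : mulLeft F (a ⊗ʰ b) = F a * b := by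
  change coeffMap (mulMap A) (mapLeft (F.restrictScalars ℂ) (a ⊗ʰ b)) = _
  rw [mapLeft_htmul, coeffMap_mulMap_htmul]

theorem mulRight_htmul (F : A⟦X⟧ →ₗ[ℂ⟦X⟧] A⟦X⟧) (a b : A⟦X⟧) : mulRight F (a ⊗ʰ b) = a * F b := by
  change coeffMap (mulMap A) (mapRight (F.restrictScalars ℂ) (a ⊗ʰ b)) = _
  rw [mapRight_htmul, coeffMap_mulMap_htmul]

end Convolution

theorem counitHom_apply (a : U⟦X⟧) : counitHom a = eps a := rfl

/-- Linear maps on `U⟦h⟧` that are multiplicative in the sense of iterated actions. -/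
theorem action_eq {N : Type*} [AddCommGroup N] [Module ℂ⟦X⟧ N] [Separated N]
    {M : Type*} [AddCommGroup M] [Module ℂ⟦X⟧ M] (L : U⟦X⟧ →ₗ[ℂ⟦X⟧] M →ₗ[ℂ⟦X⟧] M)
    (P : M →ₗ[ℂ⟦X⟧] N) (h1 : L 1 = LinearMap.id)
    (hmul : (∀ a b, L (a * b) = L a ∘ₗ L b) ∨ ∀ a b, L (a * b) = L b ∘ₗ L a)
    (h_E3 : P ∘ₗ L jE3 = 0) (h_F2 : P ∘ₗ L jF2 = 0) (h_F1 : P ∘ₗ L jF1 = 0) (a : U⟦X⟧) (w : M) :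
    P (L a w) = counitHom a • P w := by
  have : LinearMap.compRight ℂ⟦X⟧ P ∘ₗ L = counitHom.toLinearMap.smulRight P := by
    refine linearMap_ext_gens coeff_zero_jordan_E3 coeff_zero_jordan_F2 coeff_zero_jordan_F1 ?_ ?_
      (h_E3.trans ?_) (h_F2.trans ?_) (h_F1.trans ?_)
    · ext w
      change P (L 1 w) = counitHom 1 • P w
      rw [h1, map_one, one_smul]; rfl
    · intro a b ha hb
      have ha' : ∀ w, P (L a w) = counitHom a • P w := fun w => LinearMap.congr_fun ha w
      have hb' : ∀ w, P (L b w) = counitHom b • P w := fun w => LinearMap.congr_fun hb w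
      ext w
      change P (L (a * b) w) = counitHom (a * b) • P w
      rw [map_mul counitHom]
      rcases hmul with h | h
      · rw [h, LinearMap.comp_apply, ha', hb', mul_smul]
      · rw [h, LinearMap.comp_apply, hb', ha', mul_comm, mul_smul]
    · ext w
      change 0 = counitHom jE3 • P w
      rw [counitHom_apply, eps_jE3, zero_smul]
    · ext w
      change 0 = counitHom jF2 • P w
      rw [counitHom_apply, eps_jF2, zero_smul]
    · ext w
      change 0 = counitHom jF1 • P w
      rw [counitHom_apply, eps_jF1, zero_smul]
  exact LinearMap.congr_fun (LinearMap.congr_fun this a) w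

theorem mulSLeft_odd {x : U⟦X⟧} (hx : Odd x) (hS : S x = -x) (hc : x * jS = jS * x)
    (hD : Delta x = x ⊗ʰ jS + jR ⊗ʰ x) (w : (U ⊗ˢ U)⟦X⟧) : mulLeft S (Delta x * w) = 0 := by
  have e1 := even_jS
  have : mulLeft S ∘ₗ LinearMap.mulLeft ℂ⟦X⟧ (Delta x) = 0 := by
    refine tensor_ext fun a b => ?_
    generalize (C a : U⟦X⟧) = a
    change mulLeft S (Delta x * (a ⊗ʰ C b)) = 0
    have h : (jR ⊗ʰ x) * (a ⊗ʰ C b) = (jR * hparity a) ⊗ʰ (x * C b) := by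
      induction a using hparity_induction with
      | hadd a c ha hc =>
        have h : hparity (a + c) = hparity a + hparity c := map_add (hparityHom U) a c
        rw [h, add_htmul, mul_add, ha, hc, mul_add, add_htmul]
      | h0 a ha => rw [htmul_mul_of_even_right _ _ ha, ha]
      | h1 a ha => rw [htmul_mul_of_odd _ hx ha, ha, mul_neg, neg_htmul]
    rw [hD, add_mul, htmul_mul_of_even_left _ e1, h, map_add, mulLeft_htmul, mulLeft_htmul,
      S_odd_mul hx, S_even_mul even_jR, S_jR, hS, mul_assoc, mul_assoc, ← mul_add, neg_mul,
      ← mul_assoc x, ← mul_assoc jS, hc, neg_add_cancel, mul_zero]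
  exact LinearMap.congr_fun this w

theorem mulSRight_odd {x : U⟦X⟧} (hx : Odd x) (hS : S x = -x) (hc : x * jR = jR * x)
    (hD : Delta x = x ⊗ʰ jS + jR ⊗ʰ x) (w : (U ⊗ˢ U)⟦X⟧) : mulRight S (w * Delta x) = 0 := by
  have e1 := even_jR
  have : mulRight S ∘ₗ LinearMap.mulRight ℂ⟦X⟧ (Delta x) = 0 := by
    refine tensor_ext fun a b => ?_
    generalize (C b : U⟦X⟧) = b
    change mulRight S ((C a ⊗ʰ b) * Delta x) = 0
    have h : (C a ⊗ʰ b) * (x ⊗ʰ jS) = (C a * x) ⊗ʰ (hparity b * jS) := by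
      induction b using hparity_induction with
      | hadd b c hb hc =>
        have h : hparity (b + c) = hparity b + hparity c := map_add (hparityHom U) b c
        rw [h, htmul_add, add_mul, hb, hc, add_mul, htmul_add]
      | h0 b hb => rw [htmul_mul_of_even_left _ hb, hb]
      | h1 b hb => rw [htmul_mul_of_odd _ hb hx, hb, neg_mul, htmul_neg]
    rw [hD, mul_add, htmul_mul_of_even_right _ _ e1, h, map_add, mulRight_htmul, mulRight_htmul,
      S_mul_odd _ hx, S_mul_even _ even_jS, S_jS, hS, mul_assoc, mul_assoc, ← mul_add, neg_mul,
      mul_neg, ← mul_assoc x, ← mul_assoc jR, hc, add_neg_cancel, mul_zero]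
  exact LinearMap.congr_fun this w

theorem mulSLeft_jF1 (w : (U ⊗ˢ U)⟦X⟧) : mulLeft S (Delta jF1 * w) = 0 := by
  have e1 := even_jT
  have e2 := even_jF1
  have : mulLeft S ∘ₗ LinearMap.mulLeft ℂ⟦X⟧ (Delta jF1) = 0 := by
    refine tensor_ext fun a b => ?_
    change mulLeft S (Delta jF1 * (C a ⊗ʰ C b)) = 0
    rw [Delta_jF1, add_mul, htmul_mul_of_even_left _ e1, htmul_mul_of_even_left _ e2, map_add,
      mulLeft_htmul, mulLeft_htmul, S_even_mul e2, S_even_mul even_jTi, S_jTi, S_jF1,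
      mul_assoc (S _), mul_assoc (S _), ← mul_add, neg_mul, mul_assoc _ jTi, ← mul_assoc jTi jT, jc.Tinv_T, one_mul, mul_assoc,
      neg_add_cancel, mul_zero]
  exact LinearMap.congr_fun this w

theorem mulSRight_jF1 (w : (U ⊗ˢ U)⟦X⟧) : mulRight S (w * Delta jF1) = 0 := by
  have e1 := even_jTi
  have e2 := even_jF1
  have : mulRight S ∘ₗ LinearMap.mulRight ℂ⟦X⟧ (Delta jF1) = 0 := by
    refine tensor_ext fun a b => ?_
    change mulRight S ((C a ⊗ʰ C b) * Delta jF1) = 0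
    rw [Delta_jF1, mul_add, htmul_mul_of_even_right _ _ e1, htmul_mul_of_even_right _ _ e2, map_add,
      mulRight_htmul, mulRight_htmul, S_mul_even _ e2, S_mul_even _ even_jT, S_jT, S_jF1, mul_assoc,
      mul_assoc, ← mul_add, neg_mul, mul_neg, mul_assoc jT, mul_assoc jT, ← mul_assoc jTi jT,
      jc.Tinv_T, one_mul, mul_assoc, add_neg_cancel, mul_zero]
  exact LinearMap.congr_fun this w

theorem mulSLeft_Delta (a : U⟦X⟧) : mulLeft S (Delta a) = algebraMap ℂ⟦X⟧ U⟦X⟧ (counitHom a) := by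
  have h := action_eq ((LinearMap.mul ℂ⟦X⟧ (U ⊗ˢ U)⟦X⟧) ∘ₗ Delta.toLinearMap) (mulLeft S)
    (by ext w; simp) (Or.inl fun a b => by ext w : 1; simp [mul_assoc])
    (LinearMap.ext fun w => mulSLeft_odd odd_jE3 S_jE3 jE3_jS Delta_jE3 w)
    (LinearMap.ext fun w => mulSLeft_odd odd_jF2 S_jF2 jF2_jS Delta_jF2 w)
    (LinearMap.ext fun w => mulSLeft_jF1 w) a 1
  have h2 : mulLeft S 1 = 1 := by rw [← one_htmul_one, mulLeft_htmul, S_one, one_mul]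
  rw [h2, Algebra.smul_def, mul_one] at h
  rw [← h]
  change mulLeft S (Delta a) = mulLeft S (Delta a * 1)
  rw [mul_one]

theorem mulSRight_Delta (a : U⟦X⟧) : mulRight S (Delta a) = algebraMap ℂ⟦X⟧ U⟦X⟧ (counitHom a) := by
  have hE : jE3 * jR = jR * jE3 := by rw [jR_eq, ← mul_assoc, jE3_jS, mul_assoc, jc.E3_T, mul_assoc]
  have hF : jF2 * jR = jR * jF2 := by rw [jR_eq, ← mul_assoc, jF2_jS, mul_assoc, jc.F2_T, mul_assoc]
  have h := action_eq ((LinearMap.mul ℂ⟦X⟧ (U ⊗ˢ U)⟦X⟧).flip ∘ₗ Delta.toLinearMap) (mulRight S)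
    (by ext w; simp) (Or.inr fun a b => by ext w : 1; simp [mul_assoc])
    (LinearMap.ext fun w => mulSRight_odd odd_jE3 S_jE3 hE Delta_jE3 w)
    (LinearMap.ext fun w => mulSRight_odd odd_jF2 S_jF2 hF Delta_jF2 w)
    (LinearMap.ext fun w => mulSRight_jF1 w) a 1
  have h2 : mulRight S 1 = 1 := by rw [← one_htmul_one, mulRight_htmul, S_one, one_mul]
  rw [h2, Algebra.smul_def, mul_one] at h
  rw [← h]
  change mulRight S (Delta a) = mulRight S (1 * Delta a)
  rw [one_mul]

theorem kap_hparity (a : U⟦X⟧) : kap (hparity a) = hparity (kap a) := by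
  have h : hparity (kap a) = (1 / 2 : ℂ) • (hparity a + hparity (hparity a)) -
      (Complex.I / 2) • (hparity a - hparity (hparity a)) := by
    have h1 := csmul_map (hparityHom U).toLinearMap
    change hparityHom U ((1 / 2 : ℂ) • (a + hparity a) - (Complex.I / 2) • (a - hparity a)) = _
    rw [map_sub]
    refine congrArg₂ _ ((h1 _ _).trans ?_) ((h1 _ _).trans ?_)
    · exact congrArg _ (map_add (hparityHom U) _ _)
    · exact congrArg _ (map_sub (hparityHom U) _ _)
  rw [h]; rfl

theorem S_hparity (a : U⟦X⟧) : S (hparity a) = hparity (S a) := by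
  have h : anti ∘ₗ (hparityHom U).toLinearMap = (hparityHom U).toLinearMap ∘ₗ anti := by
    have key : ∀ {x}, Odd x → S x = -x → anti (hparity x) = hparity (anti x) := by
      intro x hx h
      have h2 : anti x = -Complex.I • x := by
        have : anti x = Complex.I • S x := by
          rw [S_odd hx, smul_smul, mul_neg, Complex.I_mul_I, neg_neg, one_smul]
        rw [this, h, smul_neg, neg_smul]
      rw [hx, map_neg, h2, hx.csmul]
    refine linearMap_ext_gens coeff_zero_jordan_E3 coeff_zero_jordan_F2 coeff_zero_jordan_F1 ?_ ?_
      (key odd_jE3 S_jE3) (key odd_jF2 S_jF2) ?_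
    · change anti (hparity 1) = hparity (anti 1)
      rw [anti_one, Even.one, anti_one]
    · intro a b ha hb
      have ha' : anti (hparity a) = hparity (anti a) := ha
      have hb' : anti (hparity b) = hparity (anti b) := hb
      change anti (hparity (a * b)) = hparity (anti (a * b))
      rw [hparity_mul, anti_mul, anti_mul, ha', hb', hparity_mul]
    · change anti (hparity jF1) = hparity (anti jF1)
      rw [even_jF1, anti_jF1, ((even_jT.mul even_jF1).mul even_jTi).neg]
  have h2 : anti (hparity (kap a)) = hparity (anti (kap a)) := LinearMap.congr_fun h (kap a)
  rw [← kap_hparity] at h2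
  exact h2

/-! ## The Hopf structure -/

/-- The Hopf superalgebra `U_h(sl(2|1))`. -/
def jordanHopf : HopfStructure U where
  comul := Delta
  counit := counitHom
  antipode := S
  comul_parity := Delta_hparity
  counit_parity := eps_hparity
  antipode_parity := S_hparity
  coassoc := Delta_coassoc
  counit_left a := by
    rw [← Delta_counit_left, mapLeftHom_apply]
    rfl
  counit_right a := by
    rw [← Delta_counit_right, mapRightHom_apply]
    rfl
  antipode_left := mulSLeft_Delta
  antipode_right := mulSRight_Delta

theorem eps_H2 : eps jordanGens.H2 = 0 := by
  rw [jH2_eq, map_sub, eps_csmul, eps_csmul, eps_jN, map_mul, eps_jH1, mul_zero]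
  simp

theorem eps_H3 : eps jordanGens.H3 = 0 := by
  rw [jH3_eq, map_add, eps_csmul, eps_csmul, eps_jN, map_mul, eps_jH1, mul_zero]
  simp

theorem eps_jE2 : eps jE2 = 0 := by
  rw [jc.E2_eq, map_sub, map_mul, map_mul, eps_jF1, zero_mul, mul_zero, sub_zero]

theorem eps_jF3 : eps jF3 = 0 := by
  have h2 : jF3 = jF1 * -jF2 - -jF2 * jF1 := jc.symm.E2_eq
  rw [h2, map_sub, map_mul, map_mul, eps_jF1, zero_mul, mul_zero, sub_zero]

theorem isJordanCoalgebra_jordanHopf : IsJordanCoalgebra jordanGens jordanHopf where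
  comul_T := Delta_jT
  comul_Tinv := Delta_jTi
  comul_H1 := Delta_jH1
  comul_F1 := Delta_jF1
  comul_E2 := Delta_jE2
  comul_F2 := Delta_jF2
  comul_E3 := Delta_jE3
  comul_F3 := Delta_jF3
  comul_H2 := Delta_H2
  comul_H3 := Delta_H3
  antipode_T := S_jT
  antipode_Tinv := S_jTi
  antipode_H1 := S_jH1
  antipode_F1 := S_jF1
  antipode_E2 := S_jE2
  antipode_F2 := S_jF2
  antipode_E3 := S_jE3
  antipode_F3 := S_jF3
  antipode_H2 := S_H2
  antipode_H3 := S_H3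
  counit_T := eps_jT
  counit_Tinv := eps_jTi
  counit_H1 := eps_jH1
  counit_F1 := eps_jF1
  counit_H2 := eps_H2
  counit_H3 := eps_H3
  counit_E2 := eps_jE2
  counit_F2 := eps_jF2
  counit_E3 := eps_jE3
  counit_F3 := eps_jF3

/-! ## Uniqueness of the Hopf structure -/

section Unique

variable {A : Type*} [Ring A] [Algebra ℂ A] [SuperAlgebra A]

theorem hsmul_one_complex (r : ℂ⟦X⟧) : (formalAlgebra (A := ℂ)).toSMul.smul r (1 : ℂ⟦X⟧) = r := by
  change PowerSeries.map (algebraMap ℂ ℂ) r * 1 = r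
  rw [mul_one]; ext n; simp

theorem scalar_htmul (r : ℂ⟦X⟧) (a : A⟦X⟧) : r ⊗ʰ a = r • ((1 : ℂ⟦X⟧) ⊗ʰ a) :=
  (congrArg (· ⊗ʰ a) (hsmul_one_complex r)).symm.trans (hsmul_htmul r (1 : ℂ⟦X⟧) a)

theorem htmul_scalar (r : ℂ⟦X⟧) (a : A⟦X⟧) : a ⊗ʰ r = r • (a ⊗ʰ (1 : ℂ⟦X⟧)) :=
  (congrArg (a ⊗ʰ ·) (hsmul_one_complex r)).symm.trans (htmul_hsmul r a (1 : ℂ⟦X⟧))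

variable (A) in
/-- The isomorphism `ℂ ⊗ A → A`. -/
def slid : ℂ ⊗ˢ A →ₗ[ℂ] A :=
  (TensorProduct.lid ℂ A).toLinearMap ∘ₗ
    (GradedTensorProduct.of ℂ (grading ℂ) (grading A)).symm.toLinearMap

variable (A) in
/-- The isomorphism `A ⊗ ℂ → A`. -/
def srid : A ⊗ˢ ℂ →ₗ[ℂ] A :=
  (TensorProduct.rid ℂ A).toLinearMap ∘ₗ
    (GradedTensorProduct.of ℂ (grading A) (grading ℂ)).symm.toLinearMap

theorem coeffMap_slid (r : ℂ⟦X⟧) (a : A⟦X⟧) : coeffMapₗ (slid A) (r ⊗ʰ a) = r • a := by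
  rw [scalar_htmul, map_smul, ← inclRight_apply]
  congr 1
  ext n
  rw [coeffMapₗ_apply, coeff_coeffMap, inclRight, coeff_coeffHom]
  exact one_smul ℂ _

theorem coeffMap_srid (r : ℂ⟦X⟧) (a : A⟦X⟧) : coeffMapₗ (srid A) (a ⊗ʰ r) = r • a := by
  rw [htmul_scalar, map_smul, ← inclLeft_apply]
  congr 1
  ext n
  rw [coeffMapₗ_apply, coeff_coeffMap, inclLeft, coeff_coeffHom]
  exact one_smul ℂ _

theorem mul_assoc_triple (F G : A⟦X⟧ →ₗ[ℂ⟦X⟧] A⟦X⟧) (w : ((A ⊗ˢ A) ⊗ˢ A)⟦X⟧) :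
    mulLeft F (mapRight ((mulRight G).restrictScalars ℂ) (coeffMap (sassoc A A A) w)) =
      mulRight G (mapLeft ((mulLeft F).restrictScalars ℂ) w) := by
  have : mulLeft F ∘ₗ mapRightₗ ((mulRight G).restrictScalars ℂ) ∘ₗ coeffMapₗ (sassoc A A A) =
      mulRight G ∘ₗ mapLeftₗ ((mulLeft F).restrictScalars ℂ) := by
    refine tensor_ext fun x c => ?_
    refine DFunLike.congr_fun (tensor_ext (L₁ := (mulLeft F ∘ₗ mapRightₗ ((mulRight G).restrictScalars ℂ) ∘ₗ
      coeffMapₗ (sassoc A A A)) ∘ₗ htmulLeft (C c)) (L₂ := (mulRight G ∘ₗ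
        mapLeftₗ ((mulLeft F).restrictScalars ℂ)) ∘ₗ htmulLeft (C c)) fun a b => ?_) (C x)
    change mulLeft F (mapRight ((mulRight G).restrictScalars ℂ) (coeffMap (sassoc A A A)
      ((C a ⊗ʰ C b) ⊗ʰ C c))) = mulRight G (mapLeft ((mulLeft F).restrictScalars ℂ)
        ((C a ⊗ʰ C b) ⊗ʰ C c))
    rw [coeffMap_sassoc_htmul, mapRight_htmul, mapLeft_htmul, mulRight_htmul, mulLeft_htmul,
      mulLeft_htmul, mulRight_htmul, mul_assoc]
  exact DFunLike.congr_fun this w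

theorem antipode_unique {𝓗 𝓗' : HopfStructure A} (hΔ : 𝓗'.comul = 𝓗.comul)
    (hε : 𝓗'.counit = 𝓗.counit) : 𝓗'.antipode = 𝓗.antipode := by
  ext1 a
  have h1 : mulRight 𝓗.antipode (mapLeft ((mulLeft 𝓗'.antipode).restrictScalars ℂ)
      (mapLeft (𝓗.comul.toLinearMap.restrictScalars ℂ) (𝓗.comul a))) = 𝓗.antipode a := by
    have key : mulRight 𝓗.antipode ∘ₗ mapLeftₗ ((mulLeft 𝓗'.antipode).restrictScalars ℂ) ∘ₗ
        mapLeftₗ (𝓗.comul.toLinearMap.restrictScalars ℂ) = 𝓗.antipode ∘ₗ coeffMapₗ (slid A) ∘ₗ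
          mapLeftₗ (𝓗.counit.toLinearMap.restrictScalars ℂ) := by
      refine tensor_ext fun b c => ?_
      change mulRight 𝓗.antipode (mapLeft ((mulLeft 𝓗'.antipode).restrictScalars ℂ)
        (mapLeft (𝓗.comul.toLinearMap.restrictScalars ℂ) (C b ⊗ʰ C c))) =
        𝓗.antipode (coeffMapₗ (slid A) (mapLeft (𝓗.counit.toLinearMap.restrictScalars ℂ)
          (C b ⊗ʰ C c)))
      have hb : mulLeft 𝓗'.antipode (𝓗.comul (C b)) = algebraMap ℂ⟦X⟧ A⟦X⟧ (𝓗.counit (C b)) := by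
        rw [← hΔ, ← hε]; exact 𝓗'.antipode_left _
      rw [mapLeft_htmul, mapLeft_htmul, mapLeft_C, coeffMap_slid, mulRight_htmul,
        AlgHom.toLinearMap_apply, hb, map_smul, Algebra.smul_def]
      rfl
    refine (LinearMap.congr_fun key (𝓗.comul a)).trans ?_
    change 𝓗.antipode (coeffMapₗ (slid A) (mapLeft (𝓗.counit.toLinearMap.restrictScalars ℂ)
      (𝓗.comul a))) = _
    rw [𝓗.counit_left, coeffMap_slid, one_smul]
  have h2 : mulLeft 𝓗'.antipode (mapRight ((mulRight 𝓗.antipode).restrictScalars ℂ)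
      (mapRight (𝓗.comul.toLinearMap.restrictScalars ℂ) (𝓗.comul a))) = 𝓗'.antipode a := by
    have key : mulLeft 𝓗'.antipode ∘ₗ mapRightₗ ((mulRight 𝓗.antipode).restrictScalars ℂ) ∘ₗ
        mapRightₗ (𝓗.comul.toLinearMap.restrictScalars ℂ) = 𝓗'.antipode ∘ₗ coeffMapₗ (srid A) ∘ₗ
          mapRightₗ (𝓗.counit.toLinearMap.restrictScalars ℂ) := by
      refine tensor_ext fun b c => ?_
      change mulLeft 𝓗'.antipode (mapRight ((mulRight 𝓗.antipode).restrictScalars ℂ)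
        (mapRight (𝓗.comul.toLinearMap.restrictScalars ℂ) (C b ⊗ʰ C c))) =
        𝓗'.antipode (coeffMapₗ (srid A) (mapRight (𝓗.counit.toLinearMap.restrictScalars ℂ)
          (C b ⊗ʰ C c)))
      have hb : mulRight 𝓗.antipode (𝓗.comul (C c)) = algebraMap ℂ⟦X⟧ A⟦X⟧ (𝓗.counit (C c)) :=
        𝓗.antipode_right _
      rw [mapRight_htmul, mapRight_htmul, mapRight_C, coeffMap_srid, mulLeft_htmul,
        AlgHom.toLinearMap_apply, hb, map_smul, Algebra.smul_def, Algebra.commutes]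
      rfl
    refine (LinearMap.congr_fun key (𝓗.comul a)).trans ?_
    change 𝓗'.antipode (coeffMapₗ (srid A) (mapRight (𝓗.counit.toLinearMap.restrictScalars ℂ)
      (𝓗.comul a))) = _
    rw [𝓗.counit_right, coeffMap_srid, one_smul]
  rw [← h1, ← h2, ← mul_assoc_triple, 𝓗.coassoc]

theorem HopfStructure.ext_of {𝓗 𝓗' : HopfStructure A} (hΔ : 𝓗'.comul = 𝓗.comul)
    (hε : 𝓗'.counit = 𝓗.counit) : 𝓗' = 𝓗 := by
  have h := antipode_unique hΔ hε
  obtain ⟨⟩ := 𝓗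
  obtain ⟨⟩ := 𝓗'
  simp only at hΔ hε h
  subst hΔ hε h
  rfl

theorem eq_jordanHopf (𝓗 : HopfStructure U) (h : IsJordanCoalgebra jordanGens 𝓗) :
    𝓗 = jordanHopf :=
  HopfStructure.ext_of
    (algHom_ext_jordan (h.comul_E3.trans isJordanCoalgebra_jordanHopf.comul_E3.symm)
      (h.comul_F2.trans isJordanCoalgebra_jordanHopf.comul_F2.symm)
      (h.comul_F1.trans isJordanCoalgebra_jordanHopf.comul_F1.symm))
    (algHom_ext_jordan (h.counit_E3.trans isJordanCoalgebra_jordanHopf.counit_E3.symm)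
      (h.counit_F2.trans isJordanCoalgebra_jordanHopf.counit_F2.symm)
      (h.counit_F1.trans isJordanCoalgebra_jordanHopf.counit_F1.symm))

end Unique

/-! ## Logarithms -/

theorem log_exp : hlog (PowerSeries.exp ℂ) = X := by
  have h0 : coeff 0 (PowerSeries.exp ℂ) = 1 := by simp
  have h1 : coeff 0 (PowerSeries.exp ℂ - 1) = 0 := coeff_zero_sub_one h0
  refine PowerSeries.derivative.ext ?_ ?_
  · rw [hlog, derivative_subst_comp h1, map_sub, PowerSeries.derivative_one, sub_zero,
      PowerSeries.derivative_exp, PowerSeries.derivative_X]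
    have h := congrArg (substHom _ h1) one_add_X_mul_derivative_log
    rw [map_mul, map_add, map_one, substHom_apply, substHom_apply, subst_X h1, add_sub_cancel] at h
    rw [mul_comm, h]
  · have : coeff 0 (hlog (PowerSeries.exp ℂ)) = 0 := coeff_zero_hlog _
    rw [← PowerSeries.coeff_zero_eq_constantCoeff_apply, this]; simp

theorem hlog_hexp {A : Type*} [Ring A] [Algebra ℂ A] {a : A⟦X⟧} (ha : coeff 0 a = 0) :
    hlog (hexp a) = a := by
  have h : hexp a - 1 = subst (PowerSeries.exp ℂ - 1) a := by
    have : substHom a ha (PowerSeries.exp ℂ - 1) = substHom a ha (PowerSeries.exp ℂ) - 1 := by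
      rw [map_sub, map_one]
    exact this.symm
  rw [hlog, h, subst_subst ha (coeff_zero_sub_one (by simp))]
  change subst (hlog (PowerSeries.exp ℂ)) a = a
  rw [log_exp, subst_X ha]

/-! ## The universal `R`-matrix -/

theorem hexp_commute {A : Type*} [Ring A] [Algebra ℂ A] {a x : A⟦X⟧} (ha : coeff 0 a = 0)
    (h : Commute a x) : Commute (hexp a) x := subst_commute ha h _

section Slots

variable {A B : Type*} [Ring A] [Algebra ℂ A] [SuperAlgebra A] [Ring B] [Algebra ℂ B]
  [SuperAlgebra B] {i1 i2 i3 : A⟦X⟧ →ₐ[ℂ⟦X⟧] B⟦X⟧}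
  (c12 : ∀ {a b}, Even a → Even b → Commute (i1 a) (i2 b))
  (c13 : ∀ {a b}, Even a → Even b → Commute (i1 a) (i3 b))
  (c23 : ∀ {a b}, Even a → Even b → Commute (i2 a) (i3 b))
  {K L : A⟦X⟧} (hK : Even K) (hL : Even L) (hL0 : coeff 0 L = 0)

include c12 c13 c23 hK hL hL0

theorem slots_left (hR : Commute (hexp (-(i2 L * i3 K)) * hexp (i2 K * i3 L)) (i2 L + i3 L)) :
    hexp (-((i1 L + i2 L) * i3 K)) * (hexp (-(i1 K * i2 L)) *
      (hexp ((i1 K + i2 K) * i3 L) * hexp (i1 K * i2 L))) =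
    (hexp (-(i1 L * i3 K)) * hexp (i1 K * i3 L)) *
      (hexp (-(i2 L * i3 K)) * hexp (i2 K * i3 L)) := by
  have z : ∀ (i : A⟦X⟧ →ₐ[ℂ⟦X⟧] B⟦X⟧) x, coeff 0 (i L * x) = 0 := fun i x => by
    rw [coeff_zero_mul_eq, show coeff 0 (i L) = 0 from map_dvd i.toLinearMap hL0, zero_mul]
  have z' : ∀ (i : A⟦X⟧ →ₐ[ℂ⟦X⟧] B⟦X⟧) x, coeff 0 (x * i L) = 0 := fun i x => by
    rw [coeff_zero_mul_eq, show coeff 0 (i L) = 0 from map_dvd i.toLinearMap hL0, mul_zero]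
  have e1 : hexp (-((i1 L + i2 L) * i3 K)) = hexp (-(i1 L * i3 K)) * hexp (-(i2 L * i3 K)) := by
    rw [add_mul, neg_add, hexp_add (coeff_zero_neg (z _ _)) (coeff_zero_neg (z _ _))]
    exact (((c12 hL hL).mul_right (c13 hL hK)).mul_left
      ((c23 hL hK).symm.mul_right (Commute.refl _))).neg_left.neg_right
  have cab : Commute (i1 K * i3 L) (i2 K * i3 L) :=
    ((c12 hK hK).mul_right (c13 hK hL)).mul_left ((c23 hK hL).symm.mul_right (Commute.refl _))
  have e2 : hexp ((i1 K + i2 K) * i3 L) = hexp (i1 K * i3 L) * hexp (i2 K * i3 L) := by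
    rw [add_mul, hexp_add (z' _ _) (z' _ _) cab]
  have cca : Commute (i1 K * i2 L) (i1 K * i3 L) :=
    ((Commute.refl _).mul_right (c13 hK hL)).mul_left ((c12 hK hL).symm.mul_right (c23 hL hL))
  have e3 : hexp (i1 K * (i2 L + i3 L)) = hexp (i1 K * i2 L) * hexp (i1 K * i3 L) := by
    rw [mul_add, hexp_add (z' _ _) (z' _ _) cca]
  have k1 : hexp (i1 K * i3 L) * hexp (i2 K * i3 L) = hexp (i2 K * i3 L) * hexp (i1 K * i3 L) :=
    hexp_commute (z' _ _) (hexp_commute (z' _ _) cab.symm).symm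
  have k2 : hexp (i1 K * i2 L) * hexp (i1 K * i3 L) = hexp (i1 K * i3 L) * hexp (i1 K * i2 L) :=
    hexp_commute (z' _ _) (hexp_commute (z' _ _) cca.symm).symm
  have k3 : hexp (-(i2 L * i3 K)) * hexp (-(i1 K * i2 L)) =
      hexp (-(i1 K * i2 L)) * hexp (-(i2 L * i3 K)) := by
    refine hexp_commute (coeff_zero_neg (z _ _)) (hexp_commute (coeff_zero_neg (z' _ _)) ?_).symm
    exact (((c12 hK hL).mul_right (c13 hK hK)).mul_left
      ((Commute.refl _).mul_right (c23 hL hK))).neg_left.neg_right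
  have k4 : (hexp (-(i2 L * i3 K)) * hexp (i2 K * i3 L)) * hexp (i1 K * (i2 L + i3 L)) =
      hexp (i1 K * (i2 L + i3 L)) * (hexp (-(i2 L * i3 K)) * hexp (i2 K * i3 L)) := by
    refine (hexp_commute (by rw [mul_add, map_add, z', z', add_zero]) (Commute.mul_left ?_ hR.symm)).symm
    refine Commute.mul_right ?_ ?_
    · exact (hexp_commute (coeff_zero_neg (z _ _)) ((c12 hK hL).mul_right (c13 hK hK)).neg_right.symm).symm
    · exact (hexp_commute (z' _ _) ((c12 hK hK).mul_right (c13 hK hL)).symm).symm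
  have k5 : hexp (-(i1 K * i2 L)) * hexp (i1 K * i2 L) = 1 := hexp_neg_mul (z' _ _)
  rw [e3] at k4
  rw [e1, e2]
  generalize hexp (-(i1 L * i3 K)) = p at *
  generalize hexp (-(i2 L * i3 K)) = q at *
  generalize hexp (-(i1 K * i2 L)) = f at *
  generalize hexp (i1 K * i3 L) = a at *
  generalize hexp (i2 K * i3 L) = b at *
  generalize hexp (i1 K * i2 L) = c at *
  linear_combination (norm := noncomm_ring) p * k3 * a * b * c + p * f * q * k1 * c -
    p * f * q * b * k2 + p * f * k4 + p * k5 * a * q * b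

theorem slots_right (hR : Commute (hexp (-(i1 L * i3 K)) * hexp (i1 K * i3 L)) (i1 L + i3 L)) :
    (hexp (-(i2 K * i3 L)) * (hexp (-(i1 L * (i2 K + i3 K))) * hexp (i2 K * i3 L))) *
      hexp (i1 K * (i2 L + i3 L)) =
    (hexp (-(i1 L * i3 K)) * hexp (i1 K * i3 L)) *
      (hexp (-(i1 L * i2 K)) * hexp (i1 K * i2 L)) := by
  have z : ∀ (i : A⟦X⟧ →ₐ[ℂ⟦X⟧] B⟦X⟧) x, coeff 0 (i L * x) = 0 := fun i x => by
    rw [coeff_zero_mul_eq, show coeff 0 (i L) = 0 from map_dvd i.toLinearMap hL0, zero_mul]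
  have z' : ∀ (i : A⟦X⟧ →ₐ[ℂ⟦X⟧] B⟦X⟧) x, coeff 0 (x * i L) = 0 := fun i x => by
    rw [coeff_zero_mul_eq, show coeff 0 (i L) = 0 from map_dvd i.toLinearMap hL0, mul_zero]
  have e1 : hexp (-(i1 L * (i2 K + i3 K))) = hexp (-(i1 L * i2 K)) * hexp (-(i1 L * i3 K)) := by
    rw [mul_add, neg_add, hexp_add (coeff_zero_neg (z _ _)) (coeff_zero_neg (z _ _))]
    exact (((Commute.refl _).mul_right (c13 hL hK)).mul_left
      ((c12 hL hK).symm.mul_right (c23 hK hK))).neg_left.neg_right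
  have cca : Commute (i1 K * i2 L) (i1 K * i3 L) :=
    ((Commute.refl _).mul_right (c13 hK hL)).mul_left ((c12 hK hL).symm.mul_right (c23 hL hL))
  have e2 : hexp (i1 K * (i2 L + i3 L)) = hexp (i1 K * i2 L) * hexp (i1 K * i3 L) := by
    rw [mul_add, hexp_add (z' _ _) (z' _ _) cca]
  have cnm : Commute (-(i1 L * i2 K)) (-(i2 K * i3 L)) :=
    (((c12 hL hK).mul_right (c13 hL hL)).mul_left
      ((Commute.refl _).mul_right (c23 hK hL))).neg_left.neg_right
  have e3 : hexp (-((i1 L + i3 L) * i2 K)) = hexp (-(i1 L * i2 K)) * hexp (-(i2 K * i3 L)) := by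
    rw [add_mul, (c23 hK hL).symm.eq, neg_add,
      hexp_add (coeff_zero_neg (z _ _)) (coeff_zero_neg (z' _ _)) cnm]
  have k1 : hexp (i1 K * i2 L) * hexp (i1 K * i3 L) = hexp (i1 K * i3 L) * hexp (i1 K * i2 L) :=
    hexp_commute (z' _ _) (hexp_commute (z' _ _) cca.symm).symm
  have k2 : hexp (i2 K * i3 L) * hexp (i1 K * i3 L) = hexp (i1 K * i3 L) * hexp (i2 K * i3 L) :=
    hexp_commute (z' _ _) (hexp_commute (z' _ _) (((c12 hK hK).mul_right (c13 hK hL)).mul_left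
      ((c23 hK hL).symm.mul_right (Commute.refl _)))).symm
  have k3 : hexp (-(i1 L * i2 K)) * hexp (-(i2 K * i3 L)) =
      hexp (-(i2 K * i3 L)) * hexp (-(i1 L * i2 K)) :=
    hexp_commute (coeff_zero_neg (z _ _)) (hexp_commute (coeff_zero_neg (z' _ _)) cnm.symm).symm
  have k4 : hexp (-((i1 L + i3 L) * i2 K)) * (hexp (-(i1 L * i3 K)) * hexp (i1 K * i3 L)) =
      (hexp (-(i1 L * i3 K)) * hexp (i1 K * i3 L)) * hexp (-((i1 L + i3 L) * i2 K)) := by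
    refine hexp_commute (coeff_zero_neg (by rw [add_mul, map_add, z, z, add_zero]))
      (Commute.mul_left hR.symm ?_).neg_left
    refine Commute.mul_right ?_ ?_
    · exact (hexp_commute (coeff_zero_neg (z _ _)) ((c12 hL hK).mul_left (c23 hK hK).symm).neg_left).symm
    · exact (hexp_commute (z' _ _) ((c12 hK hK).mul_left (c23 hK hL).symm)).symm
  have k5 : hexp (-(i2 K * i3 L)) * hexp (i2 K * i3 L) = 1 := hexp_neg_mul (z' _ _)
  rw [e3] at k4
  rw [e1, e2]
  generalize hexp (-(i1 L * i3 K)) = p at *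
  generalize hexp (-(i1 L * i2 K)) = n at *
  generalize hexp (-(i2 K * i3 L)) = m at *
  generalize hexp (i1 K * i3 L) = a at *
  generalize hexp (i2 K * i3 L) = b at *
  generalize hexp (i1 K * i2 L) = c at *
  linear_combination (norm := noncomm_ring) m * n * p * b * k1 + m * n * p * k2 * c - k3 * p * a * b * c +
    k4 * b * c + p * a * n * k5 * c

end Slots

theorem parity_includeLeft {A B : Type*} [Ring A] [Algebra ℂ A] [SuperAlgebra A] [Ring B]
    [Algebra ℂ B] [SuperAlgebra B] (a : A) :
    GradedTensorProduct.includeLeft (grading A) (grading B) (SuperAlgebra.parity a) =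
      SuperAlgebra.parity (GradedTensorProduct.includeLeft (grading A) (grading B) a) := by
  have h := congrArg (coeff 0) (inclLeft_parity (B := B) (C a))
  simpa [inclLeft] using h

theorem parity_includeRight {A B : Type*} [Ring A] [Algebra ℂ A] [SuperAlgebra A] [Ring B]
    [Algebra ℂ B] [SuperAlgebra B] (b : B) :
    GradedTensorProduct.includeRight (grading A) (grading B) (SuperAlgebra.parity b) =
      SuperAlgebra.parity (GradedTensorProduct.includeRight (grading A) (grading B) b) := by
  have h := congrArg (coeff 0) (inclRight_parity (A := A) (C b))
  simpa [inclRight] using h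

theorem parity_id {A : Type*} [Ring A] [Algebra ℂ A] [SuperAlgebra A] (a : A) :
    AlgHom.id ℂ A (SuperAlgebra.parity a) = SuperAlgebra.parity (AlgHom.id ℂ A a) := rfl

theorem commute_incl {A B : Type*} [Ring A] [Algebra ℂ A] [SuperAlgebra A] [Ring B]
    [Algebra ℂ B] [SuperAlgebra B] {a : A⟦X⟧} (ha : Even a) (b : B⟦X⟧) :
    Commute (inclLeft A B a) (inclRight A B b) := by
  rw [inclLeft_apply, inclRight_apply]
  change _ * _ = _ * _
  rw [htmul_mul_of_even_left _ Even.one, htmul_mul_of_even_right _ _ ha, one_mul, mul_one, one_mul,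
    mul_one]

theorem Delta_jL : Delta jL = jL ⊗ʰ (1 : U⟦X⟧) + (1 : U⟦X⟧) ⊗ʰ jL := by
  have z1 : coeff 0 (inclLeft U U jL) = 0 := map_dvd (inclLeft U U).toLinearMap jL0
  have z2 : coeff 0 (inclRight U U jL) = 0 := map_dvd (inclRight U U).toLinearMap jL0
  have h : hexp (inclLeft U U jL + inclRight U U jL) = jT ⊗ʰ jT := by
    rw [hexp_add z1 z2 (commute_incl even_jL jL), ← algHom_hexp _ jL0, ← algHom_hexp _ jL0, hexp_jL,
      inclLeft_apply, inclRight_apply, ← htmul_eq_mul]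
  rw [← inclLeft_apply, ← inclRight_apply, ← hlog_hexp (a := inclLeft U U jL + inclRight U U jL)
    (by rw [map_add, z1, z2, add_zero]), h, ← Delta_jT, ← algHom_hlog _ jT0]
  rfl

/-- The universal `R`-matrix. -/
def jR12 : (U ⊗ˢ U)⟦X⟧ := RMatrix jT jH1

theorem jR12_eq : jR12 = hexp (-(jL ⊗ʰ jK)) * hexp (jK ⊗ʰ jL) := by
  have h : hbar • lnT jT = jL := hbar_divH jL0
  rw [jR12, RMatrix, ← hsmul_htmul, ← htmul_hsmul, h]; rfl

theorem coeff_zero_LK : coeff 0 (jL ⊗ʰ jK) = 0 := by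
  rw [htmul_eq_mul, coeff_zero_mul_eq, ← inclLeft_apply,
    show coeff 0 (inclLeft U U jL) = 0 from map_dvd (inclLeft U U).toLinearMap jL0, zero_mul]

theorem coeff_zero_KL : coeff 0 (jK ⊗ʰ jL) = 0 := coeff_zero_htmul_of_right _ jL0

theorem flip_tF : flipHom U tF = hexp (-(jL ⊗ʰ jK)) := by
  rw [tF, algHom_hexp _ (coeff_zero_neg coeff_zero_KL), map_neg, flipHom_of_even_left even_jK]

theorem jR12_eq_flip : jR12 = flipHom U tF * tFi := by rw [jR12_eq, flip_tF]; rfl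

theorem flip_jR12 : flipHom U jR12 = tF * flipHom U tFi := by
  rw [jR12_eq_flip, map_mul, flip_tF, algHom_hexp _ (coeff_zero_neg coeff_zero_LK), map_neg,
    flipHom_of_even_left even_jL]
  rfl

theorem flip_tFi_tF : flipHom U tFi * flipHom U tF = 1 := by rw [← map_mul, tFi_tF, map_one]

theorem flip_tF_tFi : flipHom U tF * flipHom U tFi = 1 := by rw [← map_mul, tF_tFi, map_one]

theorem triangular_jR12 : flipHom U jR12 * jR12 = 1 := by
  rw [flip_jR12, jR12_eq_flip, mul_assoc, mul_assoc_of_eq flip_tFi_tF, one_mul, tF_tFi]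

theorem jR12_flip : jR12 * flipHom U jR12 = 1 := by
  rw [flip_jR12, jR12_eq_flip, mul_assoc, mul_assoc_of_eq tFi_tF, one_mul, flip_tF_tFi]

theorem even_jR12 : Even jR12 := by
  rw [jR12_eq]
  exact (((even_jL.htmul even_jK).neg).hexp (coeff_zero_neg coeff_zero_LK)).mul
    ((even_jK.htmul even_jL).hexp coeff_zero_KL)

theorem flip_Delta0 (a : U⟦X⟧) : flipHom U (Delta0 a) = Delta0 a := by
  have key : ∀ {x}, Delta0 x = x ⊗ʰ (1 : U⟦X⟧) + (1 : U⟦X⟧) ⊗ʰ x →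
      flipHom U (Delta0 x) = Delta0 x := fun h => by
    rw [h, map_add, flipHom_of_even_left Even.one, flipHom_of_even_right _ Even.one, add_comm]
  have : (flipHom U).comp Delta0 = Delta0 :=
    algHom_ext_tw (key core_tensor.twHom_tw.2.2.2.2.1) (key core_tensor.twHom_tw.2.2.2.2.2)
      (key core_tensor.twHom_tw.2.2.1)
  exact DFunLike.congr_fun this a

theorem Delta_apply (a : U⟦X⟧) : Delta a = tF * (Delta0 a * tFi) := rfl

theorem intertwine_jR12 (a : U⟦X⟧) : jR12 * Delta a = flipHom U (Delta a) * jR12 := by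
  rw [Delta_apply, map_mul, map_mul, flip_Delta0, jR12_eq_flip]
  simp only [mul_assoc, mul_assoc_of_eq tFi_tF, mul_assoc_of_eq flip_tFi_tF, one_mul]

theorem commute_jR12 : Commute jR12 (jL ⊗ʰ (1 : U⟦X⟧) + (1 : U⟦X⟧) ⊗ʰ jL) := by
  have h := intertwine_jR12 jL
  rw [Delta_jL, map_add, flipHom_of_even_left Even.one, flipHom_of_even_right _ Even.one,
    add_comm ((1 : U⟦X⟧) ⊗ʰ jL)] at h
  exact h

theorem comul_left_jR12 : mapLeftHom Delta Delta_hparity jR12 =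
    smapHom (GradedTensorProduct.includeLeft (grading U) (grading U)) (AlgHom.id ℂ U)
        parity_includeLeft parity_id jR12 *
      smapHom (GradedTensorProduct.includeRight (grading U) (grading U)) (AlgHom.id ℂ U)
        parity_includeRight parity_id jR12 := by
  let i1 : U⟦X⟧ →ₐ[ℂ⟦X⟧] ((U ⊗ˢ U) ⊗ˢ U)⟦X⟧ := (inclLeft (U ⊗ˢ U) U).comp (inclLeft U U)
  let i2 : U⟦X⟧ →ₐ[ℂ⟦X⟧] ((U ⊗ˢ U) ⊗ˢ U)⟦X⟧ := (inclLeft (U ⊗ˢ U) U).comp (inclRight U U)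
  let i3 : U⟦X⟧ →ₐ[ℂ⟦X⟧] ((U ⊗ˢ U) ⊗ˢ U)⟦X⟧ := inclRight (U ⊗ˢ U) U
  have c12 : ∀ {a b}, Even a → Even b → Commute (i1 a) (i2 b) := fun {a b} ha _ =>
    (commute_incl ha b).map (inclLeft (U ⊗ˢ U) U)
  have c13 : ∀ {a b}, Even a → Even b → Commute (i1 a) (i3 b) := fun {a b} ha _ =>
    commute_incl (a := inclLeft U U a) (by rw [inclLeft_apply]; exact ha.htmul Even.one) b
  have c23 : ∀ {a b}, Even a → Even b → Commute (i2 a) (i3 b) := fun {a b} ha _ =>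
    commute_incl (a := inclRight U U a) (by rw [inclRight_apply]; exact Even.one.htmul ha) b
  set f1 := smapHom (GradedTensorProduct.includeLeft (grading U) (grading U)) (AlgHom.id ℂ U)
        parity_includeLeft parity_id with hf1
  set f2 := smapHom (GradedTensorProduct.includeRight (grading U) (grading U)) (AlgHom.id ℂ U)
        parity_includeRight parity_id with hf2
  have hid : ∀ b : U⟦X⟧, coeffHom (AlgHom.id ℂ U) b = b := fun b => by ext n; simp
  have s1 : ∀ a b, f1 (a ⊗ʰ b) = i1 a * i3 b := fun a b => by
    rw [hf1, smapHom_htmul, hid, htmul_eq_mul, ← inclLeft_apply, ← inclRight_apply]; rfl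
  have s2 : ∀ a b, f2 (a ⊗ʰ b) = i2 a * i3 b := fun a b => by
    rw [hf2, smapHom_htmul, hid, htmul_eq_mul, ← inclLeft_apply, ← inclRight_apply]; rfl
  have s3 : ∀ a b, inclLeft (U ⊗ˢ U) U (a ⊗ʰ b) = i1 a * i2 b := fun a b => by
    rw [htmul_eq_mul, map_mul, ← inclLeft_apply, ← inclRight_apply]; rfl
  have sR : ∀ x : (U ⊗ˢ U)⟦X⟧ , ∀ b, x ⊗ʰ b = inclLeft (U ⊗ˢ U) U x * i3 b := fun x b => by
    rw [htmul_eq_mul, ← inclLeft_apply, ← inclRight_apply]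
  have hm : ∀ a b : U⟦X⟧, mapLeftHom Delta Delta_hparity (a ⊗ʰ b) = Delta a ⊗ʰ b :=
    mapLeft_htmul Delta.toLinearMap
  have r1 : f1 jR12 = hexp (-(i1 jL * i3 jK)) * hexp (i1 jK * i3 jL) := by
    rw [jR12_eq, map_mul, algHom_hexp _ (coeff_zero_neg coeff_zero_LK), algHom_hexp _ coeff_zero_KL,
      map_neg, s1, s1]
  have r2 : f2 jR12 = hexp (-(i2 jL * i3 jK)) * hexp (i2 jK * i3 jL) := by
    rw [jR12_eq, map_mul, algHom_hexp _ (coeff_zero_neg coeff_zero_LK), algHom_hexp _ coeff_zero_KL,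
      map_neg, s2, s2]
  have hc : Commute (hexp (-(i2 jL * i3 jK)) * hexp (i2 jK * i3 jL)) (i2 jL + i3 jL) := by
    have h := commute_jR12.map f2
    rwa [r2, map_add, s2, s2, map_one, map_one, mul_one, one_mul] at h
  have t1 : inclLeft (U ⊗ˢ U) U tF = hexp (-(i1 jK * i2 jL)) := by
    rw [tF, algHom_hexp _ (coeff_zero_neg coeff_zero_KL), map_neg, s3]
  have t2 : inclLeft (U ⊗ˢ U) U tFi = hexp (i1 jK * i2 jL) := by
    rw [tFi, algHom_hexp _ coeff_zero_KL, s3]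
  have t12 : inclLeft (U ⊗ˢ U) U tF * inclLeft (U ⊗ˢ U) U tFi = 1 := by
    rw [← map_mul, tF_tFi, map_one]
  have t21 : inclLeft (U ⊗ˢ U) U tFi * inclLeft (U ⊗ˢ U) U tF = 1 := by
    rw [← map_mul, tFi_tF, map_one]
  have z3 : ∀ x, coeff 0 (x * i3 jL) = 0 := fun x => by
    rw [coeff_zero_mul_eq, show coeff 0 (i3 jL) = 0 from map_dvd i3.toLinearMap jL0, mul_zero]
  have m1 : mapLeftHom Delta Delta_hparity (hexp (-(jL ⊗ʰ jK))) =
      hexp (-((i1 jL + i2 jL) * i3 jK)) := by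
    rw [algHom_hexp _ (coeff_zero_neg coeff_zero_LK), map_neg, hm, Delta_jL, sR, map_add,
      ← inclLeft_apply, ← inclRight_apply]
    rfl
  have m2 : mapLeftHom Delta Delta_hparity (hexp (jK ⊗ʰ jL)) =
      hexp (-(i1 jK * i2 jL)) * (hexp ((i1 jK + i2 jK) * i3 jL) * hexp (i1 jK * i2 jL)) := by
    have h0 : Delta0 jK = jK ⊗ʰ (1 : U⟦X⟧) + (1 : U⟦X⟧) ⊗ʰ jK := core_tensor.twHom_tw.2.1
    have hk : inclLeft (U ⊗ˢ U) U (Delta0 jK) = i1 jK + i2 jK := by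
      rw [h0, map_add, ← inclLeft_apply, ← inclRight_apply]; rfl
    have hcc : inclLeft (U ⊗ˢ U) U tFi * i3 jL = i3 jL * inclLeft (U ⊗ˢ U) U tFi :=
      (commute_incl ((even_jK.htmul even_jL).hexp coeff_zero_KL) jL)
    rw [algHom_hexp _ coeff_zero_KL, hm, sR, Delta_apply, map_mul, map_mul, hk, mul_assoc, mul_assoc,
      hcc, ← mul_assoc (_ + _), ← conjHom_apply t12 t21, ← algHom_hexp _ (z3 _), conjHom_apply, t1, t2]
  rw [r1, r2, ← slots_left c12 c13 c23 even_jK even_jL jL0 hc, ← m1, ← m2, ← map_mul, ← jR12_eq]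

theorem comul_right_jR12 : mapRightHom Delta Delta_hparity jR12 =
    smapHom (AlgHom.id ℂ U) (GradedTensorProduct.includeRight (grading U) (grading U))
        parity_id parity_includeRight jR12 *
      smapHom (AlgHom.id ℂ U) (GradedTensorProduct.includeLeft (grading U) (grading U))
        parity_id parity_includeLeft jR12 := by
  let i1 : U⟦X⟧ →ₐ[ℂ⟦X⟧] (U ⊗ˢ (U ⊗ˢ U))⟦X⟧ := inclLeft U (U ⊗ˢ U)
  let i2 : U⟦X⟧ →ₐ[ℂ⟦X⟧] (U ⊗ˢ (U ⊗ˢ U))⟦X⟧ := (inclRight U (U ⊗ˢ U)).comp (inclLeft U U)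
  let i3 : U⟦X⟧ →ₐ[ℂ⟦X⟧] (U ⊗ˢ (U ⊗ˢ U))⟦X⟧ := (inclRight U (U ⊗ˢ U)).comp (inclRight U U)
  have c12 : ∀ {a b}, Even a → Even b → Commute (i1 a) (i2 b) := fun {a b} ha _ =>
    commute_incl ha _
  have c13 : ∀ {a b}, Even a → Even b → Commute (i1 a) (i3 b) := fun {a b} ha _ =>
    commute_incl ha _
  have c23 : ∀ {a b}, Even a → Even b → Commute (i2 a) (i3 b) := fun {a b} ha _ =>
    (commute_incl ha b).map (inclRight U (U ⊗ˢ U))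
  set f1 := smapHom (AlgHom.id ℂ U) (GradedTensorProduct.includeRight (grading U) (grading U))
        parity_id parity_includeRight with hf1
  set f2 := smapHom (AlgHom.id ℂ U) (GradedTensorProduct.includeLeft (grading U) (grading U))
        parity_id parity_includeLeft with hf2
  have hid : ∀ b : U⟦X⟧, coeffHom (AlgHom.id ℂ U) b = b := fun b => by ext n; simp
  have s1 : ∀ a b, f1 (a ⊗ʰ b) = i1 a * i3 b := fun a b => by
    rw [hf1, smapHom_htmul, hid, htmul_eq_mul, ← inclLeft_apply, ← inclRight_apply]; rfl
  have s2 : ∀ a b, f2 (a ⊗ʰ b) = i1 a * i2 b := fun a b => by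
    rw [hf2, smapHom_htmul, hid, htmul_eq_mul, ← inclLeft_apply, ← inclRight_apply]; rfl
  have s3 : ∀ a b, inclRight U (U ⊗ˢ U) (a ⊗ʰ b) = i2 a * i3 b := fun a b => by
    rw [htmul_eq_mul, map_mul, ← inclLeft_apply, ← inclRight_apply]; rfl
  have sR : ∀ a, ∀ x : (U ⊗ˢ U)⟦X⟧, a ⊗ʰ x = i1 a * inclRight U (U ⊗ˢ U) x := fun a x => by
    rw [htmul_eq_mul, ← inclLeft_apply, ← inclRight_apply]
  have hm : ∀ a b : U⟦X⟧, mapRightHom Delta Delta_hparity (a ⊗ʰ b) = a ⊗ʰ Delta b :=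
    mapRight_htmul Delta.toLinearMap
  have r1 : f1 jR12 = hexp (-(i1 jL * i3 jK)) * hexp (i1 jK * i3 jL) := by
    rw [jR12_eq, map_mul, algHom_hexp _ (coeff_zero_neg coeff_zero_LK), algHom_hexp _ coeff_zero_KL,
      map_neg, s1, s1]
  have r2 : f2 jR12 = hexp (-(i1 jL * i2 jK)) * hexp (i1 jK * i2 jL) := by
    rw [jR12_eq, map_mul, algHom_hexp _ (coeff_zero_neg coeff_zero_LK), algHom_hexp _ coeff_zero_KL,
      map_neg, s2, s2]
  have hc : Commute (hexp (-(i1 jL * i3 jK)) * hexp (i1 jK * i3 jL)) (i1 jL + i3 jL) := by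
    have h := commute_jR12.map f1
    rwa [r1, map_add, s1, s1, map_one, map_one, mul_one, one_mul] at h
  have t1 : inclRight U (U ⊗ˢ U) tF = hexp (-(i2 jK * i3 jL)) := by
    rw [tF, algHom_hexp _ (coeff_zero_neg coeff_zero_KL), map_neg, s3]
  have t2 : inclRight U (U ⊗ˢ U) tFi = hexp (i2 jK * i3 jL) := by
    rw [tFi, algHom_hexp _ coeff_zero_KL, s3]
  have t12 : inclRight U (U ⊗ˢ U) tF * inclRight U (U ⊗ˢ U) tFi = 1 := by
    rw [← map_mul, tF_tFi, map_one]
  have t21 : inclRight U (U ⊗ˢ U) tFi * inclRight U (U ⊗ˢ U) tF = 1 := by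
    rw [← map_mul, tFi_tF, map_one]
  have z1 : ∀ x, coeff 0 (i1 jL * x) = 0 := fun x => by
    rw [coeff_zero_mul_eq, show coeff 0 (i1 jL) = 0 from map_dvd i1.toLinearMap jL0, zero_mul]
  have m1 : mapRightHom Delta Delta_hparity (hexp (jK ⊗ʰ jL)) =
      hexp (i1 jK * (i2 jL + i3 jL)) := by
    rw [algHom_hexp _ coeff_zero_KL, hm, Delta_jL, sR, map_add, ← inclLeft_apply, ← inclRight_apply]
    rfl
  have m2 : mapRightHom Delta Delta_hparity (hexp (-(jL ⊗ʰ jK))) =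
      hexp (-(i2 jK * i3 jL)) * (hexp (-(i1 jL * (i2 jK + i3 jK))) * hexp (i2 jK * i3 jL)) := by
    have h0 : Delta0 jK = jK ⊗ʰ (1 : U⟦X⟧) + (1 : U⟦X⟧) ⊗ʰ jK := core_tensor.twHom_tw.2.1
    have hk : inclRight U (U ⊗ˢ U) (Delta0 jK) = i2 jK + i3 jK := by
      rw [h0, map_add, ← inclLeft_apply, ← inclRight_apply]; rfl
    have hcc : i1 jL * inclRight U (U ⊗ˢ U) tF = inclRight U (U ⊗ˢ U) tF * i1 jL :=
      (commute_incl even_jL tF)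
    rw [algHom_hexp _ (coeff_zero_neg coeff_zero_LK), map_neg, hm, sR, Delta_apply, map_mul, map_mul,
      hk, ← mul_assoc, hcc, mul_assoc, ← mul_assoc (i1 jL), ← conjHom_apply t12 t21, ← map_neg,
      ← algHom_hexp _ (coeff_zero_neg (z1 _)), conjHom_apply, t1, t2]
  rw [r1, r2, ← slots_right c12 c13 c23 even_jK even_jL jL0 hc, ← m1, ← m2, ← map_mul, ← jR12_eq]

theorem isTriangularRMatrix_jR12 : IsTriangularRMatrix jordanHopf jR12 where
  isUnit := ⟨⟨jR12, flipHom U jR12, jR12_flip, triangular_jR12⟩, rfl⟩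
  even := even_jR12
  intertwine := intertwine_jR12
  comul_left := by
    have h := comul_left_jR12
    rw [smapHom_apply, smapHom_apply, mapLeftHom_apply] at h
    exact h
  comul_right := by
    have h := comul_right_jR12
    rw [smapHom_apply, smapHom_apply, mapRightHom_apply] at h
    exact h
  triangular := triangular_jR12

/-! ## Hopf structures on subalgebras -/

section Pullback

open SuperAlgebra (parity)

variable {A A' B B' D D' : Type*} [Ring A] [Algebra ℂ A] [SuperAlgebra A] [Ring A'] [Algebra ℂ A']
  [SuperAlgebra A'] [Ring B] [Algebra ℂ B] [SuperAlgebra B] [Ring B'] [Algebra ℂ B']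
  [SuperAlgebra B'] [Ring D] [Algebra ℂ D] [SuperAlgebra D] [Ring D'] [Algebra ℂ D']
  [SuperAlgebra D']

theorem add_tmul (a a' : A) (b : B) : (GradedTensorProduct.tmul ℂ (a + a') b : A ⊗ˢ B) =
    GradedTensorProduct.tmul ℂ a b + GradedTensorProduct.tmul ℂ a' b := by
  simp [GradedTensorProduct.tmul, TensorProduct.add_tmul]

theorem tmul_add (a : A) (b b' : B) : (GradedTensorProduct.tmul ℂ a (b + b') : A ⊗ˢ B) =
    GradedTensorProduct.tmul ℂ a b + GradedTensorProduct.tmul ℂ a b' := by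
  simp [GradedTensorProduct.tmul, TensorProduct.tmul_add]

theorem zero_tmul (b : B) : (GradedTensorProduct.tmul ℂ (0 : A) b : A ⊗ˢ B) = 0 := by
  simp [GradedTensorProduct.tmul]

/-- Homomorphisms of superalgebras. -/
abbrev IsSuperHom (f : A →ₐ[ℂ] A') : Prop := ∀ a, f (parity a) = parity (f a)

/-- The tensor product of two homomorphisms of superalgebras. -/
def smapAlg (f : A →ₐ[ℂ] A') (g : B →ₐ[ℂ] B') (hf : IsSuperHom f) (hg : IsSuperHom g) :
    A ⊗ˢ B →ₐ[ℂ] A' ⊗ˢ B' :=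
  AlgHom.ofLinearMap (smap f.toLinearMap g.toLinearMap)
    (by
      change GradedTensorProduct.tmul ℂ (f 1) (g 1) = _
      rw [map_one, map_one]
      rfl)
    (fun x y => by
      have h := map_mul (smapHom f g hf hg) (C x) (C y)
      rw [← map_mul, smapHom_apply, smapHom_apply, smapHom_apply, coeffMap_C, coeffMap_C,
        coeffMap_C, ← map_mul] at h
      exact PowerSeries.C_injective h)

variable {f : A →ₐ[ℂ] A'} {g : B →ₐ[ℂ] B'} (hf : IsSuperHom f) (hg : IsSuperHom g)

theorem smapAlg_tmul (a : A) (b : B) : smapAlg f g hf hg (GradedTensorProduct.tmul ℂ a b) =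
    GradedTensorProduct.tmul ℂ (f a) (g b) := rfl

theorem coeffHom_smapAlg_htmul (a : A⟦X⟧) (b : B⟦X⟧) :
    coeffHom (smapAlg f g hf hg) (a ⊗ʰ b) = coeffHom f a ⊗ʰ coeffHom g b :=
  (smapHom_apply f g hf hg _).symm.trans (smapHom_htmul f g hf hg a b)

theorem parity_tmul (a : A) (b : B) : parity (GradedTensorProduct.tmul ℂ a b : A ⊗ˢ B) =
    GradedTensorProduct.tmul ℂ (parity a) (parity b) := by
  have h := hparity_htmul (C a) (C b)
  rw [hparity_C, hparity_C, C_htmul_C, C_htmul_C, hparity_C] at h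
  exact PowerSeries.C_injective h

theorem IsSuperHom.smapAlg : IsSuperHom (smapAlg f g hf hg) := fun x => by
  induction x using tensor_induction with
  | h0 => simp only [map_zero]
  | hadd x y hx hy => simp only [map_add, hx, hy]
  | h a b => rw [parity_tmul, smapAlg_tmul, smapAlg_tmul, parity_tmul, hf, hg]

theorem IsSuperHom.id : IsSuperHom (AlgHom.id ℂ A) := fun _ => rfl

include hf in
theorem IsSuperHom.hparity (a : A⟦X⟧) : coeffHom f (hparity a) = hparity (coeffHom f a) := by
  ext n
  simp [hf _]

theorem smap_smapAlg {r : A' →ₗ[ℂ] A} {s : B' →ₗ[ℂ] B} (hr : ∀ a, r (f a) = a)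
    (hs : ∀ b, s (g b) = b) (x : A ⊗ˢ B) : smap r s (smapAlg f g hf hg x) = x := by
  induction x using tensor_induction with
  | h0 => simp only [map_zero]
  | hadd x y hx hy => simp only [map_add, hx, hy]
  | h a b => rw [smapAlg_tmul, smap_tmul, hr, hs]

theorem coeffHom_id (a : A⟦X⟧) : coeffHom (AlgHom.id ℂ A) a = a := by
  ext n
  simp

theorem coeffHom_injective {r : A' →ₗ[ℂ] A} (hr : ∀ a, r (f a) = a) :
    Function.Injective (coeffHom f) :=
  coeffMap_injective (f := f.toLinearMap) (Function.LeftInverse.injective hr)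

theorem smapAlg_mulMap (x : A ⊗ˢ A) :
    f (mulMap A x) = mulMap A' (smapAlg f f hf hf x) := by
  induction x using tensor_induction with
  | h0 => simp only [map_zero]
  | hadd x y hx hy => simp only [map_add, hx, hy]
  | h a b => exact map_mul f a b

theorem smapAlg_flip (x : A ⊗ˢ A) : smapAlg f f hf hf (flip A x) =
    flip A' (smapAlg f f hf hf x) := by
  have e : ∀ {a}, parity a = a → parity (f a) = f a := fun h => by rw [← hf, h]
  have o : ∀ {a}, parity a = -a → parity (f a) = -f a := fun h => by rw [← hf, h, map_neg]
  induction x using tensor_induction with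
  | h0 => simp only [map_zero]
  | hadd x y hx hy => simp only [map_add, hx, hy]
  | h a b =>
    rw [smapAlg_tmul]
    induction a using parity_induction with
    | hadd a a' h h' => rw [map_add, add_tmul, add_tmul, map_add, map_add, map_add, h, h']
    | h0 a ha => rw [flip_tmul_of_even_left ha, flip_tmul_of_even_left (e ha), smapAlg_tmul]
    | h1 a ha =>
      induction b using parity_induction with
      | hadd b b' h h' => rw [map_add, tmul_add, tmul_add, map_add, map_add, map_add, h, h']
      | h0 b hb => rw [flip_tmul_of_even_right _ hb, flip_tmul_of_even_right _ (e hb), smapAlg_tmul]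
      | h1 b hb => rw [flip_tmul_of_odd ha hb, flip_tmul_of_odd (o ha) (o hb), map_neg, smapAlg_tmul]

theorem smapAlg_sassoc {k : D →ₐ[ℂ] D'} (hk : IsSuperHom k) (x : (A ⊗ˢ B) ⊗ˢ D) :
    smapAlg f (smapAlg g k hg hk) hf (hg.smapAlg hk) (sassoc A B D x) =
      sassoc A' B' D'
        (smapAlg (smapAlg f g hf hg) k (hf.smapAlg hg) hk x) := by
  induction x using tensor_induction with
  | h0 => simp only [map_zero]
  | hadd x y hx hy => simp only [map_add, hx, hy]
  | h a b =>
    induction a using tensor_induction with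
    | h0 => simp only [zero_tmul, map_zero]
    | hadd x y hx hy => simp only [add_tmul, map_add, hx, hy]
    | h a c => rfl

theorem mapLeft_natural {k : D →ₐ[ℂ] D'} (hk : IsSuperHom k) {G : A⟦X⟧ →ₗ[ℂ⟦X⟧] B⟦X⟧}
    {G' : A'⟦X⟧ →ₗ[ℂ⟦X⟧] B'⟦X⟧} (h : ∀ a, coeffHom g (G a) = G' (coeffHom f a))
    (x : (A ⊗ˢ D)⟦X⟧) :
    coeffHom (smapAlg g k hg hk) (mapLeft (G.restrictScalars ℂ) x) =
      mapLeft (G'.restrictScalars ℂ) (coeffHom (smapAlg f k hf hk) x) :=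
  DFunLike.congr_fun (tensor_ext
    (L₁ := (coeffHom (smapAlg g k hg hk)).toLinearMap ∘ₗ
      mapLeftₗ (G.restrictScalars ℂ))
    (L₂ := mapLeftₗ (G'.restrictScalars ℂ) ∘ₗ
      (coeffHom (smapAlg f k hf hk)).toLinearMap) fun a d => by
    simp only [LinearMap.comp_apply, AlgHom.toLinearMap_apply, mapLeftₗ_apply,
      coeffHom_smapAlg_htmul, mapLeft_htmul, h]) x

theorem mapRight_natural {k : D →ₐ[ℂ] D'} (hk : IsSuperHom k) {G : A⟦X⟧ →ₗ[ℂ⟦X⟧] B⟦X⟧}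
    {G' : A'⟦X⟧ →ₗ[ℂ⟦X⟧] B'⟦X⟧} (h : ∀ a, coeffHom g (G a) = G' (coeffHom f a))
    (x : (D ⊗ˢ A)⟦X⟧) :
    coeffHom (smapAlg k g hk hg) (mapRight (G.restrictScalars ℂ) x) =
      mapRight (G'.restrictScalars ℂ) (coeffHom (smapAlg k f hk hf) x) :=
  DFunLike.congr_fun (tensor_ext
    (L₁ := (coeffHom (smapAlg k g hk hg)).toLinearMap ∘ₗ
      mapRightₗ (G.restrictScalars ℂ))
    (L₂ := mapRightₗ (G'.restrictScalars ℂ) ∘ₗ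
      (coeffHom (smapAlg k f hk hf)).toLinearMap) fun a d => by
    simp only [LinearMap.comp_apply, AlgHom.toLinearMap_apply, mapRightₗ_apply,
      coeffHom_smapAlg_htmul, mapRight_htmul, h]) x

/-- The factorization of a homomorphism through an injective one. -/
theorem exists_factor_algHom {P Q M : Type*} [Ring P] [Algebra ℂ⟦X⟧ P] [Ring Q] [Algebra ℂ⟦X⟧ Q]
    [Ring M] [Algebra ℂ⟦X⟧ M] {φ : P →ₐ[ℂ⟦X⟧] Q} (hφ : Function.Injective φ) (ψ : M →ₐ[ℂ⟦X⟧] Q)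
    (h : ∀ m, ∃ p, φ p = ψ m) : ∃ χ : M →ₐ[ℂ⟦X⟧] P, ∀ m, φ (χ m) = ψ m :=
  ⟨(AlgEquiv.ofInjective φ hφ).symm.toAlgHom.comp (ψ.codRestrict φ.range h), fun m =>
    congrArg Subtype.val ((AlgEquiv.ofInjective φ hφ).apply_symm_apply ⟨ψ m, h m⟩)⟩

theorem exists_factor_linearMap {P Q M : Type*} [AddCommGroup P] [Module ℂ⟦X⟧ P] [AddCommGroup Q]
    [Module ℂ⟦X⟧ Q] [AddCommGroup M] [Module ℂ⟦X⟧ M] {φ : P →ₗ[ℂ⟦X⟧] Q}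
    (hφ : Function.Injective φ) (ψ : M →ₗ[ℂ⟦X⟧] Q) (h : ∀ m, ∃ p, φ p = ψ m) :
    ∃ χ : M →ₗ[ℂ⟦X⟧] P, ∀ m, φ (χ m) = ψ m :=
  ⟨(LinearEquiv.ofInjective φ hφ).symm.toLinearMap ∘ₗ ψ.codRestrict (LinearMap.range φ) h,
    fun m => congrArg Subtype.val ((LinearEquiv.ofInjective φ hφ).apply_symm_apply ⟨ψ m, h m⟩)⟩

variable (𝓗' : HopfStructure A')

/-- A subalgebra that is stable under the coproduct and the antipode inherits the Hopf
structure. -/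
theorem exists_isHopfEmbedding {r : A' →ₗ[ℂ] A} (hr : ∀ a, r (f a) = a)
    (hΔ : ∀ a, ∃ b, coeffHom (smapAlg f f hf hf) b = 𝓗'.comul (coeffHom f a))
    (hS : ∀ a, ∃ b, coeffHom f b = 𝓗'.antipode (coeffHom f a)) :
    ∃ 𝓗 : HopfStructure A, IsHopfEmbedding 𝓗 𝓗' f := by
  have i1 := coeffHom_injective hr
  have i2 := coeffHom_injective (smap_smapAlg hf hf hr hr)
  have i3 := coeffHom_injective (smap_smapAlg hf (hf.smapAlg hf) hr (smap_smapAlg hf hf hr hr))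
  have il := coeffHom_injective (smap_smapAlg (IsSuperHom.id (A := ℂ)) hf
    (r := LinearMap.id) (fun _ => rfl) hr)
  have ir := coeffHom_injective (smap_smapAlg hf (IsSuperHom.id (A := ℂ)) hr
    (s := LinearMap.id) (fun _ => rfl))
  obtain ⟨Δ, cΔ⟩ := exists_factor_algHom i2 (𝓗'.comul.comp (coeffHom f)) hΔ
  obtain ⟨S, cS⟩ := exists_factor_linearMap (φ := (coeffHom f).toLinearMap) i1
    (𝓗'.antipode ∘ₗ (coeffHom f).toLinearMap) hS
  have lΔ : ∀ a, coeffHom (smapAlg f f hf hf) (Δ.toLinearMap a) =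
    𝓗'.comul.toLinearMap (coeffHom f a) := cΔ
  have lS : ∀ a, coeffHom f (S a) = 𝓗'.antipode (coeffHom f a) := cS
  have lε : ∀ a, coeffHom (AlgHom.id ℂ ℂ) ((𝓗'.counit.comp (coeffHom f)).toLinearMap a) =
      𝓗'.counit.toLinearMap (coeffHom f a) := fun a => coeffHom_id _
  have nm : ∀ x, coeffHom f (coeffMap (mulMap A) x) =
      coeffMap (mulMap A') (coeffHom (smapAlg f f hf hf) x) := fun x => by
    ext n
    simp [smapAlg_mulMap hf]
  have na : ∀ x, coeffHom (smapAlg f (smapAlg f f hf hf) hf (hf.smapAlg hf))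
      (coeffMap (sassoc A A A) x) = coeffMap (sassoc A' A' A')
        (coeffHom (smapAlg (smapAlg f f hf hf) f (hf.smapAlg hf) hf) x) :=
    fun x => by
      ext n
      simp [smapAlg_sassoc hf hf]
  refine ⟨{ comul := Δ
            counit := 𝓗'.counit.comp (coeffHom f)
            antipode := S
            comul_parity := fun a => i2 ?_
            counit_parity := fun a => ?_
            antipode_parity := fun a => i1 ?_
            coassoc := fun a => i3 ?_
            counit_left := fun a => il ?_
            counit_right := fun a => ir ?_
            antipode_left := fun a => i1 ?_
            antipode_right := fun a => i1 ?_ },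
    Function.LeftInverse.injective hr, hf, fun a => ?_, fun a => rfl, fun a => (cS a).symm⟩
  · rw [(hf.smapAlg hf).hparity, cΔ, cΔ, AlgHom.comp_apply, AlgHom.comp_apply, hf.hparity,
      𝓗'.comul_parity]
  · rw [AlgHom.comp_apply, AlgHom.comp_apply, hf.hparity, 𝓗'.counit_parity]
  · rw [hf.hparity]
    refine (cS _).trans (.trans ?_ (congrArg hparity (cS a).symm))
    exact (congrArg 𝓗'.antipode (hf.hparity a)).trans (𝓗'.antipode_parity _)
  · rw [na, mapLeft_natural hf (hf.smapAlg hf) hf lΔ, mapRight_natural hf (hf.smapAlg hf) hf lΔ, cΔ]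
    exact 𝓗'.coassoc _
  · refine (mapLeft_natural hf IsSuperHom.id hf lε _).trans ?_
    rw [cΔ, coeffHom_smapAlg_htmul, map_one]
    exact 𝓗'.counit_left _
  · refine (mapRight_natural hf IsSuperHom.id hf lε _).trans ?_
    rw [cΔ, coeffHom_smapAlg_htmul, map_one]
    exact 𝓗'.counit_right _
  · rw [nm, mapLeft_natural hf hf hf lS, cΔ, AlgHom.commutes]
    exact 𝓗'.antipode_left _
  · rw [nm, mapRight_natural hf hf hf lS, cΔ, AlgHom.commutes]
    exact 𝓗'.antipode_right _
  · exact (cΔ a).symm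

theorem smapAlg_slot_left {p : A →ₐ[ℂ] A ⊗ˢ A} {p' : A' →ₐ[ℂ] A' ⊗ˢ A'}
    (hp : ∀ a, smapAlg f f hf hf (p a) = p' (f a)) (x : (A ⊗ˢ A)⟦X⟧) :
    coeffHom (smapAlg (smapAlg f f hf hf) f (hf.smapAlg hf) hf)
        (coeffMap (smap p.toLinearMap LinearMap.id) x) =
      coeffMap (smap p'.toLinearMap LinearMap.id) (coeffHom (smapAlg f f hf hf) x) := by
  ext n
  rw [coeff_coeffHom, coeff_coeffMap, coeff_coeffMap, coeff_coeffHom]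
  induction coeff n x using tensor_induction with
  | h0 => simp only [map_zero]
  | hadd x y hx hy => simp only [map_add, hx, hy]
  | h a b =>
    rw [smap_tmul, smapAlg_tmul, smapAlg_tmul, smap_tmul, AlgHom.toLinearMap_apply, hp]
    rfl

theorem smapAlg_slot_right {p : A →ₐ[ℂ] A ⊗ˢ A} {p' : A' →ₐ[ℂ] A' ⊗ˢ A'}
    (hp : ∀ a, smapAlg f f hf hf (p a) = p' (f a)) (x : (A ⊗ˢ A)⟦X⟧) :
    coeffHom (smapAlg f (smapAlg f f hf hf) hf (hf.smapAlg hf))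
        (coeffMap (smap LinearMap.id p.toLinearMap) x) =
      coeffMap (smap LinearMap.id p'.toLinearMap) (coeffHom (smapAlg f f hf hf) x) := by
  ext n
  rw [coeff_coeffHom, coeff_coeffMap, coeff_coeffMap, coeff_coeffHom]
  induction coeff n x using tensor_induction with
  | h0 => simp only [map_zero]
  | hadd x y hx hy => simp only [map_add, hx, hy]
  | h a b =>
    rw [smap_tmul, smapAlg_tmul, smapAlg_tmul, smap_tmul, AlgHom.toLinearMap_apply, hp]
    rfl

/-- The pullback of a triangular universal `R`-matrix along an embedding of Hopf superalgebras. -/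
theorem IsHopfEmbedding.isTriangularRMatrix {𝓗 : HopfStructure A} {𝓗' : HopfStructure A'}
    (h : IsHopfEmbedding 𝓗 𝓗' f) {r : A' →ₗ[ℂ] A} (hr : ∀ a, r (f a) = a)
    {R : (A ⊗ˢ A)⟦X⟧} {R' : (A' ⊗ˢ A')⟦X⟧} (hR : coeffHom (smapAlg f f hf hf) R = R')
    (h' : IsTriangularRMatrix 𝓗' R') : IsTriangularRMatrix 𝓗 R := by
  have i2 := coeffHom_injective (smap_smapAlg hf hf hr hr)
  have i3 := coeffHom_injective (smap_smapAlg hf (hf.smapAlg hf) hr (smap_smapAlg hf hf hr hr))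
  have i3' := coeffHom_injective (smap_smapAlg (hf.smapAlg hf) hf (smap_smapAlg hf hf hr hr) hr)
  have cΔ : ∀ a, coeffHom (smapAlg f f hf hf) (𝓗.comul.toLinearMap a) =
    𝓗'.comul.toLinearMap (coeffHom f a) := fun a => (h.comul a).symm
  have nf : ∀ x, coeffHom (smapAlg f f hf hf) (coeffMap (flip A) x) =
      coeffMap (flip A') (coeffHom (smapAlg f f hf hf) x) := fun x => by
    ext n
    simp [smapAlg_flip hf]
  have tri : coeffMap (flip A) R * R = 1 := i2 (by
    rw [map_mul, nf, hR, map_one]; exact h'.triangular)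
  have pl : ∀ a, smapAlg f f hf hf
      (GradedTensorProduct.includeLeft (grading A) (grading A) a) =
      GradedTensorProduct.includeLeft (grading A') (grading A') (f a) := fun a => by
    rw [GradedTensorProduct.includeLeft_apply, GradedTensorProduct.includeLeft_apply, smapAlg_tmul,
      map_one]
  have pr : ∀ a, smapAlg f f hf hf
      (GradedTensorProduct.includeRight (grading A) (grading A) a) =
      GradedTensorProduct.includeRight (grading A') (grading A') (f a) := fun a => by
    rw [GradedTensorProduct.includeRight_apply, GradedTensorProduct.includeRight_apply,
      smapAlg_tmul, map_one]
  have tri' : R * coeffMap (flip A) R = 1 := i2 (by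
    rw [map_mul, nf, hR, map_one]
    obtain ⟨v, hv⟩ := h'.isUnit.exists_right_inv
    rwa [left_inv_eq_right_inv h'.triangular hv])
  refine ⟨⟨⟨R, _, tri', tri⟩, rfl⟩, i2 ?_, fun a => i2 ?_, i3' ?_, i3 ?_, tri⟩
  · rw [(hf.smapAlg hf).hparity, hR, h'.even]
  · rw [map_mul, map_mul, nf, hR]
    have := h'.intertwine (coeffHom f a)
    rwa [← show _ = 𝓗'.comul (coeffHom f a) from cΔ a] at this
  · rw [map_mul, smapAlg_slot_left hf pl, smapAlg_slot_left hf pr,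
      mapLeft_natural hf (hf.smapAlg hf) hf cΔ, hR]
    exact h'.comul_left
  · rw [map_mul, smapAlg_slot_right hf pr, smapAlg_slot_right hf pl,
      mapRight_natural hf (hf.smapAlg hf) hf cΔ, hR]
    exact h'.comul_right

end Pullback

/-! ## The subalgebra `U(sl(2))` -/

section Lie

open LieAlgebra.SpecialLinear (sl)

attribute [local instance] LieRing.ofAssociativeRing

theorem sl_apply_one_one (x : sl (Fin 2) ℂ) : x.1 1 1 = -x.1 0 0 := by
  have h : Matrix.trace x.1 = 0 := x.2
  rw [Matrix.trace_fin_two] at h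
  linear_combination h

/-- The matrix `diag (1, -1)`. -/
def slH : sl (Fin 2) ℂ := LieAlgebra.SpecialLinear.singleSubSingle 0 1 1

/-- The upper triangular matrix unit. -/
def slE : sl (Fin 2) ℂ := LieAlgebra.SpecialLinear.single 0 1 Fin.zero_ne_one 1

/-- The lower triangular matrix unit. -/
def slF : sl (Fin 2) ℂ := LieAlgebra.SpecialLinear.single 1 0 Fin.zero_ne_one.symm 1

theorem slH_val : slH.1 = !![1, 0; 0, -1] := by
  ext i j
  fin_cases i <;> fin_cases j <;> simp [slH, LieAlgebra.SpecialLinear.val_singleSubSingle]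

theorem slE_val : slE.1 = !![0, 1; 0, 0] := by
  ext i j
  fin_cases i <;> fin_cases j <;> simp [slE, LieAlgebra.SpecialLinear.val_single]

theorem slF_val : slF.1 = !![0, 0; 1, 0] := by
  ext i j
  fin_cases i <;> fin_cases j <;> simp [slF, LieAlgebra.SpecialLinear.val_single]

theorem ι_eq (x : sl (Fin 2) ℂ) : UniversalEnvelopingAlgebra.ι ℂ x =
    x.1 0 0 • J0 + x.1 0 1 • Jp + x.1 1 0 • Jm := by
  have h : x = x.1 0 0 • slH + x.1 0 1 • slE + x.1 1 0 • slF := Subtype.ext (by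
    change x.1 = x.1 0 0 • slH.1 + x.1 0 1 • slE.1 + x.1 1 0 • slF.1
    rw [slH_val, slE_val, slF_val]
    ext i j
    fin_cases i <;> fin_cases j <;> simp [sl_apply_one_one])
  exact (congrArg (UniversalEnvelopingAlgebra.ι ℂ).toLinearMap h).trans (by
    simp only [map_add, map_smul]; rfl)

theorem J0_Jp : J0 * Jp - Jp * J0 = (2 : ℂ) • Jp := by
  have h : ⁅slH, slE⁆ = (2 : ℂ) • slE := Subtype.ext (by
    change slH.1 * slE.1 - slE.1 * slH.1 = (2 : ℂ) • slE.1
    rw [slH_val, slE_val]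
    ext i j
    fin_cases i <;> fin_cases j <;> simp; norm_num)
  exact ((LieHom.map_lie (UniversalEnvelopingAlgebra.ι ℂ) slH slE).symm.trans (congrArg _ h)).trans
    (map_smul (UniversalEnvelopingAlgebra.ι ℂ).toLinearMap _ _)

theorem J0_Jm : J0 * Jm - Jm * J0 = (-2 : ℂ) • Jm := by
  have h : ⁅slH, slF⁆ = (-2 : ℂ) • slF := Subtype.ext (by
    change slH.1 * slF.1 - slF.1 * slH.1 = (-2 : ℂ) • slF.1
    rw [slH_val, slF_val]
    ext i j
    fin_cases i <;> fin_cases j <;> simp; norm_num)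
  exact ((LieHom.map_lie (UniversalEnvelopingAlgebra.ι ℂ) slH slF).symm.trans (congrArg _ h)).trans
    (map_smul (UniversalEnvelopingAlgebra.ι ℂ).toLinearMap _ _)

theorem Jp_Jm : Jp * Jm - Jm * Jp = J0 := by
  have h : ⁅slE, slF⁆ = slH := Subtype.ext (by
    change slE.1 * slF.1 - slF.1 * slE.1 = slH.1
    rw [slH_val, slE_val, slF_val]
    ext i j
    fin_cases i <;> fin_cases j <;> simp)
  exact (LieHom.map_lie (UniversalEnvelopingAlgebra.ι ℂ) slE slF).symm.trans (congrArg _ h)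

@[elab_as_elim]
theorem V_induction {P : V → Prop} (hc : ∀ r : ℂ, P (algebraMap ℂ V r))
    (hadd : ∀ a b, P a → P b → P (a + b)) (hmul : ∀ a b, P a → P b → P (a * b)) (hp : P Jp)
    (hm : P Jm) (a : V) : P a := by
  have hs : ∀ (r : ℂ) a, P a → P (r • a) := fun r a h => by
    rw [Algebra.smul_def]; exact hmul _ _ (hc r) h
  have h0 : P J0 := by
    rw [← Jp_Jm, sub_eq_add_neg, ← neg_one_smul ℂ]
    exact hadd _ _ (hmul _ _ hp hm) (hs _ _ (hmul _ _ hm hp))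
  let 𝒮 : Subalgebra ℂ V :=
    { carrier := {a | P a}
      mul_mem' := fun {a b} ha hb => hmul a b ha hb
      add_mem' := fun {a b} ha hb => hadd a b ha hb
      algebraMap_mem' := hc }
  have hι : ∀ x, UniversalEnvelopingAlgebra.ι ℂ x ∈ 𝒮 := fun x => by
    rw [ι_eq]
    exact hadd _ _ (hadd _ _ (hs _ _ h0) (hs _ _ hp)) (hs _ _ hm)
  let j : sl (Fin 2) ℂ →ₗ⁅ℂ⁆ 𝒮 :=
    { toFun := fun x => ⟨_, hι x⟩
      map_add' := fun x y => Subtype.ext (map_add (UniversalEnvelopingAlgebra.ι ℂ) x y)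
      map_smul' := fun r x => Subtype.ext (map_smul (UniversalEnvelopingAlgebra.ι ℂ) r x)
      map_lie' := fun {x y} => Subtype.ext (LieHom.map_lie (UniversalEnvelopingAlgebra.ι ℂ) x y) }
  have key : 𝒮.val.comp (UniversalEnvelopingAlgebra.lift ℂ j) = AlgHom.id ℂ V := by
    apply UniversalEnvelopingAlgebra.hom_ext
    ext x
    simp [j]
  have := (UniversalEnvelopingAlgebra.lift ℂ j a).2
  rwa [show ((UniversalEnvelopingAlgebra.lift ℂ j a : 𝒮) : V) = a from DFunLike.congr_fun key a]
    at this

/-- The embedding of `U(sl(2))`, on `sl(2)`. -/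
def slHom : sl (Fin 2) ℂ →ₗ⁅ℂ⁆ U where
  toFun x := x.1 0 0 • u .h1 + x.1 0 1 • u .e1 + x.1 1 0 • u .f1
  map_add' x y := by
    change (x.1 0 0 + y.1 0 0) • u .h1 + (x.1 0 1 + y.1 0 1) • u .e1 +
      (x.1 1 0 + y.1 1 0) • u .f1 = _
    module
  map_smul' r x := by
    change (r * x.1 0 0) • u .h1 + (r * x.1 0 1) • u .e1 + (r * x.1 1 0) • u .f1 = r • _
    module
  map_lie' := fun {x y} => by
    have h1 : u .h1 * u .e1 = u .e1 * u .h1 + (2 : ℂ) • u .e1 := eq_add_of_sub_eq' core_u.h1_e1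
    have h2 : u .h1 * u .f1 = u .f1 * u .h1 + (-2 : ℂ) • u .f1 := eq_add_of_sub_eq' core_u.h1_f1
    have h3 : u .e1 * u .f1 = u .f1 * u .e1 + u .h1 := eq_add_of_sub_eq' core_u.e1_f1
    simp only [LieAlgebra.SpecialLinear.sl_bracket, LieRing.of_associative_ring_bracket,
      Matrix.sub_apply, Matrix.mul_apply, Fin.sum_univ_two, sl_apply_one_one, mul_add, add_mul,
      smul_mul_assoc, mul_smul_comm, h1, h2, h3]
    module

/-- The embedding of `U(sl(2))`. -/
def emb : V →ₐ[ℂ] U := UniversalEnvelopingAlgebra.lift ℂ slHom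

theorem emb_J0 : emb J0 = u .h1 := by
  refine (UniversalEnvelopingAlgebra.lift_ι_apply ℂ slHom slH).trans ?_
  change slH.1 0 0 • u .h1 + slH.1 0 1 • u .e1 + slH.1 1 0 • u .f1 = _
  simp [slH_val]

theorem emb_Jp : emb Jp = u .e1 := by
  refine (UniversalEnvelopingAlgebra.lift_ι_apply ℂ slHom slE).trans ?_
  change slE.1 0 0 • u .h1 + slE.1 0 1 • u .e1 + slE.1 1 0 • u .f1 = _
  simp [slE_val]

theorem emb_Jm : emb Jm = u .f1 := by
  refine (UniversalEnvelopingAlgebra.lift_ι_apply ℂ slHom slF).trans ?_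
  change slF.1 0 0 • u .h1 + slF.1 0 1 • u .e1 + slF.1 1 0 • u .f1 = _
  simp [slF_val]

theorem isSuperHom_emb : IsSuperHom emb := fun a => by
  change emb a = _
  induction a using V_induction with
  | hc r => simp
  | hadd a b ha hb => rw [map_add, map_add, ← ha, ← hb]
  | hmul a b ha hb => rw [map_mul, map_mul, ← ha, ← hb]
  | hp => rw [emb_Jp, parity_e1]
  | hm => rw [emb_Jm, parity_f1]

end Lie

set_option maxHeartbeats 2000000 in
/-- The module `U(sl(2|1)) ⊗ V` induced from the left regular representation of `U(sl(2))`
(extended by zero to `e₂`, `e₃` and `n`), with coordinates with respect to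
`1`, `f₂`, `f₃`, `f₂ f₃`. -/
theorem core_kac : Core (R := Matrix (Fin 4) (Fin 4) V)
    !![Jp, 0, 0, 0; 0, Jp, -1, 0; 0, 0, Jp, 0; 0, 0, 0, Jp]
    !![J0, 0, 0, 0; 0, J0 + 1, 0, 0; 0, 0, J0 - 1, 0; 0, 0, 0, J0]
    !![Jm, 0, 0, 0; 0, Jm, 0, 0; 0, -1, Jm, 0; 0, 0, 0, Jm]
    !![0, 0, 0, 0; 0, 1, 0, 0; 0, 0, 1, 0; 0, 0, 0, (2 : ℂ) • 1]
    !![0, Jp, (1 / 2 : ℂ) • J0, 0; 0, 0, 0, -((1 / 2 : ℂ) • J0) - 1; 0, 0, 0, Jp; 0, 0, 0, 0]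
    !![0, 0, 0, 0; 1, 0, 0, 0; 0, 0, 0, 0; 0, 0, 1, 0] := by
  have h1 : J0 * Jp = Jp * J0 + (2 : ℂ) • Jp := eq_add_of_sub_eq' J0_Jp
  have h2 : J0 * Jm = Jm * J0 + (-2 : ℂ) • Jm := eq_add_of_sub_eq' J0_Jm
  have h3 : Jp * Jm = Jm * Jp + J0 := eq_add_of_sub_eq' Jp_Jm
  constructor <;> ext i j <;> fin_cases i <;> fin_cases j <;>
    simp [Matrix.mul_apply, Fin.sum_univ_four] <;>
    (try simp only [mul_add, add_mul, mul_sub, sub_mul, mul_one, one_mul, mul_neg, neg_mul,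
      smul_mul_assoc, mul_smul_comm, h1, h2, h3]) <;> module

/-- The representation on the induced module. -/
def kac : U →ₐ[ℂ] Matrix (Fin 4) (Fin 4) V := core_kac.lift

theorem kac_emb (a : V) (i : Fin 4) : kac (emb a) i 0 = if i = 0 then a else 0 := by
  induction a using V_induction generalizing i with
  | hc r => rw [AlgHom.commutes, AlgHom.commutes, Matrix.algebraMap_matrix_apply]
  | hadd a b ha hb =>
    rw [map_add, map_add, Matrix.add_apply, ha, hb]
    split_ifs <;> simp
  | hmul a b ha hb =>
    rw [map_mul, map_mul, Matrix.mul_apply]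
    simp only [hb, mul_ite, mul_zero, Finset.sum_ite_eq', Finset.mem_univ, if_true, ha, ite_mul,
      zero_mul]
  | hp =>
    rw [emb_Jp]
    refine (congrFun (congrFun (core_kac.lift_u .e1) i) 0).trans ?_
    fin_cases i <;> simp [Core.image]
  | hm =>
    rw [emb_Jm]
    refine (congrFun (congrFun (core_kac.lift_u .f1) i) 0).trans ?_
    fin_cases i <;> simp [Core.image]

/-- A linear left inverse of the embedding of `U(sl(2))`. -/
def retr : U →ₗ[ℂ] V := Matrix.entryLinearMap ℂ V 0 0 ∘ₗ kac.toLinearMap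

theorem retr_emb (a : V) : retr (emb a) = a := kac_emb a 0

/-! ## The Hopf subalgebra `U_h(sl(2))` -/

theorem coeffHom_sqrtSeries {A B : Type*} [Ring A] [Algebra ℂ A] [Ring B] [Algebra ℂ B]
    (f : A →ₐ[ℂ] B) (e : A) : coeffHom f (sqrtSeries e) = sqrtSeries (f e) := by
  rw [sqrtSeries, algHom_hpow _ (coeff_zero_sqrt_arg _), map_add, map_one, map_smul, coeffHom_C,
    map_pow, sqrtSeries]

theorem emb_ohnT : coeffHom emb ohnT = jT := by
  rw [ohnT, TSeries, map_add, map_smul, coeffHom_sqrtSeries, coeffHom_C, emb_Jp]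
  rfl

theorem emb_ohnTinv : coeffHom emb ohnTinv = jTi := by
  rw [ohnTinv, TinvSeries, map_add, map_neg, map_smul, coeffHom_sqrtSeries, coeffHom_C, emb_Jp]
  rfl

theorem emb_ohnH : coeffHom emb ohnH = jH1 := by
  rw [ohnH]
  refine (csmul_map (coeffHom emb).toLinearMap _ _).trans ?_
  rw [AlgHom.toLinearMap_apply, map_mul, map_add, emb_ohnT, emb_ohnTinv, coeffHom_C, emb_J0]
  rfl

theorem emb_ohnY : coeffHom emb ohnY = jF1 := by
  rw [ohnY, map_sub]
  refine (congrArg _ (csmul_map (coeffHom emb).toLinearMap _ _)).trans ?_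
  rw [AlgHom.toLinearMap_apply, map_smul, coeffHom_C, coeffHom_C, map_mul, map_sub, map_pow, map_one,
    emb_Jp, emb_J0, emb_Jm]
  rfl

theorem coeff_zero_ohnT : coeff 0 ohnT = 1 := coeff_zero_TSeries _

theorem hbar_ohnX : hbar • ohnX = hlog ohnT := hbar_divH (coeff_zero_hlog _)

theorem hbar_lnT_jT : hbar • lnT jT = jL := hbar_divH jL0

theorem emb_ohnX : coeffHom emb ohnX = lnT jT := by
  refine hbar_smul_injective ?_
  rw [← map_smul, hbar_ohnX, algHom_hlog _ coeff_zero_ohnT, emb_ohnT, hbar_lnT_jT, jL]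

theorem emb_injective : Function.Injective (coeffHom emb) := coeffHom_injective retr_emb

/-- The embedding of the tensor square of `U(sl(2))⟦h⟧`. -/
def embTwo : (V ⊗ˢ V)⟦X⟧ →ₐ[ℂ⟦X⟧] (U ⊗ˢ U)⟦X⟧ :=
  coeffHom (smapAlg emb emb isSuperHom_emb isSuperHom_emb)

theorem embTwo_htmul (a b : V⟦X⟧) : embTwo (a ⊗ʰ b) = coeffHom emb a ⊗ʰ coeffHom emb b :=
  coeffHom_smapAlg_htmul isSuperHom_emb isSuperHom_emb a b

theorem retr_embTwo : ∀ x, smap retr retr (smapAlg emb emb isSuperHom_emb isSuperHom_emb x) = x :=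
  smap_smapAlg isSuperHom_emb isSuperHom_emb retr_emb retr_emb

theorem embTwo_injective : Function.Injective embTwo := coeffHom_injective retr_embTwo

theorem even_emb (a : V⟦X⟧) : Even (coeffHom emb a) :=
  (isSuperHom_emb.hparity a).symm.trans (congrArg _ (by ext n; rw [coeff_hparity]; rfl))

theorem linearMap_ext_V {N : Type*} [AddCommGroup N] [Module ℂ⟦X⟧ N] [Separated N]
    {L₁ L₂ : V⟦X⟧ →ₗ[ℂ⟦X⟧] N} {x y : V⟦X⟧} (hx : coeff 0 x = Jp) (hy : coeff 0 y = Jm)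
    (h1 : L₁ 1 = L₂ 1) (hmul : ∀ a b, L₁ a = L₂ a → L₁ b = L₂ b → L₁ (a * b) = L₂ (a * b))
    (h_x : L₁ x = L₂ x) (h_y : L₁ y = L₂ y) : L₁ = L₂ := by
  refine eq_of_submodule_dense (LinearMap.eqLocus L₁ L₂) (fun m => ?_) fun s hs => hs
  have : ∃ s ∈ LinearMap.eqLocus L₁ L₂, coeff 0 s = coeff 0 m := by
    refine V_induction (P := fun a => ∃ s ∈ LinearMap.eqLocus L₁ L₂, coeff 0 s = a) ?_ ?_ ?_
      ⟨x, h_x, hx⟩ ⟨y, h_y, hy⟩ _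
    · intro r
      refine ⟨(C r : ℂ⟦X⟧) • 1, Submodule.smul_mem _ _ h1, ?_⟩
      rw [Algebra.smul_def, mul_one]
      change coeff 0 (PowerSeries.map _ (C r)) = _
      simp
    · rintro a b ⟨s, hs, rfl⟩ ⟨t, ht, rfl⟩
      exact ⟨s + t, Submodule.add_mem _ hs ht, map_add _ _ _⟩
    · rintro a b ⟨s, hs, rfl⟩ ⟨t, ht, rfl⟩
      refine ⟨s * t, hmul s t hs ht, ?_⟩
      simp
  obtain ⟨s, hs, h⟩ := this
  obtain ⟨b, hb⟩ := exists_hbar_smul (a := m - s) (by rw [map_sub, h, sub_self])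
  exact ⟨s, hs, b, by rw [← hb]; abel⟩

theorem coeff_zero_ohnY : coeff 0 ohnY = Jm := by
  simp only [ohnY, map_sub, PowerSeries.coeff_smul, sq hbar, mul_smul, coeff_zero_hbar_smul]
  simp

theorem hbar_Jp : hbar • C Jp = (1 / 2 : ℂ) • (ohnT - ohnTinv) := by
  rw [ohnT, ohnTinv, TSeries, TinvSeries]
  generalize hbar • C Jp = x
  module

/-- To be in the range of a split injection can be tested on the generators. -/
theorem forall_mem_range {P Q : Type*} [Ring P] [Algebra ℂ P] [Ring Q] [Algebra ℂ Q] {φ : P →ₐ[ℂ] Q}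
    {r : Q →ₗ[ℂ] P} (hr : ∀ p, r (φ p) = p) {ψ : V⟦X⟧ →ₗ[ℂ⟦X⟧] Q⟦X⟧}
    (h1 : ∃ p, coeffHom φ p = ψ 1)
    (hmul : ∀ a b, (∃ p, coeffHom φ p = ψ a) → (∃ p, coeffHom φ p = ψ b) →
      ∃ p, coeffHom φ p = ψ (a * b))
    (hT : ∃ p, coeffHom φ p = ψ ohnT) (hTi : ∃ p, coeffHom φ p = ψ ohnTinv)
    (hY : ∃ p, coeffHom φ p = ψ ohnY) (a : V⟦X⟧) : ∃ p, coeffHom φ p = ψ a := by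
  let L := (coeffHom φ).toLinearMap ∘ₗ coeffMapₗ r ∘ₗ ψ
  have hL : ∀ {a}, (∃ p, coeffHom φ p = ψ a) → L a = ψ a := fun {a} ⟨p, hp⟩ => by
    change coeffHom φ (coeffMap r (ψ a)) = ψ a
    rw [← hp]
    congr 1
    ext n
    simp [hr]
  have h : L = ψ := by
    refine linearMap_ext_V (x := C Jp) (by simp) coeff_zero_ohnY (hL h1)
      (fun a b ha hb => hL (hmul a b ⟨_, ha⟩ ⟨_, hb⟩)) (hbar_smul_injective ?_) (hL hY)
    rw [← map_smul L, ← map_smul ψ, hbar_Jp, csmul_map, csmul_map, map_sub, map_sub, hL hT, hL hTi]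
  exact ⟨_, DFunLike.congr_fun h a⟩

theorem exists_embTwo_eq (a : V⟦X⟧) : ∃ b, embTwo b = Delta (coeffHom emb a) := by
  refine forall_mem_range (ψ := Delta.toLinearMap ∘ₗ (coeffHom emb).toLinearMap) retr_embTwo
    ⟨1, ?_⟩ ?_ ⟨ohnT ⊗ʰ ohnT, ?_⟩ ⟨ohnTinv ⊗ʰ ohnTinv, ?_⟩ ⟨ohnY ⊗ʰ ohnT + ohnTinv ⊗ʰ ohnY, ?_⟩ a
  · simp
  · rintro a b ⟨p, hp⟩ ⟨q, hq⟩
    refine ⟨p * q, ?_⟩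
    simp only [LinearMap.comp_apply, AlgHom.toLinearMap_apply, map_mul] at *
    rw [hp, hq]
  · refine (embTwo_htmul _ _).trans ?_
    rw [LinearMap.comp_apply, AlgHom.toLinearMap_apply, AlgHom.toLinearMap_apply, emb_ohnT, Delta_jT]
  · refine (embTwo_htmul _ _).trans ?_
    rw [LinearMap.comp_apply, AlgHom.toLinearMap_apply, AlgHom.toLinearMap_apply, emb_ohnTinv,
      Delta_jTi]
  · refine (map_add embTwo _ _).trans ?_
    rw [embTwo_htmul, embTwo_htmul, LinearMap.comp_apply, AlgHom.toLinearMap_apply,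
      AlgHom.toLinearMap_apply, emb_ohnT, emb_ohnTinv, emb_ohnY, Delta_jF1]

theorem exists_emb_eq (a : V⟦X⟧) : ∃ b, coeffHom emb b = S (coeffHom emb a) := by
  refine forall_mem_range (ψ := S ∘ₗ (coeffHom emb).toLinearMap) retr_emb
    ⟨1, ?_⟩ ?_ ⟨ohnTinv, ?_⟩ ⟨ohnT, ?_⟩ ⟨-(ohnT * ohnY * ohnTinv), ?_⟩ a
  · rw [LinearMap.comp_apply, AlgHom.toLinearMap_apply, map_one, S_one]
  · rintro a b ⟨p, hp⟩ ⟨q, hq⟩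
    refine ⟨q * p, ?_⟩
    rw [LinearMap.comp_apply, AlgHom.toLinearMap_apply] at *
    rw [map_mul, map_mul, S_even_mul (even_emb a), hp, hq]
  · rw [LinearMap.comp_apply, AlgHom.toLinearMap_apply, emb_ohnT, emb_ohnTinv, S_jT]
  · rw [LinearMap.comp_apply, AlgHom.toLinearMap_apply, emb_ohnT, emb_ohnTinv, S_jTi]
  · rw [LinearMap.comp_apply, AlgHom.toLinearMap_apply, map_neg, map_mul, map_mul, emb_ohnT,
      emb_ohnTinv, emb_ohnY, S_jF1]

theorem exists_sl_hopf : ∃ 𝓗 : HopfStructure V, IsHopfEmbedding 𝓗 jordanHopf emb :=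
  exists_isHopfEmbedding isSuperHom_emb jordanHopf retr_emb exists_embTwo_eq exists_emb_eq

theorem embTwo_RMatrix : embTwo (RMatrix ohnT ohnH) = jR12 := by
  rw [RMatrix, map_mul, algHom_hexp _ (coeff_zero_neg (coeff_zero_hbar_smul _)),
    algHom_hexp _ (coeff_zero_hbar_smul _), map_neg, map_smul, map_smul, embTwo_htmul, embTwo_htmul,
    map_mul, emb_ohnT, emb_ohnH, show coeffHom emb (lnT ohnT) = lnT jT from emb_ohnX]
  rfl

theorem embTwo_comul {𝓗 : HopfStructure V} (h : IsHopfEmbedding 𝓗 jordanHopf emb) (a : V⟦X⟧) :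
    embTwo (𝓗.comul a) = Delta (coeffHom emb a) := (h.comul a).symm

theorem isOhn_of_isHopfEmbedding {𝓗 : HopfStructure V} (h : IsHopfEmbedding 𝓗 jordanHopf emb) :
    IsOhn 𝓗 where
  exp_X := by rw [hbar_ohnX, hexp_hlog coeff_zero_ohnT]
  exp_neg_X := emb_injective (by
    rw [algHom_hexp _ (coeff_zero_neg (coeff_zero_hbar_smul _)), map_neg, map_smul, emb_ohnX,
      hbar_lnT_jT, hexp_neg_jL, emb_ohnTinv])
  H_X := emb_injective (by
    rw [Ring.lie_def, map_smul, map_sub, map_sub, map_mul, map_mul, emb_ohnX, emb_ohnH, emb_ohnT,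
      emb_ohnTinv, smul_sub, ← mul_smul_comm, ← smul_mul_assoc, hbar_lnT_jT, jL, jc.log_H1 jT0]
    abel)
  H_Y := emb_injective (by
    have e := deformedRelations_jordanGens.H1_F1
    change ⁅jH1, jF1⁆ = -((1 / 2 : ℂ) • (jT * jF1 + jF1 * jT + jTi * jF1 + jF1 * jTi)) at e
    have hs : ∀ (r : ℂ) x, coeffHom emb (r • x) = r • coeffHom emb x := fun r x =>
      csmul_map (coeffHom emb).toLinearMap r x
    rw [Ring.lie_def] at e ⊢
    rw [map_sub, map_sub, map_neg, hs, hs]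
    simp only [map_mul, map_add]
    rw [emb_ohnH, emb_ohnT, emb_ohnTinv, emb_ohnY, e]
    simp only [mul_add, add_mul]
    module)
  X_Y := emb_injective (hbar_smul_injective (by
    rw [Ring.lie_def, map_sub, map_mul, map_mul, emb_ohnX, emb_ohnH, emb_ohnY, smul_sub,
      ← smul_mul_assoc, ← mul_smul_comm, hbar_lnT_jT, jL, jc.log_F1 jT0, hIn_mul]
    abel))
  comul_X := embTwo_injective (hbar_smul_injective (by
    rw [embTwo_comul h, map_add, embTwo_htmul, embTwo_htmul, emb_ohnX, map_one, smul_add,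
      ← hsmul_htmul, ← htmul_hsmul, ← map_smul, hbar_lnT_jT, Delta_jL]))
  comul_Y := embTwo_injective (by
    rw [embTwo_comul h, map_add, embTwo_htmul, embTwo_htmul, emb_ohnT, emb_ohnTinv, emb_ohnY,
      Delta_jF1])
  comul_H := embTwo_injective (by
    rw [embTwo_comul h, map_add, embTwo_htmul, embTwo_htmul, emb_ohnT, emb_ohnTinv, emb_ohnH,
      Delta_jH1])

end SuperJordan

end

theorem mainTheorem8 :
    -- the nonlinear map satisfies the deformed relations
    SuperJordan.DeformedRelations (SuperJordan.hIn SuperJordan.U⟦X⟧) SuperJordan.jordanGens ∧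
    -- these generators and relations present the complete algebra `U(sl(2|1))⟦h⟧`
    (∀ (B : Type*) [Ring B] [Algebra ℂ B] [Algebra ℂ⟦X⟧ B] [IsScalarTower ℂ ℂ⟦X⟧ B]
      [IsAdicComplete (Ideal.span {(SuperJordan.hbar : ℂ⟦X⟧)}) B],
      (∀ b : B, SuperJordan.hbar • b = 0 → b = 0) →
      ∀ g : SuperJordan.Gens B, SuperJordan.DeformedRelations (SuperJordan.hIn B) g →
        (∃ b : B, g.T = 1 + SuperJordan.hbar • b) →
        ∃! ψ : SuperJordan.U⟦X⟧ →ₐ[ℂ⟦X⟧] B, SuperJordan.jordanGens.map ψ = g) ∧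
    -- the grading
    SuperJordan.IsParity SuperJordan.jordanGens SuperJordan.hparity ∧
    (∀ π : SuperJordan.U⟦X⟧ →ₐ[ℂ⟦X⟧] SuperJordan.U⟦X⟧,
      SuperJordan.IsParity SuperJordan.jordanGens π → ∀ a, π a = SuperJordan.hparity a) ∧
    -- the automorphism
    (∃! Φ : SuperJordan.U⟦X⟧ ≃ₐ[ℂ⟦X⟧] SuperJordan.U⟦X⟧,
      SuperJordan.IsPhi SuperJordan.jordanGens Φ) ∧
    -- the Hopf structure and the universal `R`-matrix
    ∃ 𝓗 : SuperJordan.HopfStructure SuperJordan.U,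
      SuperJordan.IsJordanCoalgebra SuperJordan.jordanGens 𝓗 ∧
      (∀ 𝓗' : SuperJordan.HopfStructure SuperJordan.U,
        SuperJordan.IsJordanCoalgebra SuperJordan.jordanGens 𝓗' → 𝓗' = 𝓗) ∧
      SuperJordan.IsTriangularRMatrix 𝓗
        (SuperJordan.RMatrix SuperJordan.jordanGens.T SuperJordan.jordanGens.H1) ∧
      -- the subalgebra `U_h(sl(2))` and its `R`-matrix
      ∃ (𝓗₂ : SuperJordan.HopfStructure SuperJordan.V) (f : SuperJordan.V →ₐ[ℂ] SuperJordan.U),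
        SuperJordan.IsOhn 𝓗₂ ∧
        SuperJordan.IsTriangularRMatrix 𝓗₂
          (SuperJordan.RMatrix SuperJordan.ohnT SuperJordan.ohnH) ∧
        SuperJordan.IsHopfEmbedding 𝓗₂ 𝓗 f ∧
        SuperJordan.coeffMap f.toLinearMap SuperJordan.ohnT = SuperJordan.jordanGens.T ∧
        SuperJordan.coeffMap f.toLinearMap SuperJordan.ohnTinv = SuperJordan.jordanGens.Tinv ∧
        SuperJordan.coeffMap f.toLinearMap SuperJordan.ohnH = SuperJordan.jordanGens.H1 ∧
        SuperJordan.coeffMap f.toLinearMap SuperJordan.ohnY = SuperJordan.jordanGens.F1 ∧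
        SuperJordan.coeffMap (SuperJordan.smap f.toLinearMap f.toLinearMap)
            (SuperJordan.RMatrix SuperJordan.ohnT SuperJordan.ohnH) =
          SuperJordan.RMatrix SuperJordan.jordanGens.T SuperJordan.jordanGens.H1 := by
  refine ⟨SuperJordan.deformedRelations_jordanGens, ?_, SuperJordan.isParity_jordan,
    SuperJordan.eq_hparity, SuperJordan.existsUnique_isPhi, ?_⟩
  · intro B _ _ _ _ _ tf g d hT
    exact SuperJordan.existsUnique_lift tf g d hT
  · obtain ⟨𝓗, h⟩ := SuperJordan.exists_sl_hopf
    exact ⟨SuperJordan.jordanHopf, SuperJordan.isJordanCoalgebra_jordanHopf,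
      SuperJordan.eq_jordanHopf, SuperJordan.isTriangularRMatrix_jR12, 𝓗, SuperJordan.emb,
      SuperJordan.isOhn_of_isHopfEmbedding h,
      h.isTriangularRMatrix SuperJordan.isSuperHom_emb SuperJordan.retr_emb
        SuperJordan.embTwo_RMatrix SuperJordan.isTriangularRMatrix_jR12,
      h, SuperJordan.emb_ohnT, SuperJordan.emb_ohnTinv, SuperJordan.emb_ohnH, SuperJordan.emb_ohnY,
      SuperJordan.embTwo_RMatrix⟩
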